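/- Let $d\in\mathbb N$ and let $\chi,\varphi:\mathbb R^d\to[0,1]$ be smooth radial functions, $\operatorname{supp}\chi$ a compact subset of $\{|\xi|<4/3\}$, $\operatorname{supp}\varphi\subset\{3/4\le|\xi|\le 8/3\}$, with $\chi(\xi)+\sum_{j\ge 0}\varphi(2^{-j}\xi)=1$ for all $\xi$. For a tempered distribution $T$ put $\Delta_jT=0$ for $j\le -2$, $\Delta_{-1}T=\mathcal F^{-1}(\chi\,\mathcal F T)$, $\Delta_jT=\mathcal F^{-1}(\varphi(2^{-j}\cdot)\mathcal F T)$ for $j\ge 0$, and $\|T\|_{B^0_{\infty,1}}=\sum_{j\in\mathbb Z}\|\Delta_jT\|_{L^\infty}$. Let $1<p<2$ and $\frac{p}{p-1}\le q<\infty$. For a Fourier multiplier $A=m(D)$ with bounded symbol, a locally integrable vector field $u:\mathbb R^d\to\mathbb R^d$ with weak gradient $\nabla u\in L^p$, and $\tau\in L^q\cap B^0_{\infty,1}$, the commutator $[A,u\cdot\nabla]\tau=A(u\cdot\nabla\tau)-u\cdot\nabla(A\tau)$ is understood in the weak sense: for every Schwartz function $\theta$, $$\langle [A,u\cdot\nabla]\tau,\theta\rangle=-\int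 \operatorname{div}\big(u\,m(-D)\theta\big)\,\tau\,dx+\int \operatorname{div}(u\,\theta)\,A\tau\,dx ,$$ where $A\tau$ is the function with $\int \theta\,A\tau\,dx=\int (m(-D)\theta)\,\tau\,dx$ for all Schwartz $\theta$. (i) Let $\mathscr R_i=\partial_i/|D|$, $1\le i\le d$, be the Riesz transforms. For every finite-dimensional complex normed space $F$ (scalars, vectors or tensors; $\mathscr R_i$ acts componentwise) there is a constant $C$, depending only on $d,p,q,F$ and $(\chi,\varphi)$, such that for all $i$, all $u$ with $\nabla u\in L^p$ and all $F$-valued $\tau\in L^q\cap B^0_{\infty,1}$, all integrals above converge absolutely, the commutator $[\mathscr R_i,u\cdot\nabla]\tau$ is an $L^p$ function, and $$\|[\mathscr R_i,u\cdot\nabla]\tau\|_{L^p}\le C\,\|\nabla u\|_{L^p}\big(\|\tau\|_{L^q}+\|\tau\|_{B^0_{\infty,1}}\big).$$ (ii) Let $\mathscr R=\Delta^{-1}\operatorname{curl}\operatorname{div}$, acting on $d\times d$ matrix-valued $\tau$ by $(\operatorname{div}\tau)_i=\sum_j\partial_j\tau_{ij}$ and $(\operatorname{curl}v)_{kl}=\partial_kv_l-\partial_lv_k$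 (for $d=2$ the component $(k,l)=(1,2)$ is the scalar curl). There is a constant $C$, depending only on $d,p,q$ and $(\chi,\varphi)$, such that for all $u$ with $\nabla u\in L^p$ and $\operatorname{div}u=0$, and all matrix-valued $\tau\in L^q\cap B^0_{\infty,1}$, each component of $[\mathscr R,u\cdot\nabla]\tau$ satisfies (with absolutely convergent integrals) $$\|[\mathscr R,u\cdot\nabla]\tau\|_{L^p}\le C\,\|\nabla u\|_{L^p}\big(\|\tau\|_{L^q}+\|\tau\|_{B^0_{\infty,1}}\big).$$ -/

import Mathlib

open MeasureTheory FourierTransform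
open scoped ENNReal NNReal SchwartzMap

noncomputable section

namespace CommutatorEstimate

/-- The Euclidean space `ℝ^d`. -/
abbrev Space (d : ℕ) : Type := EuclideanSpace ℝ (Fin d)

/-! ### Littlewood-Paley decomposition and the Besov norm -/

/-- `χ`, `φ` are a (nonhomogeneous) dyadic partition of unity: smooth radial functions with values
in `[0,1]`, `χ` compactly supported in the open ball `|ξ| < 4/3`, `φ` supported in the annulus
`3/4 ≤ |ξ| ≤ 8/3`, and `χ(ξ) + ∑_{j ≥ 0} φ(2^{-j} ξ) = 1`. The other usual properties
(`∑_{j ∈ ℤ} φ(2^{-j} ξ) = 1` for `ξ ≠ 0`, almost orthogonality of the supports) follow. -/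
structure IsDyadicPartition {d : ℕ} (χ φ : Space d → ℝ) : Prop where
  smooth_low : ContDiff ℝ ((⊤ : ℕ∞) : WithTop ℕ∞) χ
  smooth_annulus : ContDiff ℝ ((⊤ : ℕ∞) : WithTop ℕ∞) φ
  radial_low : ∀ ξ η : Space d, ‖ξ‖ = ‖η‖ → χ ξ = χ η
  radial_annulus : ∀ ξ η : Space d, ‖ξ‖ = ‖η‖ → φ ξ = φ η
  mem_Icc_low : ∀ ξ, χ ξ ∈ Set.Icc (0 : ℝ) 1
  mem_Icc_annulus : ∀ ξ, φ ξ ∈ Set.Icc (0 : ℝ) 1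
  support_low : tsupport χ ⊆ Metric.ball 0 (4 / 3)
  support_annulus : tsupport φ ⊆ {ξ | 3 / 4 ≤ ‖ξ‖ ∧ ‖ξ‖ ≤ 8 / 3}
  sum_eq_one : ∀ ξ, HasSum (fun j : ℕ => φ (((2 : ℝ) ^ j)⁻¹ • ξ)) (1 - χ ξ)

section Besov

variable {d : ℕ} {F : Type*} [NormedAddCommGroup F] [NormedSpace ℂ F]

/-- The nonhomogeneous dyadic block `Δ_j` on tempered distributions: `0` for `j ≤ -2`,
`𝓕⁻¹ (χ 𝓕 T)` for `j = -1`, and `𝓕⁻¹ (φ(2^{-j} ·) 𝓕 T)` for `j ≥ 0`. -/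
def dyadicBlock (χ φ : Space d → ℝ) (j : ℤ) (T : 𝓢'(Space d, F)) : 𝓢'(Space d, F) :=
  if j ≤ -2 then 0
  else if j = -1 then
    TemperedDistribution.fourierMultiplierCLM F (fun ξ => ((χ ξ : ℝ) : ℂ)) T
  else
    TemperedDistribution.fourierMultiplierCLM F
      (fun ξ => ((φ (((2 : ℝ) ^ j)⁻¹ • ξ) : ℝ) : ℂ)) T

/-- The `L^p` norm of a tempered distribution: the norm of the `L^p` function representing it
(which is unique), and `∞` if there is none. -/
def distLpNorm [CompleteSpace F] (p : ℝ≥0∞) [Fact (1 ≤ p)] (T : 𝓢'(Space d, F)) : ℝ≥0∞ :=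
  ⨅ (f : Lp F p (volume : Measure (Space d))) (_ : (f : 𝓢'(Space d, F)) = T), ‖f‖ₑ

/-- The norm of the nonhomogeneous Besov space `B^0_{∞,1}`:
`∑_{j ∈ ℤ} ‖Δ_j T‖_{L^∞}`. -/
def besovNorm [CompleteSpace F] (χ φ : Space d → ℝ) (T : 𝓢'(Space d, F)) : ℝ≥0∞ :=
  ∑' j : ℤ, distLpNorm ∞ (dyadicBlock χ φ j T)

end Besov

/-! ### Weak gradients -/

/-- `Du` is the weak gradient of the locally integrable vector field `u`: for every real test
function `θ` and direction `v`, `∫ (∂_v θ) u = - ∫ θ (Du v)`. -/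
def IsWeakGradient {d : ℕ} (u : Space d → Space d) (Du : Space d → Space d →L[ℝ] Space d) :
    Prop :=
  LocallyIntegrable u ∧ LocallyIntegrable Du ∧
    ∀ θ : Space d → ℝ, ContDiff ℝ ((⊤ : ℕ∞) : WithTop ℕ∞) θ → HasCompactSupport θ →
      ∀ v : Space d, ∫ x, (fderiv ℝ θ x v) • u x = - ∫ x, θ x • Du x v

/-- The divergence of a vector field with gradient `Du`, i.e. the trace of `Du`. -/
def divergence {d : ℕ} (Du : Space d → Space d →L[ℝ] Space d) (x : Space d) : ℝ :=
  LinearMap.trace ℝ (Space d) (Du x : Space d →ₗ[ℝ] Space d)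

/-! ### Fourier multipliers and the commutator with `u · ∇` -/

section Multiplier

variable {d : ℕ} {F G : Type*} [NormedAddCommGroup F] [NormedSpace ℂ F]
  [NormedAddCommGroup G] [NormedSpace ℂ G]

/-- The transpose of the Fourier multiplier `m(D)` with (bounded, operator-valued) symbol `m`,
applied to a scalar test function `θ`: the function `𝓕⁻¹ (m(-ξ) 𝓕θ(ξ))`. By definition,
`⟨m(D) f, θ⟩ = ⟨f, m(-D) θ⟩`. -/
def transposeMultiplier (m : Space d → F →L[ℂ] G) (θ : 𝓢(Space d, ℂ)) :
    Space d → F →L[ℂ] G :=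
  𝓕⁻ (fun ξ : Space d => (𝓕 θ) ξ • m (-ξ))

/-- `g = m(D) f`, tested against Schwartz functions. -/
def IsMultiplierImage (m : Space d → F →L[ℂ] G) (f : Space d → F) (g : Space d → G) : Prop :=
  ∀ θ : 𝓢(Space d, ℂ),
    Integrable (fun x => θ x • g x) ∧
    Integrable (fun x => transposeMultiplier m θ x (f x)) ∧
    ∫ x, θ x • g x = ∫ x, transposeMultiplier m θ x (f x)

/-- The function `div (ψ u) f = (u · ∇ψ + (div u) ψ) f` for an operator-valued `ψ`. -/
def divMul (u : Space d → Space d) (Du : Space d → Space d →L[ℝ] Space d)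
    (ψ : Space d → F →L[ℂ] G) (f : Space d → F) (x : Space d) : G :=
  (fderiv ℝ ψ x (u x)) (f x) + ((divergence Du x : ℝ) : ℂ) • ψ x (f x)

/-- `⟨u · ∇f, ψ⟩ = - ∫ div (ψ u) f`, the weak form of the convection term `u · ∇f` (which is
`∫ ψ (u · ∇f)` when `f` is smooth). -/
def convection (u : Space d → Space d) (Du : Space d → Space d →L[ℝ] Space d)
    (f : Space d → F) (ψ : Space d → F →L[ℂ] G) : G :=
  - ∫ x, divMul u Du ψ f x

/-- The function `h` is the commutator `[m(D), u · ∇] τ = m(D)(u · ∇τ) - u · ∇(m(D) τ)`, tested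
against Schwartz functions `θ`:
`⟨h, θ⟩ = ⟨u · ∇τ, m(-D) θ⟩ - ⟨u · ∇(m(D) τ), θ⟩`. All the integrals are required to converge
absolutely. -/
def IsCommutator (m : Space d → F →L[ℂ] G) (u : Space d → Space d)
    (Du : Space d → Space d →L[ℝ] Space d) (τ : Space d → F) (h : Space d → G) : Prop :=
  ∃ g : Space d → G, IsMultiplierImage m τ g ∧
    ∀ θ : 𝓢(Space d, ℂ),
      Integrable (fun x => θ x • h x) ∧
      Integrable (divMul u Du (transposeMultiplier m θ) τ) ∧
      Integrable (divMul u Du (fun x => θ x • ContinuousLinearMap.id ℂ G) g) ∧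
      ∫ x, θ x • h x =
        convection u Du τ (transposeMultiplier m θ) -
          convection u Du g (fun x => θ x • ContinuousLinearMap.id ℂ G)

end Multiplier

/-! ### The operators -/

/-- The symbol `i ξ_k / |ξ|` of the Riesz transform `R_k = ∂_k / |D|`, acting componentwise on
`F`-valued functions. -/
def rieszSymbol {d : ℕ} (F : Type*) [NormedAddCommGroup F] [NormedSpace ℂ F] (k : Fin d)
    (ξ : Space d) : F →L[ℂ] F :=
  (Complex.I * ((ξ k / ‖ξ‖ : ℝ) : ℂ)) • ContinuousLinearMap.id ℂ F

/-- Square matrices (second-order tensors), with the Frobenius norm. -/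
abbrev Tensor (d : ℕ) : Type := EuclideanSpace ℂ (Fin d × Fin d)

/-- The symbol of (the `(k,l)` component of) `Δ⁻¹ curl div` on second-order tensors. With
`(div τ)_i = ∑_j ∂_j τ_{ij}` and `(curl v)_{kl} = ∂_k v_l - ∂_l v_k` it is
`τ ↦ ∑_j (ξ_k ξ_j τ_{lj} - ξ_l ξ_j τ_{kj}) / |ξ|²`. For `d = 2`, the case `k = 0`, `l = 1` is the
scalar `curl v = ∂_1 v_2 - ∂_2 v_1`. -/
def curlDivSymbol {d : ℕ} (k l : Fin d) (ξ : Space d) : Tensor d →L[ℂ] ℂ :=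
  ∑ j : Fin d,
    (((ξ k * ξ j / ‖ξ‖ ^ 2 : ℝ) : ℂ) • EuclideanSpace.proj (𝕜 := ℂ) (l, j) -
      ((ξ l * ξ j / ‖ξ‖ ^ 2 : ℝ) : ℂ) • EuclideanSpace.proj (𝕜 := ℂ) (k, j))

end CommutatorEstimate

end

noncomputable section

namespace CommutatorEstimate

set_option linter.unusedSectionVars false

/-! ### Minkowski's integral inequality -/

section Minkowski

variable {α β : Type*} [MeasurableSpace α] [MeasurableSpace β] {μ : Measure α} {ν : Measure β}
  [SFinite μ] [SFinite ν]

/-! The proof avoids paraproducts. Let `f_j` be the homogeneous dyadic blocks of `τ`, let `κ_j` be a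
Schwartz kernel with `κ_j * f_j = f_j`, and let `M_j = m(D) κ_j`. For a kernel `K` put `E_K(f) =
u·∇(K * f) - K * (u·∇f)`; this is `localCommutator`. Then `u·∇f_j = E_{κ_j}(f_j) + κ_j * (u·∇f_j)`.
Applying `m(D)` and subtracting `u·∇(M_j * f_j)` gives `[m(D), u·∇] f_j = m(D) E_{κ_j}(f_j) -
E_{M_j}(f_j)`, where the singular operator acts only on an `L^p` function.

Since `E_K(f)(x) = ∫ K(z) ∇f(x - z)·(u(x) - u(x - z)) dz` and `‖u(· - z) - u‖_p ≤ |z| ‖∇u‖_p`,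
Minkowski's inequality bounds `‖E_K(f)‖_p` by `‖ |z| K ‖_1 ‖∇f‖_∞ ‖∇u‖_p`. At scale `2^j` the first
moment of the kernel is `O(2^{-j})` and `‖∇f_j‖_∞ = O(2^j ‖f_j‖_∞)`, so the powers cancel
(`IsWeakGradient.eLpNorm_localCommutator_scaled_le`) and the sum over `j` costs `∑ ‖f_j‖_∞`. For `j
≥ 0` this is controlled by the Besov norm, for `j < 0` by Bernstein's inequality and `‖τ‖_q`
(`IsDyadicPartition.exists_block_decomposition`).

The `L^p` bound for the Riesz transforms comes from M. Riesz' argument with holomorphic powers for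
the Hilbert transform (`exists_abs_im_rpow_le`, `exists_hilbert`), followed by the method of
rotations with a Gaussian angular weight (`exists_eLpNorm_riesz_le`). The symbol of `Δ⁻¹ curl div`
is a combination of products of two Riesz symbols, handled by `IsLpMultiplier.mul`.

The weak formulation needs care: `u` may grow, and `m(-D) θ` is not Schwartz, because `m` is
singular at the origin. It decays like `(1 + |x|)^{-s}` for all `s < d`, and its gradient for all `s
< d + 1` (`IsHomogeneousSymbol.exists_approx`). On the other side, the translation bound makes `u`
minus a constant integrable against `(1 + |x|)^{-(d + 1/2)}` (`exists_lintegral_weight_le`), so all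
pairings converge. The block identity is obtained by integration by parts when `u` is `C^1` with `u,
∇u ∈ L^p`, and when `u` is constant. Its defect is linear in `u` and, after removal of a suitable
constant, bounded by `‖∇u‖_p`; hence it vanishes for every `u` by density
(`commutatorDefect_eq_zero`). -/

/-- Hölder's inequality with a weight. -/
theorem lintegral_weight_mul_rpow_le {p : ℝ} (hp : 1 ≤ p) {k h : β → ℝ≥0∞}
    (hk : AEMeasurable k ν) (hh : AEMeasurable h ν) :
    (∫⁻ z, k z * h z ∂ν) ^ p ≤ (∫⁻ z, k z ∂ν) ^ (p - 1) * ∫⁻ z, k z * h z ^ p ∂ν := by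
  rcases hp.eq_or_lt with rfl | hp
  · simp
  have hpq : p.HolderConjugate (p / (p - 1)) := Real.HolderConjugate.conjExponent hp
  set q := p / (p - 1) with hq
  have hp0 : 0 < p := by linarith
  have hq0 : 0 < q := hpq.symm.pos
  have h1 : ∀ z, k z * h z = (k z ^ (1 / p) * h z) * k z ^ (1 / q) := fun z => by
    rw [mul_right_comm, ← ENNReal.rpow_add_of_nonneg _ _ (by positivity) (by positivity)]
    have : 1 / p + 1 / q = 1 := by simpa using hpq.inv_add_inv_eq_one
    rw [this, ENNReal.rpow_one]
  have h2 : ∫⁻ z, k z * h z ∂ν ≤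
      (∫⁻ z, k z * h z ^ p ∂ν) ^ (1 / p) * (∫⁻ z, k z ∂ν) ^ (1 / q) := by
    calc ∫⁻ z, k z * h z ∂ν = ∫⁻ z, (k z ^ (1 / p) * h z) * k z ^ (1 / q) ∂ν :=
          lintegral_congr h1
      _ ≤ _ := ENNReal.lintegral_mul_le_Lp_mul_Lq ν hpq
          ((hk.pow_const _).mul hh) (hk.pow_const _)
      _ = _ := by
          congr 3
          · ext z
            rw [ENNReal.mul_rpow_of_nonneg _ _ hp0.le, ← ENNReal.rpow_mul,
              one_div_mul_cancel hp0.ne', ENNReal.rpow_one]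
          · ext z
            rw [← ENNReal.rpow_mul, one_div_mul_cancel hq0.ne', ENNReal.rpow_one]
  calc (∫⁻ z, k z * h z ∂ν) ^ p
      ≤ ((∫⁻ z, k z * h z ^ p ∂ν) ^ (1 / p) * (∫⁻ z, k z ∂ν) ^ (1 / q)) ^ p := by gcongr
    _ = _ := by
      rw [ENNReal.mul_rpow_of_nonneg _ _ hp0.le, ← ENNReal.rpow_mul, ← ENNReal.rpow_mul,
        one_div_mul_cancel hp0.ne', ENNReal.rpow_one, mul_comm]
      congr 2
      rw [hq]; field_simp

/-- Hölder is applied for the measure `k a dν` to the normalised integrand `a⁻¹ H`, and Tonelli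
exchanges the two integrals. The weight `a` lets the `L^p` norm of `H(·, z)` depend on `z`: `a = 1`
yields Young's inequality, `a = |z|` the commutator estimate. -/
theorem lintegral_minkowski {p : ℝ} (hp : 1 ≤ p) {k a : β → ℝ≥0∞} {H : α → β → ℝ≥0∞}
    (hk : AEMeasurable k ν) (ha : AEMeasurable a ν)
    (hH : AEMeasurable (Function.uncurry H) (μ.prod ν)) {N : ℝ≥0∞}
    (ha0 : ∀ᵐ z ∂ν, a z ≠ 0) (ha1 : ∀ᵐ z ∂ν, a z ≠ ∞)
    (hN : ∀ᵐ z ∂ν, ∫⁻ x, H x z ^ p ∂μ ≤ (a z * N) ^ p) :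
    ∫⁻ x, (∫⁻ z, k z * H x z ∂ν) ^ p ∂μ ≤ ((∫⁻ z, k z * a z ∂ν) * N) ^ p := by
  have hp0 : 0 ≤ p := by linarith
  have hka : AEMeasurable (fun z => k z * a z) ν := hk.mul ha
  have hHx : ∀ᵐ x ∂μ, AEMeasurable (H x) ν := by
    have h3 := hH.aestronglyMeasurable.prodMk_left
    filter_upwards [h3] with x hx using hx.aemeasurable
  have hm : AEMeasurable (fun y : α × β => (k y.2 * a y.2) * ((a y.2)⁻¹ * H y.1 y.2) ^ p)
      (μ.prod ν) := by
    have h1 : AEMeasurable (fun y : α × β => k y.2) (μ.prod ν) := hk.comp_snd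
    have h2 : AEMeasurable (fun y : α × β => a y.2) (μ.prod ν) := ha.comp_snd
    exact (h1.mul h2).mul ((h2.inv.mul hH).pow_const _)
  calc ∫⁻ x, (∫⁻ z, k z * H x z ∂ν) ^ p ∂μ
      = ∫⁻ x, (∫⁻ z, (k z * a z) * ((a z)⁻¹ * H x z) ∂ν) ^ p ∂μ := by
        refine lintegral_congr fun x => ?_
        congr 1
        refine lintegral_congr_ae ?_
        filter_upwards [ha0, ha1] with z h0 h1
        rw [mul_assoc, ← mul_assoc (a z), ENNReal.mul_inv_cancel h0 h1, one_mul]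
    _ ≤ ∫⁻ x, (∫⁻ z, k z * a z ∂ν) ^ (p - 1) *
          ∫⁻ z, (k z * a z) * ((a z)⁻¹ * H x z) ^ p ∂ν ∂μ := by
        refine lintegral_mono_ae ?_
        filter_upwards [hHx] with x hx
        exact lintegral_weight_mul_rpow_le hp hka (ha.inv.mul hx)
    _ = (∫⁻ z, k z * a z ∂ν) ^ (p - 1) *
          ∫⁻ x, ∫⁻ z, (k z * a z) * ((a z)⁻¹ * H x z) ^ p ∂ν ∂μ :=
        lintegral_const_mul'' _ hm.lintegral_prod_right'
    _ = (∫⁻ z, k z * a z ∂ν) ^ (p - 1) *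
          ∫⁻ z, ∫⁻ x, (k z * a z) * ((a z)⁻¹ * H x z) ^ p ∂μ ∂ν := by
        rw [lintegral_lintegral_swap hm]
    _ ≤ (∫⁻ z, k z * a z ∂ν) ^ (p - 1) * ∫⁻ z, (k z * a z) * N ^ p ∂ν := by
        gcongr 1
        refine lintegral_mono_ae ?_
        have hHz : ∀ᵐ z ∂ν, AEMeasurable (fun x => H x z) μ := by
          have h3 := hH.prod_swap.aestronglyMeasurable.prodMk_left
          filter_upwards [h3] with x hx using hx.aemeasurable
        filter_upwards [ha0, ha1, hN, hHz] with z h0 h1 h2 h3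
        rw [lintegral_const_mul'' _ ((h3.const_mul _).pow_const _)]
        gcongr 1
        simp_rw [ENNReal.mul_rpow_of_nonneg _ _ hp0]
        rw [lintegral_const_mul'' _ (h3.pow_const _)]
        calc _ ≤ (a z)⁻¹ ^ p * (a z * N) ^ p := by gcongr
          _ = N ^ p := by
            rw [← ENNReal.mul_rpow_of_nonneg _ _ hp0, ← mul_assoc,
              ENNReal.inv_mul_cancel h0 h1, one_mul]
    _ = _ := by
        rw [lintegral_mul_const'' _ hka, ENNReal.mul_rpow_of_nonneg _ _ hp0, ← mul_assoc]
        congr 1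
        conv_lhs => enter [2]; rw [← ENNReal.rpow_one (∫⁻ z, k z * a z ∂ν)]
        rw [← ENNReal.rpow_add_of_nonneg _ _ (by linarith) zero_le_one]
        congr 1; ring

variable {F : Type*} [NormedAddCommGroup F] [NormedSpace ℂ F]

theorem eLpNorm_ofReal_rpow {G : Type*} [NormedAddCommGroup G] {p : ℝ} (hp : 1 ≤ p)
    (f : α → G) :
    eLpNorm f (ENNReal.ofReal p) μ ^ p = ∫⁻ x, ‖f x‖ₑ ^ p ∂μ := by
  have hp0 : 0 < p := by linarith
  rw [eLpNorm_eq_lintegral_rpow_enorm_toReal (by simpa using hp0) ENNReal.ofReal_ne_top,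
    ENNReal.toReal_ofReal hp0.le, ← ENNReal.rpow_mul, one_div_mul_cancel hp0.ne', ENNReal.rpow_one]

theorem eLpNorm_ofReal_le_iff {G : Type*} [NormedAddCommGroup G] {p : ℝ} (hp : 1 ≤ p)
    (f : α → G) (N : ℝ≥0∞) :
    eLpNorm f (ENNReal.ofReal p) μ ≤ N ↔ ∫⁻ x, ‖f x‖ₑ ^ p ∂μ ≤ N ^ p := by
  rw [← eLpNorm_ofReal_rpow hp, ENNReal.rpow_le_rpow_iff (by linarith)]

/-- The version with absolute values inside. It gives both the norm bound for the integral and its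
absolute convergence for almost every `x`. -/
theorem ae_lintegral_lt_top_of_minkowski {p : ℝ} (hp : 1 ≤ p) {K : β → ℂ} {a : β → ℝ≥0∞}
    {H : α → β → F} (hK : AEStronglyMeasurable K ν) (ha : AEMeasurable a ν)
    (hH : AEStronglyMeasurable (Function.uncurry H) (μ.prod ν)) {N : ℝ≥0∞}
    (ha0 : ∀ᵐ z ∂ν, a z ≠ 0) (ha1 : ∀ᵐ z ∂ν, a z ≠ ∞)
    (hN : ∀ᵐ z ∂ν, eLpNorm (fun x => H x z) (ENNReal.ofReal p) μ ≤ a z * N) :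
    ∫⁻ x, (∫⁻ z, ‖K z • H x z‖ₑ ∂ν) ^ p ∂μ ≤ ((∫⁻ z, ‖K z‖ₑ * a z ∂ν) * N) ^ p := by
  simp_rw [enorm_smul]
  refine lintegral_minkowski (H := fun x z => ‖H x z‖ₑ) hp hK.enorm ha hH.enorm ha0 ha1 ?_
  filter_upwards [hN] with z hz
  exact (eLpNorm_ofReal_le_iff hp _ _).1 hz

/-- Minkowski's inequality for `x ↦ ∫ K z • H x z`. -/
theorem eLpNorm_integral_smul_le {p : ℝ} (hp : 1 ≤ p) {K : β → ℂ} {a : β → ℝ≥0∞}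
    {H : α → β → F} (hK : AEStronglyMeasurable K ν) (ha : AEMeasurable a ν)
    (hH : AEStronglyMeasurable (Function.uncurry H) (μ.prod ν)) {N : ℝ≥0∞}
    (ha0 : ∀ᵐ z ∂ν, a z ≠ 0) (ha1 : ∀ᵐ z ∂ν, a z ≠ ∞)
    (hN : ∀ᵐ z ∂ν, eLpNorm (fun x => H x z) (ENNReal.ofReal p) μ ≤ a z * N) :
    eLpNorm (fun x => ∫ z, K z • H x z ∂ν) (ENNReal.ofReal p) μ ≤
      (∫⁻ z, ‖K z‖ₑ * a z ∂ν) * N := by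
  rw [eLpNorm_ofReal_le_iff hp]
  refine le_trans (lintegral_mono fun x => ?_)
    (ae_lintegral_lt_top_of_minkowski hp hK ha hH ha0 ha1 hN)
  gcongr
  exact enorm_integral_le_lintegral_enorm _

theorem ae_integrable_smul_of_minkowski {p : ℝ} (hp : 1 ≤ p) {K : β → ℂ} {a : β → ℝ≥0∞}
    {H : α → β → F} (hK : AEStronglyMeasurable K ν) (ha : AEMeasurable a ν)
    (hH : AEStronglyMeasurable (Function.uncurry H) (μ.prod ν)) {N : ℝ≥0∞}
    (ha0 : ∀ᵐ z ∂ν, a z ≠ 0) (ha1 : ∀ᵐ z ∂ν, a z ≠ ∞)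
    (hN : ∀ᵐ z ∂ν, eLpNorm (fun x => H x z) (ENNReal.ofReal p) μ ≤ a z * N)
    (hKa : ∫⁻ z, ‖K z‖ₑ * a z ∂ν ≠ ∞) (hNt : N ≠ ∞) :
    ∀ᵐ x ∂μ, Integrable (fun z => K z • H x z) ν := by
  have hp0 : 0 < p := by linarith
  have h := ae_lintegral_lt_top_of_minkowski hp hK ha hH ha0 ha1 hN
  have hlt : ((∫⁻ z, ‖K z‖ₑ * a z ∂ν) * N) ^ p ≠ ∞ :=
    ENNReal.rpow_ne_top_of_nonneg hp0.le (ENNReal.mul_ne_top hKa hNt)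
  have hKH : AEStronglyMeasurable (fun y : α × β => K y.2 • H y.1 y.2) (μ.prod ν) :=
    (hK.comp_snd (μ := μ)).smul hH
  have hmeas : AEMeasurable (fun x => (∫⁻ z, ‖K z • H x z‖ₑ ∂ν) ^ p) μ :=
    (hKH.enorm.lintegral_prod_right').pow_const _
  filter_upwards [ae_lt_top' hmeas (ne_top_of_le_ne_top hlt h), hKH.prodMk_left] with x hx hx2
  refine ⟨hx2, ?_⟩
  rw [hasFiniteIntegral_iff_enorm]
  exact (ENNReal.rpow_lt_top_iff_of_pos hp0).1 hx

theorem aestronglyMeasurable_integral_smul {K : β → ℂ} {H : α → β → F}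
    (hK : AEStronglyMeasurable K ν)
    (hH : AEStronglyMeasurable (Function.uncurry H) (μ.prod ν)) :
    AEStronglyMeasurable (fun x => ∫ z, K z • H x z ∂ν) μ :=
  AEStronglyMeasurable.integral_prod_right'
    (f := fun y : α × β => K y.2 • H y.1 y.2) ((hK.comp_snd (μ := μ)).smul hH)

end Minkowski

/-! ### Convolution with scalar kernels -/

section Convolution

open LineDeriv

variable {d : ℕ} {F : Type*} [NormedAddCommGroup F] [NormedSpace ℂ F] [CompleteSpace F]

/-- The convolution `K * f`. -/
def conv (K : Space d → ℂ) (f : Space d → F) (x : Space d) : F := ∫ z, K z • f (x - z)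

theorem conv_eq_integral_sub (K : Space d → ℂ) (f : Space d → F) (x : Space d) :
    conv K f x = ∫ z, K (x - z) • f z := by
  rw [conv, ← integral_sub_left_eq_self _ volume x]
  simp

theorem aestronglyMeasurable_comp_sub {f : Space d → F} (hf : AEStronglyMeasurable f) :
    AEStronglyMeasurable (Function.uncurry fun x z : Space d => f (x - z))
      (volume.prod volume) :=
  hf.comp_quasiMeasurePreserving (quasiMeasurePreserving_sub (volume : Measure (Space d)) volume)

theorem eLpNorm_comp_sub {f : Space d → F} (hf : AEStronglyMeasurable f) (p : ℝ≥0∞)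
    (z : Space d) : eLpNorm (fun x => f (x - z)) p volume = eLpNorm f p volume :=
  eLpNorm_comp_measurePreserving hf (measurePreserving_sub_right volume z)

/-- Young's inequality. -/
theorem eLpNorm_conv_le {p : ℝ} (hp : 1 ≤ p) {K : Space d → ℂ} {f : Space d → F}
    (hK : AEStronglyMeasurable K) (hf : AEStronglyMeasurable f) :
    eLpNorm (conv K f) (ENNReal.ofReal p) volume ≤
      (∫⁻ z, ‖K z‖ₑ) * eLpNorm f (ENNReal.ofReal p) volume := by
  have := eLpNorm_integral_smul_le (a := fun _ => 1) hp hK aemeasurable_const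
    (aestronglyMeasurable_comp_sub hf) (by simp) (by simp)
    (N := eLpNorm f (ENNReal.ofReal p) volume)
    (Filter.Eventually.of_forall fun z => by rw [eLpNorm_comp_sub hf, one_mul])
  simp only [mul_one] at this
  exact this

theorem aestronglyMeasurable_conv {K : Space d → ℂ} {f : Space d → F}
    (hK : AEStronglyMeasurable K) (hf : AEStronglyMeasurable f) :
    AEStronglyMeasurable (conv K f) :=
  aestronglyMeasurable_integral_smul hK (aestronglyMeasurable_comp_sub hf)

theorem memLp_conv {p : ℝ} (hp : 1 ≤ p) {K : Space d → ℂ} {f : Space d → F}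
    (hK : Integrable K) (hf : MemLp f (ENNReal.ofReal p)) :
    MemLp (conv K f) (ENNReal.ofReal p) :=
  ⟨aestronglyMeasurable_conv hK.1 hf.1, (eLpNorm_conv_le hp hK.1 hf.1).trans_lt
    (ENNReal.mul_lt_top hK.2 hf.2)⟩

theorem norm_conv_le {K : Space d → ℂ} {f : Space d → F} (hK : Integrable K) {B : ℝ}
    (hf : ∀ᵐ x, ‖f x‖ ≤ B) (x : Space d) : ‖conv K f x‖ ≤ (∫ z, ‖K z‖) * B := by
  rw [← integral_mul_const]
  refine norm_integral_le_of_norm_le (hK.norm.mul_const B) ?_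
  filter_upwards [(quasiMeasurePreserving_sub_left volume x).ae hf] with z hz
  rw [norm_smul]
  gcongr

/-- Functions that are integrable against some negative power of `1 + |x|`. -/
def IsTempered (f : Space d → F) : Prop :=
  AEStronglyMeasurable f ∧ ∃ n : ℕ, Integrable fun z : Space d => ((1 + ‖z‖) ^ n)⁻¹ * ‖f z‖

theorem integrable_one_add_norm_pow_inv :
    Integrable fun z : Space d => ((1 + ‖z‖) ^ (d + 1))⁻¹ := by
  have := integrable_one_add_norm (E := Space d) (μ := volume) (r := d + 1) (by simp)
  refine this.congr (Filter.Eventually.of_forall fun z => ?_)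
  have : 0 ≤ 1 + ‖z‖ := by positivity
  dsimp only
  rw [Real.rpow_neg this]
  norm_cast

theorem IsTempered.of_norm_le {f : Space d → F} (hf : AEStronglyMeasurable f) {B : ℝ}
    (h : ∀ᵐ x, ‖f x‖ ≤ B) : IsTempered f := by
  refine ⟨hf, d + 1, ?_⟩
  refine (integrable_one_add_norm_pow_inv.mul_const B).mono'
    (integrable_one_add_norm_pow_inv.1.mul hf.norm) ?_
  filter_upwards [h] with x hx
  rw [Real.norm_of_nonneg (by positivity)]
  gcongr

/-- For a weight `0 ≤ w ≤ 1` one has `w t ≤ w + t ^ p`: either `t ≤ 1`, or `t ≤ t ^ p`. -/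
theorem IsTempered.of_memLp {p : ℝ} (hp : 1 ≤ p) {f : Space d → F}
    (hf : MemLp f (ENNReal.ofReal p)) : IsTempered f := by
  refine ⟨hf.1, d + 1, ?_⟩
  have hp0 : 0 < p := by linarith
  have h1 : Integrable fun x => ‖f x‖ ^ p := by
    have := hf.integrable_norm_rpow (by simpa using hp0) ENNReal.ofReal_ne_top
    rwa [ENNReal.toReal_ofReal hp0.le] at this
  refine (integrable_one_add_norm_pow_inv.add h1).mono'
    (integrable_one_add_norm_pow_inv.1.mul hf.1.norm) ?_
  filter_upwards with x
  rw [Real.norm_of_nonneg (by positivity)]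
  have h2 : ((1 + ‖x‖) ^ (d + 1))⁻¹ ≤ 1 :=
    inv_le_one_of_one_le₀ (one_le_pow₀ (by simp))
  have h3 : 0 ≤ ((1 + ‖x‖) ^ (d + 1))⁻¹ := by positivity
  have h4 : 0 ≤ ‖f x‖ ^ p := by positivity
  dsimp only [Pi.add_apply]
  rcases le_total ‖f x‖ 1 with h | h
  · nlinarith [norm_nonneg (f x)]
  · have := Real.self_le_rpow_of_one_le h hp
    nlinarith [norm_nonneg (f x)]

theorem schwartz_decay (K : 𝓢(Space d, F)) (n : ℕ) :
    ∃ C, 0 ≤ C ∧ ∀ x, ‖K x‖ ≤ C * ((1 + ‖x‖) ^ n)⁻¹ ∧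
      ‖fderiv ℝ K x‖ ≤ C * ((1 + ‖x‖) ^ n)⁻¹ := by
  refine ⟨2 ^ n * ((Finset.Iic (n, 1)).sup fun m =>
    SchwartzMap.seminorm ℝ (E := Space d) (F := F) m.1 m.2) K, by positivity, fun x => ⟨?_, ?_⟩⟩
  · have := SchwartzMap.one_add_le_sup_seminorm_apply (𝕜 := ℝ) (m := (n, 1)) (k := n) (n := 0)
      le_rfl zero_le_one K x
    rw [norm_iteratedFDeriv_zero] at this
    rw [← div_eq_mul_inv, le_div_iff₀ (by positivity), mul_comm]
    exact this
  · have := SchwartzMap.one_add_le_sup_seminorm_apply (𝕜 := ℝ) (m := (n, 1)) (k := n) (n := 1)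
      le_rfl le_rfl K x
    rw [norm_iteratedFDeriv_one] at this
    rw [← div_eq_mul_inv, le_div_iff₀ (by positivity), mul_comm]
    exact this

/-- Peetre's inequality: translating the weight costs only a polynomial factor in the translation,
so Schwartz kernels centred at any point can be paired with tempered functions. -/
theorem inv_one_add_norm_sub_pow_le (x z : Space d) (n : ℕ) :
    ((1 + ‖x - z‖) ^ n)⁻¹ ≤ (1 + ‖x‖) ^ n * ((1 + ‖z‖) ^ n)⁻¹ := by
  rw [← div_eq_mul_inv, le_div_iff₀ (by positivity), inv_mul_le_iff₀ (by positivity), ← mul_pow]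
  gcongr
  have : ‖z‖ ≤ ‖x‖ + ‖x - z‖ := by
    have := norm_sub_le x (x - z); simpa using this
  nlinarith [norm_nonneg x, norm_nonneg (x - z)]

theorem IsTempered.integrable_smul {f : Space d → F} (hf : IsTempered f) (K : 𝓢(Space d, ℂ))
    (x : Space d) : Integrable fun z => K (x - z) • f z := by
  obtain ⟨hm, n, hn⟩ := hf
  obtain ⟨C, hC, hK⟩ := schwartz_decay K n
  refine (hn.const_mul (C * (1 + ‖x‖) ^ n)).mono'
    ((K.continuous.comp (continuous_const.sub continuous_id)).aestronglyMeasurable.smul hm) ?_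
  filter_upwards with z
  rw [norm_smul]
  calc ‖K (x - z)‖ * ‖f z‖ ≤ C * ((1 + ‖x‖) ^ n * ((1 + ‖z‖) ^ n)⁻¹) * ‖f z‖ := by
        gcongr
        exact (hK _).1.trans (by gcongr; exact inv_one_add_norm_sub_pow_le x z n)
    _ = _ := by ring

theorem aestronglyMeasurable_fderiv_smulRight {f : Space d → F} (hf : AEStronglyMeasurable f)
    (K : 𝓢(Space d, ℂ)) (x : Space d) :
    AEStronglyMeasurable fun z => (fderiv ℝ K (x - z)).smulRight (f z) := by
  have h1 : Continuous fun z => fderiv ℝ K (x - z) :=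
    ((K.smooth 1).continuous_fderiv one_ne_zero).comp (by fun_prop)
  have h2 : AEStronglyMeasurable fun z => (ContinuousLinearMap.lsmul ℝ ℂ (E := F)).flip (f z) :=
    ((ContinuousLinearMap.lsmul ℝ ℂ (E := F)).flip.continuous).comp_aestronglyMeasurable hf
  exact (ContinuousLinearMap.compL ℝ (Space d) ℂ F).aestronglyMeasurable_comp₂ h2
    h1.aestronglyMeasurable

theorem norm_smulRight_complex_le (c : Space d →L[ℝ] ℂ) (v : F) :
    ‖c.smulRight v‖ ≤ ‖c‖ * ‖v‖ := by
  refine ContinuousLinearMap.opNorm_le_bound _ (by positivity) fun w => ?_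
  rw [ContinuousLinearMap.smulRight_apply, norm_smul, mul_right_comm]
  gcongr
  exact c.le_opNorm w

theorem IsTempered.integrable_fderiv_smulRight {f : Space d → F} (hf : IsTempered f)
    (K : 𝓢(Space d, ℂ)) (x : Space d) :
    Integrable fun z => (fderiv ℝ K (x - z)).smulRight (f z) := by
  obtain ⟨hm, n, hn⟩ := hf
  obtain ⟨C, hC, hK⟩ := schwartz_decay K n
  refine (hn.const_mul (C * (1 + ‖x‖) ^ n)).mono'
    (aestronglyMeasurable_fderiv_smulRight hm K x) ?_
  filter_upwards with z
  refine (norm_smulRight_complex_le _ _).trans ?_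
  calc ‖fderiv ℝ K (x - z)‖ * ‖f z‖ ≤ C * ((1 + ‖x‖) ^ n * ((1 + ‖z‖) ^ n)⁻¹) * ‖f z‖ := by
        gcongr
        exact (hK _).2.trans (by gcongr; exact inv_one_add_norm_sub_pow_le x z n)
    _ = _ := by ring

/-- Differentiation under the integral sign. For `y` in the unit ball around `x`, Peetre's
inequality and `1 + ‖y‖ ≤ 2 + ‖x‖` dominate the differentiated kernel by a fixed multiple of the
weight for which `f` is integrable. -/
theorem IsTempered.hasFDerivAt_conv {f : Space d → F} (hf : IsTempered f) (K : 𝓢(Space d, ℂ))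
    (x : Space d) :
    HasFDerivAt (conv K f) (∫ z, (fderiv ℝ K (x - z)).smulRight (f z)) x := by
  have h0 : conv K f = fun x => ∫ z, K (x - z) • f z := funext (conv_eq_integral_sub _ _)
  rw [h0]
  have hf' := hf
  obtain ⟨hm, n, hn⟩ := hf
  obtain ⟨C, hC, hK⟩ := schwartz_decay K n
  refine hasFDerivAt_integral_of_dominated_of_fderiv_le (𝕜 := ℝ) (s := Metric.ball x 1)
    (F' := fun x z => (fderiv ℝ K (x - z)).smulRight (f z))
    (bound := fun z => (C * (2 + ‖x‖) ^ n) * (((1 + ‖z‖) ^ n)⁻¹ * ‖f z‖))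
    (Metric.ball_mem_nhds x one_pos) (Filter.Eventually.of_forall fun y =>
      (hf'.integrable_smul K y).1) (hf'.integrable_smul K x) ?_ ?_ (hn.const_mul _) ?_
  · exact aestronglyMeasurable_fderiv_smulRight hm K x
  · filter_upwards with z y hy
    refine (norm_smulRight_complex_le _ _).trans ?_
    have hy' : ‖y‖ ≤ 1 + ‖x‖ := by
      rw [mem_ball_iff_norm] at hy
      have := norm_add_le (y - x) x
      rw [sub_add_cancel] at this; linarith
    calc ‖fderiv ℝ K (y - z)‖ * ‖f z‖ ≤ C * ((2 + ‖x‖) ^ n * ((1 + ‖z‖) ^ n)⁻¹) * ‖f z‖ := by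
          gcongr
          refine (hK _).2.trans ?_
          gcongr
          refine (inv_one_add_norm_sub_pow_le y z n).trans
            (mul_le_mul_of_nonneg_right (pow_le_pow_left₀ (by positivity) ?_ n) (by positivity))
          linarith
      _ = _ := by ring
  · filter_upwards with z y _
    have h1 : HasFDerivAt (fun y => K (y - z)) (fderiv ℝ K (y - z)) y := by
      have := (K.differentiableAt (x := y - z)).hasFDerivAt.comp y
        ((hasFDerivAt_id y).sub_const z)
      simp only [ContinuousLinearMap.comp_id] at this
      exact this
    exact h1.smul_const (f z)

theorem IsTempered.differentiable_conv {f : Space d → F} (hf : IsTempered f) (K : 𝓢(Space d, ℂ)) :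
    Differentiable ℝ (conv K f) := fun x => (hf.hasFDerivAt_conv K x).differentiableAt

theorem IsTempered.fderiv_conv_apply {f : Space d → F} (hf : IsTempered f)
    (K : 𝓢(Space d, ℂ)) (x v : Space d) :
    fderiv ℝ (conv K f) x v = conv (∂_{v} K : 𝓢(Space d, ℂ)) f x := by
  rw [(hf.hasFDerivAt_conv K x).fderiv,
    ContinuousLinearMap.integral_apply (hf.integrable_fderiv_smulRight K x), conv_eq_integral_sub]
  simp [SchwartzMap.lineDerivOp_apply_eq_fderiv]

theorem IsTempered.continuous_fderiv_conv {f : Space d → F} (hf : IsTempered f)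
    (K : 𝓢(Space d, ℂ)) : Continuous (fderiv ℝ (conv K f)) := by
  rw [continuous_clm_apply]
  intro v
  simp_rw [IsTempered.fderiv_conv_apply hf]
  exact (hf.differentiable_conv _).continuous

/-- Convolution operators are transposed to convolution operators. -/
theorem integral_smul_conv {p q : ℝ} (hpq : p.HolderConjugate q) {K θ : Space d → ℂ}
    {f : Space d → F} (hK : Integrable K) (hθ : MemLp θ (ENNReal.ofReal q))
    (hf : MemLp f (ENNReal.ofReal p)) :
    ∫ x, θ x • conv K f x = ∫ y, conv (fun z => K (-z)) θ y • f y := by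
  have hp : 1 ≤ p := hpq.lt.le
  have hq : 1 ≤ q := hpq.symm.lt.le
  have hmeas : AEStronglyMeasurable
      (fun y : Space d × Space d => θ y.1 • (K (y.1 - y.2) • f y.2)) (volume.prod volume) :=
    (hθ.1.comp_fst (ν := volume)).smul ((aestronglyMeasurable_comp_sub hK.1).smul
      (hf.1.comp_snd (μ := volume)))
  have hint : Integrable (Function.uncurry fun x y : Space d => θ x • (K (x - y) • f y))
      (volume.prod volume) := by
    refine ⟨hmeas, ?_⟩
    rw [hasFiniteIntegral_iff_enorm]
    change ∫⁻ y : Space d × Space d, ‖θ y.1 • (K (y.1 - y.2) • f y.2)‖ₑ ∂_ < ∞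
    rw [lintegral_prod _ hmeas.enorm]
    have h1 : ∀ x, ∫⁻ y, ‖θ x • (K (x - y) • f y)‖ₑ = ‖θ x‖ₑ * ∫⁻ z, ‖K z • f (x - z)‖ₑ := by
      intro x
      simp_rw [enorm_smul (θ x)]
      rw [lintegral_const_mul' _ _ (by simp),
        ← lintegral_sub_left_eq_self (fun z => ‖K z • f (x - z)‖ₑ) x]
      simp
    have h2 : AEMeasurable fun x => ∫⁻ z, ‖K z • f (x - z)‖ₑ :=
      (((hK.1.comp_snd (μ := volume)).smul
        (aestronglyMeasurable_comp_sub hf.1)).enorm).lintegral_prod_right'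
    calc ∫⁻ x, ∫⁻ y, ‖θ x • (K (x - y) • f y)‖ₑ
        = ∫⁻ x, ‖θ x‖ₑ * ∫⁻ z, ‖K z • f (x - z)‖ₑ := lintegral_congr h1
      _ ≤ (∫⁻ x, ‖θ x‖ₑ ^ q) ^ (1 / q) * (∫⁻ x, (∫⁻ z, ‖K z • f (x - z)‖ₑ) ^ p) ^ (1 / p) :=
        ENNReal.lintegral_mul_le_Lp_mul_Lq volume hpq.symm hθ.1.enorm h2
      _ < ∞ := by
        refine ENNReal.mul_lt_top (ENNReal.rpow_lt_top_of_nonneg (by positivity) ?_)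
          (ENNReal.rpow_lt_top_of_nonneg (by positivity) ?_)
        · rw [← eLpNorm_ofReal_rpow hq]
          exact ENNReal.rpow_ne_top_of_nonneg (by positivity) hθ.2.ne
        · refine ne_top_of_le_ne_top ?_ (ae_lintegral_lt_top_of_minkowski hp
            (a := fun _ => 1) hK.1 aemeasurable_const
            (aestronglyMeasurable_comp_sub hf.1) (by simp) (by simp)
            (N := eLpNorm f (ENNReal.ofReal p) volume)
            (Filter.Eventually.of_forall fun z => by rw [eLpNorm_comp_sub hf.1, one_mul]))
          refine ENNReal.rpow_ne_top_of_nonneg (by positivity) (ENNReal.mul_ne_top ?_ hf.2.ne)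
          simpa using hK.2.ne
  calc ∫ x, θ x • conv K f x = ∫ x, ∫ y, θ x • (K (x - y) • f y) := by
        simp_rw [conv_eq_integral_sub, integral_smul]
    _ = ∫ y, ∫ x, θ x • (K (x - y) • f y) := integral_integral_swap hint
    _ = _ := by
        refine integral_congr_ae (Filter.Eventually.of_forall fun y => ?_)
        dsimp only
        rw [conv_eq_integral_sub, ← integral_smul_const]
        simp [smul_smul, mul_comm]

/-- Convolution with an inverse Fourier transform. -/
theorem conv_fourierInv {K s : Space d → ℂ} (hK : Integrable K) (hs : Integrable s) :
    conv K (𝓕⁻ s) = 𝓕⁻ (fun ξ => 𝓕 K ξ * s ξ) := by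
  ext x
  have hint : Integrable (Function.uncurry fun z ξ : Space d =>
      K z • (Real.fourierChar (inner ℝ ξ (x - z)) • s ξ)) (volume.prod volume) := by
    have h1 := hK.mul_prod hs
    have h2 : Continuous fun y : Space d × Space d => Real.fourierChar (inner ℝ y.2 (x - y.1)) :=
      Real.continuous_fourierChar.comp (by fun_prop)
    refine h1.mono ((hK.1.comp_fst (ν := volume)).smul
      (h2.aestronglyMeasurable.smul (hs.1.comp_snd (μ := volume)))) ?_
    exact Filter.Eventually.of_forall fun y => by simp [Function.uncurry]
  calc conv K (𝓕⁻ s) x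
      = ∫ z, ∫ ξ, K z • (Real.fourierChar (inner ℝ ξ (x - z)) • s ξ) := by
        simp_rw [conv, Real.fourierInv_eq, integral_smul]
    _ = ∫ ξ, ∫ z, K z • (Real.fourierChar (inner ℝ ξ (x - z)) • s ξ) :=
        integral_integral_swap hint
    _ = _ := by
        rw [Real.fourierInv_eq]
        refine integral_congr_ae (Filter.Eventually.of_forall fun ξ => ?_)
        dsimp only
        simp only [Circle.smul_def, smul_eq_mul]
        rw [Real.fourier_eq, ← integral_mul_const, ← integral_const_mul]
        refine integral_congr_ae (Filter.Eventually.of_forall fun z => ?_)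
        have h4 : inner ℝ ξ (x - z) = inner ℝ ξ x + -inner ℝ z ξ := by
          rw [inner_sub_right, real_inner_comm z ξ, sub_eq_add_neg]
        dsimp only
        rw [h4, AddChar.map_add_eq_mul, Circle.coe_mul, Circle.smul_def, smul_eq_mul]
        ring

/-- Fourier inversion reduces a convolution identity to a pointwise product of symbols. The
reproducing and telescoping identities of the dyadic kernels are checked in this form. -/
theorem conv_eq_of_fourier_eq {K L M : 𝓢(Space d, ℂ)} (h : ∀ ξ, 𝓕 K ξ * 𝓕 L ξ = 𝓕 M ξ) :
    conv K L = M := by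
  have h1 : (L : Space d → ℂ) = 𝓕⁻ ⇑(𝓕 L : 𝓢(Space d, ℂ)) := by
    rw [← SchwartzMap.fourierInv_coe]; simp
  have h2 : (M : Space d → ℂ) = 𝓕⁻ ⇑(𝓕 M : 𝓢(Space d, ℂ)) := by
    rw [← SchwartzMap.fourierInv_coe]; simp
  rw [h1, conv_fourierInv K.integrable (𝓕 L).integrable, h2]
  congr 1
  ext ξ
  rw [← h, SchwartzMap.fourier_coe K]

/-- Associativity is the transposition rule `integral_smul_conv` with the translate `K (x - ·)` as
test function. A change of variables then identifies the kernel. -/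
theorem conv_conv {p : ℝ} (hp : 1 < p) (K L : 𝓢(Space d, ℂ)) {f : Space d → F}
    (hf : MemLp f (ENNReal.ofReal p)) : conv K (conv L f) = conv (conv K L) f := by
  ext x
  have hpq : p.HolderConjugate (p / (p - 1)) := Real.HolderConjugate.conjExponent hp
  have hθ : MemLp (fun w => K (x - w)) (ENNReal.ofReal (p / (p - 1))) :=
    (K.memLp _ volume).comp_measurePreserving (volume.measurePreserving_sub_left x)
  rw [conv_eq_integral_sub, integral_smul_conv hpq L.integrable hθ hf, conv_eq_integral_sub]
  congr 1
  ext y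
  congr 1
  rw [conv_eq_integral_sub, conv, ← integral_add_right_eq_self _ y]
  rw [← integral_sub_left_eq_self _ volume (x - y)]
  refine integral_congr_ae (Filter.Eventually.of_forall fun z => ?_)
  have h1 : x - (x - y - z + y) = z := by abel
  simp only [smul_eq_mul, neg_sub, add_sub_cancel_right, h1]
  ring

end Convolution

/-! ### Dilated kernels and approximate identities -/

section Dilation

open LineDeriv Filter Topology

variable {d : ℕ} {F : Type*} [NormedAddCommGroup F] [NormedSpace ℂ F] [CompleteSpace F]

/-- The dilation by `2 ^ j`. -/
def dyadicDilation (d : ℕ) (j : ℤ) : Space d ≃L[ℝ] Space d :=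
  ContinuousLinearEquiv.smulLeft (Units.mk0 ((2 : ℝ) ^ j) (by positivity))

/-- The kernel `2 ^ (j d) K (2 ^ j x)`. -/
def scaled (j : ℤ) (K : 𝓢(Space d, ℂ)) : 𝓢(Space d, ℂ) :=
  ((((2 : ℝ) ^ j) ^ d : ℝ) : ℂ) •
    SchwartzMap.compCLMOfContinuousLinearEquiv ℂ (dyadicDilation d j) K

theorem scaled_apply (j : ℤ) (K : 𝓢(Space d, ℂ)) (x : Space d) :
    scaled j K x = ((((2 : ℝ) ^ j) ^ d : ℝ) : ℂ) * K ((2 : ℝ) ^ j • x) := by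
  rfl

theorem lintegral_comp_smul {f : Space d → ℝ≥0∞} (hf : Measurable f) {c : ℝ} (hc : 0 < c) :
    ∫⁻ x, f (c • x) = ENNReal.ofReal ((c ^ d)⁻¹) * ∫⁻ x, f x := by
  have h := Measure.map_addHaar_smul (volume : Measure (Space d)) hc.ne'
  rw [← lintegral_map hf (measurable_const_smul c), h, lintegral_smul_measure]
  simp [abs_of_pos hc]

theorem lintegral_scaled_mul (j : ℤ) (K : 𝓢(Space d, ℂ)) {g : Space d → ℝ≥0∞}
    (hg : Measurable g) :
    ∫⁻ z, ‖scaled j K z‖ₑ * g z = ∫⁻ z, ‖K z‖ₑ * g (((2 : ℝ) ^ j)⁻¹ • z) := by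
  have hc : (0 : ℝ) < 2 ^ j := by positivity
  obtain ⟨G, hG⟩ : ∃ G : Space d → ℝ≥0∞, G = fun y => ‖K y‖ₑ * g (((2 : ℝ) ^ j)⁻¹ • y) :=
    ⟨_, rfl⟩
  have h1 : ∀ z, ‖scaled j K z‖ₑ * g z = ENNReal.ofReal (((2 : ℝ) ^ j) ^ d) *
      G ((2 : ℝ) ^ j • z) := by
    intro z
    rw [hG]
    dsimp only
    rw [scaled_apply, enorm_mul, inv_smul_smul₀ hc.ne', mul_assoc]
    congr 1
    rw [← ofReal_norm, Complex.norm_real, Real.norm_of_nonneg (by positivity)]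
  have hm : Measurable G := by
    rw [hG]
    exact K.continuous.measurable.enorm.mul (hg.comp (measurable_const_smul _))
  rw [lintegral_congr h1, lintegral_const_mul _ (show Measurable fun z => G ((2 : ℝ) ^ j • z) from
      hm.comp (measurable_const_smul _)), lintegral_comp_smul hm hc, ← mul_assoc,
          ← ENNReal.ofReal_mul (by positivity),
    mul_inv_cancel₀ (by positivity), hG]
  simp

theorem lintegral_enorm_scaled (j : ℤ) (K : 𝓢(Space d, ℂ)) :
    ∫⁻ z, ‖scaled j K z‖ₑ = ∫⁻ z, ‖K z‖ₑ := by
  simpa using lintegral_scaled_mul j K (g := fun _ => 1) measurable_const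

/-- The first moment gains `2 ^ (-j)`. In the commutator this compensates the factor `2 ^ j` lost to
the gradient of a block. -/
theorem lintegral_scaled_mul_enorm (j : ℤ) (K : 𝓢(Space d, ℂ)) :
    ∫⁻ z, ‖scaled j K z‖ₑ * ‖z‖ₑ = ENNReal.ofReal (2 ^ (-j)) * ∫⁻ z, ‖K z‖ₑ * ‖z‖ₑ := by
  rw [lintegral_scaled_mul j K measurable_enorm, ← lintegral_const_mul]
  · congr 1
    ext z
    rw [enorm_smul, Real.enorm_of_nonneg (by positivity), zpow_neg]
    ring
  · exact K.continuous.measurable.enorm.mul measurable_enorm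

theorem integral_scaled_smul (j : ℤ) (K : 𝓢(Space d, ℂ)) (g : Space d → F) :
    ∫ z, scaled j K z • g z = ∫ z, K z • g (((2 : ℝ) ^ j)⁻¹ • z) := by
  have hc : (0 : ℝ) < 2 ^ j := by positivity
  have h := Measure.integral_comp_smul (volume : Measure (Space d))
    (fun z => K z • g (((2 : ℝ) ^ j)⁻¹ • z)) ((2 : ℝ) ^ j)
  have h1 : ∀ z, scaled j K z • g z = (((2 : ℝ) ^ j) ^ d : ℝ) •
      (K ((2 : ℝ) ^ j • z) • g (((2 : ℝ) ^ j)⁻¹ • ((2 : ℝ) ^ j • z))) := by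
    intro z
    rw [scaled_apply, inv_smul_smul₀ hc.ne', mul_smul, Complex.coe_smul]
  simp_rw [h1]
  rw [integral_smul, h, smul_smul, abs_of_nonneg (by positivity)]
  simp [hc.ne']

theorem integral_norm_scaled (j : ℤ) (K : 𝓢(Space d, ℂ)) :
    ∫ z, ‖scaled j K z‖ = ∫ z, ‖K z‖ := by
  rw [integral_norm_eq_lintegral_enorm (scaled j K).integrable.1,
    integral_norm_eq_lintegral_enorm K.integrable.1, lintegral_enorm_scaled]

theorem fourier_scaled (j : ℤ) (K : 𝓢(Space d, ℂ)) (ξ : Space d) :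
    𝓕 (scaled j K) ξ = 𝓕 K (((2 : ℝ) ^ j)⁻¹ • ξ) := by
  have h := integral_scaled_smul j K (fun z => (Real.fourierChar (-inner ℝ z ξ) : ℂ))
  rw [SchwartzMap.fourier_coe, SchwartzMap.fourier_coe, Real.fourier_eq, Real.fourier_eq]
  simp only [smul_eq_mul] at h
  simp only [Circle.smul_def, smul_eq_mul]
  simp_rw [mul_comm _ (scaled j K _), h, inner_smul_left, inner_smul_right, mul_comm (K _)]
  rfl

theorem lineDeriv_scaled (j : ℤ) (K : 𝓢(Space d, ℂ)) (v : Space d) :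
    (∂_{v} (scaled j K) : 𝓢(Space d, ℂ)) = ((2 : ℝ) ^ j) • scaled j (∂_{v} K) := by
  ext x
  have h2 : HasFDerivAt (fun x => K ((2 : ℝ) ^ j • x))
      ((fderiv ℝ K ((2 : ℝ) ^ j • x)).comp (((2 : ℝ) ^ j) • ContinuousLinearMap.id ℝ (Space d)))
      x :=
    (K.differentiableAt (x := (2 : ℝ) ^ j • x)).hasFDerivAt.comp x
      ((hasFDerivAt_id x).const_smul ((2 : ℝ) ^ j))
  have h3 := h2.const_mul ((((2 : ℝ) ^ j) ^ d : ℝ) : ℂ)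
  have h4 : (scaled j K : Space d → ℂ) =
      fun x => ((((2 : ℝ) ^ j) ^ d : ℝ) : ℂ) * K ((2 : ℝ) ^ j • x) := rfl
  rw [SchwartzMap.lineDerivOp_apply_eq_fderiv, h4, h3.fderiv]
  change _ = ((2 : ℝ) ^ j) • (scaled j (∂_{v} K) x)
  rw [scaled_apply, SchwartzMap.lineDerivOp_apply_eq_fderiv]
  simp
  ring

theorem conv_comm (K L : Space d → ℂ) : conv K L = conv L K := by
  ext x
  rw [conv_eq_integral_sub, conv]
  simp [mul_comm]

/-- The translation bound for continuously differentiable functions. -/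
theorem eLpNorm_sub_translate_le {G : Type*} [NormedAddCommGroup G] [NormedSpace ℝ G]
    [CompleteSpace G] {p : ℝ} (hp : 1 ≤ p) {v : Space d → G} (hv : ContDiff ℝ 1 v) (z : Space d) :
    eLpNorm (fun x => v (x - z) - v x) (ENNReal.ofReal p) volume ≤
      ‖z‖ₑ * eLpNorm (fderiv ℝ v) (ENNReal.ofReal p) volume := by
  have hc : Continuous (fderiv ℝ v) := hv.continuous_fderiv one_ne_zero
  have h1 : ∀ x, ‖v (x - z) - v x‖ₑ ≤
      ∫⁻ t in Set.Ioc (0 : ℝ) 1, ‖z‖ₑ * ‖fderiv ℝ v (x - t • z)‖ₑ := by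
    intro x
    have h2 : ∀ t : ℝ, HasDerivAt (fun t : ℝ => v (x - t • z)) (fderiv ℝ v (x - t • z) (-z)) t := by
      intro t
      have h3 : HasDerivAt (fun t : ℝ => x - t • z) (-z) t := by
        simpa using ((hasDerivAt_id t).smul_const z).const_sub x
      exact ((hv.differentiable one_ne_zero _).hasFDerivAt).comp_hasDerivAt t h3
    have h3 : Continuous fun t : ℝ => fderiv ℝ v (x - t • z) (-z) := by fun_prop
    have h4 := intervalIntegral.integral_eq_sub_of_hasDerivAt (a := 0) (b := 1)
      (fun t _ => h2 t) (h3.intervalIntegrable _ _)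
    simp only [one_smul, zero_smul, sub_zero] at h4
    rw [← h4, intervalIntegral.integral_of_le zero_le_one]
    refine (enorm_integral_le_lintegral_enorm _).trans (lintegral_mono fun t => ?_)
    rw [mul_comm]
    simpa using (fderiv ℝ v (x - t • z)).le_opENorm (-z)
  rw [eLpNorm_ofReal_le_iff hp]
  have h5 := lintegral_minkowski (μ := (volume : Measure (Space d)))
    (ν := volume.restrict (Set.Ioc (0 : ℝ) 1)) hp (k := fun _ => ‖z‖ₑ) (a := fun _ => 1)
    (H := fun x t => ‖fderiv ℝ v (x - t • z)‖ₑ)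
      (N := eLpNorm (fderiv ℝ v) (ENNReal.ofReal p) volume)
    aemeasurable_const aemeasurable_const ?_ (by simp) (by simp) ?_
  · refine (lintegral_mono fun x => ?_).trans (h5.trans_eq (by simp))
    have := h1 x
    gcongr
  · exact Continuous.aemeasurable (by
      change Continuous fun y : Space d × ℝ => ‖fderiv ℝ v (y.1 - y.2 • z)‖ₑ
      fun_prop)
  · refine Eventually.of_forall fun t => ?_
    rw [one_mul]
    exact (eLpNorm_ofReal_le_iff hp _ _).1 (eLpNorm_comp_measurePreserving
      (f := fun x => x - t • z) (g := fderiv ℝ v) hc.aestronglyMeasurable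
      (measurePreserving_sub_right volume _)).le

theorem IsTempered.integrable_smul_comp_sub {f : Space d → F} (hf : IsTempered f)
    (K : 𝓢(Space d, ℂ)) (x : Space d) : Integrable fun z => K z • f (x - z) := by
  simpa using (hf.integrable_smul K x).comp_sub_left x

theorem IsTempered.sub {f g : Space d → F} (hf : IsTempered f) (hg : IsTempered g) :
    IsTempered (fun x => f x - g x) := by
  obtain ⟨hf, n, hn⟩ := hf
  obtain ⟨hg, m, hm⟩ := hg
  refine ⟨hf.sub hg, n + m, (hn.add hm).mono' ?_ ?_⟩
  · have : Continuous fun z : Space d => ((1 + ‖z‖) ^ (n + m))⁻¹ := by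
      refine Continuous.inv₀ (by fun_prop) fun z => by positivity
    exact this.aestronglyMeasurable.mul (hf.sub hg).norm
  · refine Eventually.of_forall fun z => ?_
    rw [Real.norm_of_nonneg (by positivity)]
    have h1 : 1 ≤ 1 + ‖z‖ := by simp
    calc ((1 + ‖z‖) ^ (n + m))⁻¹ * ‖f z - g z‖
        ≤ ((1 + ‖z‖) ^ (n + m))⁻¹ * ‖f z‖ + ((1 + ‖z‖) ^ (n + m))⁻¹ * ‖g z‖ := by
          rw [← mul_add]; gcongr; exact norm_sub_le _ _
      _ ≤ _ := by
          dsimp only [Pi.add_apply]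
          exact add_le_add
            (mul_le_mul_of_nonneg_right (inv_anti₀ (by positivity)
              (pow_le_pow_right₀ h1 (by omega))) (norm_nonneg _))
            (mul_le_mul_of_nonneg_right (inv_anti₀ (by positivity)
              (pow_le_pow_right₀ h1 (by omega))) (norm_nonneg _))

theorem conv_sub_right {f g : Space d → F} (hf : IsTempered f) (hg : IsTempered g)
    (K : 𝓢(Space d, ℂ)) (x : Space d) :
    conv K (fun x => f x - g x) x = conv K f x - conv K g x := by
  simp only [conv, smul_sub]
  exact integral_sub (hf.integrable_smul_comp_sub K x) (hg.integrable_smul_comp_sub K x)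

theorem ae_enorm_ne_zero (hd : 0 < d) : ∀ᵐ z : Space d, ‖z‖ₑ ≠ 0 := by
  have : Nonempty (Fin d) := ⟨⟨0, hd⟩⟩
  have : ∀ᵐ z : Space d, z ≠ 0 := by simp [ae_iff]
  filter_upwards [this] with z hz
  simpa using hz

/-- As `∫ K = 1`, the difference is `∫ K(z) (v(x - z) - v(x)) dz`; Minkowski with `a = |z|` and the
translation bound conclude. Positive dimension ensures that `|z|` is nonzero almost everywhere. -/
theorem eLpNorm_conv_sub_le {p : ℝ} (hp : 1 ≤ p) {v : Space d → F} (hv : ContDiff ℝ 1 v)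
    (hvt : IsTempered v) {K : 𝓢(Space d, ℂ)} (hK : ∫ z, K z = 1) (hd : 0 < d) :
    eLpNorm (fun x => conv K v x - v x) (ENNReal.ofReal p) volume ≤
      (∫⁻ z, ‖K z‖ₑ * ‖z‖ₑ) * eLpNorm (fderiv ℝ v) (ENNReal.ofReal p) volume := by
  have h1 : (fun x => conv K v x - v x) = fun x => ∫ z, K z • (v (x - z) - v x) := by
    ext x
    simp only [smul_sub]
    rw [integral_sub (hvt.integrable_smul_comp_sub K x) (K.integrable.smul_const _),
      integral_smul_const, hK, one_smul]
    rfl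
  rw [h1]
  refine eLpNorm_integral_smul_le (H := fun x z => v (x - z) - v x) hp K.integrable.1
    measurable_enorm.aemeasurable ?_ (ae_enorm_ne_zero hd) (by simp) ?_
  · have := hv.continuous
    exact Continuous.aestronglyMeasurable (by
      change Continuous fun y : Space d × Space d => v (y.1 - y.2) - v y.1
      fun_prop)
  · exact Eventually.of_forall fun z => eLpNorm_sub_translate_le hp hv z

theorem exists_schwartz_eLpNorm_sub_le {p : ℝ} (hp : 1 ≤ p) {f : Space d → F}
    (hf : MemLp f (ENNReal.ofReal p)) {δ : ℝ≥0∞} (hδ : δ ≠ 0) :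
    ∃ θ : 𝓢(Space d, F), eLpNorm (fun x => f x - θ x) (ENNReal.ofReal p) volume ≤ δ := by
  have : Fact (1 ≤ ENNReal.ofReal p) := ⟨by simpa using hp⟩
  have h := SchwartzMap.denseRange_toLpCLM (E := Space d) (F := F) (μ := volume)
    (p := ENNReal.ofReal p) ENNReal.ofReal_ne_top (hf.toLp f)
  rw [EMetric.mem_closure_iff] at h
  obtain ⟨_, ⟨θ, rfl⟩, hθ⟩ := h δ (pos_iff_ne_zero.2 hδ)
  refine ⟨θ, ?_⟩
  rw [Lp.edist_def] at hθ
  refine le_of_eq_of_le (eLpNorm_congr_ae ?_) hθ.le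
  filter_upwards [hf.coeFn_toLp, θ.coeFn_toLp (ENNReal.ofReal p) volume] with x h1 h2
  simp only [Pi.sub_apply, h1]
  exact congrArg _ h2.symm

/-- The shape of the density arguments below: `A * δ` is the uniform cost of replacing `f` by a nice
function, and `b` is the error for the nice function, which tends to zero. -/
theorem tendsto_zero_of_forall_le_mul_add {A : ℝ≥0∞} (hA : A ≠ ∞) {x : ℕ → ℝ≥0∞}
    (h : ∀ δ : ℝ≥0∞, δ ≠ 0 → ∃ b : ℕ → ℝ≥0∞, Tendsto b atTop (𝓝 0) ∧ ∀ n, x n ≤ A * δ + b n) :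
    Tendsto x atTop (𝓝 0) := by
  rw [ENNReal.tendsto_nhds_zero]
  intro ε hε
  have hε2 : 0 < ε / 2 := ENNReal.half_pos hε.ne'
  obtain ⟨b, hb, hx⟩ := h (ε / 2 / (A + 1))
    (ENNReal.div_pos hε2.ne' (by simp [hA])).ne'
  filter_upwards [ENNReal.tendsto_nhds_zero.1 hb _ hε2] with n hn
  calc x n ≤ A * (ε / 2 / (A + 1)) + b n := hx n
    _ ≤ (A + 1) * (ε / 2 / (A + 1)) + ε / 2 := by gcongr; simp
    _ ≤ ε / 2 + ε / 2 := by gcongr; exact ENNReal.mul_div_le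
    _ = ε := ENNReal.add_halves ε

theorem tendsto_ofReal_two_zpow_neg_mul {B : ℝ≥0∞} (hB : B ≠ ∞) :
    Tendsto (fun n : ℕ => ENNReal.ofReal (2 ^ (-(n : ℤ))) * B) atTop (𝓝 0) := by
  have h1 : Tendsto (fun n : ℕ => ENNReal.ofReal (2 ^ (-(n : ℤ)))) atTop (𝓝 0) := by
    rw [← ENNReal.ofReal_zero]
    refine ENNReal.tendsto_ofReal ?_
    have := tendsto_pow_atTop_nhds_zero_of_lt_one (r := (1 / 2 : ℝ)) (by norm_num) (by norm_num)
    refine this.congr fun n => ?_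
    rw [zpow_neg, zpow_natCast, one_div, inv_pow]
  simpa using ENNReal.Tendsto.mul_const h1 (Or.inr hB)

theorem lintegral_enorm_ne_top (K : 𝓢(Space d, ℂ)) : ∫⁻ z, ‖K z‖ₑ ≠ ∞ := K.integrable.2.ne

theorem lintegral_mul_enorm_ne_top (K : 𝓢(Space d, ℂ)) : ∫⁻ z, ‖K z‖ₑ * ‖z‖ₑ ≠ ∞ := by
  have h := (K.integrable_pow_mul volume 1).2
  rw [hasFiniteIntegral_iff_enorm] at h
  refine ne_of_eq_of_ne (lintegral_congr fun z => ?_) h.ne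
  rw [enorm_mul, pow_one, enorm_norm, enorm_norm, mul_comm]

/-- The operators are uniformly bounded by `‖K‖_1`, so `f` may be replaced by a Schwartz function
`θ`. For `θ` the error is at most the first moment of the dilated kernel times `‖∇θ‖_p`, which is
`O(2^{-n})`. -/
theorem tendsto_conv_scaled_sub {p : ℝ} (hp : 1 ≤ p) {f : Space d → F}
    (hf : MemLp f (ENNReal.ofReal p)) {K : 𝓢(Space d, ℂ)} (hK : ∫ z, K z = 1) (hd : 0 < d) :
    Tendsto (fun n : ℕ => eLpNorm (fun x => conv (scaled n K) f x - f x) (ENNReal.ofReal p) volume)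
      atTop (𝓝 0) := by
  have hP : 1 ≤ ENNReal.ofReal p := by simpa using hp
  refine tendsto_zero_of_forall_le_mul_add (A := (∫⁻ z, ‖K z‖ₑ) + 1)
    (by simpa using lintegral_enorm_ne_top K) fun δ hδ => ?_
  obtain ⟨θ, hθ⟩ := exists_schwartz_eLpNorm_sub_le hp hf hδ
  have hθp : MemLp θ (ENNReal.ofReal p) := θ.memLp _ _
  have hfθ : MemLp (fun x => f x - θ x) (ENNReal.ofReal p) := hf.sub hθp
  have hθ' : eLpNorm (fderiv ℝ θ) (ENNReal.ofReal p) volume ≠ ∞ :=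
    ((SchwartzMap.fderivCLM ℝ (Space d) F θ).memLp (ENNReal.ofReal p) volume).2.ne
  refine ⟨_, tendsto_ofReal_two_zpow_neg_mul
    (ENNReal.mul_ne_top (lintegral_mul_enorm_ne_top K) hθ'), fun n => ?_⟩
  have hKn : ∫ z, scaled n K z = 1 := by
    have := integral_scaled_smul n K (fun _ => (1 : ℂ))
    simp only [smul_eq_mul, mul_one] at this
    rw [this, hK]
  have h1 : (fun x => conv (scaled n K) f x - f x) =
      (fun x => conv (scaled n K) (fun x => f x - θ x) x) +
        ((fun x => conv (scaled n K) θ x - θ x) + fun x => θ x - f x) := by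
    ext x
    simp only [Pi.add_apply]
    rw [conv_sub_right (.of_memLp hp hf) (.of_memLp hp hθp)]
    abel
  have m1 := (memLp_conv hp (scaled n K).integrable hfθ).1
  have m2 := (memLp_conv hp (scaled n K).integrable hθp).1
  have hswap : eLpNorm (fun x => θ x - f x) (ENNReal.ofReal p) volume ≤ δ := by
    rw [← eLpNorm_neg]
    refine le_of_eq_of_le (congrArg (fun g => eLpNorm g _ _) ?_) hθ
    ext x; simp
  rw [h1]
  calc _ ≤ _ := eLpNorm_add_le m1 ((m2.sub hθp.1).add (hθp.1.sub hf.1)) hP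
    _ ≤ _ := add_le_add_right (eLpNorm_add_le (m2.sub hθp.1) (hθp.1.sub hf.1) hP) _
    _ ≤ (∫⁻ z, ‖K z‖ₑ) * δ + (ENNReal.ofReal (2 ^ (-(n : ℤ))) *
          ((∫⁻ z, ‖K z‖ₑ * ‖z‖ₑ) * eLpNorm (fderiv ℝ θ) (ENNReal.ofReal p) volume) + δ) := by
        gcongr
        · refine (eLpNorm_conv_le hp (scaled n K).integrable.1 hfθ.1).trans ?_
          rw [lintegral_enorm_scaled]
          gcongr
        · refine (eLpNorm_conv_sub_le hp (θ.smooth 1) (.of_memLp hp hθp) hKn hd).trans ?_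
          rw [lintegral_scaled_mul_enorm, mul_assoc]
        · exact hswap
    _ = _ := by ring

/-- The scaling law behind both the vanishing of low frequencies in `L^p` and Bernstein's inequality
for the blocks with `j < 0`. -/
theorem eLpNorm_scaled_rpow {p : ℝ} (hp : 1 ≤ p) (j : ℤ) (K : 𝓢(Space d, ℂ)) :
    eLpNorm (scaled j K) (ENNReal.ofReal p) volume ^ p =
      ENNReal.ofReal ((((2 : ℝ) ^ j) ^ d) ^ (p - 1)) *
        eLpNorm K (ENNReal.ofReal p) volume ^ p := by
  have hc : (0 : ℝ) < ((2 : ℝ) ^ j) ^ d := by positivity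
  have hm : Measurable fun x => ‖K x‖ₑ ^ p := K.continuous.measurable.enorm.pow_const _
  rw [eLpNorm_ofReal_rpow hp, eLpNorm_ofReal_rpow hp]
  calc ∫⁻ x, ‖scaled j K x‖ₑ ^ p
      = ∫⁻ x, ENNReal.ofReal ((((2 : ℝ) ^ j) ^ d) ^ p) * ‖K ((2 : ℝ) ^ j • x)‖ₑ ^ p := by
        refine lintegral_congr fun x => ?_
        rw [scaled_apply, enorm_mul, ENNReal.mul_rpow_of_nonneg _ _ (by linarith),
          ← ofReal_norm (((((2 : ℝ) ^ j) ^ d : ℝ)) : ℂ), Complex.norm_real,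
          Real.norm_of_nonneg hc.le, ENNReal.ofReal_rpow_of_pos hc]
    _ = ENNReal.ofReal ((((2 : ℝ) ^ j) ^ d) ^ p) * (ENNReal.ofReal ((((2 : ℝ) ^ j) ^ d)⁻¹) *
          ∫⁻ x, ‖K x‖ₑ ^ p) := by
        rw [lintegral_const_mul _ (show Measurable fun x => ‖K ((2 : ℝ) ^ j • x)‖ₑ ^ p from
          hm.comp (measurable_const_smul _)), lintegral_comp_smul hm (by positivity)]
    _ = _ := by
        rw [← mul_assoc, ← ENNReal.ofReal_mul (by positivity), Real.rpow_sub_one hc.ne',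
          div_eq_mul_inv]

/-- Low frequencies disappear in `L^p` as soon as `p > 1`. After replacing `f` by a Schwartz `θ`,
Young's inequality gives `‖θ‖_1` times the `L^p` norm of the dilated kernel, whose `p`-th power
decays like `2^{-nd(p-1)}`. -/
theorem tendsto_conv_scaled_neg {p : ℝ} (hp : 1 < p) {f : Space d → F}
    (hf : MemLp f (ENNReal.ofReal p)) (K : 𝓢(Space d, ℂ)) (hd : 0 < d) :
    Tendsto (fun n : ℕ => eLpNorm (conv (scaled (-n) K) f) (ENNReal.ofReal p) volume)
      atTop (𝓝 0) := by
  have hP : 1 ≤ ENNReal.ofReal p := by simpa using hp.le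
  have hp0 : 0 < p := by linarith
  refine tendsto_zero_of_forall_le_mul_add (A := ∫⁻ z, ‖K z‖ₑ)
    (lintegral_enorm_ne_top K) fun δ hδ => ?_
  obtain ⟨θ, hθ⟩ := exists_schwartz_eLpNorm_sub_le hp.le hf hδ
  have hθp : MemLp θ (ENNReal.ofReal p) := θ.memLp _ _
  have hfθ : MemLp (fun x => f x - θ x) (ENNReal.ofReal p) := hf.sub hθp
  refine ⟨fun n => (∫⁻ z, ‖θ z‖ₑ) * eLpNorm (scaled (-n) K) (ENNReal.ofReal p) volume, ?_,
    fun n => ?_⟩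
  · have h1 : Tendsto (fun n : ℕ => ENNReal.ofReal ((((2 : ℝ) ^ (-(n : ℤ))) ^ d) ^ (p - 1)))
        atTop (𝓝 0) := by
      rw [← ENNReal.ofReal_zero]
      refine ENNReal.tendsto_ofReal ?_
      have hr : (((2 : ℝ)⁻¹ ^ d) ^ (p - 1)) < 1 :=
        Real.rpow_lt_one (by positivity) (pow_lt_one₀ (by norm_num) (by norm_num) hd.ne')
          (by linarith)
      refine (tendsto_pow_atTop_nhds_zero_of_lt_one (by positivity) hr).congr fun n => ?_
      rw [zpow_neg, zpow_natCast, ← inv_pow, ← pow_mul, mul_comm n d, pow_mul,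
        ← Real.rpow_natCast, ← Real.rpow_natCast (_ ^ d) n, ← Real.rpow_mul (by positivity),
        ← Real.rpow_mul (by positivity), mul_comm]
    have h2 : Tendsto (fun n : ℕ => eLpNorm (scaled (-n) K) (ENNReal.ofReal p) volume ^ p)
        atTop (𝓝 0) := by
      simp_rw [eLpNorm_scaled_rpow hp.le]
      simpa using ENNReal.Tendsto.mul_const h1
        (Or.inr (ENNReal.rpow_ne_top_of_nonneg hp0.le (K.memLp (ENNReal.ofReal p) volume).2.ne))
    have h3 := h2.ennrpow_const (1 / p)
    simp_rw [← ENNReal.rpow_mul, mul_one_div_cancel hp0.ne', ENNReal.rpow_one] at h3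
    rw [ENNReal.zero_rpow_of_pos (by positivity)] at h3
    simpa using ENNReal.Tendsto.const_mul h3 (Or.inr θ.integrable.2.ne)
  have h1 : conv (scaled (-n) K) f =
      (fun x => conv (scaled (-n) K) (fun x => f x - θ x) x) + conv (scaled (-n) K) θ := by
    ext x
    simp only [Pi.add_apply]
    rw [conv_sub_right (.of_memLp hp.le hf) (.of_memLp hp.le hθp)]
    abel
  have m1 := (memLp_conv hp.le (scaled (-n) K).integrable hfθ).1
  have m2 := (memLp_conv hp.le (scaled (-n) K).integrable hθp).1
  rw [h1]
  refine (eLpNorm_add_le m1 m2 hP).trans (add_le_add ?_ ?_)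
  · refine (eLpNorm_conv_le hp.le (scaled (-n) K).integrable.1 hfθ.1).trans ?_
    rw [lintegral_enorm_scaled]
    gcongr
  -- Young's inequality with the roles exchanged: `θ` is taken in `L^1` and the dilated kernel in
  -- `L^p`.
  · rw [eLpNorm_ofReal_le_iff hp.le]
    have h5 := lintegral_minkowski (μ := (volume : Measure (Space d)))
      (ν := (volume : Measure (Space d))) hp.le (k := fun z => ‖θ z‖ₑ) (a := fun _ => 1)
      (H := fun x z => ‖scaled (-n) K (x - z)‖ₑ)
      (N := eLpNorm (scaled (-n) K) (ENNReal.ofReal p) volume)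
      θ.continuous.enorm.measurable.aemeasurable aemeasurable_const ?_ (by simp) (by simp) ?_
    · refine (lintegral_mono fun x => ?_).trans (h5.trans_eq (by simp))
      gcongr
      rw [conv_eq_integral_sub]
      refine (enorm_integral_le_lintegral_enorm _).trans_eq (lintegral_congr fun z => ?_)
      rw [enorm_smul, mul_comm]
    · exact (aestronglyMeasurable_comp_sub (scaled (-n) K).integrable.1).enorm
    · refine Eventually.of_forall fun z => ?_
      rw [one_mul, ← eLpNorm_ofReal_le_iff hp.le, eLpNorm_comp_sub (scaled (-n) K).integrable.1]

end Dilation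

/-! ### The Hilbert transform on `L^p`, `1 < p < 2` -/

section Hilbert

open Filter Topology Set

/-- The key pointwise inequality in M. Riesz' proof of the boundedness of the Hilbert transform. -/
theorem exists_abs_im_rpow_le {p : ℝ} (hp₁ : 1 < p) (hp₂ : p < 2) :
    ∃ A B : ℝ, 0 ≤ A ∧ 0 ≤ B ∧ ∀ z : ℂ, 0 ≤ z.re →
      |z.im| ^ p ≤ A * z.re ^ p - B * (z ^ (p : ℂ)).re := by
  have hπ := Real.pi_pos
  have hp0 : 0 < p := by linarith
  -- The angle is chosen so that `(π/2 - δ) p = π/2 + α`. If `|arg z| ≥ π/2 - δ`, then `p |arg z|`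
  -- lies in `[π/2 + α, π]`, the upper bound because `p < 2`. There `Re z^p ≤ -sin α · |z|^p`, and
  -- the `B` term dominates. Otherwise `Re z ≥ sin δ · |z|`, and the `A` term dominates.
  set α := (p - 1) * (Real.pi / 4) with hα
  have hα0 : 0 < α := by have := sub_pos.2 hp₁; positivity
  have hα1 : α < Real.pi / 4 := by nlinarith
  set c := Real.sin α with hc
  have hc0 : 0 < c := Real.sin_pos_of_pos_of_lt_pi hα0 (by linarith)
  set δ := α / p with hδ
  have hδ0 : 0 < δ := by positivity
  have hδ1 : δ < Real.pi / 4 := by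
    rw [hδ, div_lt_iff₀ hp0]; nlinarith
  set s := Real.sin δ with hs
  have hs0 : 0 < s := Real.sin_pos_of_pos_of_lt_pi hδ0 (by linarith)
  have hsp : 0 < s ^ p := Real.rpow_pos_of_pos hs0 p
  refine ⟨(1 + c⁻¹) / s ^ p, c⁻¹, by positivity, by positivity, fun z hz => ?_⟩
  have hr : 0 ≤ ‖z‖ ^ p := by positivity
  rw [Complex.cpow_ofReal_re]
  have h1 : |z.im| ^ p ≤ ‖z‖ ^ p :=
    Real.rpow_le_rpow (abs_nonneg _) (Complex.abs_im_le_norm z) hp0.le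
  have harg : |z.arg| ≤ Real.pi / 2 := Complex.abs_arg_le_pi_div_two_iff.2 hz
  have hcosabs : Real.cos (z.arg * p) = Real.cos (|z.arg| * p) := by
    rcases abs_choice z.arg with h | h <;> rw [h]
    rw [neg_mul, Real.cos_neg]
  have hre : z.re = ‖z‖ * Real.cos |z.arg| := by
    rw [Real.cos_abs, Complex.norm_mul_cos_arg]
  rw [hcosabs]
  set φ := |z.arg| with hφ
  have hφ0 : 0 ≤ φ := abs_nonneg _
  rcases le_total (Real.pi / 2 - δ) φ with h | h
  · have h2 : Real.cos (φ * p) ≤ -c := by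
      have h3 : -c = Real.cos (Real.pi / 2 + α) := by rw [add_comm, Real.cos_add_pi_div_two]
      rw [h3]
      refine Real.cos_le_cos_of_nonneg_of_le_pi (by linarith) (by nlinarith) ?_
      have h4 : (Real.pi / 2 - δ) * p ≤ φ * p := by gcongr
      have h5 : (Real.pi / 2 - δ) * p = Real.pi / 2 + α := by
        rw [hδ, sub_mul, div_mul_cancel₀ _ hp0.ne', hα]; ring
      linarith
    have h3 : 0 ≤ (1 + c⁻¹) / s ^ p * z.re ^ p := by positivity
    have h4 : 1 ≤ -(c⁻¹ * Real.cos (φ * p)) := by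
      rw [← mul_neg, ← div_le_iff₀' (by positivity)]
      simpa using le_neg.2 h2
    nlinarith
  · have h2 : s ≤ Real.cos φ := by
      have : s = Real.cos (Real.pi / 2 - δ) := by rw [Real.cos_pi_div_two_sub]
      rw [this]
      exact Real.cos_le_cos_of_nonneg_of_le_pi hφ0 (by linarith) h
    have h3 : (‖z‖ * s) ^ p ≤ z.re ^ p := by
      rw [hre]
      gcongr
    rw [Real.mul_rpow (by positivity) hs0.le] at h3
    have h4 : (1 + c⁻¹) * ‖z‖ ^ p ≤ (1 + c⁻¹) / s ^ p * z.re ^ p := by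
      calc (1 + c⁻¹) * ‖z‖ ^ p = (1 + c⁻¹) / s ^ p * (‖z‖ ^ p * s ^ p) := by field_simp
        _ ≤ _ := by gcongr
    have h5 : c⁻¹ * (‖z‖ ^ p * Real.cos (φ * p)) ≤ c⁻¹ * ‖z‖ ^ p := by
      have := Real.cos_le_one (φ * p)
      gcongr
      nlinarith
    linarith

/-- The real part of `F ^ p` has vanishing integral over horizontal lines, for `F` holomorphic on
the upper half plane with positive real part and decay `‖F z‖ ≤ C / ‖z‖`. -/
theorem norm_integral_cpow_le {p : ℝ} (hp : 1 < p) {F : ℂ → ℂ}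
    (hF : DifferentiableOn ℂ F {z | 0 < z.im}) (hre : ∀ z : ℂ, 0 < z.im → 0 < (F z).re)
    {C R : ℝ} (hFC : ∀ z : ℂ, 0 < z.im → R ≤ ‖z‖ → ‖F z‖ ≤ C / ‖z‖) {ε L : ℝ} (hε : 0 < ε)
    (hεL : ε ≤ L) (hRL : R ≤ L) (hC : 0 ≤ C) :
    ‖∫ x in (-L)..L, F (x + ε * Complex.I) ^ (p : ℂ)‖ ≤ 4 * L * (C / L) ^ p := by
  have hL : 0 < L := hε.trans_le hεL
  set G : ℂ → ℂ := fun z => F z ^ (p : ℂ) with hG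
  have hGd : DifferentiableOn ℂ G {z | 0 < z.im} := fun z hz =>
    (hF z hz).cpow_const (Or.inl (hre z hz))
  have hb : ∀ z : ℂ, 0 < z.im → L ≤ ‖z‖ → ‖G z‖ ≤ (C / L) ^ p := by
    intro z hz hz2
    rw [hG]
    dsimp only
    rw [Complex.norm_cpow_real]
    refine Real.rpow_le_rpow (norm_nonneg _) ((hFC z hz (hRL.trans hz2)).trans ?_) (by linarith)
    gcongr
  -- Cauchy's theorem on the rectangle with corners `-L + iε` and `L + iL`. The power is holomorphic
  -- because `Re F > 0` avoids the cut. The three remaining sides stay at distance at least `L` from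
  -- the origin and have total length at most `4 L`.
  have hrect := Complex.integral_boundary_rect_eq_zero_of_differentiableOn G
    ⟨-L, ε⟩ ⟨L, L⟩ (hGd.mono ?_)
  · simp only [smul_eq_mul] at hrect
    have i1 : ‖∫ x in (-L)..L, G (x + L * Complex.I)‖ ≤ (C / L) ^ p * |L - -L| := by
      refine intervalIntegral.norm_integral_le_of_norm_le_const fun x _ => hb _ (by simpa) ?_
      refine le_trans ?_ (Complex.abs_im_le_norm _)
      simp [abs_of_pos hL]
    have i2 : ‖∫ y in ε..L, G (L + y * Complex.I)‖ ≤ (C / L) ^ p * |L - ε| := by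
      refine intervalIntegral.norm_integral_le_of_norm_le_const fun y hy => ?_
      rw [uIoc_of_le hεL] at hy
      refine hb _ (by simpa using hε.trans hy.1) (le_trans ?_ (Complex.abs_re_le_norm _))
      simp [abs_of_pos hL]
    have i3 : ‖∫ y in ε..L, G (-L + y * Complex.I)‖ ≤ (C / L) ^ p * |L - ε| := by
      refine intervalIntegral.norm_integral_le_of_norm_le_const fun y hy => ?_
      rw [uIoc_of_le hεL] at hy
      refine hb _ (by simpa using hε.trans hy.1) (le_trans ?_ (Complex.abs_re_le_norm _))
      simp [abs_of_pos hL]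
    have e : ∫ x in (-L)..L, F (x + ε * Complex.I) ^ (p : ℂ) =
        (∫ x in (-L)..L, G (x + L * Complex.I)) -
          Complex.I * (∫ y in ε..L, G (L + y * Complex.I)) +
          Complex.I * ∫ y in ε..L, G (-L + y * Complex.I) := by
      push_cast at hrect
      linear_combination hrect
    rw [e]
    have hCL : 0 ≤ (C / L) ^ p := by positivity
    calc _ ≤ ‖∫ x in (-L)..L, G (x + L * Complex.I)‖ +
          ‖Complex.I * (∫ y in ε..L, G (L + y * Complex.I))‖ +
          ‖Complex.I * ∫ y in ε..L, G (-L + y * Complex.I)‖ :=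
          (norm_add_le _ _).trans (by gcongr; exact norm_sub_le _ _)
      _ ≤ (C / L) ^ p * |L - -L| + (C / L) ^ p * |L - ε| + (C / L) ^ p * |L - ε| := by
          simp only [norm_mul, Complex.norm_I, one_mul]
          gcongr
      _ ≤ _ := by
          rw [abs_of_nonneg (by linarith), abs_of_nonneg (by linarith)]
          nlinarith
  · intro z hz
    rw [Complex.mem_reProdIm] at hz
    have := hz.2
    simp only [uIcc_of_le hεL] at this
    exact hε.trans_le this.1

/-- The pointwise inequality is integrated over `(-n, n)`. The integral of `Re F^p` contributes at
most `4n (C/n)^p`, which tends to zero since `p > 1`. -/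
theorem lintegral_im_rpow_le {p : ℝ} (hp₁ : 1 < p) {A B : ℝ} (hA : 0 ≤ A) (hB : 0 ≤ B)
    (hAB : ∀ z : ℂ, 0 ≤ z.re → |z.im| ^ p ≤ A * z.re ^ p - B * (z ^ (p : ℂ)).re)
    {F : ℂ → ℂ} (hF : DifferentiableOn ℂ F {z | 0 < z.im})
    (hre : ∀ z : ℂ, 0 < z.im → 0 < (F z).re)
    {C R : ℝ} (hFC : ∀ z : ℂ, 0 < z.im → R ≤ ‖z‖ → ‖F z‖ ≤ C / ‖z‖) (hC : 0 ≤ C)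
    {ε : ℝ} (hε : 0 < ε) :
    ∫⁻ x : ℝ, ‖(F (x + ε * Complex.I)).im‖ₑ ^ p ≤
      ENNReal.ofReal A * ∫⁻ x : ℝ, ‖(F (x + ε * Complex.I)).re‖ₑ ^ p := by
  have hp0 : 0 < p := by linarith
  set f : ℝ → ℂ := fun x => F (x + ε * Complex.I) with hf
  have him : ∀ x : ℝ, 0 < ((x : ℂ) + ε * Complex.I).im := fun x => by simpa using hε
  have hfc : Continuous f := by
    have : ContinuousOn F {z | 0 < z.im} := hF.continuousOn
    exact this.comp_continuous (by fun_prop) him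
  have hfp : Continuous fun x => f x ^ (p : ℂ) :=
    hfc.cpow continuous_const fun x => Or.inl (hre _ (him x))
  have h1 : Continuous fun x => |(f x).im| ^ p :=
    (Complex.continuous_im.comp hfc).abs.rpow_const fun _ => Or.inr hp0.le
  have h2 : Continuous fun x => (f x).re ^ p :=
    (Complex.continuous_re.comp hfc).rpow_const fun _ => Or.inr hp0.le
  have hfpos : ∀ x, 0 < (f x).re := fun x => hre _ (him x)
  have key : ∀ n : ℕ, max ε R ≤ n → ∫⁻ x in Ioc (-(n : ℝ)) n, ‖(f x).im‖ₑ ^ p ≤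
      ENNReal.ofReal A * (∫⁻ x, ‖(f x).re‖ₑ ^ p) +
        ENNReal.ofReal (B * (4 * n * (C / n) ^ p)) := by
    intro n hn
    have hn0 : (0 : ℝ) < n := hε.trans_le ((le_max_left _ _).trans hn)
    have hnn : -(n : ℝ) ≤ n := by linarith
    have e1 : ∀ x, ‖(f x).im‖ₑ ^ p = ENNReal.ofReal (|(f x).im| ^ p) := fun x => by
      rw [← ofReal_norm, ENNReal.ofReal_rpow_of_nonneg (norm_nonneg _) hp0.le, Real.norm_eq_abs]
    have e2 : ∀ x, ‖(f x).re‖ₑ ^ p = ENNReal.ofReal ((f x).re ^ p) := fun x => by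
      rw [← ofReal_norm, ENNReal.ofReal_rpow_of_nonneg (norm_nonneg _) hp0.le,
        Real.norm_of_nonneg (hfpos x).le]
    simp_rw [e1]
    rw [← ofReal_integral_eq_lintegral_ofReal h1.integrableOn_Ioc
      (Eventually.of_forall fun x => by positivity), ← intervalIntegral.integral_of_le hnn]
    have i1 : ∫ x in (-(n : ℝ))..n, |(f x).im| ^ p ≤
        A * (∫ x in (-(n : ℝ))..n, (f x).re ^ p) + B * (4 * n * (C / n) ^ p) := by
      have i2 : ∫ x in (-(n : ℝ))..n, |(f x).im| ^ p ≤
          ∫ x in (-(n : ℝ))..n, (A * (f x).re ^ p - B * (f x ^ (p : ℂ)).re) := by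
        refine intervalIntegral.integral_mono_on hnn (h1.intervalIntegrable _ _)
          (Continuous.intervalIntegrable ?_ _ _) fun x _ => hAB _ (hfpos x).le
        exact (continuous_const.mul h2).sub (continuous_const.mul (Complex.continuous_re.comp hfp))
      refine i2.trans ?_
      have h6 : IntervalIntegrable (fun x => A * (f x).re ^ p) volume (-n) n :=
        (continuous_const.mul h2).intervalIntegrable _ _
      have h7 : IntervalIntegrable (fun x => B * (f x ^ (p : ℂ)).re) volume (-n) n :=
        (continuous_const.mul (Complex.continuous_re.comp hfp)).intervalIntegrable _ _
      rw [intervalIntegral.integral_sub h6 h7, intervalIntegral.integral_const_mul,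
          intervalIntegral.integral_const_mul]
      have i3 : ∫ x in (-(n : ℝ))..n, (f x ^ (p : ℂ)).re =
          (∫ x in (-(n : ℝ))..n, f x ^ (p : ℂ)).re := by
        rw [← Complex.reCLM_apply, ← ContinuousLinearMap.intervalIntegral_comp_comm _
          (hfp.intervalIntegrable _ _)]
        rfl
      have i4 := norm_integral_cpow_le hp₁ hF hre hFC hε ((le_max_left _ _).trans hn)
        ((le_max_right _ _).trans hn) hC
      have i5 := (abs_le.1 (Complex.abs_re_le_norm
        (∫ x in (-(n : ℝ))..n, f x ^ (p : ℂ)))).1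
      rw [i3]
      nlinarith
    refine (ENNReal.ofReal_le_ofReal i1).trans (ENNReal.ofReal_add_le.trans ?_)
    gcongr
    rw [ENNReal.ofReal_mul hA]
    gcongr
    simp_rw [e2]
    rw [intervalIntegral.integral_of_le hnn, ofReal_integral_eq_lintegral_ofReal h2.integrableOn_Ioc
      (Eventually.of_forall fun x => (Real.rpow_pos_of_pos (hfpos x) p).le)]
    exact setLIntegral_le_lintegral _ _
  have t1 : Tendsto (fun n : ℕ => ∫⁻ x in Ioc (-(n : ℝ)) n, ‖(f x).im‖ₑ ^ p) atTop
      (𝓝 (∫⁻ x, ‖(f x).im‖ₑ ^ p)) := by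
    refine AECover.lintegral_tendsto_of_countably_generated (aecover_Ioc
      (tendsto_neg_atTop_atBot.comp tendsto_natCast_atTop_atTop) tendsto_natCast_atTop_atTop) ?_
    exact ((Complex.continuous_im.comp hfc).measurable.enorm.pow_const p).aemeasurable
  have t2 : Tendsto (fun n : ℕ => ENNReal.ofReal (B * (4 * n * (C / n) ^ p))) atTop (𝓝 0) := by
    rw [← ENNReal.ofReal_zero]
    refine ENNReal.tendsto_ofReal ?_
    have : Tendsto (fun n : ℕ => (B * 4 * C ^ p) * (n : ℝ) ^ (-(p - 1))) atTop
        (𝓝 ((B * 4 * C ^ p) * 0)) :=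
      ((tendsto_rpow_neg_atTop (by linarith)).comp tendsto_natCast_atTop_atTop).const_mul _
    rw [mul_zero] at this
    refine this.congr' ?_
    filter_upwards [eventually_gt_atTop 0] with n hn
    have hn' : (0 : ℝ) < n := by exact_mod_cast hn
    rw [Real.div_rpow hC hn'.le, neg_sub, Real.rpow_sub hn', Real.rpow_one]
    field_simp
  refine le_of_tendsto_of_tendsto t1 (by simpa using t2.const_add _) ?_
  filter_upwards [eventually_ge_atTop ⌈max ε R⌉₊] with n hn
  exact key n (Nat.ceil_le.1 hn)

end Hilbert

/-! ### Poisson kernels and truncated Hilbert kernels -/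

section HilbertKernel

open Filter Topology Set

/-- The Poisson kernel on the line. -/
def poissonKernel (ε t : ℝ) : ℝ := ε / (Real.pi * (t ^ 2 + ε ^ 2))

/-- The conjugate Poisson kernel on the line. -/
def conjPoissonKernel (ε t : ℝ) : ℝ := t / (Real.pi * (t ^ 2 + ε ^ 2))

theorem poissonKernel_pos {ε : ℝ} (hε : 0 < ε) (t : ℝ) : 0 < poissonKernel ε t := by
  unfold poissonKernel
  have := Real.pi_pos
  positivity

theorem continuous_poissonKernel {ε : ℝ} (hε : 0 < ε) : Continuous (poissonKernel ε) := by
  unfold poissonKernel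
  have := Real.pi_pos
  exact continuous_const.div (by fun_prop) fun t => by positivity

theorem continuous_conjPoissonKernel {ε : ℝ} (hε : 0 < ε) : Continuous (conjPoissonKernel ε) := by
  unfold conjPoissonKernel
  have := Real.pi_pos
  exact continuous_id.div (by fun_prop) fun t => by positivity

theorem abs_conjPoissonKernel_le {ε : ℝ} (hε : 0 < ε) (t : ℝ) :
    |conjPoissonKernel ε t| ≤ 1 / ε := by
  unfold conjPoissonKernel
  have := Real.pi_gt_three
  rw [abs_div, abs_of_pos (by positivity : 0 < Real.pi * (t ^ 2 + ε ^ 2)), div_le_div_iff₀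
    (by positivity) hε]
  have h1 : 2 * (|t| * ε) ≤ t ^ 2 + ε ^ 2 := by
    rw [← sq_abs t]; nlinarith [sq_nonneg (|t| - ε)]
  have h2 : 0 ≤ t ^ 2 + ε ^ 2 := by positivity
  nlinarith

theorem lintegral_poissonKernel {ε : ℝ} (hε : 0 < ε) : ∫⁻ t, ‖poissonKernel ε t‖ₑ = 1 := by
  have hπ := Real.pi_pos
  have h1 : ∀ t, poissonKernel ε t = (Real.pi * ε)⁻¹ * (fun x : ℝ => (1 + x ^ 2)⁻¹) (t / ε) := by
    intro t
    unfold poissonKernel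
    field_simp
    rw [add_comm]
  have h2 : Integrable fun t : ℝ => (1 + (t / ε) ^ 2)⁻¹ :=
    integrable_inv_one_add_sq.comp_div hε.ne'
  have h3 : Integrable (poissonKernel ε) := by
    rw [show poissonKernel ε = _ from funext h1]
    exact h2.const_mul _
  have h4 : ∀ t, ‖poissonKernel ε t‖ₑ = ENNReal.ofReal (poissonKernel ε t) := fun t =>
    Real.enorm_of_nonneg (poissonKernel_pos hε t).le
  simp_rw [h4]
  rw [← ofReal_integral_eq_lintegral_ofReal h3
    (Eventually.of_forall fun t => (poissonKernel_pos hε t).le)]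
  simp_rw [h1]
  rw [integral_const_mul, Measure.integral_comp_div (fun x : ℝ => (1 + x ^ 2)⁻¹),
    integral_univ_inv_one_add_sq, abs_of_pos hε, smul_eq_mul]
  rw [show (Real.pi * ε)⁻¹ * (ε * Real.pi) = 1 by field_simp]
  simp

/-- Bounded measurable functions with bounded support. -/
structure IsNiceFun {E G : Type*} [NormedAddCommGroup E] [MeasurableSpace E]
    [NormedAddCommGroup G] [MeasurableSpace G] (f : E → G) : Prop where
  meas : Measurable f
  bdd : ∃ B, ∀ x, ‖f x‖ ≤ B
  supp : ∃ R, ∀ x, R < ‖x‖ → f x = 0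

theorem IsNiceFun.memLp {E G : Type*} [NormedAddCommGroup E] [ProperSpace E] [MeasurableSpace E]
    [BorelSpace E] [NormedAddCommGroup G] [MeasurableSpace G] [BorelSpace G]
    [SecondCountableTopology G]
    {μ : Measure E} [IsFiniteMeasureOnCompacts μ] {f : E → G} (hf : IsNiceFun f)
    (p : ℝ≥0∞) : MemLp f p μ := by
  obtain ⟨hm, ⟨B, hB⟩, R, hR⟩ := hf
  have h1 : MemLp ((Metric.closedBall (0 : E) R).indicator fun _ => B) p μ :=
    memLp_indicator_const p Metric.isClosed_closedBall.measurableSet B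
      (Or.inr (isCompact_closedBall 0 R).measure_lt_top.ne)
  refine h1.mono hm.aestronglyMeasurable (Eventually.of_forall fun x => ?_)
  by_cases hx : x ∈ Metric.closedBall (0 : E) R
  · rw [indicator_of_mem hx]
    exact (hB x).trans (le_abs_self B)
  · rw [hR x (by simpa using hx)]
    simp

theorem IsNiceFun.integrable {E G : Type*} [NormedAddCommGroup E] [ProperSpace E]
    [MeasurableSpace E] [BorelSpace E] [NormedAddCommGroup G] [MeasurableSpace G] [BorelSpace G]
    [SecondCountableTopology G]
    {μ : Measure E} [IsFiniteMeasureOnCompacts μ] {f : E → G} (hf : IsNiceFun f) :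
    Integrable f μ :=
  memLp_one_iff_integrable.1 (hf.memLp 1)

/-- The function `F(z) = (i/π) ∫ f(t) / (z - t) dt` is holomorphic in the upper half plane. On the
line `Im z = ε` its real part is the Poisson integral of `f` and its imaginary part the conjugate
Poisson integral. For `f ≥ 0` the real part is nonnegative, and `F = O(1/|z|)` by the bounded
support, so Riesz' inequality bounds the imaginary part by the real one. The Poisson integral is a
contraction on `L^p`. -/
theorem exists_hilbert_nonneg {p : ℝ} (hp₁ : 1 < p) (hp₂ : p < 2) :
    ∃ A : ℝ≥0, ∀ ε : ℝ, 0 < ε → ∀ f : ℝ → ℝ, IsNiceFun f → (∀ t, 0 ≤ f t) →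
      eLpNorm (fun x => ∫ t, conjPoissonKernel ε (x - t) * f t) (ENNReal.ofReal p) volume ≤
        A * eLpNorm f (ENNReal.ofReal p) volume := by
  obtain ⟨A, B, hA, hB, hAB⟩ := exists_abs_im_rpow_le hp₁ hp₂
  have hπ := Real.pi_pos
  have hp0 : 0 < p := by linarith
  refine ⟨A.toNNReal ^ (1 / p), fun ε hε f hf h0 => ?_⟩
  have hfi : Integrable f := hf.integrable
  -- The null case is separated because the holomorphic power needs `Re F` strictly positive.
  by_cases hfz : f =ᵐ[volume] 0
  · have : (fun x => ∫ t, conjPoissonKernel ε (x - t) * f t) = 0 := by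
      ext x
      refine integral_eq_zero_of_ae ?_
      filter_upwards [hfz] with t ht
      simp [ht]
    rw [this, eLpNorm_zero]
    exact zero_le
  set F : ℂ → ℂ := fun z => ∫ t, (f t : ℂ) * (Complex.I / Real.pi * (z - t)⁻¹) with hFdef
  have hpt : ∀ (x y t : ℝ), 0 < y → Complex.I / Real.pi * ((x + y * Complex.I : ℂ) - t)⁻¹ =
      ⟨poissonKernel y (x - t), conjPoissonKernel y (x - t)⟩ := by
    intro x y t hy
    have hne : ((x + y * Complex.I : ℂ) - t) ≠ 0 := by
      intro h
      have := congrArg Complex.im h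
      simp at this
      exact hy.ne' this
    have hne2 : (x - t) ^ 2 + y ^ 2 ≠ 0 := by positivity
    have hpi : (Real.pi : ℂ) ≠ 0 := by exact_mod_cast hπ.ne'
    rw [← div_eq_mul_inv, div_eq_iff hne, div_eq_iff hpi]
    apply Complex.ext
    · simp [poissonKernel, conjPoissonKernel]
      field_simp
      ring
    · simp [poissonKernel, conjPoissonKernel]
      field_simp
      ring
  have hnorm : ∀ (z : ℂ), 0 < z.im → ∀ t : ℝ, z.im ≤ ‖z - t‖ := fun z hz t => by
    have := Complex.abs_im_le_norm (z - t)
    simp only [Complex.sub_im, Complex.ofReal_im, sub_zero] at this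
    exact (le_abs_self _).trans this
  have hFint : ∀ z : ℂ, 0 < z.im →
      Integrable fun t => (f t : ℂ) * (Complex.I / Real.pi * (z - t)⁻¹) := by
    intro z hz
    refine hfi.ofReal.mul_bdd (c := 1 / Real.pi * z.im⁻¹) ?_ ?_
    · refine (Continuous.aestronglyMeasurable ?_)
      refine continuous_const.mul (Continuous.inv₀ (by fun_prop) fun t h => ?_)
      have := hnorm z hz t
      rw [h, norm_zero] at this
      linarith
    · refine Eventually.of_forall fun t => ?_
      rw [norm_mul, norm_inv, norm_div, Complex.norm_I, Complex.norm_real,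
        Real.norm_of_nonneg hπ.le]
      gcongr
      exact hnorm z hz t
  have hdiff : DifferentiableOn ℂ F {z | 0 < z.im} := by
    intro z hz
    have hz' : 0 < z.im := hz
    have hball : ∀ w ∈ Metric.ball z (z.im / 2), z.im / 2 < w.im := by
      intro w hw
      rw [mem_ball_iff_norm] at hw
      have := (Complex.abs_im_le_norm (w - z)).trans_lt hw
      rw [Complex.sub_im, abs_lt] at this
      linarith
    have h := hasDerivAt_integral_of_dominated_loc_of_deriv_le (𝕜 := ℂ) (μ := volume)
      (F := fun (z : ℂ) (t : ℝ) => (f t : ℂ) * (Complex.I / Real.pi * (z - t)⁻¹))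
      (F' := fun (z : ℂ) (t : ℝ) => (f t : ℂ) * (Complex.I / Real.pi * (-1 / (z - t) ^ 2)))
      (x₀ := z) (s := Metric.ball z (z.im / 2))
      (bound := fun t => |f t| * (1 / Real.pi * (1 / (z.im / 2) ^ 2)))
      (Metric.ball_mem_nhds z (by linarith)) ?_ (hFint z hz) ?_ ?_ ?_ ?_
    · exact h.2.differentiableAt.differentiableWithinAt
    · filter_upwards [Metric.ball_mem_nhds z (half_pos hz')] with w hw
      exact (hFint w ((half_pos hz').trans (hball w hw))).1
    · refine hfi.ofReal.1.mul (Continuous.aestronglyMeasurable ?_)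
      refine continuous_const.mul (continuous_const.div (by fun_prop) fun t h => ?_)
      have h2 := hnorm z hz t
      rw [pow_eq_zero_iff two_ne_zero] at h
      rw [h, norm_zero] at h2
      linarith
    · refine Eventually.of_forall fun t w hw => ?_
      have h1 := hball w hw
      have h2 := hnorm w ((half_pos hz').trans h1) t
      rw [norm_mul, norm_mul, norm_div, norm_div, norm_neg, norm_one, norm_pow, Complex.norm_I,
        Complex.norm_real, Complex.norm_real, Real.norm_of_nonneg hπ.le, Real.norm_eq_abs]
      gcongr
      linarith
    · exact hfi.abs.mul_const _
    · refine Eventually.of_forall fun t w hw => ?_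
      have h1 := hball w hw
      have h2 := hnorm w ((half_pos hz').trans h1) t
      have h3 : w - t ≠ 0 := fun h => by
        rw [h, norm_zero] at h2; linarith
      have h4 : HasDerivAt (fun z : ℂ => (z - t)⁻¹) (-1 / (w - t) ^ 2) w :=
        ((hasDerivAt_id w).sub_const (t : ℂ)).inv h3
      exact (h4.const_mul _).const_mul _
  have hxy : ∀ z : ℂ, z = z.re + z.im * Complex.I := fun z => (Complex.re_add_im z).symm
  have hFre : ∀ z : ℂ, 0 < z.im → (F z).re = ∫ t, f t * poissonKernel z.im (z.re - t) := by
    intro z hz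
    rw [hFdef, ← Complex.reCLM_apply, ← ContinuousLinearMap.integral_comp_comm _ (hFint z hz)]
    refine integral_congr_ae (Eventually.of_forall fun t => ?_)
    dsimp only
    conv_lhs => rw [hxy z]
    rw [hpt _ _ _ hz]
    simp
  have hFim : ∀ z : ℂ, 0 < z.im → (F z).im = ∫ t, f t * conjPoissonKernel z.im (z.re - t) := by
    intro z hz
    rw [hFdef, ← Complex.imCLM_apply, ← ContinuousLinearMap.integral_comp_comm _ (hFint z hz)]
    refine integral_congr_ae (Eventually.of_forall fun t => ?_)
    dsimp only
    conv_lhs => rw [hxy z]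
    rw [hpt _ _ _ hz]
    simp
  have hpos : ∀ z : ℂ, 0 < z.im → 0 < (F z).re := by
    intro z hz
    rw [hFre z hz, integral_pos_iff_support_of_nonneg
      (fun t => mul_nonneg (h0 t) (poissonKernel_pos hz _).le)]
    · have : Function.support (fun t => f t * poissonKernel z.im (z.re - t)) =
          Function.support f := by
        ext t
        simp [(poissonKernel_pos hz (z.re - t)).ne']
      rw [this, pos_iff_ne_zero]
      intro h
      exact hfz (by rwa [Filter.EventuallyEq, ae_iff])
    · have := (hFint z hz).re
      refine this.congr (Eventually.of_forall fun t => ?_)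
      dsimp only
      conv_lhs => rw [hxy z]
      rw [hpt _ _ _ hz]
      simp
  obtain ⟨R, hR⟩ := hf.supp
  have hdecay : ∀ z : ℂ, 0 < z.im → max (2 * R) 1 ≤ ‖z‖ →
      ‖F z‖ ≤ (2 / Real.pi * ∫ t, |f t|) / ‖z‖ := by
    intro z hz hzR
    have hz0 : 0 < ‖z‖ := one_pos.trans_le ((le_max_right _ _).trans hzR)
    have : (2 / Real.pi * ∫ t, |f t|) / ‖z‖ = ∫ t, |f t| * (2 / Real.pi / ‖z‖) := by
      rw [integral_mul_const]; ring
    rw [this]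
    refine norm_integral_le_of_norm_le (hfi.abs.mul_const _) (Eventually.of_forall fun t => ?_)
    rw [norm_mul, norm_mul, norm_inv, norm_div, Complex.norm_I,
        Complex.norm_real, Complex.norm_real, Real.norm_of_nonneg hπ.le, Real.norm_eq_abs]
    by_cases ht : R < ‖t‖
    · simp [hR t ht]
    · have h1 : ‖z‖ / 2 ≤ ‖z - t‖ := by
        have h2 := norm_sub_norm_le z (t : ℂ)
        have h3 := (le_max_left _ _).trans hzR
        rw [Complex.norm_real] at h2
        push Not at ht
        linarith
      have h4 : ‖z - t‖⁻¹ ≤ 2 / ‖z‖ := by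
        rw [inv_le_comm₀ (by linarith) (by positivity), inv_div]; exact h1
      calc |f t| * (1 / Real.pi * ‖z - t‖⁻¹) ≤ |f t| * (1 / Real.pi * (2 / ‖z‖)) := by gcongr
        _ = _ := by ring
  have hmain := lintegral_im_rpow_le hp₁ hA hB hAB hdiff hpos hdecay (by positivity) hε
  have eim : ∀ x : ℝ, (F (x + ε * Complex.I)).im = ∫ t, conjPoissonKernel ε (x - t) * f t := by
    intro x
    rw [hFim _ (by simpa using hε)]
    simp [mul_comm]
  have ere : ∀ x : ℝ, (F (x + ε * Complex.I)).re = ∫ z, poissonKernel ε z * f (x - z) := by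
    intro x
    rw [hFre _ (by simpa using hε), ← integral_sub_left_eq_self _ volume x]
    simp [mul_comm]
  simp_rw [eim, ere] at hmain
  have hpois : ∫⁻ x, ‖∫ z, poissonKernel ε z * f (x - z)‖ₑ ^ p ≤
      eLpNorm f (ENNReal.ofReal p) volume ^ p := by
    have hH : AEMeasurable (Function.uncurry fun x z : ℝ => ‖f (x - z)‖ₑ) (volume.prod volume) :=
      (hf.meas.enorm.comp (measurable_fst.sub measurable_snd)).aemeasurable
    have h5 := lintegral_minkowski (μ := (volume : Measure ℝ)) (ν := (volume : Measure ℝ))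
      hp₁.le (k := fun z => ‖poissonKernel ε z‖ₑ) (a := fun _ => 1)
      (H := fun x z => ‖f (x - z)‖ₑ) (N := eLpNorm f (ENNReal.ofReal p) volume)
      (continuous_poissonKernel hε).measurable.enorm.aemeasurable aemeasurable_const hH
      (by simp) (by simp) ?_
    · simp only [mul_one, lintegral_poissonKernel hε, one_mul] at h5
      refine (lintegral_mono fun x => ?_).trans h5
      gcongr
      refine (enorm_integral_le_lintegral_enorm _).trans_eq (lintegral_congr fun z => ?_)
      rw [enorm_mul]
    · refine Eventually.of_forall fun z => ?_
      rw [one_mul]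
      exact (eLpNorm_ofReal_le_iff hp₁.le _ _).1 (eLpNorm_comp_measurePreserving
        (f := fun x => x - z) hf.meas.aestronglyMeasurable (measurePreserving_sub_right volume z)).le
  rw [eLpNorm_ofReal_le_iff hp₁.le]
  refine hmain.trans ?_
  rw [ENNReal.mul_rpow_of_nonneg _ _ hp0.le]
  gcongr
  rw [ENNReal.coe_rpow_of_nonneg _ (by positivity), ← ENNReal.rpow_mul, one_div_mul_cancel hp0.ne',
    ENNReal.rpow_one]
  rfl

theorem integrable_conjPoissonKernel_mul {ε : ℝ} (hε : 0 < ε) {f : ℝ → ℂ} (hf : IsNiceFun f)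
    (x : ℝ) : Integrable fun t => (conjPoissonKernel ε t : ℂ) * f (x - t) := by
  refine Integrable.bdd_mul (c := 1 / ε) (hf.integrable.comp_sub_left x) ?_ ?_
  · exact (Complex.continuous_ofReal.comp (continuous_conjPoissonKernel hε)).aestronglyMeasurable
  · refine Eventually.of_forall fun t => ?_
    rw [Complex.norm_real]
    exact abs_conjPoissonKernel_le hε t

theorem aestronglyMeasurable_conjPoissonKernel_integral {ε : ℝ} (hε : 0 < ε) {f : ℝ → ℂ}
    (hf : IsNiceFun f) :
    AEStronglyMeasurable (fun x => ∫ t, (conjPoissonKernel ε t : ℂ) * f (x - t)) volume := by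
  refine (StronglyMeasurable.integral_prod_right ?_).aestronglyMeasurable
  refine Measurable.stronglyMeasurable ?_
  exact (Complex.measurable_ofReal.comp
    ((continuous_conjPoissonKernel hε).measurable.comp measurable_snd)).mul
    (hf.meas.comp (measurable_fst.sub measurable_snd))

/-- A complex function is split into the positive and negative parts of its real and imaginary
parts. Each is dominated by `|f|`, whence the factor four. -/
theorem exists_hilbert {p : ℝ} (hp₁ : 1 < p) (hp₂ : p < 2) :
    ∃ A : ℝ≥0, ∀ ε : ℝ, 0 < ε → ∀ f : ℝ → ℂ, IsNiceFun f →
      eLpNorm (fun x => ∫ t, (conjPoissonKernel ε t : ℂ) * f (x - t)) (ENNReal.ofReal p) volume ≤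
        A * eLpNorm f (ENNReal.ofReal p) volume := by
  obtain ⟨A, hA⟩ := exists_hilbert_nonneg hp₁ hp₂
  have hP : 1 ≤ ENNReal.ofReal p := by simpa using hp₁.le
  refine ⟨4 * A, fun ε hε f hf => ?_⟩
  have key : ∀ L : ℂ → ℝ, Continuous L → (∀ z, L z ≤ ‖z‖) → L 0 ≤ 0 →
      IsNiceFun (fun t => max (L (f t)) 0) ∧
      eLpNorm (fun x => ∫ t, conjPoissonKernel ε (x - t) * max (L (f t)) 0) (ENNReal.ofReal p)
        volume ≤ A * eLpNorm f (ENNReal.ofReal p) volume := by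
    intro L hL hLn hL0
    have hb : ∀ t, ‖max (L (f t)) 0‖ ≤ ‖f t‖ := fun t => by
      rw [Real.norm_of_nonneg (le_max_right _ _)]
      exact max_le (hLn _) (norm_nonneg _)
    have hn : IsNiceFun (fun t => max (L (f t)) 0) := by
      obtain ⟨B, hB⟩ := hf.bdd
      obtain ⟨R, hR⟩ := hf.supp
      refine ⟨(hL.measurable.comp hf.meas).max measurable_const, ⟨B, fun t => (hb t).trans (hB t)⟩,
        R, fun t ht => ?_⟩
      rw [hR t ht]
      exact max_eq_right hL0
    refine ⟨hn, (hA ε hε _ hn fun t => le_max_right _ _).trans ?_⟩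
    gcongr
    exact eLpNorm_mono hb
  obtain ⟨n1, b1⟩ := key Complex.re Complex.continuous_re Complex.re_le_norm le_rfl
  obtain ⟨n2, b2⟩ := key (fun z => -z.re) (by fun_prop)
    (fun z => (neg_le_abs _).trans (Complex.abs_re_le_norm z)) (by simp)
  obtain ⟨n3, b3⟩ := key Complex.im Complex.continuous_im
    (fun z => (le_abs_self _).trans (Complex.abs_im_le_norm z)) le_rfl
  obtain ⟨n4, b4⟩ := key (fun z => -z.im) (by fun_prop)
    (fun z => (neg_le_abs _).trans (Complex.abs_im_le_norm z)) (by simp)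
  have hcv : ∀ (g : ℝ → ℝ) (x : ℝ), ∫ t, conjPoissonKernel ε (x - t) * g t =
      ∫ t, conjPoissonKernel ε t * g (x - t) := by
    intro g x
    rw [← integral_sub_left_eq_self _ volume x]
    simp
  have hint : ∀ g : ℝ → ℝ, IsNiceFun g → ∀ x, Integrable fun t =>
      conjPoissonKernel ε t * g (x - t) := by
    intro g hg x
    refine Integrable.bdd_mul (c := 1 / ε) (hg.integrable.comp_sub_left x)
      (continuous_conjPoissonKernel hε).aestronglyMeasurable
      (Eventually.of_forall fun t => abs_conjPoissonKernel_le hε t)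
  have hmeas : ∀ g : ℝ → ℝ, IsNiceFun g → AEStronglyMeasurable
      (fun x => ∫ t, conjPoissonKernel ε t * g (x - t)) volume := by
    intro g hg
    refine (StronglyMeasurable.integral_prod_right ?_).aestronglyMeasurable
    refine Measurable.stronglyMeasurable ?_
    exact ((continuous_conjPoissonKernel hε).measurable.comp measurable_snd).mul
      (hg.meas.comp (measurable_fst.sub measurable_snd))
  simp_rw [hcv] at b1 b2 b3 b4
  have hdom : ∀ x, ‖∫ t, (conjPoissonKernel ε t : ℂ) * f (x - t)‖ ≤
      ‖(‖∫ t, conjPoissonKernel ε t * max (f (x - t)).re 0‖ +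
        ‖∫ t, conjPoissonKernel ε t * max (-(f (x - t)).re) 0‖) +
      (‖∫ t, conjPoissonKernel ε t * max (f (x - t)).im 0‖ +
        ‖∫ t, conjPoissonKernel ε t * max (-(f (x - t)).im) 0‖)‖ := by
    intro x
    have hI := integrable_conjPoissonKernel_mul hε hf x
    refine (Complex.norm_le_abs_re_add_abs_im _).trans ?_
    refine le_trans ?_ (le_abs_self _)
    have hre : (∫ t, (conjPoissonKernel ε t : ℂ) * f (x - t)).re =
        (∫ t, conjPoissonKernel ε t * max (f (x - t)).re 0) -
        ∫ t, conjPoissonKernel ε t * max (-(f (x - t)).re) 0 := by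
      rw [← integral_sub (hint _ n1 x) (hint _ n2 x), ← Complex.reCLM_apply,
        ← ContinuousLinearMap.integral_comp_comm _ hI]
      refine integral_congr_ae (Eventually.of_forall fun t => ?_)
      dsimp only
      rw [← mul_sub, Complex.reCLM_apply, Complex.re_ofReal_mul]
      congr 1
      exact (max_zero_sub_max_neg_zero_eq_self _).symm
    have him : (∫ t, (conjPoissonKernel ε t : ℂ) * f (x - t)).im =
        (∫ t, conjPoissonKernel ε t * max (f (x - t)).im 0) -
        ∫ t, conjPoissonKernel ε t * max (-(f (x - t)).im) 0 := by
      rw [← integral_sub (hint _ n3 x) (hint _ n4 x), ← Complex.imCLM_apply,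
        ← ContinuousLinearMap.integral_comp_comm _ hI]
      refine integral_congr_ae (Eventually.of_forall fun t => ?_)
      dsimp only
      rw [← mul_sub, Complex.imCLM_apply, Complex.im_ofReal_mul]
      congr 1
      exact (max_zero_sub_max_neg_zero_eq_self _).symm
    rw [hre, him]
    exact add_le_add (abs_sub _ _) (abs_sub _ _)
  refine (eLpNorm_mono hdom).trans ?_
  have m1 := (hmeas _ n1).norm
  have m2 := (hmeas _ n2).norm
  have m3 := (hmeas _ n3).norm
  have m4 := (hmeas _ n4).norm
  refine (eLpNorm_add_le (m1.add m2) (m3.add m4) hP).trans ?_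
  refine (add_le_add (eLpNorm_add_le m1 m2 hP) (eLpNorm_add_le m3 m4 hP)).trans ?_
  simp only [eLpNorm_norm]
  refine (add_le_add (add_le_add b1 b2) (add_le_add b3 b4)).trans_eq ?_
  push_cast
  ring

/-- The truncated kernel of the Hilbert transform. -/
def hilbertKernel (ε N t : ℝ) : ℝ := conjPoissonKernel ε t - conjPoissonKernel N t

theorem hilbertKernel_eq {ε N : ℝ} (hε : 0 < ε) (hN : 0 < N) (t : ℝ) :
    hilbertKernel ε N t =
      t * (N ^ 2 - ε ^ 2) / (Real.pi * ((t ^ 2 + ε ^ 2) * (t ^ 2 + N ^ 2))) := by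
  unfold hilbertKernel conjPoissonKernel
  have := Real.pi_pos
  field_simp
  ring

theorem continuous_hilbertKernel {ε N : ℝ} (hε : 0 < ε) (hN : 0 < N) :
    Continuous (hilbertKernel ε N) :=
  (continuous_conjPoissonKernel hε).sub (continuous_conjPoissonKernel hN)

/-- A single conjugate Poisson kernel has a tail `1/(π t)` and is not integrable. In the difference
the tails cancel, and a multiple of `1/(t² + N²)` majorises it. Integrability permits the Fubini
arguments in the method of rotations. -/
theorem integrable_hilbertKernel {ε N : ℝ} (hε : 0 < ε) (hN : 0 < N) :
    Integrable (hilbertKernel ε N) := by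
  have hπ := Real.pi_gt_three
  have h2 : Integrable fun t : ℝ => |N ^ 2 - ε ^ 2| / ε * (N ^ 2)⁻¹ * (1 + (t / N) ^ 2)⁻¹ :=
    (integrable_inv_one_add_sq.comp_div hN.ne').const_mul _
  refine h2.mono' (continuous_hilbertKernel hε hN).aestronglyMeasurable
    (Eventually.of_forall fun t => ?_)
  rw [hilbertKernel_eq hε hN, norm_div, norm_mul, Real.norm_eq_abs, Real.norm_eq_abs,
    Real.norm_of_nonneg (by positivity)]
  have h3 : |N ^ 2 - ε ^ 2| / ε * (N ^ 2)⁻¹ * (1 + (t / N) ^ 2)⁻¹ =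
      |N ^ 2 - ε ^ 2| * (1 / ε) / (t ^ 2 + N ^ 2) := by field_simp; ring
  rw [h3, mul_comm |t|, mul_div_assoc, mul_div_assoc]
  gcongr ?_ * ?_
  rw [div_le_div_iff₀ (by positivity) (by positivity)]
  have h1 : |t| ≤ 1 / ε * (Real.pi * (t ^ 2 + ε ^ 2)) := by
    have h1 : 2 * (|t| * ε) ≤ t ^ 2 + ε ^ 2 := by
      rw [← sq_abs t]; nlinarith [sq_nonneg (|t| - ε)]
    have h2 : 0 ≤ t ^ 2 + ε ^ 2 := by positivity
    rw [one_div_mul_eq_div, le_div_iff₀ hε]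
    nlinarith
  have h4 : 0 ≤ t ^ 2 + N ^ 2 := by positivity
  nlinarith [mul_le_mul_of_nonneg_right h1 h4]

/-- These bounds, uniform in both truncations, provide the dominating function for the approximate
Riesz symbols. -/
theorem mul_hilbertKernel_mem {ε N : ℝ} (hε : 0 < ε) (hN : ε ≤ N) (t : ℝ) :
    0 ≤ t * hilbertKernel ε N t ∧ t * hilbertKernel ε N t ≤ 1 := by
  have hπ := Real.pi_gt_three
  have hN0 : 0 < N := hε.trans_le hN
  have h0 : 0 ≤ N ^ 2 - ε ^ 2 := by nlinarith
  rw [hilbertKernel_eq hε hN0, ← mul_div_assoc, ← mul_assoc]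
  refine ⟨div_nonneg (mul_nonneg (mul_self_nonneg _) h0) (by positivity), ?_⟩
  rw [div_le_one (by positivity)]
  have h1 : t * t * (N ^ 2 - ε ^ 2) ≤ (t ^ 2 + ε ^ 2) * (t ^ 2 + N ^ 2) := by
    nlinarith [sq_nonneg t, sq_nonneg ε, mul_nonneg (sq_nonneg t) (sq_nonneg ε),
      mul_nonneg (sq_nonneg ε) (sq_nonneg N), mul_nonneg (sq_nonneg t) (sq_nonneg t)]
  have h2 : 0 ≤ (t ^ 2 + ε ^ 2) * (t ^ 2 + N ^ 2) := by positivity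
  nlinarith

theorem tendsto_mul_hilbertKernel {t : ℝ} (ht : t ≠ 0) :
    Tendsto (fun n : ℕ => t * hilbertKernel ((n : ℝ) + 1)⁻¹ ((n : ℝ) + 1) t) atTop
      (𝓝 (1 / Real.pi)) := by
  have hπ := Real.pi_pos
  have hinf : Tendsto (fun n : ℕ => (n : ℝ) + 1) atTop atTop :=
    tendsto_atTop_add_const_right _ _ tendsto_natCast_atTop_atTop
  have h1 : Tendsto (fun n : ℕ => t * conjPoissonKernel ((n : ℝ) + 1)⁻¹ t) atTop
      (𝓝 (t * (t / (Real.pi * (t ^ 2 + 0 ^ 2))))) := by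
    refine tendsto_const_nhds.mul (tendsto_const_nhds.div (tendsto_const_nhds.mul
      (tendsto_const_nhds.add (hinf.inv_tendsto_atTop.pow 2))) ?_)
    positivity
  have h2 : Tendsto (fun n : ℕ => t * conjPoissonKernel ((n : ℝ) + 1) t) atTop
      (𝓝 (t * 0)) := by
    refine tendsto_const_nhds.mul (tendsto_const_nhds.div_atTop ?_)
    refine Tendsto.const_mul_atTop hπ (tendsto_atTop_add_const_left _ _ ?_)
    exact (tendsto_pow_atTop two_ne_zero).comp hinf
  have h3 := h1.sub h2
  have h4 : t * (t / (Real.pi * (t ^ 2 + 0 ^ 2))) - t * 0 = 1 / Real.pi := by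
    field_simp
    ring
  rw [h4] at h3
  refine h3.congr fun n => ?_
  unfold hilbertKernel
  ring

theorem exists_hilbertKernel {p : ℝ} (hp₁ : 1 < p) (hp₂ : p < 2) :
    ∃ A : ℝ≥0, ∀ ε N : ℝ, 0 < ε → 0 < N → ∀ f : ℝ → ℂ, IsNiceFun f →
      eLpNorm (fun x => ∫ t, (hilbertKernel ε N t : ℂ) * f (x - t)) (ENNReal.ofReal p) volume ≤
        A * eLpNorm f (ENNReal.ofReal p) volume := by
  obtain ⟨A, hA⟩ := exists_hilbert hp₁ hp₂
  have hP : 1 ≤ ENNReal.ofReal p := by simpa using hp₁.le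
  refine ⟨A + A, fun ε N hε hN f hf => ?_⟩
  have : (fun x => ∫ t, (hilbertKernel ε N t : ℂ) * f (x - t)) =
      (fun x => ∫ t, (conjPoissonKernel ε t : ℂ) * f (x - t)) -
      fun x => ∫ t, (conjPoissonKernel N t : ℂ) * f (x - t) := by
    ext x
    rw [Pi.sub_apply, ← integral_sub (integrable_conjPoissonKernel_mul hε hf x)
      (integrable_conjPoissonKernel_mul hN hf x)]
    simp [hilbertKernel, sub_mul]
  rw [this]
  refine (eLpNorm_sub_le (aestronglyMeasurable_conjPoissonKernel_integral hε hf)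
    (aestronglyMeasurable_conjPoissonKernel_integral hN hf) hP).trans ?_
  refine (add_le_add (hA ε hε f hf) (hA N hN f hf)).trans_eq ?_
  push_cast
  ring

end HilbertKernel

/-! ### Riesz transforms by the method of rotations -/

section Rotations

open Filter Topology Set
open scoped RealInnerProductSpace

variable {d : ℕ}

/-- Fubini along lines of direction `θ` without choosing hyperplanes. After translating `x` by `-s
θ` the indicator becomes that of an interval of length one in `s`, so its `s`-integral equals `1`.
Integrals over space thus become weighted averages of line integrals. -/
theorem lintegral_line_average {θ : Space d} (hθ : θ ≠ 0) {G : Space d → ℝ≥0∞}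
    (hG : Measurable G) :
    ∫⁻ x, (Icc (0 : ℝ) 1).indicator 1 (-(⟪x, θ⟫ / ‖θ‖ ^ 2)) * ∫⁻ s : ℝ, G (x + s • θ) =
      ∫⁻ x, G x := by
  have hw : Measurable ((Icc (0 : ℝ) 1).indicator (1 : ℝ → ℝ≥0∞)) :=
    measurable_one.indicator measurableSet_Icc
  have h1 : ∀ x : Space d, (Icc (0 : ℝ) 1).indicator 1 (-(⟪x, θ⟫ / ‖θ‖ ^ 2)) *
      ∫⁻ s : ℝ, G (x + s • θ) =
      ∫⁻ s : ℝ, (Icc (0 : ℝ) 1).indicator 1 (-(⟪x, θ⟫ / ‖θ‖ ^ 2)) * G (x + s • θ) := fun x =>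
    (lintegral_const_mul _ (show Measurable fun s : ℝ => G (x + s • θ) from
      hG.comp (by fun_prop))).symm
  have hn : ‖θ‖ ^ 2 ≠ 0 := by positivity
  simp_rw [h1]
  rw [lintegral_lintegral_swap]
  · have h2 : ∀ s : ℝ, ∫⁻ x : Space d, (Icc (0 : ℝ) 1).indicator 1 (-(⟪x, θ⟫ / ‖θ‖ ^ 2)) *
        G (x + s • θ) = ∫⁻ y : Space d, (Icc (0 : ℝ) 1).indicator 1 (s - ⟪y, θ⟫ / ‖θ‖ ^ 2) *
        G y := by
      intro s
      rw [← lintegral_sub_right_eq_self (fun x : Space d => (Icc (0 : ℝ) 1).indicator 1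
        (-(⟪x, θ⟫ / ‖θ‖ ^ 2)) * G (x + s • θ)) (s • θ)]
      refine lintegral_congr fun x => ?_
      rw [inner_sub_left, real_inner_smul_left, real_inner_self_eq_norm_sq, sub_add_cancel]
      congr 2
      field_simp
      ring
    simp_rw [h2]
    rw [lintegral_lintegral_swap]
    · refine lintegral_congr fun y => ?_
      rw [lintegral_mul_const _ (show Measurable fun s : ℝ =>
        (Icc (0 : ℝ) 1).indicator (1 : ℝ → ℝ≥0∞) (s - ⟪y, θ⟫ / ‖θ‖ ^ 2) from
        hw.comp (by fun_prop)),
        lintegral_sub_right_eq_self (fun s => (Icc (0 : ℝ) 1).indicator (1 : ℝ → ℝ≥0∞) s),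
        lintegral_indicator_one measurableSet_Icc]
      simp
    · refine Measurable.aemeasurable ?_
      exact (hw.comp (by fun_prop)).mul (hG.comp measurable_snd)
  · refine Measurable.aemeasurable ?_
    exact (hw.comp (by fun_prop)).mul (hG.comp (by fun_prop))

/-- The truncated directional Hilbert transform. -/
def directionalHilbert (ε N : ℝ) (f : Space d → ℂ) (x θ : Space d) : ℂ :=
  ∫ t : ℝ, (hilbertKernel ε N t : ℂ) * f (x - t • θ)

theorem stronglyMeasurable_directionalHilbert {ε N : ℝ} (hε : 0 < ε) (hN : 0 < N)
    {f : Space d → ℂ} (hf : Measurable f) :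
    StronglyMeasurable (Function.uncurry (directionalHilbert ε N f)) := by
  have : Measurable fun y : (Space d × Space d) × ℝ =>
      (hilbertKernel ε N y.2 : ℂ) * f (y.1.1 - y.2 • y.1.2) :=
    (Complex.measurable_ofReal.comp
      ((continuous_hilbertKernel hε hN).measurable.comp measurable_snd)).mul
      (hf.comp (by fun_prop))
  exact this.stronglyMeasurable.integral_prod_right

/-- On each line the operator is the one-dimensional truncated Hilbert transform of the restriction
of `f`, and `lintegral_line_average` integrates the one-dimensional bound over all lines. The
parametrisation by `t • θ` makes the constant independent of `|θ|`. -/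
theorem eLpNorm_directionalHilbert_le {p : ℝ} (hp : 1 ≤ p) {A : ℝ≥0} {ε N : ℝ} (hε : 0 < ε)
    (hN : 0 < N)
    (hA : ∀ f : ℝ → ℂ, IsNiceFun f →
      eLpNorm (fun x => ∫ t, (hilbertKernel ε N t : ℂ) * f (x - t)) (ENNReal.ofReal p) volume ≤
        A * eLpNorm f (ENNReal.ofReal p) volume)
    {f : Space d → ℂ} (hf : IsNiceFun f) {θ : Space d} (hθ : θ ≠ 0) :
    eLpNorm (fun x => directionalHilbert ε N f x θ) (ENNReal.ofReal p) volume ≤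
      A * eLpNorm f (ENNReal.ofReal p) volume := by
  have hp0 : 0 < p := by linarith
  have hT : Measurable fun x => directionalHilbert ε N f x θ :=
    (stronglyMeasurable_directionalHilbert hε hN hf.meas).measurable.comp
      (measurable_id.prodMk measurable_const)
  have hG1 : Measurable fun x => ‖directionalHilbert ε N f x θ‖ₑ ^ p := hT.enorm.pow_const p
  have hG2 : Measurable fun x => ‖f x‖ₑ ^ p := hf.meas.enorm.pow_const p
  rw [eLpNorm_ofReal_le_iff hp, ENNReal.mul_rpow_of_nonneg _ _ hp0.le, eLpNorm_ofReal_rpow hp,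
    ← lintegral_line_average hθ hG1, ← lintegral_line_average hθ hG2,
    ← lintegral_const_mul' _ _ (by simp [hp0.le])]
  refine lintegral_mono fun x => ?_
  rw [mul_left_comm]
  gcongr
  have hF : IsNiceFun fun s : ℝ => f (x + s • θ) := by
    obtain ⟨B, hB⟩ := hf.bdd
    obtain ⟨R, hR⟩ := hf.supp
    refine ⟨hf.meas.comp (by fun_prop), ⟨B, fun s => hB _⟩, (R + ‖x‖) / ‖θ‖, fun s hs => hR _ ?_⟩
    rw [div_lt_iff₀ (norm_pos_iff.2 hθ), ← norm_smul] at hs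
    have := norm_sub_le (x + s • θ) x
    rw [add_sub_cancel_left] at this
    linarith
  have h3 := (eLpNorm_ofReal_le_iff hp _ _).1 (hA _ hF)
  rw [ENNReal.mul_rpow_of_nonneg _ _ hp0.le, eLpNorm_ofReal_rpow hp] at h3
  refine le_trans (le_of_eq (lintegral_congr fun s => ?_)) h3
  unfold directionalHilbert
  simp only [sub_smul, add_sub_assoc]

/-- The angular weight `θ_i e^{-π|θ|²}`. -/
def rieszWeight (i : Fin d) (θ : Space d) : ℂ := θ i * Complex.exp (-Real.pi * ‖θ‖ ^ 2)

theorem continuous_rieszWeight (i : Fin d) : Continuous (rieszWeight i) := by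
  unfold rieszWeight
  fun_prop

theorem norm_cexp_neg_mul_sq (b : ℝ) (θ : Space d) :
    ‖Complex.exp (-b * ‖θ‖ ^ 2)‖ = Real.exp (-b * ‖θ‖ ^ 2) := by
  rw [Complex.norm_exp]
  norm_cast

theorem integrable_gaussian {b : ℝ} (hb : 0 < b) :
    Integrable fun θ : Space d => Complex.exp (-b * ‖θ‖ ^ 2) := by
  simpa using GaussianFourier.integrable_cexp_neg_mul_sq_norm_add (V := Space d) (b := b)
    (by simpa using hb) 0 0

theorem integrable_norm_mul_gaussian :
    Integrable fun θ : Space d => ‖θ‖ * Real.exp (-Real.pi * ‖θ‖ ^ 2) := by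
  have hπ := Real.pi_gt_three
  refine (integrable_gaussian (d := d) one_pos).norm.mono' (by fun_prop)
    (Eventually.of_forall fun θ => ?_)
  rw [norm_cexp_neg_mul_sq, Real.norm_of_nonneg (by positivity)]
  have h1 : ‖θ‖ ≤ Real.exp (‖θ‖ ^ 2) := by
    have := Real.add_one_le_exp (‖θ‖ ^ 2)
    nlinarith [sq_nonneg (‖θ‖ - 1)]
  calc _ ≤ Real.exp (‖θ‖ ^ 2) * Real.exp (-Real.pi * ‖θ‖ ^ 2) := by gcongr
    _ = Real.exp (‖θ‖ ^ 2 + -Real.pi * ‖θ‖ ^ 2) := (Real.exp_add _ _).symm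
    _ ≤ _ := Real.exp_le_exp.2 (by nlinarith [sq_nonneg ‖θ‖])

theorem integrable_rieszWeight (i : Fin d) : Integrable (rieszWeight i) := by
  refine integrable_norm_mul_gaussian.mono' (continuous_rieszWeight i).aestronglyMeasurable
    (Eventually.of_forall fun θ => ?_)
  rw [rieszWeight, norm_mul, Complex.norm_real, norm_cexp_neg_mul_sq]
  gcongr
  exact PiLp.norm_apply_le θ i

theorem hasFDerivAt_gaussian (θ : Space d) :
    HasFDerivAt (fun θ : Space d => Complex.exp (-Real.pi * ‖θ‖ ^ 2))
      ((Complex.exp (-Real.pi * ‖θ‖ ^ 2) * (-2 * Real.pi)) •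
        (Complex.ofRealCLM ∘L innerSL ℝ θ)) θ := by
  have h1 : HasFDerivAt (fun θ : Space d => ((‖θ‖ ^ 2 : ℝ) : ℂ))
      (Complex.ofRealCLM ∘L (2 • innerSL ℝ θ)) θ :=
    Complex.ofRealCLM.hasFDerivAt.comp θ (hasStrictFDerivAt_norm_sq θ).hasFDerivAt
  have h2 := (h1.const_mul (-(Real.pi : ℂ))).cexp
  push_cast at h2
  convert! h2 using 1
  ext v
  simp
  ring

/-- The weight is `-1/(2π)` times the `i`-th derivative of the Gaussian `e^{-π|θ|²}`, which is its
own Fourier transform. -/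
theorem fourier_rieszWeight (i : Fin d) (η : Space d) :
    𝓕 (rieszWeight i) η = -Complex.I * η i * Complex.exp (-Real.pi * ‖η‖ ^ 2) := by
  have hπ := Real.pi_pos
  have hπ' : (Real.pi : ℂ) ≠ 0 := by exact_mod_cast hπ.ne'
  set g : Space d → ℂ := fun θ => Complex.exp (-Real.pi * ‖θ‖ ^ 2) with hg
  have hgi : Integrable g := integrable_gaussian hπ
  have hgd : fderiv ℝ g = fun θ => (g θ * (-2 * Real.pi)) • (Complex.ofRealCLM ∘L innerSL ℝ θ) :=
    funext fun θ => (hasFDerivAt_gaussian θ).fderiv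
  have hgdi : Integrable (fderiv ℝ g) := by
    rw [hgd]
    refine (integrable_norm_mul_gaussian.const_mul (2 * Real.pi)).mono'
      (Continuous.aestronglyMeasurable (by fun_prop)) (Eventually.of_forall fun θ => ?_)
    rw [norm_smul, norm_mul, hg, norm_cexp_neg_mul_sq, norm_mul, norm_neg, Complex.norm_real,
      Real.norm_of_nonneg hπ.le, Complex.norm_ofNat]
    have : ‖Complex.ofRealCLM ∘L innerSL ℝ θ‖ ≤ ‖θ‖ := by
      refine (ContinuousLinearMap.opNorm_comp_le _ _).trans ?_
      rw [Complex.ofRealCLM_norm, one_mul, innerSL_apply_norm]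
    calc _ ≤ Real.exp (-Real.pi * ‖θ‖ ^ 2) * (2 * Real.pi) * ‖θ‖ := by gcongr
      _ = _ := by ring
  have hF := congrFun (Real.fourier_fderiv hgi
    (fun θ => (hasFDerivAt_gaussian θ).differentiableAt) hgdi) η
  have hF2 := DFunLike.congr_fun hF (EuclideanSpace.single i (1 : ℝ))
  have hgau : 𝓕 g η = Complex.exp (-Real.pi * ‖η‖ ^ 2) := by
    have := fourier_gaussian_innerProductSpace (V := Space d) (b := (Real.pi : ℂ))
      (by simpa using hπ) η
    rw [hg, this, div_self hπ', Complex.one_cpow, one_mul]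
    congr 1
    field_simp
  have hL : (𝓕 (fderiv ℝ g) η) (EuclideanSpace.single i (1 : ℝ)) =
      -2 * Real.pi * 𝓕 (rieszWeight i) η := by
    rw [Real.fourier_eq, Real.fourier_eq, ← integral_const_mul,
      ContinuousLinearMap.integral_apply]
    · refine integral_congr_ae (Eventually.of_forall fun θ => ?_)
      simp only [hgd, rieszWeight]
      rw [show Complex.exp (-Real.pi * ‖θ‖ ^ 2) = g θ from rfl]
      simp [Circle.smul_def, EuclideanSpace.inner_single_right]
      ring
    · exact (Real.fourierIntegral_convergent_iff η).2 hgdi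
  rw [hL] at hF2
  have hin : innerSL ℝ η (EuclideanSpace.single i (1 : ℝ)) = η i := by
    simp [EuclideanSpace.inner_single_right]
  simp only [hgau, VectorFourier.fourierSMulRight_apply, neg_apply, hin,
    smul_eq_mul, Complex.real_smul, Complex.ofReal_neg] at hF2
  have h3 : -2 * Real.pi * 𝓕 (rieszWeight i) η =
      -2 * Real.pi * (-Complex.I * η i * Complex.exp (-Real.pi * ‖η‖ ^ 2)) := by
    linear_combination hF2
  exact mul_left_cancel₀ (by simp [hπ.ne']) h3

/-- A superposition of translates is a Fourier multiplier, its symbol being the same superposition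
of characters. With `γ (θ, t) = t • θ` this yields the symbol of the averaged directional
transforms. -/
theorem integral_mul_comp_sub_eq_fourierInv {β : Type*} [MeasurableSpace β] {ν : Measure β}
    [SFinite ν] {K : β → ℂ} (hK : Integrable K ν) {γ : β → Space d} (hγ : Measurable γ)
    (f : 𝓢(Space d, ℂ)) (x : Space d) :
    ∫ b, K b * f (x - γ b) ∂ν =
      𝓕⁻ (fun ξ : Space d => (∫ b, K b * Real.fourierChar (-⟪γ b, ξ⟫) ∂ν) * 𝓕 f ξ) x := by
  have h1 : ∀ y, f y = ∫ ξ, (Real.fourierChar ⟪ξ, y⟫ : ℂ) * 𝓕 f ξ := by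
    intro y
    have : f y = 𝓕⁻ (𝓕 f) y := by rw [FourierTransform.fourierInv_fourier_eq]
    rw [this, SchwartzMap.fourierInv_coe, Real.fourierInv_eq]
    rfl
  have hS : Integrable (⇑(𝓕 f : 𝓢(Space d, ℂ))) volume := (𝓕 f : 𝓢(Space d, ℂ)).integrable
  rw [Real.fourierInv_eq]
  simp_rw [Circle.smul_def, smul_eq_mul, ← integral_mul_const, ← integral_const_mul]
  rw [integral_integral_swap]
  · refine integral_congr_ae (Eventually.of_forall fun b => ?_)
    dsimp only
    rw [h1, ← integral_const_mul]
    refine integral_congr_ae (Eventually.of_forall fun ξ => ?_)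
    dsimp only
    rw [inner_sub_right, sub_eq_add_neg, AddChar.map_add_eq_mul, real_inner_comm (γ b) ξ]
    push_cast
    ring
  · have hi := hS.mul_prod hK
    have hc : Continuous fun t : ℝ => (Real.fourierChar t : ℂ) := by fun_prop
    refine hi.mono ?_ (Eventually.of_forall fun y => ?_)
    · have m1 : Measurable fun y : Space d × β => (Real.fourierChar ⟪y.1, x⟫ : ℂ) :=
        hc.measurable.comp (measurable_fst.inner measurable_const)
      have m2 : Measurable fun y : Space d × β => (Real.fourierChar (-⟪γ y.2, y.1⟫) : ℂ) :=
        hc.measurable.comp ((hγ.comp measurable_snd).inner measurable_fst).neg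
      exact m1.aestronglyMeasurable.mul ((hK.1.comp_snd.mul m2.aestronglyMeasurable).mul
        hS.1.comp_fst)
    · simp only [Function.uncurry, norm_mul]
      rw [Circle.norm_coe, Circle.norm_coe, one_mul, mul_one, mul_comm]

/-- The symbol of the truncated Riesz transform. -/
def rieszApproxSymbol (i : Fin d) (ε N : ℝ) (ξ : Space d) : ℂ :=
  ∫ t : ℝ, (hilbertKernel ε N t : ℂ) * 𝓕 (rieszWeight i) (t • ξ)

theorem integral_rieszWeight_directionalHilbert (i : Fin d) {ε N : ℝ} (hε : 0 < ε) (hN : 0 < N)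
    (f : 𝓢(Space d, ℂ)) (x : Space d) :
    ∫ θ, rieszWeight i θ • directionalHilbert ε N f x θ =
      𝓕⁻ (fun ξ : Space d => rieszApproxSymbol i ε N ξ * 𝓕 f ξ) x := by
  have hK : Integrable (fun b : Space d × ℝ => rieszWeight i b.1 * (hilbertKernel ε N b.2 : ℂ))
      (volume.prod volume) :=
    (integrable_rieszWeight i).mul_prod (integrable_hilbertKernel hε hN).ofReal
  have h1 := integral_mul_comp_sub_eq_fourierInv hK
    (γ := fun b : Space d × ℝ => b.2 • b.1) (by fun_prop) f x
  obtain ⟨B, -, hB⟩ := schwartz_decay f 0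
  have hc : Continuous fun t : ℝ => (Real.fourierChar t : ℂ) := by fun_prop
  have h2 : Integrable (fun b : Space d × ℝ =>
      (rieszWeight i b.1 * (hilbertKernel ε N b.2 : ℂ)) * f (x - b.2 • b.1))
      (volume.prod volume) := by
    refine hK.mul_bdd (c := B) ?_ (Eventually.of_forall fun b => by simpa using (hB (x - b.2 • b.1)).1)
    exact (f.continuous.comp (by fun_prop)).aestronglyMeasurable
  have h3 : ∀ ξ : Space d, Integrable (fun b : Space d × ℝ =>
      (rieszWeight i b.1 * (hilbertKernel ε N b.2 : ℂ)) *
        (Real.fourierChar (-⟪b.2 • b.1, ξ⟫) : ℂ)) (volume.prod volume) := by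
    intro ξ
    refine hK.mul_bdd (c := 1) ?_ (Eventually.of_forall fun b => (Circle.norm_coe _).le)
    exact (hc.comp (by fun_prop)).aestronglyMeasurable
  rw [integral_prod _ h2] at h1
  have h4 : ∀ ξ : Space d, ∫ b : Space d × ℝ, (rieszWeight i b.1 * (hilbertKernel ε N b.2 : ℂ)) *
        (Real.fourierChar (-⟪b.2 • b.1, ξ⟫) : ℂ) ∂(volume.prod volume) =
        rieszApproxSymbol i ε N ξ := by
    intro ξ
    rw [integral_prod_symm _ (h3 ξ)]
    refine integral_congr_ae (Eventually.of_forall fun t => ?_)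
    dsimp only
    rw [Real.fourier_eq, ← integral_const_mul]
    refine integral_congr_ae (Eventually.of_forall fun θ => ?_)
    dsimp only
    rw [Circle.smul_def, smul_eq_mul, real_inner_smul_left, real_inner_smul_right]
    ring
  simp_rw [h4] at h1
  rw [← h1]
  refine integral_congr_ae (Eventually.of_forall fun θ => ?_)
  simp only [directionalHilbert, smul_eq_mul]
  rw [← integral_const_mul]
  simp_rw [mul_assoc]

theorem integrable_exp_neg_pi_mul_sq {r : ℝ} (hr : 0 < r) :
    Integrable fun t : ℝ => Real.exp (-(Real.pi * r ^ 2) * t ^ 2) :=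
  integrable_exp_neg_mul_sq (by have := Real.pi_pos; positivity)

theorem integral_exp_neg_pi_mul_sq {r : ℝ} (hr : 0 < r) :
    ∫ t : ℝ, Real.exp (-(Real.pi * r ^ 2) * t ^ 2) = 1 / r := by
  have hπ := Real.pi_pos
  rw [integral_gaussian, show Real.pi / (Real.pi * r ^ 2) = (1 / r) ^ 2 by field_simp,
    Real.sqrt_sq (by positivity)]

/-- The factor `t` from the odd angular weight combines with the kernel into `t * hilbertKernel ε N
t`, which is bounded by `1` and tends to `1/π`. As `∫ e^{-π|ξ|²t²} dt = 1/|ξ|`, the limiting symbol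
is `-i ξ_i / (π|ξ|)`, a multiple of the Riesz symbol. -/
theorem hilbertKernel_mul_fourier (i : Fin d) (ε N : ℝ) (ξ : Space d) (t : ℝ) :
    (hilbertKernel ε N t : ℂ) * 𝓕 (rieszWeight i) (t • ξ) =
      -Complex.I * ξ i * ((t * hilbertKernel ε N t *
        Real.exp (-(Real.pi * ‖ξ‖ ^ 2) * t ^ 2) : ℝ) : ℂ) := by
  rw [fourier_rieszWeight, norm_smul, PiLp.smul_apply, smul_eq_mul]
  have : -(Real.pi : ℂ) * ((‖t‖ * ‖ξ‖ : ℝ) : ℂ) ^ 2 =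
      ((-(Real.pi * ‖ξ‖ ^ 2) * t ^ 2 : ℝ) : ℂ) := by
    rw [← Complex.ofReal_pow, mul_pow, Real.norm_eq_abs, sq_abs]
    push_cast
    ring
  rw [this]
  push_cast
  ring

theorem norm_hilbertKernel_mul_fourier_le (i : Fin d) {ε N : ℝ} (hε : 0 < ε) (hN : ε ≤ N)
    (ξ : Space d) (t : ℝ) :
    ‖(hilbertKernel ε N t : ℂ) * 𝓕 (rieszWeight i) (t • ξ)‖ ≤
      ‖ξ‖ * Real.exp (-(Real.pi * ‖ξ‖ ^ 2) * t ^ 2) := by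
  obtain ⟨h0, h1⟩ := mul_hilbertKernel_mem hε hN t
  rw [hilbertKernel_mul_fourier, norm_mul, norm_mul, norm_neg, Complex.norm_I, one_mul,
    Complex.norm_real, Complex.norm_real, norm_mul, Real.norm_of_nonneg h0, Real.norm_of_nonneg
    (Real.exp_pos _).le]
  refine mul_le_mul (PiLp.norm_apply_le ξ i) ?_ (by positivity) (norm_nonneg _)
  exact mul_le_of_le_one_left (Real.exp_pos _).le h1

theorem norm_rieszApproxSymbol_le (i : Fin d) {ε N : ℝ} (hε : 0 < ε) (hN : ε ≤ N) {ξ : Space d}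
    (hξ : ξ ≠ 0) : ‖rieszApproxSymbol i ε N ξ‖ ≤ 1 := by
  have h0 := norm_pos_iff.2 hξ
  refine (norm_integral_le_of_norm_le ((integrable_exp_neg_pi_mul_sq h0).const_mul ‖ξ‖)
    (Eventually.of_forall fun t => norm_hilbertKernel_mul_fourier_le i hε hN ξ t)).trans_eq ?_
  rw [integral_const_mul, integral_exp_neg_pi_mul_sq h0]
  field_simp

theorem tendsto_rieszApproxSymbol (i : Fin d) {ξ : Space d} (hξ : ξ ≠ 0) :
    Tendsto (fun n : ℕ => rieszApproxSymbol i ((n : ℝ) + 1)⁻¹ ((n : ℝ) + 1) ξ) atTop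
      (𝓝 (-Complex.I * ξ i * ((1 / Real.pi * (1 / ‖ξ‖) : ℝ) : ℂ))) := by
  have h0 := norm_pos_iff.2 hξ
  rw [← integral_exp_neg_pi_mul_sq h0, ← integral_const_mul, ← integral_complex_ofReal,
    ← integral_const_mul]
  have hpos : ∀ n : ℕ, 0 < (n : ℝ) + 1 := fun n => by positivity
  have hle : ∀ n : ℕ, ((n : ℝ) + 1)⁻¹ ≤ (n : ℝ) + 1 := fun n =>
    (inv_le_one_of_one_le₀ (by linarith [n.cast_nonneg (α := ℝ)])).trans
      (by linarith [n.cast_nonneg (α := ℝ)])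
  refine tendsto_integral_of_dominated_convergence _ (fun n => ?_)
    ((integrable_exp_neg_pi_mul_sq h0).const_mul ‖ξ‖)
    (fun n => Eventually.of_forall fun t =>
      norm_hilbertKernel_mul_fourier_le i (inv_pos.2 (hpos n)) (hle n) ξ t) ?_
  · simp_rw [hilbertKernel_mul_fourier]
    have := continuous_hilbertKernel (inv_pos.2 (hpos n)) (hpos n)
    exact Continuous.aestronglyMeasurable (by fun_prop)
  · have h1 : ∀ᵐ t : ℝ, t ≠ 0 := by simp [ae_iff]
    filter_upwards [h1] with t ht
    simp_rw [hilbertKernel_mul_fourier]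
    exact tendsto_const_nhds.mul ((Complex.continuous_ofReal.tendsto _).comp
      ((tendsto_mul_hilbertKernel ht).mul_const _))

theorem aestronglyMeasurable_rieszApproxSymbol (i : Fin d) {ε N : ℝ} (hε : 0 < ε) (hN : 0 < N) :
    AEStronglyMeasurable (rieszApproxSymbol i ε N) volume := by
  have h : Continuous fun y : Space d × ℝ =>
      (hilbertKernel ε N y.2 : ℂ) * 𝓕 (rieszWeight i) (y.2 • y.1) := by
    simp_rw [hilbertKernel_mul_fourier]
    have := continuous_hilbertKernel hε hN
    fun_prop
  exact (h.stronglyMeasurable.integral_prod_right).aestronglyMeasurable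

/-- The Riesz transforms are bounded on `L^p` on smooth compactly supported functions. -/
theorem exists_eLpNorm_riesz_le {p : ℝ} (hp₁ : 1 < p) (hp₂ : p < 2) (i : Fin d) :
    ∃ C : ℝ≥0, ∀ f : 𝓢(Space d, ℂ), HasCompactSupport f →
      eLpNorm (𝓕⁻ (fun ξ : Space d => (Complex.I * ((ξ i / ‖ξ‖ : ℝ) : ℂ)) * 𝓕 f ξ))
        (ENNReal.ofReal p) volume ≤ C * eLpNorm f (ENNReal.ofReal p) volume := by
  obtain ⟨A, hA⟩ := exists_hilbertKernel hp₁ hp₂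
  have hd : 0 < d := i.pos
  have hπ := Real.pi_pos
  have hne0 : ∀ᵐ z : Space d, z ≠ 0 := by
    filter_upwards [ae_enorm_ne_zero hd] with z hz h
    simp [h] at hz
  -- `A + 1` replaces `A` because the weight in Minkowski's inequality must not vanish.
  have hwi : ∫⁻ θ : Space d, ‖rieszWeight i θ‖ₑ * ((A + 1 : ℝ≥0) : ℝ≥0∞) ≠ ∞ := by
    rw [lintegral_mul_const' _ _ ENNReal.coe_ne_top]
    exact ENNReal.mul_ne_top (integrable_rieszWeight i).2.ne ENNReal.coe_ne_top
  set D : ℝ≥0 := (∫⁻ θ : Space d, ‖rieszWeight i θ‖ₑ * ((A + 1 : ℝ≥0) : ℝ≥0∞)).toNNReal with hD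
  refine ⟨Real.pi.toNNReal * D, fun f hf => ?_⟩
  have hnice : IsNiceFun f := by
    refine ⟨f.continuous.measurable, ?_, ?_⟩
    · obtain ⟨B, -, hB⟩ := schwartz_decay f 0
      exact ⟨B, fun x => by simpa using (hB x).1⟩
    · obtain ⟨R, hR⟩ := hf.isCompact.isBounded.subset_closedBall 0
      exact ⟨R, fun x hx => image_eq_zero_of_notMem_tsupport fun h => by
        have := hR h; simp at this; linarith⟩
  have hbound : ∀ ε N : ℝ, 0 < ε → 0 < N →
      eLpNorm (fun x => ∫ θ, rieszWeight i θ • directionalHilbert ε N f x θ) (ENNReal.ofReal p)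
        volume ≤ D * eLpNorm f (ENNReal.ofReal p) volume := by
    intro ε N hε hN
    rw [hD, ENNReal.coe_toNNReal hwi]
    refine eLpNorm_integral_smul_le hp₁.le (continuous_rieszWeight i).aestronglyMeasurable
      aemeasurable_const
      (stronglyMeasurable_directionalHilbert hε hN hnice.meas).aestronglyMeasurable
      (Eventually.of_forall fun _ => by simp) (Eventually.of_forall fun _ => by simp) ?_
    filter_upwards [hne0] with θ hθ
    refine (eLpNorm_directionalHilbert_le hp₁.le hε hN (fun g hg => hA ε N hε hN g hg) hnice
      hθ).trans ?_
    gcongr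
    simp
  have hpos : ∀ n : ℕ, 0 < (n : ℝ) + 1 := fun n => by positivity
  have hle : ∀ n : ℕ, ((n : ℝ) + 1)⁻¹ ≤ (n : ℝ) + 1 := fun n =>
    (inv_le_one_of_one_le₀ (by linarith [n.cast_nonneg (α := ℝ)])).trans
      (by linarith [n.cast_nonneg (α := ℝ)])
  have hS : Integrable (⇑(𝓕 f : 𝓢(Space d, ℂ))) volume := (𝓕 f : 𝓢(Space d, ℂ)).integrable
  -- The uniform bound passes to the pointwise limit by Fatou. The factor `-π` turns the limiting
  -- symbol `-i ξ_i / (π|ξ|)` into `i ξ_i / |ξ|`.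
  refine Lp.eLpNorm_le_of_ae_tendsto (u := atTop)
    (f := fun (n : ℕ) x => (-Real.pi : ℂ) •
      ∫ θ, rieszWeight i θ • directionalHilbert ((n : ℝ) + 1)⁻¹ ((n : ℝ) + 1) f x θ)
    (Eventually.of_forall fun n => ?_) (fun n => ?_) (Eventually.of_forall fun x => ?_)
  · refine (eLpNorm_const_smul_le (c := (-Real.pi : ℂ))
      (f := fun x => ∫ θ, rieszWeight i θ •
        directionalHilbert ((n : ℝ) + 1)⁻¹ ((n : ℝ) + 1) f x θ)).trans ?_
    rw [ENNReal.coe_mul, mul_assoc]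
    gcongr
    · rw [enorm_neg, ← ofReal_norm, Complex.norm_real, Real.norm_of_nonneg hπ.le]
      rfl
    · exact hbound _ _ (inv_pos.2 (hpos n)) (hpos n)
  · refine AEStronglyMeasurable.fun_const_smul ?_ _
    exact aestronglyMeasurable_integral_smul (continuous_rieszWeight i).aestronglyMeasurable
      (stronglyMeasurable_directionalHilbert (inv_pos.2 (hpos n)) (hpos n)
        hnice.meas).aestronglyMeasurable
  · simp_rw [integral_rieszWeight_directionalHilbert i (inv_pos.2 (hpos _)) (hpos _)]
    have h1 : 𝓕⁻ (fun ξ : Space d => (Complex.I * ((ξ i / ‖ξ‖ : ℝ) : ℂ)) * 𝓕 f ξ) x =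
        (-Real.pi : ℂ) • 𝓕⁻ (fun ξ : Space d =>
          (-Complex.I * ξ i * ((1 / Real.pi * (1 / ‖ξ‖) : ℝ) : ℂ)) * 𝓕 f ξ) x := by
      rw [Real.fourierInv_eq, Real.fourierInv_eq, ← integral_smul]
      refine integral_congr_ae (Eventually.of_forall fun ξ => ?_)
      simp only [Circle.smul_def, smul_eq_mul]
      have hπ' : (Real.pi : ℂ) ≠ 0 := by exact_mod_cast hπ.ne'
      push_cast
      field_simp
    rw [h1]
    refine Tendsto.const_smul ?_ _
    simp_rw [Real.fourierInv_eq]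
    refine tendsto_integral_of_dominated_convergence (fun ξ => ‖𝓕 f ξ‖) (fun n => ?_) hS.norm
      (fun n => ?_) ?_
    · refine AEStronglyMeasurable.smul (Continuous.aestronglyMeasurable (by fun_prop)) ?_
      exact (aestronglyMeasurable_rieszApproxSymbol i (inv_pos.2 (hpos n)) (hpos n)).mul hS.1
    · filter_upwards [hne0] with ξ hξ
      rw [Circle.norm_smul, norm_mul]
      exact mul_le_of_le_one_left (norm_nonneg _)
        (norm_rieszApproxSymbol_le i (inv_pos.2 (hpos n)) (hle n) hξ)
    · filter_upwards [hne0] with ξ hξ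
      exact ((tendsto_rieszApproxSymbol i hξ).mul_const _).const_smul _

end Rotations

/-! ### Homogeneous symbols and their dyadic kernels -/

section Symbols

open Filter Topology Set
open scoped ContDiff

variable {d : ℕ}

/-- Bounded symbols that are homogeneous of degree zero and smooth away from the origin. -/
structure IsHomogeneousSymbol (m : Space d → ℂ) : Prop where
  smooth : ∀ ξ, ξ ≠ 0 → ContDiffAt ℝ ∞ m ξ
  hom : ∀ (c : ℝ) (ξ : Space d), 0 < c → m (c • ξ) = m ξ
  norm_le : ∀ ξ, ‖m ξ‖ ≤ 1

/-- Smooth cutoff functions, equal to one near the origin. -/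
structure IsCutoff (χ : Space d → ℝ) : Prop where
  smooth : ContDiff ℝ ∞ χ
  eq_one : ∀ ξ, ‖ξ‖ < 3 / 4 → χ ξ = 1
  eq_zero : ∀ ξ, 4 / 3 ≤ ‖ξ‖ → χ ξ = 0
  mem_Icc : ∀ ξ, χ ξ ∈ Icc (0 : ℝ) 1

theorem IsHomogeneousSymbol.comp_neg {m : Space d → ℂ} (hm : IsHomogeneousSymbol m) :
    IsHomogeneousSymbol fun ξ => m (-ξ) where
  smooth ξ hξ := (hm.smooth (-ξ) (neg_ne_zero.2 hξ)).comp ξ contDiff_neg.contDiffAt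
  hom c ξ hc := by rw [← smul_neg, hm.hom c _ hc]
  norm_le ξ := hm.norm_le _

theorem IsHomogeneousSymbol.mul {m n : Space d → ℂ} (hm : IsHomogeneousSymbol m)
    (hn : IsHomogeneousSymbol n) : IsHomogeneousSymbol fun ξ => m ξ * n ξ where
  smooth ξ hξ := (hm.smooth ξ hξ).mul (hn.smooth ξ hξ)
  hom c ξ hc := by rw [hm.hom c _ hc, hn.hom c _ hc]
  norm_le ξ := by
    rw [norm_mul]
    exact mul_le_one₀ (hm.norm_le ξ) (norm_nonneg _) (hn.norm_le ξ)

theorem isHomogeneousSymbol_riesz (i : Fin d) :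
    IsHomogeneousSymbol fun ξ : Space d => Complex.I * ((ξ i / ‖ξ‖ : ℝ) : ℂ) where
  smooth ξ hξ := by
    refine contDiffAt_const.mul (Complex.ofRealCLM.contDiff.contDiffAt.comp ξ ?_)
    exact ContDiffAt.div (EuclideanSpace.proj (𝕜 := ℝ) i).contDiff.contDiffAt
      (contDiffAt_norm ℝ hξ) (norm_ne_zero_iff.2 hξ)
  hom c ξ hc := by
    rw [norm_smul, Real.norm_of_nonneg hc.le, PiLp.smul_apply, smul_eq_mul,
      mul_div_mul_left _ _ hc.ne']
  norm_le ξ := by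
    rw [norm_mul, Complex.norm_I, one_mul, Complex.norm_real, norm_div, norm_norm]
    exact div_le_one_of_le₀ (PiLp.norm_apply_le ξ i) (norm_nonneg _)

theorem IsHomogeneousSymbol.measurable {m : Space d → ℂ} (hm : IsHomogeneousSymbol m) :
    Measurable m := by
  have h : ContinuousOn m {0}ᶜ := fun ξ hξ => (hm.smooth ξ hξ).continuousAt.continuousWithinAt
  exact measurable_of_continuousOn_compl_singleton 0 h

theorem IsHomogeneousSymbol.contDiff_mul {m : Space d → ℂ} (hm : IsHomogeneousSymbol m)
    {a : Space d → ℝ} (ha : ContDiff ℝ ∞ a) {r : ℝ} (hr : 0 < r) (h0 : ∀ ξ, ‖ξ‖ < r → a ξ = 0) :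
    ContDiff ℝ ∞ fun ξ => (a ξ : ℂ) * m ξ := by
  rw [contDiff_iff_contDiffAt]
  intro ξ
  by_cases hξ : ξ = 0
  · refine (contDiffAt_const (c := (0 : ℂ))).congr_of_eventuallyEq ?_
    filter_upwards [Metric.ball_mem_nhds ξ hr] with η hη
    rw [h0 η (by simpa [hξ] using hη)]
    simp
  · exact (Complex.ofRealCLM.contDiff.comp ha).contDiffAt.mul (hm.smooth ξ hξ)

/-- The Schwartz function with Fourier transform `a m`, for `a` smooth, vanishing near the origin
and compactly supported. -/
theorem IsHomogeneousSymbol.exists_kernel {m : Space d → ℂ} (hm : IsHomogeneousSymbol m)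
    {a : Space d → ℝ} (ha : ContDiff ℝ ∞ a) {r R : ℝ} (hr : 0 < r)
    (h0 : ∀ ξ, ‖ξ‖ < r → a ξ = 0) (h1 : ∀ ξ, R ≤ ‖ξ‖ → a ξ = 0) :
    ∃ K : 𝓢(Space d, ℂ), ∀ ξ, 𝓕 K ξ = a ξ * m ξ := by
  have hs : HasCompactSupport fun ξ => (a ξ : ℂ) * m ξ := by
    refine HasCompactSupport.intro (isCompact_closedBall (0 : Space d) R) fun ξ hξ => ?_
    rw [Metric.mem_closedBall, dist_zero_right, not_le] at hξ
    rw [h1 ξ hξ.le]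
    simp
  refine ⟨𝓕⁻ (hs.toSchwartzMap (hm.contDiff_mul ha hr h0)), fun ξ => ?_⟩
  rw [FourierTransform.fourier_fourierInv_eq]
  rfl

theorem exists_kernel_of_contDiff {a : Space d → ℝ} (ha : ContDiff ℝ ∞ a) {R : ℝ}
    (h1 : ∀ ξ, R ≤ ‖ξ‖ → a ξ = 0) : ∃ K : 𝓢(Space d, ℂ), ∀ ξ, 𝓕 K ξ = a ξ := by
  have hs : HasCompactSupport fun ξ => (a ξ : ℂ) := by
    refine HasCompactSupport.intro (isCompact_closedBall (0 : Space d) R) fun ξ hξ => ?_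
    rw [Metric.mem_closedBall, dist_zero_right, not_le] at hξ
    rw [h1 ξ hξ.le]
    simp
  refine ⟨𝓕⁻ (hs.toSchwartzMap (Complex.ofRealCLM.contDiff.comp ha)), fun ξ => ?_⟩
  rw [FourierTransform.fourier_fourierInv_eq]
  rfl

theorem iteratedFDeriv_comp_const_smul_norm_le {f : Space d → ℂ} {c : ℝ} (hc0 : 0 < c) (hc : c ≤ 1)
    (n : ℕ) (x : Space d) :
    ‖iteratedFDeriv ℝ n (fun y => f (c • y)) x‖ ≤ ‖iteratedFDeriv ℝ n f (c • x)‖ := by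
  have h := ContinuousLinearEquiv.iteratedFDerivWithin_comp_right
    (ContinuousLinearEquiv.smulLeft (Units.mk0 c hc0.ne') : Space d ≃L[ℝ] Space d) f
    uniqueDiffOn_univ (mem_univ _) n (x := x)
  rw [preimage_univ, iteratedFDerivWithin_univ, iteratedFDerivWithin_univ] at h
  have h2 : (f ∘ (ContinuousLinearEquiv.smulLeft (Units.mk0 c hc0.ne') : Space d ≃L[ℝ] Space d)) =
      fun y => f (c • y) := rfl
  rw [← h2, h]
  refine (ContinuousMultilinearMap.norm_compContinuousLinearMap_le _ _).trans ?_
  refine mul_le_of_le_one_right (norm_nonneg _) (Finset.prod_le_one (fun _ _ => norm_nonneg _)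
    fun _ _ => ContinuousLinearMap.opNorm_le_bound _ zero_le_one fun y => ?_)
  change ‖c • y‖ ≤ _
  rw [norm_smul, Real.norm_of_nonneg hc0.le]
  gcongr

/-- For `|ξ| > 2` homogeneity lets one compare with the point `2ξ/|ξ|` on the sphere of radius two.
The rescaling factor is at most one, so derivatives of the rescaled function do not increase, and
bounds on a compact ball suffice for all derivatives. -/
theorem IsHomogeneousSymbol.hasTemperateGrowth {m : Space d → ℂ} (hm : IsHomogeneousSymbol m)
    {χ : Space d → ℝ} (hχ : IsCutoff χ) :
    (fun ξ => ((1 - χ ξ : ℝ) : ℂ) * m ξ).HasTemperateGrowth := by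
  have hs : ContDiff ℝ ∞ fun ξ => ((1 - χ ξ : ℝ) : ℂ) * m ξ :=
    hm.contDiff_mul (contDiff_const.sub hχ.smooth) (r := 3 / 4) (by norm_num)
      fun ξ hξ => by rw [hχ.eq_one ξ hξ, sub_self]
  set g : Space d → ℂ := fun ξ => ((1 - χ ξ : ℝ) : ℂ) * m ξ with hg
  refine ⟨hs, fun n => ?_⟩
  obtain ⟨C, hC⟩ := (isCompact_closedBall (0 : Space d) 2).exists_bound_of_continuousOn
    (hs.continuous_iteratedFDeriv (m := n) (by exact_mod_cast le_top)).continuousOn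
  refine ⟨0, C, fun ξ => ?_⟩
  rw [pow_zero, mul_one]
  by_cases hξ : ‖ξ‖ ≤ 2
  · exact hC ξ (by simpa using hξ)
  push Not at hξ
  have h0 : 0 < ‖ξ‖ := by linarith
  have hc : 0 < 2 / ‖ξ‖ := by positivity
  have hgm : ∀ η, 4 / 3 ≤ ‖η‖ → g η = m η := fun η hη => by
    simp [hg, hχ.eq_zero η hη]
  have heq : g =ᶠ[𝓝 ξ] fun η => g ((2 / ‖ξ‖) • η) := by
    have hcont : Continuous fun η : Space d => ‖η‖ := continuous_norm
    filter_upwards [hcont.continuousAt.eventually (lt_mem_nhds (show 4 / 3 * (‖ξ‖ / 2) < ‖ξ‖ by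
      linarith))] with η hη
    rw [hgm η (by linarith), hgm, hm.hom _ _ hc]
    rw [norm_smul, Real.norm_of_nonneg hc.le, div_mul_eq_mul_div, le_div_iff₀ h0]
    linarith
  rw [(heq.iteratedFDeriv ℝ n).eq_of_nhds]
  refine (iteratedFDeriv_comp_const_smul_norm_le hc ?_ n ξ).trans (hC _ ?_)
  · rw [div_le_one h0]; exact hξ.le
  · rw [Metric.mem_closedBall, dist_zero_right, norm_smul, Real.norm_of_nonneg hc.le,
      div_mul_cancel₀ _ h0.ne']

theorem IsHomogeneousSymbol.hasTemperateGrowth_smul {m : Space d → ℂ} (hm : IsHomogeneousSymbol m)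
    {χ : Space d → ℝ} (hχ : IsCutoff χ) (n : ℕ) :
    (fun ξ => ((1 - χ ((2 : ℝ) ^ n • ξ) : ℝ) : ℂ) * m ξ).HasTemperateGrowth := by
  have h := (hm.hasTemperateGrowth hχ).comp
    ((2 : ℝ) ^ n • ContinuousLinearMap.id ℝ (Space d)).hasTemperateGrowth
  convert h using 2 with ξ
  simp [hm.hom _ ξ (show (0 : ℝ) < 2 ^ n by positivity)]

/-- Removing ever smaller neighbourhoods of the origin keeps the symbol smooth, so the approximants
of `m(D) θ` remain Schwartz. -/
theorem IsHomogeneousSymbol.exists_schwartz {m : Space d → ℂ} (hm : IsHomogeneousSymbol m)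
    {χ : Space d → ℝ} (hχ : IsCutoff χ) (θ : 𝓢(Space d, ℂ)) :
    ∃ S : ℕ → 𝓢(Space d, ℂ), ∀ n ξ,
      𝓕 (S n) ξ = ((1 - χ ((2 : ℝ) ^ n • ξ) : ℝ) : ℂ) * m ξ * 𝓕 θ ξ := by
  refine ⟨fun n => 𝓕⁻ (SchwartzMap.smulLeftCLM ℂ
    (fun ξ => ((1 - χ ((2 : ℝ) ^ n • ξ) : ℝ) : ℂ) * m ξ) (𝓕 θ)), fun n ξ => ?_⟩
  rw [FourierTransform.fourier_fourierInv_eq,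
    SchwartzMap.smulLeftCLM_apply_apply (hm.hasTemperateGrowth_smul hχ n)]
  rfl

end Symbols

/-! ### Decay of `m(D) θ` and of its gradient for homogeneous symbols. -/

section Decay

open Filter Topology Set

variable {d : ℕ}

theorem one_add_norm_sub_rpow_le {s : ℝ} (hs : 0 ≤ s) (x z : Space d) :
    (1 + ‖x - z‖) ^ (-s) ≤ (1 + ‖z‖) ^ s * (1 + ‖x‖) ^ (-s) := by
  rw [Real.rpow_neg (by positivity), Real.rpow_neg (by positivity), ← div_eq_mul_inv,
    le_div_iff₀ (by positivity), inv_mul_le_iff₀ (by positivity),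
    ← Real.mul_rpow (by positivity) (by positivity)]
  refine Real.rpow_le_rpow (by positivity) ?_ hs
  have : ‖x‖ ≤ ‖x - z‖ + ‖z‖ := by simpa using norm_add_le (x - z) z
  nlinarith [norm_nonneg z, norm_nonneg (x - z)]

theorem schwartz_rpow_decay (K : 𝓢(Space d, ℂ)) (s : ℝ) :
    ∃ C, 0 ≤ C ∧ ∀ x, ‖K x‖ ≤ C * (1 + ‖x‖) ^ (-s) ∧
      ‖fderiv ℝ K x‖ ≤ C * (1 + ‖x‖) ^ (-s) := by
  obtain ⟨C, hC, h⟩ := schwartz_decay K ⌈s⌉₊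
  have hle : ∀ x : Space d, ((1 + ‖x‖) ^ ⌈s⌉₊)⁻¹ ≤ (1 + ‖x‖) ^ (-s) := fun x => by
    rw [Real.rpow_neg (by positivity), ← Real.rpow_natCast]
    refine inv_anti₀ (by positivity) (Real.rpow_le_rpow_of_exponent_le ?_ (Nat.le_ceil s))
    linarith [norm_nonneg x]
  exact ⟨C, hC, fun x => ⟨(h x).1.trans (by gcongr; exact hle x),
    (h x).2.trans (by gcongr; exact hle x)⟩⟩

theorem integrable_schwartz_mul_rpow (θ : 𝓢(Space d, ℂ)) (s : ℝ) :
    Integrable fun z => ‖θ z‖ * (1 + ‖z‖) ^ s := by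
  obtain ⟨C, hC, h⟩ := schwartz_rpow_decay θ (s + (d + 1))
  refine ((integrable_one_add_norm (E := Space d) (μ := volume) (r := d + 1)
    (by simp)).const_mul C).mono' ?_ (Eventually.of_forall fun z => ?_)
  · refine Continuous.aestronglyMeasurable (θ.continuous.norm.mul ?_)
    exact (continuous_const.add continuous_norm).rpow_const fun z =>
      Or.inl (by have := norm_nonneg z; change 1 + ‖z‖ ≠ 0; positivity)
  · rw [Real.norm_of_nonneg (by positivity)]
    calc _ ≤ C * (1 + ‖z‖) ^ (-(s + (d + 1))) * (1 + ‖z‖) ^ s := by gcongr; exact (h z).1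
      _ = C * (1 + ‖z‖) ^ (-(d + 1 : ℝ)) := by
        rw [mul_assoc, ← Real.rpow_add (by positivity)]
        congr 2
        ring

/-- Decay of low frequency pieces. -/
theorem exists_norm_conv_scaled_neg_le (N θ : 𝓢(Space d, ℂ)) {s : ℝ} (hs : 0 ≤ s) :
    ∃ C, 0 ≤ C ∧ ∀ (k : ℕ) x, ‖conv (scaled (-k) N) θ x‖ ≤
      C * ((2 : ℝ) ^ (-(d - s))) ^ k * (1 + ‖x‖) ^ (-s) := by
  obtain ⟨B, hB0, hB⟩ := schwartz_rpow_decay N s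
  refine ⟨B * ∫ z, ‖θ z‖ * (1 + ‖z‖) ^ s, mul_nonneg hB0 (integral_nonneg fun z => by positivity),
    fun k x => ?_⟩
  rw [conv_eq_integral_sub]
  -- The normalisation of the dilated kernel contributes `2^{-kd}`; comparing the weight at `2^{-k}
  -- y` with the weight at `y` costs `2^{ks}`.
  have hN : ∀ y, ‖scaled (-(k : ℤ)) N y‖ ≤
      B * ((2 : ℝ) ^ (-(d - s))) ^ k * (1 + ‖y‖) ^ (-s) := by
    intro y
    rw [scaled_apply, norm_mul, Complex.norm_real, Real.norm_of_nonneg (by positivity)]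
    have h2 : (0 : ℝ) < 2 ^ (-(k : ℤ)) := by positivity
    have h21 : (2 : ℝ) ^ (-(k : ℤ)) ≤ 1 := zpow_le_one_of_nonpos₀ one_le_two (by simp)
    have h3 : (1 + ‖(2 : ℝ) ^ (-(k : ℤ)) • y‖) ^ (-s) ≤
        ((2 : ℝ) ^ (-(k : ℤ))) ^ (-s) * (1 + ‖y‖) ^ (-s) := by
      rw [← Real.mul_rpow (by positivity) (by positivity)]
      refine Real.rpow_le_rpow_of_nonpos (by positivity) ?_ (by linarith)
      rw [norm_smul, Real.norm_of_nonneg h2.le, mul_add, mul_one]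
      gcongr
    calc _ ≤ ((2 : ℝ) ^ (-(k : ℤ))) ^ d * (B * (((2 : ℝ) ^ (-(k : ℤ))) ^ (-s) *
          (1 + ‖y‖) ^ (-s))) := by
            gcongr
            exact (hB _).1.trans (by gcongr)
      _ = B * (((2 : ℝ) ^ (-(k : ℤ))) ^ d * ((2 : ℝ) ^ (-(k : ℤ))) ^ (-s)) *
          (1 + ‖y‖) ^ (-s) := by ring
      _ = _ := by
        congr 2
        rw [← Real.rpow_natCast, ← Real.rpow_add h2, ← Real.rpow_intCast,
            ← Real.rpow_mul two_pos.le,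
          ← Real.rpow_natCast, ← Real.rpow_mul two_pos.le]
        congr 1
        push_cast
        ring
  have hint := (integrable_schwartz_mul_rpow θ s).const_mul
    (B * ((2 : ℝ) ^ (-(d - s))) ^ k * (1 + ‖x‖) ^ (-s))
  refine (norm_integral_le_of_norm_le hint (Eventually.of_forall fun z => ?_)).trans_eq ?_
  · rw [norm_smul]
    calc _ ≤ (B * ((2 : ℝ) ^ (-(d - s))) ^ k * ((1 + ‖z‖) ^ s * (1 + ‖x‖) ^ (-s))) * ‖θ z‖ := by
          gcongr
          exact (hN _).trans (by gcongr; exact one_add_norm_sub_rpow_le hs x z)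
      _ = _ := by ring
  · rw [integral_const_mul]
    ring

theorem opNorm_le_sum_apply {G : Type*} [NormedAddCommGroup G] [NormedSpace ℝ G]
    (L : Space d →L[ℝ] G) : ‖L‖ ≤ ∑ i, ‖L (EuclideanSpace.single i 1)‖ := by
  refine L.opNorm_le_bound (Finset.sum_nonneg fun _ _ => norm_nonneg _) fun v => ?_
  have hv : v = ∑ i, v i • EuclideanSpace.single i (1 : ℝ) := by
    simpa using ((EuclideanSpace.basisFun (Fin d) ℝ).sum_repr v).symm
  conv_lhs => rw [hv]
  rw [map_sum, Finset.sum_mul]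
  refine (norm_sum_le _ _).trans (Finset.sum_le_sum fun i _ => ?_)
  rw [map_smul, norm_smul, mul_comm]
  gcongr
  exact PiLp.norm_apply_le v i

/-- A derivative of a piece at frequency `2^{-k}` gains another `2^{-k}`. The pieces are therefore
summable with weight exponents up to `d + 1` instead of `d`, which makes the pairing with a growing
`u` possible. -/
theorem exists_norm_fderiv_conv_scaled_neg_le (N θ : 𝓢(Space d, ℂ)) {s : ℝ} (hs : 0 ≤ s) :
    ∃ C, 0 ≤ C ∧ ∀ (k : ℕ) x, ‖fderiv ℝ (conv (scaled (-k) N) θ) x‖ ≤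
      C * ((2 : ℝ) ^ (-(d + 1 - s))) ^ k * (1 + ‖x‖) ^ (-s) := by
  choose C hC h using fun i : Fin d => exists_norm_conv_scaled_neg_le
    (LineDeriv.lineDerivOp (EuclideanSpace.single i (1 : ℝ)) N : 𝓢(Space d, ℂ)) θ hs
  refine ⟨∑ i, C i, Finset.sum_nonneg fun i _ => hC i, fun k x => ?_⟩
  have hθ : IsTempered θ := IsTempered.of_memLp (p := 2) one_le_two (θ.memLp _ volume)
  refine (opNorm_le_sum_apply _).trans ?_
  rw [Finset.sum_mul, Finset.sum_mul]
  refine Finset.sum_le_sum fun i _ => ?_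
  rw [hθ.fderiv_conv_apply, lineDeriv_scaled]
  have : conv (((2 : ℝ) ^ (-(k : ℤ)) • scaled (-(k : ℤ)) (LineDeriv.lineDerivOp
      (EuclideanSpace.single i (1 : ℝ)) N : 𝓢(Space d, ℂ)) : 𝓢(Space d, ℂ))) θ x =
      (2 : ℝ) ^ (-(k : ℤ)) • conv (scaled (-(k : ℤ)) (LineDeriv.lineDerivOp
      (EuclideanSpace.single i (1 : ℝ)) N : 𝓢(Space d, ℂ))) θ x := by
    rw [conv, conv, ← integral_smul]
    refine integral_congr_ae (Eventually.of_forall fun z => ?_)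
    simp only [smul_apply, smul_assoc]
  rw [this, norm_smul, Real.norm_of_nonneg (by positivity)]
  refine (mul_le_mul_of_nonneg_left (h i k x) (by positivity)).trans_eq ?_
  have : (2 : ℝ) ^ (-(k : ℤ)) * ((2 : ℝ) ^ (-((d : ℝ) - s))) ^ k =
      ((2 : ℝ) ^ (-((d : ℝ) + 1 - s))) ^ k := by
    rw [zpow_neg, zpow_natCast, ← inv_pow, ← mul_pow]
    congr 1
    rw [← Real.rpow_neg_one, ← Real.rpow_add two_pos]
    congr 1
    ring
  rw [← this]
  ring

theorem IsHomogeneousSymbol.aestronglyMeasurable {m : Space d → ℂ} (hm : IsHomogeneousSymbol m) :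
    AEStronglyMeasurable m volume := hm.measurable.aestronglyMeasurable

theorem IsCutoff.eventually_eq_zero {χ : Space d → ℝ} (hχ : IsCutoff χ) {ξ : Space d}
    (hξ : ξ ≠ 0) : ∀ᶠ n : ℕ in atTop, χ ((2 : ℝ) ^ n • ξ) = 0 := by
  have h0 := norm_pos_iff.2 hξ
  have h1 : Tendsto (fun n : ℕ => (2 : ℝ) ^ n * ‖ξ‖) atTop atTop :=
    (tendsto_pow_atTop_atTop_of_one_lt one_lt_two).atTop_mul_const h0
  filter_upwards [h1.eventually_ge_atTop (4 / 3)] with n hn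
  refine hχ.eq_zero _ ?_
  rwa [norm_smul, Real.norm_of_nonneg (by positivity)]

theorem ae_ne_zero (hd : 0 < d) : ∀ᵐ z : Space d, z ≠ 0 := by
  filter_upwards [ae_enorm_ne_zero hd] with z hz h
  simp [h] at hz

theorem tendsto_fourierInv_of_dominated {s : ℕ → Space d → ℂ} {t : Space d → ℂ}
    (hs : ∀ n, AEStronglyMeasurable (s n) volume) {b : Space d → ℝ} (hb : Integrable b)
    (hsb : ∀ n, ∀ᵐ ξ, ‖s n ξ‖ ≤ b ξ) (h : ∀ᵐ ξ, Tendsto (fun n => s n ξ) atTop (𝓝 (t ξ)))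
    (x : Space d) : Tendsto (fun n => 𝓕⁻ (s n) x) atTop (𝓝 (𝓕⁻ t x)) := by
  simp_rw [Real.fourierInv_eq]
  refine tendsto_integral_of_dominated_convergence b
    (fun n => AEStronglyMeasurable.smul (Continuous.aestronglyMeasurable (by fun_prop)) (hs n)) hb
    (fun n => ?_) ?_
  · filter_upwards [hsb n] with ξ hξ
    rwa [Circle.norm_smul]
  · filter_upwards [h] with ξ hξ
    exact hξ.const_smul _

/-- Schwartz approximations of `𝓕⁻ (m 𝓕 θ)`, with uniform decay. -/
theorem IsHomogeneousSymbol.exists_approx {m : Space d → ℂ} (hm : IsHomogeneousSymbol m)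
    {χ : Space d → ℝ} (hχ : IsCutoff χ) (hd : 0 < d) (θ : 𝓢(Space d, ℂ)) :
    ∃ S : ℕ → 𝓢(Space d, ℂ),
      (∀ n ξ, 𝓕 (S n) ξ = ((1 - χ ((2 : ℝ) ^ n • ξ) : ℝ) : ℂ) * m ξ * 𝓕 θ ξ) ∧
      (∀ x, Tendsto (fun n => S n x) atTop (𝓝 (𝓕⁻ (fun ξ => m ξ * 𝓕 θ ξ) x))) ∧
      (∀ s : ℝ, 0 ≤ s → s < d → ∃ C, ∀ n x, ‖S n x‖ ≤ C * (1 + ‖x‖) ^ (-s)) ∧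
      Differentiable ℝ (𝓕⁻ (fun ξ => m ξ * 𝓕 θ ξ)) ∧
      (∀ x, Tendsto (fun n => fderiv ℝ (S n) x) atTop
        (𝓝 (fderiv ℝ (𝓕⁻ (fun ξ => m ξ * 𝓕 θ ξ)) x))) ∧
      (∀ s : ℝ, 0 ≤ s → s < d + 1 → ∃ C, ∀ n x, ‖fderiv ℝ (S n) x‖ ≤ C * (1 + ‖x‖) ^ (-s)) := by
  obtain ⟨S, hS⟩ := hm.exists_schwartz hχ θ
  -- The kernel of one telescoping step: `S (k + 1) - S k` has symbol `(χ(2^k ξ) - χ(2^{k+1} ξ))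
  -- m(ξ)` times that of `θ`, and homogeneity turns it into a dilate of a single Schwartz kernel.
  obtain ⟨N, hN⟩ := hm.exists_kernel (a := fun ξ => χ ξ - χ ((2 : ℝ) • ξ)) (r := 3 / 8) (R := 4 / 3)
    (hχ.smooth.sub (hχ.smooth.comp (contDiff_const_smul _))) (by norm_num)
    (fun ξ hξ => by
      rw [hχ.eq_one, hχ.eq_one, sub_self]
      · rw [norm_smul, Real.norm_ofNat]; linarith
      · linarith)
    (fun ξ hξ => by
      rw [hχ.eq_zero, hχ.eq_zero, sub_self]
      · rw [norm_smul, Real.norm_ofNat]; linarith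
      · exact hξ)
  have hpiece : ∀ k : ℕ, conv (scaled (-k) N) θ = ⇑(S (k + 1) - S k) := by
    intro k
    refine conv_eq_of_fourier_eq fun ξ => ?_
    have h2 : (((2 : ℝ) ^ (-(k : ℤ)))⁻¹) = 2 ^ k := by simp
    rw [fourier_scaled, hN, h2, hm.hom _ _ (by positivity), smul_smul, ← pow_succ',
      show 𝓕 (S (k + 1) - S k) = 𝓕 (S (k + 1)) - 𝓕 (S k) from
        map_sub (FourierTransform.fourierCLE ℂ 𝓢(Space d, ℂ)) _ _, sub_apply, hS, hS]
    push_cast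
    ring
  have hsum : ∀ n x, S n x = S 0 x + ∑ k ∈ Finset.range n, conv (scaled (-k) N) θ x := by
    intro n x
    simp_rw [hpiece]
    simp only [sub_apply]
    rw [Finset.sum_range_sub (fun k => S k x)]
    ring
  have hdiff : ∀ (K : 𝓢(Space d, ℂ)) x, DifferentiableAt ℝ K x := fun K x => K.differentiableAt
  have hpd : ∀ k : ℕ, ∀ x, DifferentiableAt ℝ (conv (scaled (-k) N) θ) x := fun k x => by
    rw [hpiece]; exact hdiff _ _
  have hfsum : ∀ n x, fderiv ℝ (S n) x = fderiv ℝ (S 0) x +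
      ∑ k ∈ Finset.range n, fderiv ℝ (conv (scaled (-k) N) θ) x := by
    intro n x
    rw [show ⇑(S n) = fun x => S 0 x + ∑ k ∈ Finset.range n, conv (scaled (-k) N) θ x from
      funext (hsum n), fderiv_fun_add (hdiff _ _) (DifferentiableAt.fun_sum fun k _ => hpd k x),
      fderiv_fun_sum fun k _ => hpd k x]
  have htend : ∀ x, Tendsto (fun n => S n x) atTop (𝓝 (𝓕⁻ (fun ξ => m ξ * 𝓕 θ ξ) x)) := by
    intro x
    have h1 : ∀ n, S n x = 𝓕⁻ (fun ξ => ((1 - χ ((2 : ℝ) ^ n • ξ) : ℝ) : ℂ) * m ξ * 𝓕 θ ξ) x := by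
      intro n
      rw [← show ⇑(𝓕 (S n) : 𝓢(Space d, ℂ)) = _ from funext (hS n), ← SchwartzMap.fourierInv_coe,
        FourierTransform.fourierInv_fourier_eq]
    simp_rw [h1]
    refine tendsto_fourierInv_of_dominated (fun n => ?_) ((𝓕 θ : 𝓢(Space d, ℂ)).integrable.norm)
      (fun n => Eventually.of_forall fun ξ => ?_) ?_ x
    · have := (hχ.smooth.continuous)
      refine AEStronglyMeasurable.mul (AEStronglyMeasurable.mul
        (Continuous.aestronglyMeasurable (by fun_prop)) hm.aestronglyMeasurable)
        (𝓕 θ : 𝓢(Space d, ℂ)).continuous.aestronglyMeasurable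
    · rw [norm_mul, norm_mul, Complex.norm_real]
      have h2 := hχ.mem_Icc ((2 : ℝ) ^ n • ξ)
      refine mul_le_of_le_one_left (norm_nonneg _) (mul_le_one₀ ?_ (norm_nonneg _) (hm.norm_le ξ))
      rw [Real.norm_of_nonneg (by linarith [h2.2])]
      linarith [h2.1]
    · filter_upwards [ae_ne_zero hd] with ξ hξ
      refine tendsto_const_nhds.congr' ?_
      filter_upwards [hχ.eventually_eq_zero hξ] with n hn
      simp [hn]
  have hgeo : ∀ a : ℝ, 0 < a → (2 : ℝ) ^ (-a) < 1 := fun a ha =>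
    Real.rpow_lt_one_of_one_lt_of_neg one_lt_two (by linarith)
  have hgsum : ∀ a : ℝ, 0 < a → ∀ n, ∑ k ∈ Finset.range n, ((2 : ℝ) ^ (-a)) ^ k ≤
      (1 - (2 : ℝ) ^ (-a))⁻¹ := fun a ha n => by
    rw [← tsum_geometric_of_lt_one (by positivity) (hgeo a ha)]
    exact (summable_geometric_of_lt_one (by positivity) (hgeo a ha)).sum_le_tsum _
      fun k _ => by positivity
  obtain ⟨C1, hC1, hd1⟩ := exists_norm_fderiv_conv_scaled_neg_le N θ le_rfl
  -- With weight exponent zero the gradients of the pieces form a uniformly convergent geometric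
  -- series. Together with the pointwise limit of `S n` this gives differentiability of the limit
  -- and convergence of the gradients.
  have hunif : TendstoUniformly (fun n x => fderiv ℝ (S n) x)
      (fun x => fderiv ℝ (S 0) x + ∑' k : ℕ, fderiv ℝ (conv (scaled (-k) N) θ) x) atTop := by
    have h1 := tendstoUniformly_tsum_nat (u := fun k : ℕ => C1 * ((2 : ℝ) ^ (-((d : ℝ) + 1 - 0))) ^ k)
      (f := fun (k : ℕ) x => fderiv ℝ (conv (scaled (-k) N) θ) x)
      ((summable_geometric_of_lt_one (by positivity) (hgeo _ (by rw [sub_zero]; positivity))).mul_left C1)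
      (fun k x => by simpa using hd1 k x)
    rw [Metric.tendstoUniformly_iff] at h1 ⊢
    intro ε hε
    filter_upwards [h1 ε hε] with n hn x
    rw [hfsum n, dist_add_left]
    exact hn x
  have hderiv := hasFDerivAt_of_tendstoUniformly hunif
    (fun n x => (hdiff (S n) x).hasFDerivAt) htend
  refine ⟨S, hS, htend, fun s hs hsd => ?_, fun x => (hderiv x).differentiableAt, fun x => ?_,
    fun s hs hsd => ?_⟩
  · obtain ⟨C0, hC0, h0⟩ := schwartz_rpow_decay (S 0) s
    obtain ⟨C, hC, h⟩ := exists_norm_conv_scaled_neg_le N θ hs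
    refine ⟨C0 + C * (1 - (2 : ℝ) ^ (-(d - s)))⁻¹, fun n x => ?_⟩
    rw [hsum]
    refine (norm_add_le _ _).trans ?_
    rw [add_mul]
    refine add_le_add (h0 x).1 ((norm_sum_le _ _).trans ((Finset.sum_le_sum fun k _ =>
      h k x).trans ?_))
    rw [← Finset.sum_mul, ← Finset.mul_sum]
    gcongr
    exact hgsum _ (by linarith) n
  · rw [(hderiv x).fderiv]
    exact hunif.tendsto_at x
  · obtain ⟨C0, hC0, h0⟩ := schwartz_rpow_decay (S 0) s
    obtain ⟨C, hC, h⟩ := exists_norm_fderiv_conv_scaled_neg_le N θ hs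
    refine ⟨C0 + C * (1 - (2 : ℝ) ^ (-(d + 1 - s)))⁻¹, fun n x => ?_⟩
    rw [hfsum]
    refine (norm_add_le _ _).trans ?_
    rw [add_mul]
    refine add_le_add (h0 x).2 ((norm_sum_le _ _).trans ((Finset.sum_le_sum fun k _ =>
      h k x).trans ?_))
    rw [← Finset.sum_mul, ← Finset.mul_sum]
    gcongr
    exact hgsum _ (by linarith) n

theorem memLp_one_add_norm_rpow_neg {s r : ℝ} (hr : 0 < r) (hs : d < s * r) :
    MemLp (fun x : Space d => (1 + ‖x‖) ^ (-s)) (ENNReal.ofReal r) volume := by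
  have hc : Continuous fun x : Space d => (1 + ‖x‖) ^ (-s) :=
    (continuous_const.add continuous_norm).rpow_const fun z =>
      Or.inl (by have := norm_nonneg z; change 1 + ‖z‖ ≠ 0; positivity)
  rw [← integrable_norm_rpow_iff hc.aestronglyMeasurable (by simpa using hr) ENNReal.ofReal_ne_top]
  refine (integrable_one_add_norm (E := Space d) (μ := volume) (r := s * r)
    (by simpa using hs)).congr (Eventually.of_forall fun x => ?_)
  dsimp only
  rw [ENNReal.toReal_ofReal hr.le, Real.norm_of_nonneg (by positivity),
    ← Real.rpow_mul (by positivity)]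
  congr 1
  ring

end Decay

/-! ### Duality pairings -/

section Pairing

open Filter Topology Set

variable {α : Type*} {mα : MeasurableSpace α} {μ : Measure α}
  {F : Type*} [NormedAddCommGroup F] [NormedSpace ℂ F]

theorem holderTriple_ofReal {p q : ℝ} (hpq : p.HolderConjugate q) :
    ENNReal.HolderTriple (ENNReal.ofReal q) (ENNReal.ofReal p) 1 :=
  have := Real.HolderConjugate.ennrealOfReal hpq.symm
  this

theorem integrable_smul_of_memLp {p q : ℝ} (hpq : p.HolderConjugate q) {θ : α → ℂ} {g : α → F}
    (hθ : MemLp θ (ENNReal.ofReal q) μ) (hg : MemLp g (ENNReal.ofReal p) μ) :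
    Integrable (fun x => θ x • g x) μ := by
  have := holderTriple_ofReal hpq
  exact memLp_one_iff_integrable.1 (hg.smul hθ)

theorem tendsto_integral_smul_of_eLpNorm {p q : ℝ} (hpq : p.HolderConjugate q) {θ : α → ℂ}
    {g : ℕ → α → F} {g' : α → F} (hθ : MemLp θ (ENNReal.ofReal q) μ)
    (hg : ∀ n, MemLp (g n) (ENNReal.ofReal p) μ) (hg' : MemLp g' (ENNReal.ofReal p) μ)
    (h : Tendsto (fun n => eLpNorm (fun x => g n x - g' x) (ENNReal.ofReal p) μ) atTop (𝓝 0)) :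
    Tendsto (fun n => ∫ x, θ x • g n x ∂μ) atTop (𝓝 (∫ x, θ x • g' x ∂μ)) := by
  have := holderTriple_ofReal hpq
  refine tendsto_integral_of_L1' _ (integrable_smul_of_memLp hpq hθ hg').1
    (Eventually.of_forall fun n => integrable_smul_of_memLp hpq hθ (hg n)) ?_
  refine tendsto_of_tendsto_of_tendsto_of_le_of_le tendsto_const_nhds
    (h := fun n => eLpNorm θ (ENNReal.ofReal q) μ *
      eLpNorm (fun x => g n x - g' x) (ENNReal.ofReal p) μ) ?_ (fun n => zero_le) (fun n => ?_)
  · simpa using ENNReal.Tendsto.const_mul h (Or.inr hθ.2.ne)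
  · refine le_trans (le_of_eq ?_) (eLpNorm_smul_le_mul_eLpNorm (r := 1) ((hg n).1.sub hg'.1) hθ.1)
    congr 1
    ext x
    simp [smul_sub]

end Pairing

/-! ### Extension of multipliers to `L^p` by duality. -/

section MultiplierOperator

open Filter Topology Set

variable {d : ℕ}

theorem integral_fourierInv_mul_eq {a b : Space d → ℂ} (ha : Integrable a) (hb : Integrable b) :
    ∫ x, 𝓕⁻ a x * b x = ∫ x, a x * 𝓕⁻ b x := by
  have h := VectorFourier.integral_fourierIntegral_smul_eq_flip (L := innerₗ (Space d))
    (f := a) (g := fun x => b (-x)) Real.continuous_fourierChar continuous_inner ha hb.comp_neg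
  have h1 : ∫ x, 𝓕⁻ a x * b x = ∫ x, 𝓕 a x * b (-x) := by
    rw [← integral_neg_eq_self]
    simp [Real.fourierInv_eq_fourier_neg]
  rw [h1]
  refine h.trans (integral_congr_ae (Eventually.of_forall fun x => ?_))
  simp only [smul_eq_mul, flip_innerₗ]
  congr 1
  rw [Real.fourierInv_eq_fourier_comp_neg]
  rfl

theorem integrable_symbol_mul_fourier {m : Space d → ℂ} (hm : IsHomogeneousSymbol m)
    (f : 𝓢(Space d, ℂ)) : Integrable fun ξ => m ξ * 𝓕 f ξ :=
  (𝓕 f : 𝓢(Space d, ℂ)).integrable.bdd_mul hm.aestronglyMeasurable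
    (Eventually.of_forall hm.norm_le)

theorem continuous_fourierInv_of_integrable {a : Space d → ℂ} (ha : Integrable a) :
    Continuous (𝓕⁻ a) := by
  have h := VectorFourier.fourierIntegral_continuous (L := -innerₗ (Space d))
    Real.continuous_fourierChar (show Continuous fun x : Space d × Space d => -inner ℝ x.1 x.2 from
      continuous_inner.neg) ha
  exact h

theorem integral_mul_fourierInv_symbol {m : Space d → ℂ} (hm : IsHomogeneousSymbol m)
    (θ f : 𝓢(Space d, ℂ)) :
    ∫ x, θ x * 𝓕⁻ (fun ξ => m ξ * 𝓕 f ξ) x =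
      ∫ x, 𝓕⁻ (fun ξ => m (-ξ) * 𝓕 θ ξ) x * f x := by
  have h1 := integral_fourierInv_mul_eq (integrable_symbol_mul_fourier hm f) θ.integrable
  have h2 := integral_fourierInv_mul_eq (integrable_symbol_mul_fourier hm.comp_neg θ) f.integrable
  simp_rw [mul_comm (θ _)]
  rw [h1, h2, ← integral_neg_eq_self]
  refine integral_congr_ae (Eventually.of_forall fun ξ => ?_)
  simp only [Real.fourierInv_eq_fourier_neg, neg_neg]
  rw [SchwartzMap.fourier_coe, SchwartzMap.fourier_coe]
  ring

/-- `𝓕⁻ (m(-ξ) 𝓕 θ)`. -/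
def transposedTest (m : Space d → ℂ) (θ : 𝓢(Space d, ℂ)) : Space d → ℂ :=
  𝓕⁻ (fun ξ => m (-ξ) * 𝓕 θ ξ)

theorem exists_cutoff (d : ℕ) : ∃ χ : Space d → ℝ, IsCutoff χ := by
  let b : ContDiffBump (0 : Space d) := ⟨3 / 4, 4 / 3, by norm_num, by norm_num⟩
  refine ⟨b, b.contDiff, fun ξ hξ => b.one_of_mem_closedBall ?_, fun ξ hξ => b.zero_of_le_dist ?_,
    fun ξ => ⟨b.nonneg, b.le_one⟩⟩
  · simpa using hξ.le
  · simpa using hξ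

/-- The form used in dominated convergence: one `L^q` majorant in physical space and the majorant
`|𝓕 θ|` in frequency. -/
theorem IsHomogeneousSymbol.exists_approx_transposedTest {m : Space d → ℂ}
    (hm : IsHomogeneousSymbol m) (hd : 0 < d) {q : ℝ} (hq : 1 < q) (θ : 𝓢(Space d, ℂ)) :
    ∃ (S : ℕ → 𝓢(Space d, ℂ)) (b : Space d → ℝ), MemLp b (ENNReal.ofReal q) volume ∧
      (∀ n x, ‖S n x‖ ≤ b x) ∧ (∀ x, Tendsto (fun n => S n x) atTop (𝓝 (transposedTest m θ x))) ∧
      (∀ n ξ, ‖𝓕 (S n) ξ‖ ≤ ‖𝓕 θ ξ‖) ∧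
      (∀ ξ, ξ ≠ 0 → Tendsto (fun n => 𝓕 (S n) ξ) atTop (𝓝 (m (-ξ) * 𝓕 θ ξ))) := by
  obtain ⟨χ, hχ⟩ := exists_cutoff d
  obtain ⟨S, hS, hSt, hSb, -⟩ := hm.comp_neg.exists_approx hχ hd θ
  have hd' : (0 : ℝ) < d := by exact_mod_cast hd
  -- Any exponent with `d/q < s < d` works: the decay of order `s` is available because `s < d`, and
  -- it lies in `L^q` because `s q > d`.
  obtain ⟨s, hs1, hs2⟩ := exists_between (show (d : ℝ) / q < d from div_lt_self hd' hq)
  rw [div_lt_iff₀ (by linarith)] at hs1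
  have hs0 : 0 ≤ s := by
    by_contra! h
    nlinarith
  obtain ⟨C, hC⟩ := hSb s hs0 hs2
  refine ⟨S, fun x => C * (1 + ‖x‖) ^ (-s), (memLp_one_add_norm_rpow_neg (by linarith)
    hs1).const_mul C, hC, hSt, fun n ξ => ?_, fun ξ hξ => ?_⟩
  · rw [hS, norm_mul, norm_mul, Complex.norm_real]
    have h2 := hχ.mem_Icc ((2 : ℝ) ^ n • ξ)
    refine mul_le_of_le_one_left (norm_nonneg _) (mul_le_one₀ ?_ (norm_nonneg _) (hm.norm_le _))
    rw [Real.norm_of_nonneg (by linarith [h2.2])]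
    linarith [h2.1]
  · refine tendsto_const_nhds.congr' ?_
    filter_upwards [hχ.eventually_eq_zero hξ] with n hn
    simp [hS, hn]

theorem IsHomogeneousSymbol.memLp_transposedTest {m : Space d → ℂ}
    (hm : IsHomogeneousSymbol m) (hd : 0 < d) {q : ℝ} (hq : 1 < q) (θ : 𝓢(Space d, ℂ)) :
    MemLp (transposedTest m θ) (ENNReal.ofReal q) volume := by
  obtain ⟨S, b, hb, hSb, hS, -⟩ := hm.exists_approx_transposedTest hd hq θ
  refine hb.mono (continuous_fourierInv_of_integrable
    (integrable_symbol_mul_fourier hm.comp_neg θ)).aestronglyMeasurable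
    (Eventually.of_forall fun x => ?_)
  exact le_of_tendsto (hS x).norm (Eventually.of_forall fun n => (hSb n x).trans (le_abs_self _))

/-- Boundedness of `m(D)` in `L^p` on smooth compactly supported functions. -/
def IsLpMultiplier (p : ℝ) (m : Space d → ℂ) : Prop :=
  ∃ C : ℝ≥0, ∀ f : 𝓢(Space d, ℂ), HasCompactSupport f →
    eLpNorm (𝓕⁻ (fun ξ => m ξ * 𝓕 f ξ)) (ENNReal.ofReal p) volume ≤
      C * eLpNorm f (ENNReal.ofReal p) volume

theorem exists_seq_schwartz_eLpNorm_sub_le {p : ℝ} (hp : 1 ≤ p) {f : Space d → ℂ}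
    (hf : MemLp f (ENNReal.ofReal p) volume) :
    ∃ φ : ℕ → 𝓢(Space d, ℂ), (∀ n, HasCompactSupport (φ n)) ∧
      ∀ n, eLpNorm (fun x => φ n x - f x) (ENNReal.ofReal p) volume ≤
        ENNReal.ofReal ((1 / 2) ^ n) := by
  have h : ∀ n : ℕ, ∃ φ : 𝓢(Space d, ℂ), HasCompactSupport φ ∧
      eLpNorm (fun x => φ x - f x) (ENNReal.ofReal p) volume ≤ ENNReal.ofReal ((1 / 2) ^ n) := by
    intro n
    obtain ⟨g, hg1, hg2, hg3⟩ := hf.exist_eLpNorm_sub_le ENNReal.ofReal_ne_top (by simpa using hp)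
      (ε := (1 / 2) ^ n) (by positivity)
    refine ⟨hg1.toSchwartzMap hg2, hg1, ?_⟩
    rw [eLpNorm_sub_comm] at hg3
    exact hg3
  choose φ h1 h2 using h
  exact ⟨φ, h1, h2⟩

theorem tendsto_ofReal_half_pow {B : ℝ≥0∞} (hB : B ≠ ∞) :
    Tendsto (fun n : ℕ => B * ENNReal.ofReal ((1 / 2) ^ n)) atTop (𝓝 0) := by
  have h1 : Tendsto (fun n : ℕ => ENNReal.ofReal ((1 / 2) ^ n)) atTop (𝓝 0) := by
    rw [← ENNReal.ofReal_zero]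
    exact ENNReal.tendsto_ofReal (tendsto_pow_atTop_nhds_zero_of_lt_one (by norm_num)
      (by norm_num))
  simpa using ENNReal.Tendsto.const_mul h1 (Or.inr hB)

/-- Extension by density from smooth compactly supported functions. The image is characterised by
testing, with the symbol transposed onto `θ`; this passes to the limit because `m(-D) θ` lies in the
dual exponent. -/
theorem IsLpMultiplier.exists_image_scalar {p : ℝ} (hp : 1 < p) {m : Space d → ℂ}
    (hm : IsHomogeneousSymbol m) (hd : 0 < d) (h : IsLpMultiplier p m) :
    ∃ C : ℝ≥0, ∀ f : Space d → ℂ, MemLp f (ENNReal.ofReal p) volume →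
      ∃ g : Space d → ℂ, MemLp g (ENNReal.ofReal p) volume ∧
        eLpNorm g (ENNReal.ofReal p) volume ≤ C * eLpNorm f (ENNReal.ofReal p) volume ∧
        ∀ θ : 𝓢(Space d, ℂ), ∫ x, θ x • g x = ∫ x, transposedTest m θ x • f x := by
  obtain ⟨C, hC⟩ := h
  have hP : 1 ≤ ENNReal.ofReal p := by simpa using hp.le
  have hpq : p.HolderConjugate (p / (p - 1)) := Real.HolderConjugate.conjExponent hp
  refine ⟨C, fun f hf => ?_⟩
  obtain ⟨φ, hφc, hφ⟩ := exists_seq_schwartz_eLpNorm_sub_le hp.le hf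
  set g : ℕ → Space d → ℂ := fun n => 𝓕⁻ (fun ξ => m ξ * 𝓕 (φ n) ξ) with hgdef
  have hφL : ∀ n, MemLp (φ n) (ENNReal.ofReal p) volume := fun n => (φ n).memLp _ volume
  have hgc : ∀ n, Continuous (g n) := fun n =>
    continuous_fourierInv_of_integrable (integrable_symbol_mul_fourier hm _)
  have hgL : ∀ n, MemLp (g n) (ENNReal.ofReal p) volume := fun n =>
    ⟨(hgc n).aestronglyMeasurable, (hC _ (hφc n)).trans_lt
      (ENNReal.mul_lt_top ENNReal.coe_lt_top (hφL n).2)⟩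
  have hsub : ∀ n k, g n - g k = 𝓕⁻ (fun ξ => m ξ * 𝓕 (φ n - φ k) ξ) := by
    intro n k
    ext x
    rw [Pi.sub_apply, hgdef]
    dsimp only
    rw [Real.fourierInv_eq, Real.fourierInv_eq, Real.fourierInv_eq, ← integral_sub]
    · refine integral_congr_ae (Eventually.of_forall fun ξ => ?_)
      simp only
      rw [show 𝓕 (φ n - φ k) = 𝓕 (φ n) - 𝓕 (φ k) from
        map_sub (FourierTransform.fourierCLE ℂ 𝓢(Space d, ℂ)) _ _, sub_apply, mul_sub, smul_sub]
    · simpa using (Real.fourierIntegral_convergent_iff (-x)).2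
        (integrable_symbol_mul_fourier hm (φ n))
    · simpa using (Real.fourierIntegral_convergent_iff (-x)).2
        (integrable_symbol_mul_fourier hm (φ k))
  have hφsub : ∀ n k, eLpNorm (φ n - φ k : 𝓢(Space d, ℂ)) (ENNReal.ofReal p) volume ≤
      ENNReal.ofReal ((1 / 2) ^ n) + ENNReal.ofReal ((1 / 2) ^ k) := by
    intro n k
    have e : ⇑(φ n - φ k) = (fun x => φ n x - f x) - fun x => φ k x - f x := by
      ext x; simp
    rw [e]
    exact (eLpNorm_sub_le ((hφL n).1.sub hf.1) ((hφL k).1.sub hf.1) hP).trans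
      (add_le_add (hφ n) (hφ k))
  have hmono : ∀ N n : ℕ, N ≤ n → ENNReal.ofReal ((1 / 2) ^ n) ≤ ENNReal.ofReal ((1 / 2) ^ N) :=
    fun N n hn => ENNReal.ofReal_le_ofReal (pow_le_pow_of_le_one (by norm_num) (by norm_num) hn)
  -- The approximants converge geometrically, so their images are Cauchy with summable moduli. The
  -- constant `2 (C + 1)` instead of `2 C` makes the required inequality strict.
  obtain ⟨G, hGL, hG⟩ := Lp.cauchy_complete_eLpNorm hP hgL
    (B := fun N => ENNReal.ofReal (2 * (C + 1) * (1 / 2) ^ N)) (by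
      rw [← ENNReal.ofReal_tsum_of_nonneg (fun n => by positivity)]
      · exact ENNReal.ofReal_ne_top
      · exact (summable_geometric_of_lt_one (by norm_num) (by norm_num)).mul_left _) (by
      intro N n k hn hk
      rw [hsub]
      have hcs : HasCompactSupport (φ n - φ k : 𝓢(Space d, ℂ)) := (hφc n).sub (hφc k)
      refine (hC _ hcs).trans_lt ?_
      refine (mul_le_mul_right ((hφsub n k).trans (add_le_add (hmono N n hn) (hmono N k hk)))
        _).trans_lt ?_
      rw [← ENNReal.ofReal_add (by positivity) (by positivity), ← ENNReal.ofReal_coe_nnreal,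
        ← ENNReal.ofReal_mul (by positivity), ENNReal.ofReal_lt_ofReal_iff (by positivity)]
      have : (0 : ℝ) < (1 / 2) ^ N := by positivity
      nlinarith)
  have hφ0 : Tendsto (fun n => eLpNorm (fun x => φ n x - f x) (ENNReal.ofReal p) volume) atTop
      (𝓝 0) := by
    refine tendsto_of_tendsto_of_tendsto_of_le_of_le tendsto_const_nhds
      (by simpa using tendsto_ofReal_half_pow ENNReal.one_ne_top) (fun n => zero_le) hφ
  refine ⟨G, hGL, ?_, fun θ => ?_⟩
  · have h1 : ∀ n, eLpNorm G (ENNReal.ofReal p) volume ≤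
        (C * eLpNorm f (ENNReal.ofReal p) volume +
          C * eLpNorm (fun x => φ n x - f x) (ENNReal.ofReal p) volume) +
          eLpNorm (g n - G) (ENNReal.ofReal p) volume := by
      intro n
      have e1 : G = g n - (g n - G) := by simp
      have e2 : ⇑(φ n) = f + fun x => φ n x - f x := by ext x; simp
      conv_lhs => rw [e1]
      refine (eLpNorm_sub_le (hgL n).1 ((hgL n).1.sub hGL.1) hP).trans ?_
      gcongr
      refine (hC _ (hφc n)).trans ?_
      rw [← mul_add]
      gcongr
      conv_lhs => rw [e2]
      exact eLpNorm_add_le hf.1 ((hφL n).1.sub hf.1) hP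
    have h2 : Tendsto (fun n => (C * eLpNorm f (ENNReal.ofReal p) volume +
          C * eLpNorm (fun x => φ n x - f x) (ENNReal.ofReal p) volume) +
          eLpNorm (g n - G) (ENNReal.ofReal p) volume) atTop
        (𝓝 ((C * eLpNorm f (ENNReal.ofReal p) volume + C * 0) + 0)) :=
      (tendsto_const_nhds.add (ENNReal.Tendsto.const_mul hφ0
        (Or.inr ENNReal.coe_ne_top))).add hG
    simpa using ge_of_tendsto h2 (Eventually.of_forall h1)
  · have hθ : MemLp θ (ENNReal.ofReal (p / (p - 1))) volume := θ.memLp _ volume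
    have l1 := tendsto_integral_smul_of_eLpNorm hpq hθ hgL hGL hG
    have l2 := tendsto_integral_smul_of_eLpNorm hpq (hm.memLp_transposedTest hd hpq.symm.lt θ) hφL
      hf hφ0
    refine tendsto_nhds_unique l1 (l2.congr fun n => ?_)
    exact (integral_mul_fourierInv_symbol hm θ (φ n)).symm

/-- Composition of multipliers. -/
theorem IsLpMultiplier.mul {p : ℝ} (hp : 1 < p) {m n : Space d → ℂ}
    (hm : IsHomogeneousSymbol m) (hn : IsHomogeneousSymbol n) (hd : 0 < d)
    (h : IsLpMultiplier p m) (h' : IsLpMultiplier p n) :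
    IsLpMultiplier p fun ξ => m ξ * n ξ := by
  obtain ⟨C, hC⟩ := h.exists_image_scalar hp hm hd
  obtain ⟨D, hD⟩ := h'
  have hpq : p.HolderConjugate (p / (p - 1)) := Real.HolderConjugate.conjExponent hp
  refine ⟨C * D, fun f hf => ?_⟩
  set g := 𝓕⁻ (fun ξ => n ξ * 𝓕 f ξ) with hg
  have hgL : MemLp g (ENNReal.ofReal p) volume :=
    ⟨(continuous_fourierInv_of_integrable (integrable_symbol_mul_fourier hn f)).aestronglyMeasurable,
      (hD f hf).trans_lt (ENNReal.mul_lt_top ENNReal.coe_lt_top (f.memLp _ volume).2)⟩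
  obtain ⟨k, hkL, hkn, hk⟩ := hC g hgL
  have hmn := hm.mul hn
  have hcont : Continuous (𝓕⁻ (fun ξ => m ξ * n ξ * 𝓕 f ξ)) :=
    continuous_fourierInv_of_integrable (integrable_symbol_mul_fourier hmn f)
  have key : ∀ θ : 𝓢(Space d, ℂ), ∫ x, θ x • k x =
      ∫ x, θ x * 𝓕⁻ (fun ξ => m ξ * n ξ * 𝓕 f ξ) x := by
    intro θ
    rw [hk, integral_mul_fourierInv_symbol hmn]
    -- `m(-D) θ` is not Schwartz, so the transposition rule for `n` cannot be applied to it
    -- directly. It is applied to the Schwartz approximants, and both sides pass to the limit.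
    obtain ⟨S, b, hb, hSb, hS, hFb, hF⟩ := hm.exists_approx_transposedTest hd hpq.symm.lt θ
    have hb' : MemLp (fun x => (b x : ℂ)) (ENNReal.ofReal (p / (p - 1))) volume := hb.ofReal
    have l1 : Tendsto (fun j => ∫ x, S j x * g x) atTop
        (𝓝 (∫ x, transposedTest m θ x • g x)) := by
      refine tendsto_integral_of_dominated_convergence (fun x => ‖(b x : ℂ) • g x‖) (fun j =>
        (S j).continuous.aestronglyMeasurable.mul hgL.1)
        (integrable_smul_of_memLp hpq hb' hgL).norm (fun j => Eventually.of_forall fun x => ?_)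
        (Eventually.of_forall fun x => (hS x).mul_const _)
      rw [norm_mul, norm_smul, Complex.norm_real]
      gcongr
      exact (hSb j x).trans (le_abs_self _)
    refine tendsto_nhds_unique l1 ?_
    have l2 : ∀ j, ∫ x, S j x * g x = ∫ ξ, (n (-ξ) * 𝓕 (S j) ξ) * 𝓕⁻ f ξ := by
      intro j
      rw [hg, integral_mul_fourierInv_symbol hn, integral_fourierInv_mul_eq
        (integrable_symbol_mul_fourier hn.comp_neg (S j)) f.integrable]
      rw [SchwartzMap.fourierInv_coe]
    rw [integral_fourierInv_mul_eq (integrable_symbol_mul_fourier hmn.comp_neg θ) f.integrable]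
    simp_rw [l2, ← SchwartzMap.fourierInv_coe]
    obtain ⟨B, -, hB⟩ := schwartz_decay (𝓕⁻ f : 𝓢(Space d, ℂ)) 0
    refine tendsto_integral_of_dominated_convergence (fun ξ => ‖𝓕 θ ξ‖ * B) (fun j => ?_)
      ((𝓕 θ : 𝓢(Space d, ℂ)).integrable.norm.mul_const B)
      (fun j => Eventually.of_forall fun ξ => ?_) ?_
    · exact (hn.comp_neg.aestronglyMeasurable.mul
        (𝓕 (S j) : 𝓢(Space d, ℂ)).continuous.aestronglyMeasurable).mul
        (𝓕⁻ f : 𝓢(Space d, ℂ)).continuous.aestronglyMeasurable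
    · rw [norm_mul, norm_mul]
      refine mul_le_mul ((mul_le_of_le_one_left (norm_nonneg _) (hn.norm_le _)).trans (hFb j ξ))
        (by simpa using (hB ξ).1) (norm_nonneg _) (norm_nonneg _)
    · filter_upwards [ae_ne_zero hd] with ξ hξ
      refine Tendsto.mul_const _ ?_
      refine ((hF ξ hξ).const_mul (n (-ξ))).congr' (Eventually.of_forall fun _ => rfl) |>.trans ?_
      rw [show m (-ξ) * n (-ξ) * 𝓕 θ ξ = n (-ξ) * (m (-ξ) * 𝓕 θ ξ) by ring]
  -- The weakly defined image and the explicit inverse Fourier transform have the same pairings with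
  -- test functions, hence agree almost everywhere, and the norm bound transfers.
  have hae : 𝓕⁻ (fun ξ => m ξ * n ξ * 𝓕 f ξ) =ᵐ[volume] k := by
    refine ae_eq_of_integral_contDiff_smul_eq hcont.locallyIntegrable
      (hkL.locallyIntegrable (by simpa using hp.le)) fun θ hθ hθc => ?_
    have hc : HasCompactSupport fun x => (θ x : ℂ) := hθc.comp_left Complex.ofReal_zero
    have hs := Complex.ofRealCLM.contDiff.comp hθ
    have hco : ∀ x, (hc.toSchwartzMap hs) x = θ x := fun _ => rfl
    have := key (hc.toSchwartzMap hs)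
    simp_rw [hco] at this
    simpa using this.symm
  rw [eLpNorm_congr_ae hae]
  refine hkn.trans ?_
  rw [ENNReal.coe_mul, mul_assoc]
  gcongr
  exact hD f hf

variable {F : Type*} [NormedAddCommGroup F] [NormedSpace ℂ F] [FiniteDimensional ℂ F]

/-- The scalar operator acts on the coordinates in a basis of `F`; the norms of basis vectors and
coordinate functionals enter the constant. -/
theorem IsLpMultiplier.exists_image {p : ℝ} (hp : 1 < p) {m : Space d → ℂ}
    (hm : IsHomogeneousSymbol m) (hd : 0 < d) (h : IsLpMultiplier p m)
    (F : Type*) [NormedAddCommGroup F] [NormedSpace ℂ F] [FiniteDimensional ℂ F] :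
    ∃ C : ℝ≥0, ∀ f : Space d → F, MemLp f (ENNReal.ofReal p) volume →
      ∃ g : Space d → F, MemLp g (ENNReal.ofReal p) volume ∧
        eLpNorm g (ENNReal.ofReal p) volume ≤ C * eLpNorm f (ENNReal.ofReal p) volume ∧
        ∀ θ : 𝓢(Space d, ℂ), ∫ x, θ x • g x = ∫ x, transposedTest m θ x • f x := by
  have := FiniteDimensional.complete ℂ F
  obtain ⟨C, hC⟩ := h.exists_image_scalar hp hm hd
  have hP : 1 ≤ ENNReal.ofReal p := by simpa using hp.le
  have hpq : p.HolderConjugate (p / (p - 1)) := Real.HolderConjugate.conjExponent hp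
  let b := Module.finBasis ℂ F
  let c : Fin (Module.finrank ℂ F) → F →L[ℂ] ℂ := fun i => (b.coord i).toContinuousLinearMap
  have hbc : ∀ v, v = ∑ i, c i v • b i := fun v => (b.sum_repr v).symm
  refine ⟨∑ i, ‖b i‖₊ * (C * ‖c i‖₊), fun f hf => ?_⟩
  have hcf : ∀ i, MemLp (fun x => c i (f x)) (ENNReal.ofReal p) volume := fun i =>
    (c i).comp_memLp' hf
  choose g hg1 hg2 hg3 using fun i => hC _ (hcf i)
  have hgb : ∀ i, MemLp (fun x => g i x • b i) (ENNReal.ofReal p) volume := fun i =>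
    (((ContinuousLinearMap.id ℂ ℂ).smulRight (b i)).comp_memLp' (hg1 i))
  refine ⟨fun x => ∑ i, g i x • b i, memLp_finsetSum _ fun i _ => hgb i, ?_, fun θ => ?_⟩
  · rw [show (fun x => ∑ i, g i x • b i) = ∑ i, fun x => g i x • b i by ext x; simp]
    refine (eLpNorm_sum_le (fun i _ => (hgb i).1) hP).trans ?_
    rw [ENNReal.ofNNReal_finsetSum, Finset.sum_mul]
    refine Finset.sum_le_sum fun i _ => ?_
    have h1 : eLpNorm (fun x => g i x • b i) (ENNReal.ofReal p) volume ≤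
        ‖b i‖₊ * eLpNorm (g i) (ENNReal.ofReal p) volume :=
      eLpNorm_le_nnreal_smul_eLpNorm_of_ae_le_mul (Eventually.of_forall fun x => by
        rw [nnnorm_smul, mul_comm]) _
    have h2 : eLpNorm (fun x => c i (f x)) (ENNReal.ofReal p) volume ≤
        ‖c i‖₊ * eLpNorm f (ENNReal.ofReal p) volume :=
      eLpNorm_le_nnreal_smul_eLpNorm_of_ae_le_mul (Eventually.of_forall fun x =>
        (c i).le_opNNNorm _) _
    refine h1.trans ?_
    rw [ENNReal.coe_mul, ENNReal.coe_mul, mul_assoc, mul_assoc]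
    gcongr
    refine (hg2 i).trans ?_
    gcongr
  · have hθ : MemLp θ (ENNReal.ofReal (p / (p - 1))) volume := θ.memLp _ volume
    have hψ := hm.memLp_transposedTest hd hpq.symm.lt θ
    have e2 : ∀ x, transposedTest m θ x • f x =
        ∑ i, (transposedTest m θ x • c i (f x)) • b i := fun x => by
      conv_lhs => rw [hbc (f x)]
      simp [Finset.smul_sum, smul_smul]
    simp_rw [e2, Finset.smul_sum, ← smul_assoc]
    rw [integral_finsetSum, integral_finsetSum]
    · refine Finset.sum_congr rfl fun i _ => ?_
      rw [integral_smul_const, integral_smul_const, hg3]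
    · exact fun i _ => (integrable_smul_of_memLp hpq hψ (hcf i)).smul_const _
    · exact fun i _ => (integrable_smul_of_memLp hpq hθ (hg1 i)).smul_const _

end MultiplierOperator

/-! ### Mollification of weak gradients -/

section Mollification

open Filter Topology Set
open scoped Convolution

variable {d : ℕ} {G : Type*} [NormedAddCommGroup G] [NormedSpace ℝ G]

/-- A sequence of bump functions with shrinking supports. -/
def bumpSeq (d n : ℕ) : ContDiffBump (0 : Space d) :=
  ⟨(1 / 2) ^ (n + 1), (1 / 2) ^ n, by positivity, by
    rw [pow_succ]
    have : (0 : ℝ) < (1 / 2) ^ n := by positivity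
    linarith⟩

/-- Standard mollification. -/
def mollify (n : ℕ) (f : Space d → G) : Space d → G :=
  (bumpSeq d n).normed volume ⋆[ContinuousLinearMap.lsmul ℝ ℝ, volume] f

theorem mollify_apply (n : ℕ) (f : Space d → G) (x : Space d) :
    mollify n f x = ∫ t, (bumpSeq d n).normed volume t • f (x - t) := rfl

theorem contDiff_mollify (n : ℕ) {f : Space d → G} (hf : LocallyIntegrable f) :
    ContDiff ℝ 1 (mollify n f) :=
  (bumpSeq d n).hasCompactSupport_normed.contDiff_convolution_left (n := 1) _
    (bumpSeq d n).contDiff_normed hf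

theorem ae_tendsto_mollify [CompleteSpace G] {f : Space d → G} (hf : LocallyIntegrable f) :
    ∀ᵐ x, Tendsto (fun n => mollify n f x) atTop (𝓝 (f x)) := by
  refine ContDiffBump.ae_convolution_tendsto_right_of_locallyIntegrable (K := 2) ?_ ?_ hf
  · exact tendsto_pow_atTop_nhds_zero_of_lt_one (by norm_num) (by norm_num)
  · refine Eventually.of_forall fun n => le_of_eq ?_
    simp only [bumpSeq, pow_succ]
    ring

theorem eLpNorm_mollify_le {p : ℝ} (hp : 1 ≤ p) (n : ℕ) {f : Space d → G}
    (hf : AEStronglyMeasurable f volume) :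
    eLpNorm (mollify n f) (ENNReal.ofReal p) volume ≤ eLpNorm f (ENNReal.ofReal p) volume := by
  set φ := (bumpSeq d n).normed (volume : Measure (Space d)) with hφ
  have hφc : Continuous φ := (bumpSeq d n).continuous_normed
  have hφi : ∫⁻ z, ‖φ z‖ₑ = 1 := by
    have h4 : ∀ t, ‖φ t‖ₑ = ENNReal.ofReal (φ t) := fun t =>
      Real.enorm_of_nonneg ((bumpSeq d n).nonneg_normed t)
    simp_rw [h4]
    rw [← ofReal_integral_eq_lintegral_ofReal (bumpSeq d n).integrable_normed
      (Eventually.of_forall (bumpSeq d n).nonneg_normed), (bumpSeq d n).integral_normed]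
    simp
  have hH : AEMeasurable (Function.uncurry fun x z : Space d => ‖f (x - z)‖ₑ)
      (volume.prod volume) :=
    (hf.comp_quasiMeasurePreserving
      (quasiMeasurePreserving_sub (volume : Measure (Space d)) volume)).enorm
  rw [eLpNorm_ofReal_le_iff hp]
  have h5 := lintegral_minkowski (μ := (volume : Measure (Space d)))
    (ν := (volume : Measure (Space d)))
    hp (k := fun z => ‖φ z‖ₑ) (a := fun _ => 1)
    (H := fun x z => ‖f (x - z)‖ₑ) (N := eLpNorm f (ENNReal.ofReal p) volume)
    hφc.measurable.enorm.aemeasurable aemeasurable_const hH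
    (by simp) (by simp) ?_
  · simp only [mul_one, hφi, one_mul] at h5
    refine (lintegral_mono fun x => ?_).trans h5
    gcongr
    rw [mollify_apply]
    refine (enorm_integral_le_lintegral_enorm _).trans_eq (lintegral_congr fun z => ?_)
    rw [enorm_smul]
  · refine Eventually.of_forall fun z => ?_
    rw [one_mul]
    exact (eLpNorm_ofReal_le_iff hp _ _).1 (eLpNorm_comp_measurePreserving
      (f := fun x => x - z) hf (measurePreserving_sub_right volume z)).le

theorem IsWeakGradient.integral_smul_comp_sub {u : Space d → Space d}
    {Du : Space d → Space d →L[ℝ] Space d} (h : IsWeakGradient u Du) {φ : Space d → ℝ}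
    (hφ : ContDiff ℝ ((⊤ : ℕ∞) : WithTop ℕ∞) φ) (hc : HasCompactSupport φ) (x v : Space d) :
    ∫ t, (fderiv ℝ φ t v) • u (x - t) = ∫ t, φ t • Du (x - t) v := by
  have h1 := h.2.2 (fun s => φ (x - s)) (hφ.comp (contDiff_const.sub contDiff_id))
    (hc.comp_homeomorph (Homeomorph.subLeft x)) v
  have h2 : ∀ s, fderiv ℝ (fun s => φ (x - s)) s v = -fderiv ℝ φ (x - s) v := by
    intro s
    have h3 : HasFDerivAt (fun s : Space d => x - s) (-ContinuousLinearMap.id ℝ (Space d)) s :=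
      (hasFDerivAt_id s).const_sub x
    have h4 := ((hφ.differentiable (by simp) (x - s)).hasFDerivAt).comp s h3
    rw [show (fun s => φ (x - s)) = φ ∘ fun s => x - s from rfl, h4.fderiv]
    simp
  simp_rw [h2, neg_smul, integral_neg, neg_inj] at h1
  rw [← integral_sub_left_eq_self _ volume x, ← integral_sub_left_eq_self (fun t =>
    φ t • Du (x - t) v) volume x]
  simpa using h1

theorem locallyIntegrable_comp_sub_left {f : Space d → G} (hf : LocallyIntegrable f)
    (x : Space d) : LocallyIntegrable fun t => f (x - t) := by
  rw [locallyIntegrable_iff] at hf ⊢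
  intro k hk
  have h1 : IsCompact ((fun t => x - t) '' k) := hk.image (by fun_prop)
  have h2 := (volume.measurePreserving_sub_left x : MeasurePreserving (fun t : Space d => x - t)
    volume volume).integrableOn_comp_preimage
    (Homeomorph.subLeft x).measurableEmbedding (f := f) (s := (fun t => x - t) '' k)
  have h3 := h2.2 (hf _ h1)
  rwa [Set.preimage_image_eq _ (fun a b hab => by simpa using hab)] at h3

theorem integrable_smul_comp_sub {f : Space d → G} (hf : LocallyIntegrable f) {φ : Space d → ℝ}
    (hφ : Continuous φ) (hc : HasCompactSupport φ) (x : Space d) :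
    Integrable fun t => φ t • f (x - t) :=
  (locallyIntegrable_comp_sub_left hf x).integrable_smul_left_of_hasCompactSupport hφ hc

/-- The derivative falls on the mollifier, and a translate of the mollifier is an admissible test
function in the definition of the weak gradient. -/
theorem IsWeakGradient.fderiv_mollify {u : Space d → Space d}
    {Du : Space d → Space d →L[ℝ] Space d} (h : IsWeakGradient u Du) (n : ℕ) :
    fderiv ℝ (mollify n u) = mollify n Du := by
  ext1 x
  have hc := (bumpSeq d n).hasCompactSupport_normed (μ := (volume : Measure (Space d)))
  have hs : ContDiff ℝ ((⊤ : ℕ∞) : WithTop ℕ∞) ((bumpSeq d n).normed volume) :=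
    (bumpSeq d n).contDiff_normed
  have hs1 : ContDiff ℝ 1 ((bumpSeq d n).normed volume) := (bumpSeq d n).contDiff_normed (n := 1)
  have h1 := hc.hasFDerivAt_convolution_left (ContinuousLinearMap.lsmul ℝ ℝ) hs1 h.1 x
  rw [mollify, h1.fderiv]
  ext1 v
  have hi : ConvolutionExistsAt (fderiv ℝ ((bumpSeq d n).normed volume)) u x
      ((ContinuousLinearMap.lsmul ℝ ℝ).precompL (Space d)) volume :=
    (hc.fderiv ℝ).convolutionExists_left _ (hs1.continuous_fderiv one_ne_zero) h.1 x
  rw [mollify_apply, ContinuousLinearMap.integral_apply (integrable_smul_comp_sub h.2.1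
    (bumpSeq d n).continuous_normed hc x), convolution_def, ContinuousLinearMap.integral_apply hi]
  refine Eq.trans ?_ (h.integral_smul_comp_sub hs hc x v)
  rfl

/-- The translation bound for functions with a weak gradient in `L^p`. -/
theorem IsWeakGradient.eLpNorm_sub_translate_le {p : ℝ} (hp : 1 ≤ p) {u : Space d → Space d}
    {Du : Space d → Space d →L[ℝ] Space d} (h : IsWeakGradient u Du) (z : Space d) :
    eLpNorm (fun x => u (x - z) - u x) (ENNReal.ofReal p) volume ≤
      ‖z‖ₑ * eLpNorm Du (ENNReal.ofReal p) volume := by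
  refine Lp.eLpNorm_le_of_ae_tendsto (u := atTop)
    (f := fun (n : ℕ) x => mollify n u (x - z) - mollify n u x)
    (Eventually.of_forall fun n => ?_) (fun n => ?_) ?_
  · refine (CommutatorEstimate.eLpNorm_sub_translate_le hp (contDiff_mollify n h.1) z).trans ?_
    rw [h.fderiv_mollify]
    gcongr
    exact eLpNorm_mollify_le hp n h.2.1.aestronglyMeasurable
  · have := (contDiff_mollify n h.1).continuous
    exact Continuous.aestronglyMeasurable (by fun_prop)
  · filter_upwards [ae_tendsto_mollify h.1,
      (measurePreserving_sub_right volume z).quasiMeasurePreserving.ae (ae_tendsto_mollify h.1)]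
      with x hx hxz
    exact hxz.sub hx

end Mollification

/-! ### Weak gradients of smooth fields and of differences. -/

section WeakGradient

open Filter Topology Set

variable {d : ℕ}

theorem IsWeakGradient.of_contDiff {v : Space d → Space d} (hv : ContDiff ℝ 1 v) :
    IsWeakGradient v (fderiv ℝ v) := by
  have hc : Continuous (fderiv ℝ v) := hv.continuous_fderiv one_ne_zero
  refine ⟨hv.continuous.locallyIntegrable, hc.locallyIntegrable, fun θ hθ hθc w => ?_⟩
  have hθ1 : ContDiff ℝ 1 θ := hθ.of_le (by exact_mod_cast le_top)
  have hθ' : Continuous (fderiv ℝ θ) := hθ1.continuous_fderiv one_ne_zero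
  have hvc := hv.continuous
  have hθcc := hθ.continuous
  have hθfc : HasCompactSupport fun x => fderiv ℝ θ x w := by
    refine (hθc.fderiv ℝ).mono fun x hx => ?_
    rw [Function.mem_support] at hx ⊢
    exact fun h0 => hx (by simp [h0])
  rw [← neg_eq_iff_eq_neg, ← integral_smul_fderiv_eq_neg_fderiv_smul_of_integrable]
  · exact Continuous.integrable_of_hasCompactSupport (by fun_prop) hθfc.smul_right
  · exact Continuous.integrable_of_hasCompactSupport (by fun_prop) hθc.smul_right
  · exact Continuous.integrable_of_hasCompactSupport (by fun_prop) hθc.smul_right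
  · exact fun x _ => hθ1.differentiable one_ne_zero x
  · exact fun x _ => hv.differentiable one_ne_zero x

theorem IsWeakGradient.sub {u v : Space d → Space d} {Du Dv : Space d → Space d →L[ℝ] Space d}
    (hu : IsWeakGradient u Du) (hv : IsWeakGradient v Dv) :
    IsWeakGradient (fun x => u x - v x) (fun x => Du x - Dv x) := by
  refine ⟨hu.1.sub hv.1, hu.2.1.sub hv.2.1, fun θ hθ hθc w => ?_⟩
  have hθ1 : ContDiff ℝ 1 θ := hθ.of_le (by exact_mod_cast le_top)
  have hθ' : Continuous (fderiv ℝ θ) := hθ1.continuous_fderiv one_ne_zero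
  have hθfc : HasCompactSupport fun x => fderiv ℝ θ x w := by
    refine (hθc.fderiv ℝ).mono fun x hx => ?_
    rw [Function.mem_support] at hx ⊢
    exact fun h0 => hx (by simp [h0])
  have happ : ∀ {D : Space d → Space d →L[ℝ] Space d}, LocallyIntegrable D →
      Integrable fun x => θ x • D x w := fun {D} hD => by
    have := hD.integrable_smul_left_of_hasCompactSupport hθ.continuous hθc
    simpa using this.apply_continuousLinearMap w
  have hfa : ∀ {D : Space d → Space d}, LocallyIntegrable D →
      Integrable fun x => fderiv ℝ θ x w • D x := fun {D} hD =>
    hD.integrable_smul_left_of_hasCompactSupport (by fun_prop) hθfc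
  simp only [smul_sub, sub_apply]
  rw [integral_sub (hfa hu.1) (hfa hv.1), integral_sub (happ hu.2.1) (happ hv.2.1),
    hu.2.2 θ hθ hθc, hv.2.2 θ hθ hθc]
  abel

end WeakGradient

/-! ### A weighted Poincaré inequality -/

section WeightedPoincare

open Filter Topology Set

variable {d : ℕ} {G : Type*} [NormedAddCommGroup G]

/-- The balls of radius `2 ^ k`. -/
def dyadicBall (d k : ℕ) : Set (Space d) := Metric.ball 0 ((2 : ℝ) ^ k)

theorem measurableSet_dyadicBall (d k : ℕ) : MeasurableSet (dyadicBall d k) :=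
  Metric.isOpen_ball.measurableSet

theorem volume_dyadicBall (d k : ℕ) :
    volume (dyadicBall d k) = ((2 : ℝ≥0∞) ^ d) ^ k * volume (dyadicBall d 0) := by
  rw [dyadicBall, dyadicBall, Measure.addHaar_ball_of_pos _ _ (by positivity), pow_zero,
    finrank_euclideanSpace_fin, ENNReal.ofReal_pow (by positivity),
    ENNReal.ofReal_pow (by positivity), ← pow_mul, ← pow_mul, mul_comm]
  simp
  ring

theorem volume_dyadicBall_ne_top (d k : ℕ) : volume (dyadicBall d k) ≠ ∞ :=
  measure_ball_lt_top.ne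

theorem volume_dyadicBall_ne_zero (d k : ℕ) : volume (dyadicBall d k) ≠ 0 :=
  (Metric.measure_ball_pos _ _ (by positivity)).ne'

theorem measurable_enorm_sub_pair {u : Space d → G} (hu : StronglyMeasurable u) :
    Measurable fun y : Space d × Space d => ‖u y.1 - u y.2‖ₑ :=
  ((hu.comp_measurable measurable_fst).sub (hu.comp_measurable measurable_snd)).enorm

theorem setLIntegral_enorm_sub_translate_le {p : ℝ} (hp : 1 ≤ p) {u : Space d → G}
    (hu : StronglyMeasurable u) {N : ℝ≥0∞}
    (hN : ∀ z, eLpNorm (fun x => u (x - z) - u x) (ENNReal.ofReal p) volume ≤ ‖z‖ₑ * N)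
    (k : ℕ) (z : Space d) :
    ∫⁻ x in dyadicBall d k, ‖u x - u (x - z)‖ₑ ≤
      ‖z‖ₑ * N * volume (dyadicBall d k) ^ (1 - 1 / p) := by
  have hm : AEStronglyMeasurable (fun x => u (x - z) - u x) volume :=
    ((hu.comp_measurable (by fun_prop)).sub hu).aestronglyMeasurable
  have h1 := eLpNorm_le_eLpNorm_mul_rpow_measure_univ (p := 1) (q := ENNReal.ofReal p)
    (μ := volume.restrict (dyadicBall d k)) (by simpa using hp) hm.restrict
  rw [eLpNorm_one_eq_lintegral_enorm, Measure.restrict_apply_univ, ENNReal.toReal_one,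
    ENNReal.toReal_ofReal (by linarith), div_one] at h1
  simp_rw [enorm_sub_rev (u _) (u (_ - z))]
  refine h1.trans ?_
  gcongr
  exact (eLpNorm_mono_measure _ Measure.restrict_le_self).trans (hN z)

/-- Substituting `y = x - z`, two points of the ball of radius `2^k` differ by a vector of length
below `2^{k+1}`, to which the translation bound and Hölder apply. -/
theorem lintegral_dyadicBall_pair_le {p : ℝ} (hp : 1 ≤ p) {u : Space d → G}
    (hu : StronglyMeasurable u) {N : ℝ≥0∞}
    (hN : ∀ z, eLpNorm (fun x => u (x - z) - u x) (ENNReal.ofReal p) volume ≤ ‖z‖ₑ * N)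
    (k : ℕ) :
    ∫⁻ x in dyadicBall d k, ∫⁻ y in dyadicBall d k, ‖u x - u y‖ₑ ≤
      2 ^ (k + 1) * N * volume (dyadicBall d k) ^ (1 - 1 / p) * volume (dyadicBall d (k + 1)) := by
  have hm : Measurable fun y : Space d × Space d => ‖u y.1 - u (y.1 - y.2)‖ₑ :=
    ((hu.comp_measurable measurable_fst).sub (hu.comp_measurable (by fun_prop))).enorm
  have h1 : ∀ x ∈ dyadicBall d k, ∫⁻ y in dyadicBall d k, ‖u x - u y‖ₑ ≤
      ∫⁻ z in dyadicBall d (k + 1), ‖u x - u (x - z)‖ₑ := by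
    intro x hx
    rw [← lintegral_indicator (measurableSet_dyadicBall d k),
      ← lintegral_indicator (measurableSet_dyadicBall d (k + 1)),
      ← lintegral_sub_left_eq_self _ x]
    refine lintegral_mono fun z => ?_
    by_cases hz : x - z ∈ dyadicBall d k
    · rw [indicator_of_mem hz, indicator_of_mem]
      rw [dyadicBall, mem_ball_zero_iff] at hx hz ⊢
      have := norm_sub_le x (x - z)
      rw [sub_sub_cancel] at this
      rw [pow_succ]
      linarith
    · rw [indicator_of_notMem hz]
      exact zero_le
  refine (setLIntegral_mono' (measurableSet_dyadicBall d k) h1).trans ?_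
  rw [lintegral_lintegral_swap hm.aemeasurable]
  have h2 : ∀ z ∈ dyadicBall d (k + 1), ∫⁻ x in dyadicBall d k, ‖u x - u (x - z)‖ₑ ≤
      2 ^ (k + 1) * N * volume (dyadicBall d k) ^ (1 - 1 / p) := by
    intro z hz
    refine (setLIntegral_enorm_sub_translate_le hp hu hN k z).trans ?_
    gcongr
    rw [dyadicBall, mem_ball_zero_iff] at hz
    rw [← ofReal_norm]
    refine (ENNReal.ofReal_le_ofReal hz.le).trans_eq ?_
    rw [ENNReal.ofReal_pow two_pos.le]
    simp
  refine (setLIntegral_mono' (measurableSet_dyadicBall d (k + 1)) h2).trans_eq ?_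
  rw [setLIntegral_const]

/-- Mean oscillation between the unit ball and the dyadic balls. -/
def dyadicOsc (u : Space d → G) (k : ℕ) : ℝ≥0∞ :=
  ∫⁻ y in dyadicBall d 0, ∫⁻ x in dyadicBall d k, ‖u x - u y‖ₑ

/-- The triangle inequality through an intermediate point `x'`, integrated over the smaller ball. It
compares the oscillation at scale `k + 1` with that at scale `k`, up to the oscillation inside the
ball of radius `2^{k+1}`. -/
theorem volume_mul_dyadicOsc_succ_le {u : Space d → G} (hu : StronglyMeasurable u) (k : ℕ) :
    volume (dyadicBall d k) * dyadicOsc u (k + 1) ≤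
      volume (dyadicBall d 0) *
        (∫⁻ x in dyadicBall d (k + 1), ∫⁻ y in dyadicBall d (k + 1), ‖u x - u y‖ₑ) +
      volume (dyadicBall d (k + 1)) * dyadicOsc u k := by
  have hm := measurable_enorm_sub_pair hu
  have hm1 : ∀ s : Set (Space d), Measurable fun x => ∫⁻ y in s, ‖u x - u y‖ₑ := fun s =>
    hm.lintegral_prod_right'
  have hm2 : ∀ s : Set (Space d), Measurable fun y => ∫⁻ x in s, ‖u x - u y‖ₑ := fun s =>
    hm.lintegral_prod_left'
  have hux : ∀ y, Measurable fun x => ‖u x - u y‖ₑ := fun y =>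
    (hu.sub stronglyMeasurable_const).enorm
  have hsub : dyadicBall d k ⊆ dyadicBall d (k + 1) := Metric.ball_subset_ball
    (pow_le_pow_right₀ one_le_two k.le_succ)
  have h1 : ∀ x y, volume (dyadicBall d k) * ‖u x - u y‖ₑ ≤
      (∫⁻ x' in dyadicBall d (k + 1), ‖u x - u x'‖ₑ) +
        ∫⁻ x' in dyadicBall d k, ‖u x' - u y‖ₑ := by
    intro x y
    calc volume (dyadicBall d k) * ‖u x - u y‖ₑ = ∫⁻ _ in dyadicBall d k, ‖u x - u y‖ₑ := by
          rw [setLIntegral_const, mul_comm]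
      _ ≤ ∫⁻ x' in dyadicBall d k, (‖u x - u x'‖ₑ + ‖u x' - u y‖ₑ) := by
          refine lintegral_mono fun x' => ?_
          rw [show u x - u y = (u x - u x') + (u x' - u y) by abel]
          exact enorm_add_le _ _
      _ = (∫⁻ x' in dyadicBall d k, ‖u x - u x'‖ₑ) + ∫⁻ x' in dyadicBall d k, ‖u x' - u y‖ₑ :=
          lintegral_add_right _ (hux y)
      _ ≤ _ := by
          gcongr
  have h2 : ∀ y, volume (dyadicBall d k) * ∫⁻ x in dyadicBall d (k + 1), ‖u x - u y‖ₑ ≤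
      (∫⁻ x in dyadicBall d (k + 1), ∫⁻ x' in dyadicBall d (k + 1), ‖u x - u x'‖ₑ) +
        volume (dyadicBall d (k + 1)) * ∫⁻ x' in dyadicBall d k, ‖u x' - u y‖ₑ := by
    intro y
    rw [← lintegral_const_mul _ (hux y)]
    refine (lintegral_mono fun x => h1 x y).trans_eq ?_
    rw [lintegral_add_left (hm1 _), setLIntegral_const, mul_comm (volume _)]
  rw [dyadicOsc, ← lintegral_const_mul _ (hm2 _)]
  refine (lintegral_mono fun y => h2 y).trans_eq ?_
  rw [lintegral_add_left measurable_const, setLIntegral_const, lintegral_const_mul _ (hm2 _),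
    dyadicOsc]
  ring

/-- Induction over scales. The new oscillation and the inherited one each grow at rate at most `2^{d
+ 1 - 1/p}` per step, so accumulation costs only the linear factor `k + 1`. -/
theorem exists_dyadicOsc_le (hd : 0 < d) {p : ℝ} (hp : 1 ≤ p) :
    ∃ K : ℝ≥0, ∀ (u : Space d → G) (_ : StronglyMeasurable u) (N : ℝ≥0∞)
      (_ : ∀ z, eLpNorm (fun x => u (x - z) - u x) (ENNReal.ofReal p) volume ≤ ‖z‖ₑ * N) (k : ℕ),
      dyadicOsc u k ≤ K * (k + 1 : ℕ) * N * ((2 : ℝ≥0∞) ^ ((d : ℝ) + (1 - 1 / p))) ^ k := by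
  set V := volume (dyadicBall d 0) with hV
  have hV0 := volume_dyadicBall_ne_zero d 0
  have hVt := volume_dyadicBall_ne_top d 0
  set α := 1 - 1 / p with hα
  have hp0 : 0 < p := by linarith
  have hα0 : 0 ≤ α := by
    rw [hα, sub_nonneg, div_le_one hp0]; exact hp
  have hα1 : α ≤ 1 := by
    have : 0 < 1 / p := by positivity
    linarith
  have hd1 : (1 : ℝ) ≤ d := by exact_mod_cast hd
  set ρ := (2 : ℝ≥0∞) ^ ((d : ℝ) + α) with hρ
  have hρ1 : 1 ≤ ρ := ENNReal.one_le_rpow (by norm_num) (by positivity)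
  have hρr : (2 : ℝ≥0∞) ^ d ≤ ρ := by
    rw [hρ, ← ENNReal.rpow_natCast]
    exact ENNReal.rpow_le_rpow_of_exponent_le (by norm_num) (by linarith)
  -- The exponents satisfy `1 + d α ≤ d + α`, that is `(d - 1)(1 - α) ≥ 0`, which uses `d ≥ 1` and
  -- `α ≤ 1`.
  have hb : 2 * ((2 : ℝ≥0∞) ^ d) ^ α ≤ ρ := by
    rw [hρ, ← ENNReal.rpow_natCast, ← ENNReal.rpow_mul]
    nth_rewrite 1 [← ENNReal.rpow_one 2]
    rw [← ENNReal.rpow_add _ _ (by norm_num) (by norm_num)]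
    refine ENNReal.rpow_le_rpow_of_exponent_le (by norm_num) ?_
    nlinarith
  have hρt : ρ ≠ ∞ := ENNReal.rpow_ne_top_of_nonneg (by positivity) (by norm_num)
  set K₀ : ℝ≥0∞ := 2 * V ^ α * 2 ^ d * V * 2 ^ d * ρ with hK₀
  have hK₀t : K₀ ≠ ∞ := by
    have : V ^ α ≠ ∞ := ENNReal.rpow_ne_top_of_nonneg hα0 hVt
    rw [hK₀]
    finiteness
  refine ⟨K₀.toNNReal, fun u hu N hN k => ?_⟩
  rw [ENNReal.coe_toNNReal hK₀t]
  have hpair : ∀ k : ℕ, ∫⁻ x in dyadicBall d k, ∫⁻ y in dyadicBall d k, ‖u x - u y‖ₑ ≤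
      2 * V ^ α * 2 ^ d * V * N * (ρ * 2 ^ d) ^ k := by
    intro k
    refine (lintegral_dyadicBall_pair_le hp hu hN k).trans ?_
    rw [volume_dyadicBall d k, volume_dyadicBall d (k + 1),
      ENNReal.mul_rpow_of_nonneg _ _ hα0, ← ENNReal.rpow_natCast _ k, ← ENNReal.rpow_mul,
      mul_comm (k : ℝ), ENNReal.rpow_mul, ENNReal.rpow_natCast]
    calc _ = 2 * V ^ α * 2 ^ d * V * N * ((2 * (2 ^ d) ^ α) * 2 ^ d) ^ k := by ring
      _ ≤ _ := by gcongr
  have h2d : (2 : ℝ≥0∞) ^ d ≠ 0 := by simp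
  have h2dt : (2 : ℝ≥0∞) ^ d ≠ ∞ := by finiteness
  induction k with
  | zero =>
    have h0 : dyadicOsc u 0 = ∫⁻ x in dyadicBall d 0, ∫⁻ y in dyadicBall d 0, ‖u x - u y‖ₑ :=
      lintegral_congr fun y => lintegral_congr fun x => enorm_sub_rev _ _
    refine h0.trans_le ((hpair 0).trans ?_)
    simp only [pow_zero, mul_one, Nat.zero_add, Nat.cast_one]
    gcongr
    rw [hK₀]
    calc 2 * V ^ α * 2 ^ d * V = 2 * V ^ α * 2 ^ d * V * 1 * 1 := by ring
      _ ≤ _ := by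
        gcongr
        exact one_le_pow₀ (by norm_num)
  | succ k ih =>
    have h1 := volume_mul_dyadicOsc_succ_le hu k
    have h2 : volume (dyadicBall d k) * dyadicOsc u (k + 1) ≤ volume (dyadicBall d k) *
        (K₀ * ((k + 1 : ℕ) + 1 : ℕ) * N * ρ ^ (k + 1)) := by
      refine h1.trans ?_
      calc _ ≤ V * (2 * V ^ α * 2 ^ d * V * N * (ρ * 2 ^ d) ^ (k + 1)) +
            volume (dyadicBall d (k + 1)) * (K₀ * (k + 1 : ℕ) * N * ρ ^ k) := by
            gcongr
            exact hpair (k + 1)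
        _ = volume (dyadicBall d k) * (K₀ * N * ρ ^ k) + volume (dyadicBall d k) *
            (2 ^ d * (K₀ * (k + 1 : ℕ) * N * ρ ^ k)) := by
            rw [volume_dyadicBall d k, volume_dyadicBall d (k + 1), hK₀]
            ring
        _ ≤ volume (dyadicBall d k) * (K₀ * N * (ρ ^ k * ρ)) + volume (dyadicBall d k) *
            (ρ * (K₀ * (k + 1 : ℕ) * N * ρ ^ k)) := by
            gcongr
            exact le_mul_of_one_le_right zero_le hρ1
        _ = _ := by push_cast; ring
    rwa [ENNReal.mul_le_mul_iff_right (volume_dyadicBall_ne_zero d k)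
      (volume_dyadicBall_ne_top d k)] at h2

/-- The weight `(1 + |x|) ^ (-(d + 1/2))`. -/
def weight (x : Space d) : ℝ := (1 + ‖x‖) ^ (-((d : ℝ) + 1 / 2))

theorem weight_pos (x : Space d) : 0 < weight x := by
  unfold weight
  positivity

theorem continuous_weight : Continuous (weight (d := d)) :=
  (continuous_const.add continuous_norm).rpow_const fun z =>
    Or.inl (by have := norm_nonneg z; change 1 + ‖z‖ ≠ 0; positivity)

/-- At `x` the single term of the least `k` with `|x| < 2^k` already suffices, because `2^k ≤ 2 (1 +
|x|)`. The weighted integral thereby becomes a sum over dyadic balls. -/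
theorem ofReal_weight_le_tsum (x : Space d) :
    ENNReal.ofReal (weight x) ≤ (2 : ℝ≥0∞) ^ ((d : ℝ) + 1 / 2) *
      ∑' k : ℕ,
        (dyadicBall d k).indicator (fun _ => ((2 : ℝ≥0∞) ^ (-((d : ℝ) + 1 / 2))) ^ k) x := by
  have hex : ∃ k : ℕ, ‖x‖ < 2 ^ k := pow_unbounded_of_one_lt ‖x‖ one_lt_two
  classical
  set k := Nat.find hex with hk
  have hk1 : ‖x‖ < 2 ^ k := Nat.find_spec hex
  have hk2 : (2 : ℝ) ^ k ≤ 2 * (1 + ‖x‖) := by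
    rcases Nat.eq_zero_or_pos k with h0 | h0
    · rw [h0, pow_zero]; linarith [norm_nonneg x]
    · have := Nat.find_min hex (m := k - 1) (by omega)
      push Not at this
      calc (2 : ℝ) ^ k = 2 * 2 ^ (k - 1) := by
            rw [← pow_succ']; congr 1; omega
        _ ≤ 2 * (1 + ‖x‖) := by linarith
  have hxk : x ∈ dyadicBall d k := by simpa [dyadicBall] using hk1
  refine le_trans ?_ (mul_le_mul_right (ENNReal.le_tsum k) _)
  rw [indicator_of_mem hxk]
  have h3 : weight x ≤ 2 ^ ((d : ℝ) + 1 / 2) * ((2 : ℝ) ^ (-((d : ℝ) + 1 / 2))) ^ k := by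
    rw [weight, ← Real.rpow_natCast, ← Real.rpow_mul two_pos.le, mul_comm (-_), Real.rpow_mul
      two_pos.le, Real.rpow_natCast, Real.rpow_neg (by positivity), Real.rpow_neg (by positivity),
      ← div_eq_mul_inv, le_div_iff₀ (by positivity), inv_mul_le_iff₀ (by positivity), mul_comm,
      ← Real.mul_rpow (by positivity) (by positivity)]
    exact Real.rpow_le_rpow (by positivity) hk2 (by positivity)
  refine (ENNReal.ofReal_le_ofReal h3).trans_eq ?_
  rw [ENNReal.ofReal_mul (by positivity), ENNReal.ofReal_pow (by positivity),
    ← ENNReal.ofReal_rpow_of_pos two_pos, ← ENNReal.ofReal_rpow_of_pos two_pos]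
  simp

/-- A weighted Poincaré inequality. -/
theorem exists_lintegral_weight_le (hd : 0 < d) {p : ℝ} (hp₁ : 1 ≤ p) (hp₂ : p < 2) :
    ∃ A : ℝ≥0, ∀ (u : Space d → G) (_ : AEStronglyMeasurable u volume) (N : ℝ≥0∞)
      (_ : ∀ z, eLpNorm (fun x => u (x - z) - u x) (ENNReal.ofReal p) volume ≤ ‖z‖ₑ * N),
      ∃ c, ∫⁻ x, ‖u x - c‖ₑ * ENNReal.ofReal (weight x) ≤ A * N := by
  obtain ⟨K, hK⟩ := exists_dyadicOsc_le (G := G) hd hp₁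
  have hp0 : 0 < p := by linarith
  set s := (2 : ℝ≥0∞) ^ (-((d : ℝ) + 1 / 2)) with hs
  set ρ := (2 : ℝ≥0∞) ^ ((d : ℝ) + (1 - 1 / p)) with hρ
  -- The product is `2^{1/2 - 1/p}`. Here `p < 2` makes the weight of order `d + 1/2` beat the
  -- growth of the oscillation.
  have hσ : s * ρ < 1 := by
    rw [hs, hρ, ← ENNReal.rpow_add _ _ (by norm_num) (by norm_num)]
    refine ENNReal.rpow_lt_one_of_one_lt_of_neg (by norm_num) ?_
    have : 1 / 2 < 1 / p := one_div_lt_one_div_of_lt hp0 hp₂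
    linarith
  set S := ∑' k : ℕ, ((k + 1 : ℕ) : ℝ≥0∞) * (s * ρ) ^ k with hS
  have hSt : S ≠ ∞ := by
    obtain ⟨r, hr⟩ : ∃ r : ℝ≥0, s * ρ = r := ⟨(s * ρ).toNNReal, by
      rw [ENNReal.coe_toNNReal (hσ.trans ENNReal.one_lt_top).ne]⟩
    rw [hr] at hσ
    have hr1 : (r : ℝ) < 1 := by exact_mod_cast hσ
    have h1 : Summable fun k : ℕ => ((k + 1 : ℕ) : ℝ≥0) * r ^ k := by
      rw [← NNReal.summable_coe]
      have h2 := summable_pow_mul_geometric_of_norm_lt_one 1 (r := (r : ℝ)) (by simpa using hr1)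
      have h3 := summable_geometric_of_lt_one r.coe_nonneg hr1
      refine (h2.add h3).congr fun k => ?_
      push_cast
      ring
    rw [hS, hr]
    have := ENNReal.tsum_coe_ne_top_iff_summable.2 h1
    convert this using 3 with k
    push_cast
    ring
  set V := volume (dyadicBall d 0) with hV
  have hV0 := volume_dyadicBall_ne_zero d 0
  have hVt := volume_dyadicBall_ne_top d 0
  set A : ℝ≥0∞ := V⁻¹ * ((2 : ℝ≥0∞) ^ ((d : ℝ) + 1 / 2) * (K * S)) with hA
  have hAt : A ≠ ∞ := by
    have : (2 : ℝ≥0∞) ^ ((d : ℝ) + 1 / 2) ≠ ∞ :=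
      ENNReal.rpow_ne_top_of_nonneg (by positivity) (by norm_num)
    have : V⁻¹ ≠ ∞ := ENNReal.inv_ne_top.2 hV0
    rw [hA]
    finiteness
  refine ⟨A.toNNReal, fun u' hu' N hN' => ?_⟩
  rw [ENNReal.coe_toNNReal hAt]
  -- A strongly measurable representative is used, because the argument evaluates `u` at individual
  -- points.
  set u := hu'.mk u' with hu_def
  have hu : StronglyMeasurable u := hu'.stronglyMeasurable_mk
  have hN : ∀ z, eLpNorm (fun x => u (x - z) - u x) (ENNReal.ofReal p) volume ≤ ‖z‖ₑ * N := by
    intro z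
    refine le_trans (le_of_eq (eLpNorm_congr_ae ?_)) (hN' z)
    filter_upwards [hu'.ae_eq_mk,
      (measurePreserving_sub_right volume z).quasiMeasurePreserving.ae hu'.ae_eq_mk] with x h1 h2
    rw [h1, h2]
  have hm := measurable_enorm_sub_pair hu
  have hw : Measurable fun x : Space d => ENNReal.ofReal (weight x) :=
    continuous_weight.measurable.ennreal_ofReal
  have hux : ∀ y, Measurable fun x => ‖u x - u y‖ₑ := fun y =>
    (hu.sub stronglyMeasurable_const).enorm
  have hmain : ∫⁻ y in dyadicBall d 0, ∫⁻ x, ‖u x - u y‖ₑ * ENNReal.ofReal (weight x) ≤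
      (2 : ℝ≥0∞) ^ ((d : ℝ) + 1 / 2) * (K * S) * N := by
    calc _ ≤ ∫⁻ y in dyadicBall d 0, (2 : ℝ≥0∞) ^ ((d : ℝ) + 1 / 2) *
          ∑' k : ℕ, s ^ k * ∫⁻ x in dyadicBall d k, ‖u x - u y‖ₑ := by
          refine lintegral_mono fun y => ?_
          calc _ ≤ ∫⁻ x, (2 : ℝ≥0∞) ^ ((d : ℝ) + 1 / 2) *
                ∑' k : ℕ, s ^ k * (dyadicBall d k).indicator (fun x => ‖u x - u y‖ₑ) x := by
                refine lintegral_mono fun x => ?_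
                refine (mul_le_mul_right (ofReal_weight_le_tsum x) _).trans_eq ?_
                rw [mul_left_comm, ← ENNReal.tsum_mul_left]
                congr 2
                ext k
                by_cases hx : x ∈ dyadicBall d k
                · simp only [indicator_of_mem hx]; rw [mul_comm]
                · simp only [indicator_of_notMem hx, mul_zero]
            _ = _ := by
                have h0 : ∀ k : ℕ, Measurable fun x =>
                    s ^ k * (dyadicBall d k).indicator (fun x => ‖u x - u y‖ₑ) x := fun k =>
                  ((hux y).indicator (measurableSet_dyadicBall d k)).const_mul _
                rw [lintegral_const_mul _ (Measurable.tsum h0),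
                  lintegral_tsum fun k => (h0 k).aemeasurable]
                congr 2
                ext k
                rw [lintegral_const_mul _ ((hux y).indicator (measurableSet_dyadicBall d k)),
                  lintegral_indicator (measurableSet_dyadicBall d k)]
      _ = (2 : ℝ≥0∞) ^ ((d : ℝ) + 1 / 2) * ∑' k : ℕ, s ^ k * dyadicOsc u k := by
          have h0 : ∀ k : ℕ, Measurable fun y => ∫⁻ x in dyadicBall d k, ‖u x - u y‖ₑ := fun k =>
            hm.lintegral_prod_left'
          rw [lintegral_const_mul _ (Measurable.tsum fun k => (h0 k).const_mul _),
            lintegral_tsum fun k => ((h0 k).const_mul _).aemeasurable]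
          congr 2
          ext k
          rw [lintegral_const_mul _ (h0 k), dyadicOsc]
      _ ≤ (2 : ℝ≥0∞) ^ ((d : ℝ) + 1 / 2) *
          ∑' k : ℕ, K * N * (((k + 1 : ℕ) : ℝ≥0∞) * (s * ρ) ^ k) := by
          refine mul_le_mul_right (ENNReal.tsum_le_tsum fun k => ?_) _
          refine (mul_le_mul_right (hK u hu N hN k) _).trans_eq ?_
          ring
      _ = _ := by
          rw [ENNReal.tsum_mul_left]
          ring
  have hmy : Measurable fun y => ∫⁻ x, ‖u x - u y‖ₑ * ENNReal.ofReal (weight x) :=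
    Measurable.lintegral_prod_left' (f := fun z : Space d × Space d =>
      ‖u z.1 - u z.2‖ₑ * ENNReal.ofReal (weight z.1)) (hm.mul (hw.comp measurable_fst))
  -- Some point `y` of the unit ball does no worse than the average over the ball, and the value of
  -- `u` there serves as the constant.
  obtain ⟨y, -, hy⟩ := exists_le_setLAverage hV0 hVt hmy.aemeasurable
  refine ⟨u y, ?_⟩
  have h1 : ∫⁻ x, ‖u' x - u y‖ₑ * ENNReal.ofReal (weight x) =
      ∫⁻ x, ‖u x - u y‖ₑ * ENNReal.ofReal (weight x) := by
    refine lintegral_congr_ae ?_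
    filter_upwards [hu'.ae_eq_mk] with x hx
    rw [hx]
  rw [h1]
  refine hy.trans ?_
  rw [setLAverage_eq, ENNReal.div_eq_inv_mul, hA]
  refine (mul_le_mul_right hmain _).trans_eq ?_
  ring

end WeightedPoincare

/-! ### Approximation of Sobolev vector fields -/

section SobolevApproximation

open LineDeriv Filter Topology

variable {d : ℕ} {F : Type*} [NormedAddCommGroup F] [NormedSpace ℂ F] [CompleteSpace F]

theorem eLpNorm_conv_sub_le_of_translate {p : ℝ} (hp : 1 ≤ p) {v : Space d → F}
    (hv : IsTempered v) {N : ℝ≥0∞}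
    (hN : ∀ z, eLpNorm (fun x => v (x - z) - v x) (ENNReal.ofReal p) volume ≤ ‖z‖ₑ * N)
    {K : 𝓢(Space d, ℂ)} (hK : ∫ z, K z = 1) (hd : 0 < d) :
    eLpNorm (fun x => conv K v x - v x) (ENNReal.ofReal p) volume ≤
      (∫⁻ z, ‖K z‖ₑ * ‖z‖ₑ) * N := by
  have h1 : (fun x => conv K v x - v x) = fun x => ∫ z, K z • (v (x - z) - v x) := by
    ext x
    simp only [smul_sub]
    rw [integral_sub (hv.integrable_smul_comp_sub K x) (K.integrable.smul_const _),
      integral_smul_const, hK, one_smul]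
    rfl
  rw [h1]
  exact eLpNorm_integral_smul_le (H := fun x z => v (x - z) - v x) hp K.integrable.1
    measurable_enorm.aemeasurable ((aestronglyMeasurable_comp_sub hv.1).sub hv.1.comp_fst)
    (ae_enorm_ne_zero hd) (by simp) (Eventually.of_forall hN)

/-- Coordinatewise complexification. -/
def complexify (d : ℕ) : Space d →L[ℝ] EuclideanSpace ℂ (Fin d) :=
  LinearMap.toContinuousLinearMap
    { toFun := fun x => WithLp.toLp 2 fun i => (x i : ℂ)
      map_add' := fun x y => by ext; simp
      map_smul' := fun c x => by ext; simp }

/-- Coordinatewise real part. -/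
def realPart (d : ℕ) : EuclideanSpace ℂ (Fin d) →L[ℝ] Space d :=
  LinearMap.toContinuousLinearMap
    { toFun := fun x => WithLp.toLp 2 fun i => (x i).re
      map_add' := fun x y => by ext; simp
      map_smul' := fun c x => by ext; simp }

theorem realPart_complexify (x : Space d) : realPart d (complexify d x) = x := by
  ext i
  simp [realPart, complexify]

theorem norm_complexify (x : Space d) : ‖complexify d x‖ = ‖x‖ := by
  simp [complexify, EuclideanSpace.norm_eq]

theorem norm_realPart_le (x : EuclideanSpace ℂ (Fin d)) : ‖realPart d x‖ ≤ ‖x‖ := by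
  simp only [realPart, EuclideanSpace.norm_eq, LinearMap.coe_toContinuousLinearMap',
    LinearMap.coe_mk, AddHom.coe_mk]
  refine Real.sqrt_le_sqrt (Finset.sum_le_sum fun i _ => ?_)
  gcongr
  exact Complex.abs_re_le_norm _

theorem ofReal_smul_complexify (r : ℝ) (y : Space d) :
    (r : ℂ) • complexify d y = complexify d (r • y) := by
  ext i
  simp [complexify]

/-- By the weighted Poincaré inequality `u` is a constant plus a function integrable against a
negative power of `1 + |x|`. Complexification makes the convolution calculus, set up over `ℂ`,
available for `u`. -/
theorem IsWeakGradient.isTempered_complexify {p : ℝ} (hp₁ : 1 ≤ p) (hp₂ : p < 2) (hd : 0 < d)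
    {u : Space d → Space d} {Du : Space d → Space d →L[ℝ] Space d} (h : IsWeakGradient u Du)
    (hDu : MemLp Du (ENNReal.ofReal p) volume) :
    IsTempered fun x => complexify d (u x) := by
  have hum := h.1.aestronglyMeasurable
  obtain ⟨A, hA⟩ := exists_lintegral_weight_le (G := Space d) hd hp₁ hp₂
  obtain ⟨c, hc⟩ := hA u hum _ (h.eLpNorm_sub_translate_le hp₁)
  have h1 : IsTempered fun x => complexify d (u x - c) := by
    refine ⟨(complexify d).continuous.comp_aestronglyMeasurable
      (hum.sub aestronglyMeasurable_const), d + 1, ?_⟩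
    have hi : Integrable fun x => weight x * ‖u x - c‖ := by
      refine ⟨continuous_weight.aestronglyMeasurable.mul
        (hum.sub aestronglyMeasurable_const).norm, ?_⟩
      rw [hasFiniteIntegral_iff_enorm]
      refine lt_of_le_of_lt (le_of_eq ?_) (hc.trans_lt
        (ENNReal.mul_lt_top ENNReal.coe_lt_top hDu.2))
      refine lintegral_congr fun x => ?_
      rw [enorm_mul, enorm_norm, Real.enorm_eq_ofReal (weight_pos x).le, mul_comm]
    refine hi.mono ?_ (Eventually.of_forall fun x => ?_)
    · exact (Continuous.aestronglyMeasurable (by fun_prop (disch := intros; positivity))).mul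
        ((complexify d).continuous.comp_aestronglyMeasurable
          (hum.sub aestronglyMeasurable_const)).norm
    · rw [norm_mul, norm_mul, norm_norm, norm_norm, norm_complexify]
      gcongr
      rw [Real.norm_of_nonneg (by positivity), Real.norm_of_nonneg (weight_pos x).le, weight,
        ← Real.rpow_natCast, ← Real.rpow_neg (by positivity)]
      refine Real.rpow_le_rpow_of_exponent_le (by linarith [norm_nonneg x]) ?_
      push_cast
      linarith
  have h2 : IsTempered fun _ : Space d => complexify d (-c) :=
    IsTempered.of_norm_le aestronglyMeasurable_const (Eventually.of_forall fun _ => le_rfl)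
  simpa using h1.sub h2

/-- A derivative of the kernel is transferred to `u`. The kernel must be real and compactly
supported, since weak gradients are tested only against such functions. -/
theorem IsWeakGradient.conv_lineDeriv_complexify {u : Space d → Space d}
    {Du : Space d → Space d →L[ℝ] Space d} (h : IsWeakGradient u Du) {K : 𝓢(Space d, ℂ)}
    {φ : Space d → ℝ} (hφ : ContDiff ℝ ((⊤ : ℕ∞) : WithTop ℕ∞) φ) (hc : HasCompactSupport φ)
    (hK : ∀ t, K t = φ t) (v x : Space d) :
    conv (∂_{v} K : 𝓢(Space d, ℂ)) (fun y => complexify d (u y)) x =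
      conv K (fun y => complexify d (Du y v)) x := by
  have hdiff : ContDiff ℝ 1 φ := hφ.of_le (by exact_mod_cast le_top)
  have h1 : ∀ t, (∂_{v} K : 𝓢(Space d, ℂ)) t = ((fderiv ℝ φ t v : ℝ) : ℂ) := fun t => by
    rw [SchwartzMap.lineDerivOp_apply_eq_fderiv]
    have : (K : Space d → ℂ) = fun t => Complex.ofRealCLM (φ t) := by
      ext t
      exact hK t
    rw [this]
    have := Complex.ofRealCLM.hasFDerivAt.comp t
      (hdiff.differentiable (by norm_num) t).hasFDerivAt
    rw [show (fun t => Complex.ofRealCLM (φ t)) = Complex.ofRealCLM ∘ φ from rfl, this.fderiv]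
    rfl
  simp only [conv, h1, hK, ofReal_smul_complexify]
  rw [ContinuousLinearMap.integral_comp_comm, ContinuousLinearMap.integral_comp_comm,
    h.integral_smul_comp_sub hφ hc]
  · refine (integrable_smul_comp_sub (f := fun y => Du y v) ?_ hφ.continuous hc x)
    exact fun y => (h.2.1 y).imp fun s hs =>
      ⟨hs.1, (ContinuousLinearMap.apply ℝ (Space d) v).integrable_comp hs.2⟩
  · exact integrable_smul_comp_sub h.1
      ((hdiff.continuous_fderiv (by norm_num)).clm_apply continuous_const)
      (hc.fderiv_apply (𝕜 := ℝ) v) x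

theorem exists_real_schwartz_bump (d : ℕ) : ∃ (K : 𝓢(Space d, ℂ)),
    ∫ z, K z = 1 ∧ ∀ j : ℤ, ∃ φ : Space d → ℝ, ContDiff ℝ ((⊤ : ℕ∞) : WithTop ℕ∞) φ ∧
      HasCompactSupport φ ∧ ∀ t, scaled j K t = φ t := by
  set φ := (bumpSeq d 0).normed volume
  have hφ : ContDiff ℝ ((⊤ : ℕ∞) : WithTop ℕ∞) φ := (bumpSeq d 0).contDiff_normed
  have hc : HasCompactSupport φ := (bumpSeq d 0).hasCompactSupport_normed
  have hc' : HasCompactSupport fun x => (φ x : ℂ) := hc.comp_left (g := Complex.ofReal) (by simp)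
  have hφ' : ContDiff ℝ ((⊤ : ℕ∞) : WithTop ℕ∞) fun x => (φ x : ℂ) :=
    Complex.ofRealCLM.contDiff.comp hφ
  refine ⟨hc'.toSchwartzMap hφ', ?_, fun j => ⟨fun t => ((2 : ℝ) ^ j) ^ d * φ ((2 : ℝ) ^ j • t),
    contDiff_const.mul (hφ.comp (contDiff_const_smul _)), ?_, fun t => ?_⟩⟩
  · change ∫ z, ((φ z : ℝ) : ℂ) = 1
    rw [integral_complex_ofReal]
    simp [φ, (bumpSeq d 0).integral_normed]
  · exact (hc.comp_smul (by positivity : (2 : ℝ) ^ j ≠ 0)).mul_left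
  · rw [scaled_apply]
    push_cast
    rfl

/-- Take the real part of `K_n * u - K_{-n} * u`, with `K_j` the dilates of a real bump of mass one.
Both convolutions differ from `u` by `L^p` functions, by the translation bound, so their difference
is in `L^p` although `u` need not be. The gradient is `K_n * Du - K_{-n} * Du`; the first term tends
to `Du` and the second to zero, the latter because `p > 1`. -/
theorem IsWeakGradient.exists_approx {p : ℝ} (hp₁ : 1 < p) (hp₂ : p < 2) (hd : 0 < d)
    {u : Space d → Space d} {Du : Space d → Space d →L[ℝ] Space d} (h : IsWeakGradient u Du)
    (hDu : MemLp Du (ENNReal.ofReal p) volume) :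
    ∃ v : ℕ → Space d → Space d, (∀ n, ContDiff ℝ 1 (v n)) ∧
      (∀ n, MemLp (v n) (ENNReal.ofReal p) volume) ∧
      (∀ n, MemLp (fderiv ℝ (v n)) (ENNReal.ofReal p) volume) ∧
      Tendsto (fun n => eLpNorm (fun x => Du x - fderiv ℝ (v n) x) (ENNReal.ofReal p) volume)
        atTop (𝓝 0) := by
  have hp1 : 1 ≤ ENNReal.ofReal p := by simpa using hp₁.le
  obtain ⟨K, hK1, hKφ⟩ := exists_real_schwartz_bump d
  set U : Space d → EuclideanSpace ℂ (Fin d) := fun x => complexify d (u x) with hU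
  have hUt : IsTempered U := h.isTempered_complexify hp₁.le hp₂ hd hDu
  have hUN : ∀ z, eLpNorm (fun x => U (x - z) - U x) (ENNReal.ofReal p) volume ≤
      ‖z‖ₑ * eLpNorm Du (ENNReal.ofReal p) volume := fun z => by
    refine le_trans (le_of_eq (eLpNorm_congr_norm_ae (Eventually.of_forall fun x => ?_)))
      (h.eLpNorm_sub_translate_le hp₁.le z)
    rw [hU, ← map_sub, norm_complexify]
  set D : Space d → Space d → EuclideanSpace ℂ (Fin d) :=
      fun w x => complexify d (Du x w) with hDdef
  have hD : ∀ w, MemLp (D w) (ENNReal.ofReal p) volume := fun w =>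
    (complexify d).comp_memLp' ((ContinuousLinearMap.apply ℝ (Space d) w).comp_memLp' hDu)
  set c : ℤ → Space d → EuclideanSpace ℂ (Fin d) := fun j => conv (scaled j K) U
  have hcU : ∀ j, MemLp (fun x => c j x - U x) (ENNReal.ofReal p) volume := fun j => by
    have hKj : ∫ z, scaled j K z = 1 := by
      have := integral_scaled_smul j K (fun _ => (1 : ℂ))
      simpa [hK1] using this
    refine ⟨(aestronglyMeasurable_conv (scaled j K).integrable.1 hUt.1).sub hUt.1,
      (eLpNorm_conv_sub_le_of_translate hp₁.le hUt hUN hKj hd).trans_lt ?_⟩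
    exact ENNReal.mul_lt_top (lintegral_mul_enorm_ne_top _).lt_top hDu.2
  have hcd : ∀ j, ContDiff ℝ 1 (c j) := fun j =>
    contDiff_one_iff_fderiv.2 ⟨hUt.differentiable_conv _, hUt.continuous_fderiv_conv _⟩
  have hcD : ∀ j x w, fderiv ℝ (c j) x w = conv (scaled j K) (D w) x := fun j x w => by
    obtain ⟨φ, hφ, hφc, hφK⟩ := hKφ j
    rw [hUt.fderiv_conv_apply, h.conv_lineDeriv_complexify hφ hφc hφK]
  set v : ℕ → Space d → Space d := fun n x => realPart d (c n x - c (-n) x)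
  have hv : ∀ n, ContDiff ℝ 1 (v n) := fun n =>
    (realPart d).contDiff.comp ((hcd n).sub (hcd (-n)))
  have hvD : ∀ n x w, fderiv ℝ (v n) x w =
      realPart d (conv (scaled n K) (D w) x - conv (scaled (-n) K) (D w) x) := fun n x w => by
    have := (realPart d).hasFDerivAt.comp x
      (((hcd n).differentiable (by norm_num) x).hasFDerivAt.sub
        ((hcd (-n)).differentiable (by norm_num) x).hasFDerivAt)
    have h2 : fderiv ℝ (v n) x = _ := this.fderiv
    rw [h2]
    simp [hcD]
  set e : ℕ → Fin d → Space d → ℝ := fun n i x =>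
    ‖conv (scaled n K) (D (EuclideanSpace.single i 1)) x - D (EuclideanSpace.single i 1) x‖ +
      ‖conv (scaled (-n) K) (D (EuclideanSpace.single i 1)) x‖
  have hm : ∀ n i, MemLp (fun x => conv (scaled n K) (D (EuclideanSpace.single i 1)) x -
      D (EuclideanSpace.single i 1) x) (ENNReal.ofReal p) volume := fun n i =>
    (memLp_conv hp₁.le (scaled n K).integrable (hD _)).sub (hD _)
  have hm' : ∀ (n : ℕ) i, MemLp (conv (scaled (-n) K) (D (EuclideanSpace.single i 1)))
      (ENNReal.ofReal p) volume := fun n i => memLp_conv hp₁.le (scaled _ K).integrable (hD _)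
  have hle : ∀ n x, ‖Du x - fderiv ℝ (v n) x‖ ≤ ∑ i, e n i x := fun n x => by
    refine (opNorm_le_sum_apply _).trans (Finset.sum_le_sum fun i _ => ?_)
    rw [sub_apply, hvD, ← realPart_complexify (Du x _), ← map_sub]
    refine (norm_realPart_le _).trans ?_
    rw [← norm_neg]
    refine le_trans (le_of_eq (congrArg _ ?_)) (norm_sub_le _ _)
    simp only [hDdef]
    abel
  have hle' : ∀ n, eLpNorm (fun x => Du x - fderiv ℝ (v n) x) (ENNReal.ofReal p) volume ≤
      ∑ i, (eLpNorm (fun x => conv (scaled n K) (D (EuclideanSpace.single i 1)) x -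
        D (EuclideanSpace.single i 1) x) (ENNReal.ofReal p) volume +
        eLpNorm (conv (scaled (-n) K) (D (EuclideanSpace.single i 1)))
          (ENNReal.ofReal p) volume) := fun n => by
    refine (eLpNorm_mono_real (hle n)).trans ?_
    have h1 : (fun x => ∑ i, e n i x) = ∑ i, e n i := by
      ext x
      simp
    rw [h1]
    refine (eLpNorm_sum_le (fun i _ => ((hm n i).1.norm.add (hm' n i).1.norm)) hp1).trans
      (Finset.sum_le_sum fun i _ => ?_)
    refine (eLpNorm_add_le (hm n i).1.norm (hm' n i).1.norm hp1).trans (le_of_eq ?_)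
    rw [eLpNorm_norm, eLpNorm_norm]
  have hmeas : ∀ n, AEStronglyMeasurable (fun x => Du x - fderiv ℝ (v n) x) volume := fun n =>
    hDu.1.sub ((hv n).continuous_fderiv (by norm_num)).aestronglyMeasurable
  refine ⟨v, hv, fun n => ?_, fun n => ?_, ?_⟩
  · refine (realPart d).comp_memLp' (((hcU n).sub (hcU (-n))).ae_eq
      (Eventually.of_forall fun x => ?_))
    simp
  · have : MemLp (fun x => Du x - fderiv ℝ (v n) x) (ENNReal.ofReal p) volume := by
      refine ⟨hmeas n, (hle' n).trans_lt ?_⟩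
      exact ENNReal.sum_lt_top.2 fun i _ => ENNReal.add_lt_top.2 ⟨(hm n i).2, (hm' n i).2⟩
    refine (hDu.sub this).ae_eq (Eventually.of_forall fun x => ?_)
    simp
  · refine tendsto_of_tendsto_of_tendsto_of_le_of_le tendsto_const_nhds ?_ (fun _ => zero_le) hle'
    have : Tendsto (fun n : ℕ => ∑ i, (eLpNorm (fun x => conv (scaled n K)
        (D (EuclideanSpace.single i 1)) x - D (EuclideanSpace.single i 1) x)
        (ENNReal.ofReal p) volume + eLpNorm (conv (scaled (-n) K)
          (D (EuclideanSpace.single i 1))) (ENNReal.ofReal p) volume)) atTop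
        (𝓝 (∑ _i : Fin d, (0 + 0))) :=
      tendsto_finsetSum _ fun i _ => (tendsto_conv_scaled_sub hp₁.le (hD _) hK1 hd).add
        (tendsto_conv_scaled_neg hp₁ (hD _) K hd)
    simpa using this

end SobolevApproximation

/-! ### Frequency-localized functions -/

section Blocks

open LineDeriv Filter Topology

variable {d : ℕ} {F : Type*} [NormedAddCommGroup F] [NormedSpace ℂ F] [CompleteSpace F]

theorem conv_left_comm {p : ℝ} (hp : 1 < p) (K L : 𝓢(Space d, ℂ)) {f : Space d → F}
    (hf : MemLp f (ENNReal.ofReal p)) : conv K (conv L f) = conv L (conv K f) := by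
  rw [conv_conv hp K L hf, conv_conv hp L K hf, conv_comm]

/-- `f ∈ L^q` is reproduced by convolution with `κ`. -/
structure IsBlock (q : ℝ) (κ : 𝓢(Space d, ℂ)) (f : Space d → F) : Prop where
  memLp : MemLp f (ENNReal.ofReal q) volume
  conv_eq : conv κ f = f

namespace IsBlock

variable {q : ℝ} {κ : 𝓢(Space d, ℂ)} {f : Space d → F}

theorem isTempered (h : IsBlock q κ f) (hq : 1 < q) : IsTempered f :=
  IsTempered.of_memLp hq.le h.memLp

theorem conv (h : IsBlock q κ f) (hq : 1 < q) (M : 𝓢(Space d, ℂ)) :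
    IsBlock q κ (CommutatorEstimate.conv M f) :=
  ⟨memLp_conv hq.le M.integrable h.memLp, by rw [conv_left_comm hq κ M h.memLp, h.conv_eq]⟩

theorem contDiff (h : IsBlock q κ f) (hq : 1 < q) : ContDiff ℝ 1 f := by
  rw [← h.conv_eq]
  exact contDiff_one_iff_fderiv.2
    ⟨(h.isTempered hq).differentiable_conv κ, (h.isTempered hq).continuous_fderiv_conv κ⟩

theorem fderiv_apply (h : IsBlock q κ f) (hq : 1 < q) (x v : Space d) :
    fderiv ℝ f x v = CommutatorEstimate.conv (∂_{v} κ : 𝓢(Space d, ℂ)) f x := by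
  conv_lhs => rw [← h.conv_eq]
  exact (h.isTempered hq).fderiv_conv_apply κ x v

theorem memLp_fderiv_apply (h : IsBlock q κ f) (hq : 1 < q) (v : Space d) :
    MemLp (fun x => fderiv ℝ f x v) (ENNReal.ofReal q) volume := by
  simp only [h.fderiv_apply hq]
  exact memLp_conv hq.le (∂_{v} κ : 𝓢(Space d, ℂ)).integrable h.memLp

theorem conv_fderiv_apply (h : IsBlock q κ f) (hq : 1 < q) (M : 𝓢(Space d, ℂ)) (x v : Space d) :
    CommutatorEstimate.conv M (fun y => fderiv ℝ f y v) x =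
      fderiv ℝ (CommutatorEstimate.conv M f) x v := by
  simp only [(h.conv hq M).fderiv_apply hq, h.fderiv_apply hq]
  change CommutatorEstimate.conv M
    (CommutatorEstimate.conv (∂_{v} κ : 𝓢(Space d, ℂ)) f) x = _
  rw [conv_left_comm hq _ _ h.memLp]

theorem memLp_fderiv (h : IsBlock q κ f) (hq : 1 < q) :
    MemLp (fderiv ℝ f) (ENNReal.ofReal q) volume := by
  have h1 : MemLp (fun x => ∑ i : Fin d, ‖fderiv ℝ f x (EuclideanSpace.single i 1)‖)
      (ENNReal.ofReal q) volume :=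
    memLp_finsetSum _ fun i _ => (h.memLp_fderiv_apply hq _).norm
  refine h1.mono ((h.contDiff hq).continuous_fderiv (by norm_num)).aestronglyMeasurable
    (Eventually.of_forall fun x => (opNorm_le_sum_apply _).trans (le_abs_self _))

/-- Bernstein's inequality: the derivative falls on the reproducing kernel. -/
theorem norm_fderiv_le (h : IsBlock q κ f) (hq : 1 < q) {B : ℝ} (hB : ∀ᵐ x, ‖f x‖ ≤ B)
    (x : Space d) :
    ‖fderiv ℝ f x‖ ≤
      (∑ i : Fin d, ∫ z, ‖(∂_{EuclideanSpace.single i (1 : ℝ)} κ : 𝓢(Space d, ℂ)) z‖) * B := by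
  refine (opNorm_le_sum_apply _).trans ?_
  rw [Finset.sum_mul]
  refine Finset.sum_le_sum fun i _ => ?_
  rw [h.fderiv_apply hq]
  exact norm_conv_le (SchwartzMap.integrable _) hB x

end IsBlock

end Blocks

/-! ### Transposition and integration by parts -/

section Transposition

open Filter Topology

variable {d : ℕ} {F : Type*} [NormedAddCommGroup F] [NormedSpace ℂ F] [CompleteSpace F]

/-- On the Fourier side, `m(D)` composed with convolution by `κ` is convolution by `M`. Both
convolutions are moved to the test function, where inverse Fourier transforms of the symbols can be
compared. -/
theorem integral_transposedTest_smul_conv {m : Space d → ℂ} (hm : IsHomogeneousSymbol m)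
    (hd : 0 < d) {κ M : 𝓢(Space d, ℂ)} (hκM : ∀ ξ, 𝓕 M ξ = 𝓕 κ ξ * m ξ) {r : ℝ} (hr : 1 < r)
    {V : Space d → F} (hV : MemLp V (ENNReal.ofReal r) volume) (θ : 𝓢(Space d, ℂ)) :
    ∫ x, transposedTest m θ x • conv κ V x = ∫ x, θ x • conv M V x := by
  have hpq : r.HolderConjugate (r / (r - 1)) := Real.HolderConjugate.conjExponent hr
  have hneg : ∀ (K : 𝓢(Space d, ℂ)) ξ, 𝓕 (fun z => K (-z)) ξ = 𝓕 K (-ξ) := fun K ξ => by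
    rw [SchwartzMap.fourier_coe]
    exact Real.fourier_comp_linearIsometry (LinearIsometryEquiv.neg ℝ) K ξ
  rw [integral_smul_conv hpq κ.integrable (hm.memLp_transposedTest hd hpq.symm.lt θ) hV,
    integral_smul_conv hpq M.integrable (θ.memLp _ volume) hV]
  have h1 : conv (fun z => κ (-z)) (transposedTest m θ) = conv (fun z => M (-z)) θ := by
    have hθ : (θ : Space d → ℂ) = 𝓕⁻ (⇑(𝓕 θ : 𝓢(Space d, ℂ))) := by
      rw [← SchwartzMap.fourierInv_coe, FourierTransform.fourierInv_fourier_eq]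
    conv_rhs => rw [hθ]
    rw [transposedTest, conv_fourierInv κ.integrable.comp_neg
      (integrable_symbol_mul_fourier hm.comp_neg θ),
      conv_fourierInv M.integrable.comp_neg (𝓕 θ : 𝓢(Space d, ℂ)).integrable]
    congr 1
    ext ξ
    rw [hneg, hneg, hκM]
    ring
  rw [h1]

/-- The gradient decays at every order below `d + 1`. The order `d + 1/2` is selected to match the
weight in the Poincaré inequality. -/
theorem IsHomogeneousSymbol.transposedTest_regular {m : Space d → ℂ}
    (hm : IsHomogeneousSymbol m) (hd : 0 < d) (θ : 𝓢(Space d, ℂ)) :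
    Differentiable ℝ (transposedTest m θ) ∧
      ∃ C, ∀ x, ‖fderiv ℝ (transposedTest m θ) x‖ ≤ C * weight x := by
  obtain ⟨χ, hχ⟩ := exists_cutoff d
  obtain ⟨S, -, -, -, hdiff, hlim, hb⟩ := hm.comp_neg.exists_approx hχ hd θ
  obtain ⟨C, hC⟩ := hb (d + 1 / 2) (by positivity) (by linarith)
  exact ⟨hdiff, C, fun x => le_of_tendsto (hlim x).norm (Eventually.of_forall fun n => hC n x)⟩

theorem memLp_weight {r : ℝ} (hr : 1 ≤ r) :
    MemLp (weight (d := d)) (ENNReal.ofReal r) volume :=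
  memLp_one_add_norm_rpow_neg (by linarith) (by
    have : (0 : ℝ) ≤ d := Nat.cast_nonneg d
    nlinarith)

theorem memLp_fderiv_of_le_weight {ψ : Space d → ℂ} {C : ℝ}
    (hC : ∀ x, ‖fderiv ℝ ψ x‖ ≤ C * weight x) {r : ℝ} (hr : 1 ≤ r) :
    MemLp (fderiv ℝ ψ) (ENNReal.ofReal r) volume :=
  ((memLp_weight hr).const_mul C).mono (measurable_fderiv ℝ ψ).aestronglyMeasurable
    (Eventually.of_forall fun x => (hC x).trans (le_abs_self _))

theorem divergence_eq_sum (Du : Space d → Space d →L[ℝ] Space d) (x : Space d) :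
    divergence Du x = ∑ i, Du x (EuclideanSpace.single i 1) i := by
  rw [divergence, LinearMap.trace_eq_sum_inner _ (EuclideanSpace.basisFun (Fin d) ℝ)]
  simp [EuclideanSpace.inner_single_left]

theorem abs_divergence_le (Du : Space d → Space d →L[ℝ] Space d) (x : Space d) :
    |divergence Du x| ≤ d * ‖Du x‖ := by
  rw [divergence_eq_sum]
  refine (Finset.abs_sum_le_sum_abs _ _).trans ?_
  refine (Finset.sum_le_card_nsmul _ _ ‖Du x‖ fun i _ => ?_).trans (by simp)
  refine (PiLp.norm_apply_le (Du x (EuclideanSpace.single i 1)) i).trans ?_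
  simpa using (Du x).le_opNorm (EuclideanSpace.single i 1)

/-- The function `div (ψ u) f`, for a scalar function `ψ`. -/
def scalarDivMul (u : Space d → Space d) (Du : Space d → Space d →L[ℝ] Space d)
    (ψ : Space d → ℂ) (f : Space d → F) (x : Space d) : F :=
  fderiv ℝ ψ x (u x) • f x + ((divergence Du x : ℝ) : ℂ) • ψ x • f x

/-- Integration by parts coordinate by coordinate, for the test function `u_i ψ` against `∂_i f`. No
compact support is needed: the three `L^r` assumptions and Hölder make every product integrable. -/
theorem integral_smul_fderiv_apply {r s : ℝ} (hrs : r.HolderConjugate s) {ψ : Space d → ℂ}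
    (hψd : Differentiable ℝ ψ) (hψ : MemLp ψ (ENNReal.ofReal s) volume)
    (hψ' : MemLp (fderiv ℝ ψ) (ENNReal.ofReal s) volume) {u : Space d → Space d}
    (hu : ContDiff ℝ 1 u) {f : Space d → F} (hf : ContDiff ℝ 1 f)
    (h0 : MemLp (fun x => ‖u x‖ * ‖f x‖) (ENNReal.ofReal r) volume)
    (h1 : MemLp (fun x => ‖fderiv ℝ u x‖ * ‖f x‖) (ENNReal.ofReal r) volume)
    (h2 : MemLp (fun x => ‖u x‖ * ‖fderiv ℝ f x‖) (ENNReal.ofReal r) volume) :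
    ∫ x, ψ x • fderiv ℝ f x (u x) = - ∫ x, scalarDivMul u (fderiv ℝ u) ψ f x := by
  set e : Fin d → Space d := fun i => EuclideanSpace.single i 1
  have hec : ∀ x : Space d, x = ∑ i, x i • e i := fun x => by
    simpa using ((EuclideanSpace.basisFun (Fin d) ℝ).sum_repr x).symm
  have hen : ∀ i, ‖e i‖ = 1 := fun i => by simp [e]
  have hui : ∀ i, ContDiff ℝ 1 fun x => u x i := fun i => (contDiff_piLp_apply 2).comp hu
  have hfc : Continuous (fderiv ℝ f) := hf.continuous_fderiv (by norm_num)
  have huc : Continuous (fderiv ℝ u) := hu.continuous_fderiv (by norm_num)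
  have hucc := hu.continuous
  have hffc := hf.continuous
  have hab : ∀ i x, |u x i| ≤ ‖u x‖ := fun i x => PiLp.norm_apply_le (u x) i
  have hDui : ∀ i x, fderiv ℝ (fun x => u x i) x (e i) = fderiv ℝ u x (e i) i := fun i x => by
    have := (EuclideanSpace.proj (𝕜 := ℝ) i).hasFDerivAt.comp x
      (hu.differentiable (by norm_num) x).hasFDerivAt
    have h3 : fderiv ℝ (fun x => u x i) x = _ := this.fderiv
    rw [h3]
    rfl
  have a1 :
        ∀ i, MemLp (fun x => u x i • fderiv ℝ f x (e i)) (ENNReal.ofReal r) volume := fun i => by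
    refine h2.mono (Continuous.aestronglyMeasurable (by fun_prop))
      (Eventually.of_forall fun x => ?_)
    rw [norm_smul, norm_mul, norm_norm, norm_norm]
    refine mul_le_mul (hab i x) ?_ (norm_nonneg _) (norm_nonneg _)
    simpa [hen] using (fderiv ℝ f x).le_opNorm (e i)
  have a2 : ∀ i, MemLp (fun x => u x i • f x) (ENNReal.ofReal r) volume := fun i => by
    refine h0.mono (Continuous.aestronglyMeasurable (by fun_prop))
      (Eventually.of_forall fun x => ?_)
    rw [norm_smul, norm_mul, norm_norm, norm_norm]
    exact mul_le_mul_of_nonneg_right (hab i x) (norm_nonneg _)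
  have a3 :
        ∀ i, MemLp (fun x => fderiv ℝ u x (e i) i • f x) (ENNReal.ofReal r) volume := fun i => by
    refine h1.mono (Continuous.aestronglyMeasurable (by fun_prop))
      (Eventually.of_forall fun x => ?_)
    rw [norm_smul, norm_mul, norm_norm, norm_norm]
    refine mul_le_mul_of_nonneg_right ((PiLp.norm_apply_le _ i).trans ?_) (norm_nonneg _)
    simpa [hen] using (fderiv ℝ u x).le_opNorm (e i)
  have hψi : ∀ i, MemLp (fun x => fderiv ℝ ψ x (e i)) (ENNReal.ofReal s) volume := fun i =>
    (ContinuousLinearMap.apply ℝ ℂ (e i)).comp_memLp' hψ'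
  have key : ∀ i, ∫ x, ψ x • (u x i • fderiv ℝ f x (e i)) =
      - ∫ x, (fderiv ℝ ψ x (e i) • (u x i • f x) + ψ x • (fderiv ℝ u x (e i) i • f x)) :=
        fun i => by
    have hda : ∀ x, fderiv ℝ (fun x => u x i • ψ x) x (e i) =
        u x i • fderiv ℝ ψ x (e i) + fderiv ℝ u x (e i) i • ψ x := fun x => by
      rw [fderiv_fun_smul ((hui i).differentiable (by norm_num) x) (hψd x)]
      simp [hDui]
    have hcomm : ∀ x, (u x i • ψ x) • fderiv ℝ f x (e i) = ψ x • (u x i • fderiv ℝ f x (e i)) :=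
      fun x => by rw [smul_assoc, smul_comm]
    have hcomm' : ∀ x, (u x i • ψ x) • f x = ψ x • (u x i • f x) :=
      fun x => by rw [smul_assoc, smul_comm]
    have hda' : ∀ x, fderiv ℝ (fun x => u x i • ψ x) x (e i) • f x =
        fderiv ℝ ψ x (e i) • (u x i • f x) + ψ x • (fderiv ℝ u x (e i) i • f x) := fun x => by
      rw [hda, add_smul, smul_assoc, smul_comm, smul_assoc (fderiv ℝ u x (e i) i), smul_comm (ψ x)]
    have := integral_smul_fderiv_eq_neg_fderiv_smul_of_integrable (μ := volume)
      (f := fun x => u x i • ψ x) (g := f) (v := e i) ?_ ?_ ?_ (fun x _ => ?_) (fun x _ => ?_)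
    · simp only [hda', hcomm] at this
      exact this
    · simp only [hda']
      exact (integrable_smul_of_memLp hrs (hψi i) (a2 i)).add
        (integrable_smul_of_memLp hrs hψ (a3 i))
    · simp only [hcomm]
      exact integrable_smul_of_memLp hrs hψ (a1 i)
    · simp only [hcomm']
      exact integrable_smul_of_memLp hrs hψ (a2 i)
    · exact ((hui i).differentiable (by norm_num) x).smul (hψd x)
    · exact hf.differentiable (by norm_num) x
  have e1 : ∀ x, ψ x • fderiv ℝ f x (u x) = ∑ i, ψ x • (u x i • fderiv ℝ f x (e i)) := fun x => by
    conv_lhs => rw [hec (u x)]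
    simp [Finset.smul_sum]
  have e2 : ∀ x, scalarDivMul u (fderiv ℝ u) ψ f x =
      ∑ i, (fderiv ℝ ψ x (e i) • (u x i • f x) + ψ x • (fderiv ℝ u x (e i) i • f x)) := fun x => by
    rw [scalarDivMul, divergence_eq_sum]
    conv_lhs => rw [hec (u x)]
    rw [Finset.sum_add_distrib]
    congr 1
    · rw [map_sum, Finset.sum_smul]
      refine Finset.sum_congr rfl fun i _ => ?_
      rw [map_smul, smul_assoc, smul_comm]
    · rw [smul_comm]
      push_cast
      rw [Finset.sum_smul, Finset.smul_sum]
      rfl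
  have b : ∀ i, Integrable (fun x =>
      fderiv ℝ ψ x (e i) • (u x i • f x) + ψ x • (fderiv ℝ u x (e i) i • f x)) := fun i =>
    (integrable_smul_of_memLp hrs (hψi i) (a2 i)).add (integrable_smul_of_memLp hrs hψ (a3 i))
  simp only [e1, e2]
  rw [integral_finsetSum _ fun i _ => integrable_smul_of_memLp hrs hψ (a1 i),
    integral_finsetSum _ fun i _ => b i, ← Finset.sum_neg_distrib]
  exact Finset.sum_congr rfl fun i _ => key i

end Transposition

/-! ### The commutator on a single block -/

section LocalCommutator

open Filter Topology

variable {d : ℕ} {F : Type*} [NormedAddCommGroup F] [NormedSpace ℂ F] [CompleteSpace F]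

/-- The commutator of `u · ∇` with the convolution by `K`, applied to `f`. -/
def localCommutator (K : Space d → ℂ) (u : Space d → Space d) (f : Space d → F) (x : Space d) : F :=
  ∫ z, K z • fderiv ℝ f (x - z) (u x - u (x - z))

theorem aestronglyMeasurable_comp_sub' {G : Type*} [NormedAddCommGroup G] {f : Space d → G}
    (hf : AEStronglyMeasurable f volume) :
    AEStronglyMeasurable (Function.uncurry fun x z : Space d => f (x - z))
      (volume.prod volume) :=
  hf.comp_quasiMeasurePreserving (quasiMeasurePreserving_sub _ _)

/-! ### `L^p` bounds for the local commutator. -/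

section Estimate

variable {p : ℝ} {u : Space d → Space d} {f : Space d → F} {L : ℝ} {N : ℝ≥0∞}

theorem aestronglyMeasurable_fderiv_apply_sub (hu : AEStronglyMeasurable u volume)
    (hf : ContDiff ℝ 1 f) :
    AEStronglyMeasurable (Function.uncurry fun x z : Space d =>
      fderiv ℝ f (x - z) (u x - u (x - z))) (volume.prod volume) := by
  have hfc : Continuous (fderiv ℝ f) := hf.continuous_fderiv (by norm_num)
  exact isBoundedBilinearMap_apply.continuous.comp_aestronglyMeasurable
    ((aestronglyMeasurable_comp_sub hfc.aestronglyMeasurable).prodMk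
      (hu.comp_fst.sub (aestronglyMeasurable_comp_sub' hu)))

theorem eLpNorm_fderiv_apply_sub_le (hfL : ∀ x, ‖fderiv ℝ f x‖ ≤ L)
    (hN : ∀ z, eLpNorm (fun x => u (x - z) - u x) (ENNReal.ofReal p) volume ≤ ‖z‖ₑ * N)
    (z : Space d) :
    eLpNorm (fun x => fderiv ℝ f (x - z) (u x - u (x - z))) (ENNReal.ofReal p) volume ≤
      ‖z‖ₑ * (ENNReal.ofReal L * N) := by
  have h1 : eLpNorm (fun x => fderiv ℝ f (x - z) (u x - u (x - z))) (ENNReal.ofReal p) volume ≤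
      ENNReal.ofReal L * eLpNorm (fun x => u (x - z) - u x) (ENNReal.ofReal p) volume := by
    refine eLpNorm_le_mul_eLpNorm_of_ae_le_mul (Eventually.of_forall fun x => ?_) _
    refine ((fderiv ℝ f (x - z)).le_opNorm _).trans ?_
    rw [norm_sub_rev]
    exact mul_le_mul_of_nonneg_right (hfL _) (norm_nonneg _)
  refine h1.trans (le_trans (mul_le_mul_right (hN z) _) (le_of_eq (by ring)))

/-- Minkowski with weight `a = |z|`: the velocity difference is paid for by the first moment of the
kernel, and the gradient of `f` by its supremum. -/
theorem eLpNorm_localCommutator_le (hp : 1 ≤ p) (hd : 0 < d) (K : 𝓢(Space d, ℂ))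
    (hu : AEStronglyMeasurable u volume) (hf : ContDiff ℝ 1 f) (hfL : ∀ x, ‖fderiv ℝ f x‖ ≤ L)
    (hN : ∀ z, eLpNorm (fun x => u (x - z) - u x) (ENNReal.ofReal p) volume ≤ ‖z‖ₑ * N) :
    eLpNorm (localCommutator K u f) (ENNReal.ofReal p) volume ≤
      (∫⁻ z, ‖K z‖ₑ * ‖z‖ₑ) * (ENNReal.ofReal L * N) :=
  eLpNorm_integral_smul_le (H := fun x z => fderiv ℝ f (x - z) (u x - u (x - z))) hp
    K.integrable.1 measurable_enorm.aemeasurable (aestronglyMeasurable_fderiv_apply_sub hu hf)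
    (ae_enorm_ne_zero hd) (by simp)
    (Eventually.of_forall fun z => eLpNorm_fderiv_apply_sub_le hfL hN z)

theorem ae_integrable_localCommutator (hp : 1 ≤ p) (hd : 0 < d) (K : 𝓢(Space d, ℂ))
    (hu : AEStronglyMeasurable u volume) (hf : ContDiff ℝ 1 f) (hfL : ∀ x, ‖fderiv ℝ f x‖ ≤ L)
    (hN : ∀ z, eLpNorm (fun x => u (x - z) - u x) (ENNReal.ofReal p) volume ≤ ‖z‖ₑ * N)
    (hNt : N ≠ ∞) :
    ∀ᵐ x, Integrable fun z => K z • fderiv ℝ f (x - z) (u x - u (x - z)) :=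
  ae_integrable_smul_of_minkowski (H := fun x z => fderiv ℝ f (x - z) (u x - u (x - z))) hp
    K.integrable.1 measurable_enorm.aemeasurable (aestronglyMeasurable_fderiv_apply_sub hu hf)
    (ae_enorm_ne_zero hd) (by simp)
    (Eventually.of_forall fun z => eLpNorm_fderiv_apply_sub_le hfL hN z)
    (lintegral_mul_enorm_ne_top K) (ENNReal.mul_ne_top ENNReal.ofReal_ne_top hNt)

theorem memLp_localCommutator (hp : 1 ≤ p) (hd : 0 < d) (K : 𝓢(Space d, ℂ))
    (hu : AEStronglyMeasurable u volume) (hf : ContDiff ℝ 1 f) (hfL : ∀ x, ‖fderiv ℝ f x‖ ≤ L)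
    (hN : ∀ z, eLpNorm (fun x => u (x - z) - u x) (ENNReal.ofReal p) volume ≤ ‖z‖ₑ * N)
    (hNt : N ≠ ∞) : MemLp (localCommutator K u f) (ENNReal.ofReal p) volume :=
  ⟨aestronglyMeasurable_integral_smul K.integrable.1 (aestronglyMeasurable_fderiv_apply_sub hu hf),
    (eLpNorm_localCommutator_le hp hd K hu hf hfL hN).trans_lt
      (ENNReal.mul_lt_top (lintegral_mul_enorm_ne_top K).lt_top
        (ENNReal.mul_lt_top ENNReal.ofReal_lt_top hNt.lt_top))⟩

end Estimate

/-- The integral form makes sense for every weakly differentiable `u` with gradient in `L^p`. The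
splitting into the two terms of a commutator requires `u·∇f` to be convolvable by itself, whence the
assumption on it. -/
theorem localCommutator_eq_of_isBlock {q r : ℝ} {κ : 𝓢(Space d, ℂ)} {f : Space d → F}
    (h : IsBlock q κ f) (hq : 1 < q) (hr : 1 ≤ r) (K : 𝓢(Space d, ℂ)) {u : Space d → Space d}
    (hV : MemLp (fun x => fderiv ℝ f x (u x)) (ENNReal.ofReal r) volume) (x : Space d) :
    localCommutator K u f x =
      fderiv ℝ (conv K f) x (u x) - conv K (fun y => fderiv ℝ f y (u y)) x := by
  rw [← h.conv_fderiv_apply hq]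
  simp only [localCommutator, map_sub, smul_sub]
  rw [integral_sub]
  · rfl
  · exact (IsTempered.of_memLp hq.le (h.memLp_fderiv_apply hq (u x))).integrable_smul_comp_sub K x
  · exact (IsTempered.of_memLp hr hV).integrable_smul_comp_sub K x

/-- The defect in the weak formulation of the commutator identity. -/
def commutatorDefect (m : Space d → ℂ) (κ M θ : 𝓢(Space d, ℂ)) (u : Space d → Space d)
    (Du : Space d → Space d →L[ℝ] Space d) (f : Space d → F) : F :=
  ((∫ x, transposedTest m θ x • localCommutator κ u f x) -
      ∫ x, θ x • localCommutator M u f x) +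
    ((∫ x, scalarDivMul u Du (transposedTest m θ) f x) - ∫ x, scalarDivMul u Du θ (conv M f) x)

/-- Here all terms are genuine functions. Since `κ * f = f`, the local commutator with `κ` equals
`u·∇f - κ * (u·∇f)`. Integration by parts removes `u·∇f` and `u·∇(M * f)` against the divergence
terms, and `integral_transposedTest_smul_conv` cancels the two convolutions. The integrability
hypothesis ranges over bounded blocks because it is needed for both `f` and `M * f`. -/
theorem commutatorDefect_eq_zero_of_contDiff {m : Space d → ℂ} (hm : IsHomogeneousSymbol m)
    (hd : 0 < d) {κ M : 𝓢(Space d, ℂ)} (hκM : ∀ ξ, 𝓕 M ξ = 𝓕 κ ξ * m ξ) {q r : ℝ} (hq : 1 < q)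
    (hr : 1 < r) {f : Space d → F} (h : IsBlock q κ f) {u : Space d → Space d}
    (hu : ContDiff ℝ 1 u)
    (h0 : ∀ g : Space d → F, IsBlock q κ g → (∃ B, ∀ x, ‖g x‖ ≤ B) →
      MemLp (fun x => ‖u x‖ * ‖g x‖) (ENNReal.ofReal r) volume ∧
      MemLp (fun x => ‖fderiv ℝ u x‖ * ‖g x‖) (ENNReal.ofReal r) volume ∧
      MemLp (fun x => ‖u x‖ * ‖fderiv ℝ g x‖) (ENNReal.ofReal r) volume)
    (hf : ∃ B, ∀ x, ‖f x‖ ≤ B) (θ : 𝓢(Space d, ℂ)) :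
    commutatorDefect m κ M θ u (fderiv ℝ u) f = 0 := by
  have hrs : r.HolderConjugate (r / (r - 1)) := Real.HolderConjugate.conjExponent hr
  have hs := hrs.symm.lt
  obtain ⟨hψd, C, hC⟩ := hm.transposedTest_regular hd θ
  have hψ := hm.memLp_transposedTest hd hs θ
  have hψ' := memLp_fderiv_of_le_weight hC hs.le
  have hθ : MemLp θ (ENNReal.ofReal (r / (r - 1))) volume := θ.memLp _ volume
  have hθ' : MemLp (fderiv ℝ θ) (ENNReal.ofReal (r / (r - 1))) volume := by
    exact (SchwartzMap.fderivCLM ℝ (Space d) ℂ θ).memLp _ volume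
  have hg : IsBlock q κ (conv M f) := h.conv hq M
  have hgB : ∃ B, ∀ x, ‖conv M f x‖ ≤ B := by
    obtain ⟨B, hB⟩ := hf
    exact ⟨_, norm_conv_le M.integrable (Eventually.of_forall hB)⟩
  obtain ⟨a0, a1, a2⟩ := h0 f h hf
  obtain ⟨b0, b1, b2⟩ := h0 _ hg hgB
  have hV : ∀ g : Space d → F, IsBlock q κ g →
      MemLp (fun x => ‖u x‖ * ‖fderiv ℝ g x‖) (ENNReal.ofReal r) volume →
      MemLp (fun x => fderiv ℝ g x (u x)) (ENNReal.ofReal r) volume := fun g hg hg2 => by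
    refine hg2.mono ((((hg.contDiff hq).continuous_fderiv (by norm_num)).clm_apply
      hu.continuous).aestronglyMeasurable) (Eventually.of_forall fun x => ?_)
    rw [norm_mul, norm_norm, norm_norm, mul_comm]
    exact (fderiv ℝ g x).le_opNorm _
  have hVf := hV f h a2
  have hVg := hV _ hg b2
  have i1 := integral_smul_fderiv_apply hrs hψd hψ hψ' hu (h.contDiff hq) a0 a1 a2
  have i2 := integral_smul_fderiv_apply hrs θ.differentiable hθ hθ' hu (hg.contDiff hq) b0 b1 b2
  have i3 := integral_transposedTest_smul_conv hm hd hκM hr hVf θ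
  rw [commutatorDefect]
  simp only [localCommutator_eq_of_isBlock h hq hr.le _ hVf, smul_sub, h.conv_eq]
  rw [integral_sub (integrable_smul_of_memLp hrs hψ hVf)
      (integrable_smul_of_memLp hrs hψ (memLp_conv hr.le κ.integrable hVf)),
    integral_sub (integrable_smul_of_memLp hrs hθ hVg)
      (integrable_smul_of_memLp hrs hθ (memLp_conv hr.le M.integrable hVf)), i1, i2, i3]
  abel

theorem commutatorDefect_eq_zero_of_memLp {m : Space d → ℂ} (hm : IsHomogeneousSymbol m)
    (hd : 0 < d) {κ M : 𝓢(Space d, ℂ)} (hκM : ∀ ξ, 𝓕 M ξ = 𝓕 κ ξ * m ξ) {p q : ℝ} (hq : 1 < q)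
    (hp : 1 < p) {f : Space d → F} (h : IsBlock q κ f) {u : Space d → Space d}
    (hu : ContDiff ℝ 1 u) (hup : MemLp u (ENNReal.ofReal p) volume)
    (hDu : MemLp (fderiv ℝ u) (ENNReal.ofReal p) volume)
    (hf : ∃ B, ∀ x, ‖f x‖ ≤ B) (θ : 𝓢(Space d, ℂ)) :
    commutatorDefect m κ M θ u (fderiv ℝ u) f = 0 := by
  refine commutatorDefect_eq_zero_of_contDiff hm hd hκM hq hp h hu (fun g hg ⟨B, hB⟩ => ?_) hf θ
  have hgc := hg.contDiff hq
  have hgc' : Continuous (fderiv ℝ g) := hgc.continuous_fderiv (by norm_num)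
  have huc' : Continuous (fderiv ℝ u) := hu.continuous_fderiv (by norm_num)
  have hB' := hg.norm_fderiv_le hq (Eventually.of_forall hB)
  have key : ∀ {H : Type _} [NormedAddCommGroup H] {G : Type _} [NormedAddCommGroup G]
      {a : Space d → H} {b : Space d → G} {B : ℝ}, MemLp a (ENNReal.ofReal p) volume →
      Continuous b → (∀ x, ‖b x‖ ≤ B) →
      MemLp (fun x => ‖a x‖ * ‖b x‖) (ENNReal.ofReal p) volume := by
    intro H _ G _ a b B ha hb hbB
    refine (ha.norm.const_mul B).mono (ha.1.norm.mul hb.norm.aestronglyMeasurable)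
      (Eventually.of_forall fun x => ?_)
    rw [norm_mul, norm_mul, norm_norm, norm_norm, mul_comm]
    exact mul_le_mul_of_nonneg_right ((hbB x).trans (le_abs_self B)) (norm_nonneg _)
  exact ⟨key hup hgc.continuous hB, key hDu hgc.continuous hB, key hup hgc' hB'⟩

/-- Constant fields are not in `L^p`, but then the products are controlled by the integrability of
the block itself, so the exponent `q` takes the place of `p`. -/
theorem commutatorDefect_const {m : Space d → ℂ} (hm : IsHomogeneousSymbol m)
    (hd : 0 < d) {κ M : 𝓢(Space d, ℂ)} (hκM : ∀ ξ, 𝓕 M ξ = 𝓕 κ ξ * m ξ) {q : ℝ} (hq : 1 < q)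
    {f : Space d → F} (h : IsBlock q κ f) (hf : ∃ B, ∀ x, ‖f x‖ ≤ B) (c : Space d)
    (θ : 𝓢(Space d, ℂ)) :
    commutatorDefect m κ M θ (fun _ => c) (fderiv ℝ fun _ => c) f = 0 := by
  refine commutatorDefect_eq_zero_of_contDiff hm hd hκM hq hq h contDiff_const
    (fun g hg _ => ⟨hg.memLp.norm.const_mul _, ?_, (hg.memLp_fderiv hq).norm.const_mul _⟩) hf θ
  simp

end LocalCommutator

/-! ### The weak form of the commutator identity -/

section WeakIdentity

open Filter Topology

variable {d : ℕ} {F : Type*} [NormedAddCommGroup F] [NormedSpace ℂ F] [CompleteSpace F]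

/-- Test functions with the decay of `m(-D) θ`, for Schwartz `θ` and `m` homogeneous of degree
`0`. -/
structure IsWeightedTest (ψ : Space d → ℂ) : Prop where
  differentiable : Differentiable ℝ ψ
  memLp : ∀ r : ℝ, 1 < r → MemLp ψ (ENNReal.ofReal r) volume
  exists_bound : ∃ C : ℝ≥0, ∀ x, ‖fderiv ℝ ψ x‖ ≤ C * weight x

theorem isWeightedTest_schwartz (θ : 𝓢(Space d, ℂ)) : IsWeightedTest θ := by
  refine ⟨θ.differentiable, fun r _ => θ.memLp _ volume, ?_⟩
  obtain ⟨C, hC, h⟩ := schwartz_rpow_decay θ (d + 1 / 2)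
  exact ⟨⟨C, hC⟩, fun x => (h x).2⟩

theorem IsHomogeneousSymbol.isWeightedTest {m : Space d → ℂ} (hm : IsHomogeneousSymbol m)
    (hd : 0 < d) (θ : 𝓢(Space d, ℂ)) : IsWeightedTest (transposedTest m θ) := by
  obtain ⟨hψd, C, hC⟩ := hm.transposedTest_regular hd θ
  refine ⟨hψd, fun r hr => hm.memLp_transposedTest hd hr θ, C.toNNReal, fun x =>
    (hC x).trans ?_⟩
  exact mul_le_mul_of_nonneg_right (Real.le_coe_toNNReal C) (weight_pos x).le

/-- Majorant of the multiplier of `f` in `div (ψ u) f`. -/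
def divMajorant (u : Space d → Space d) (Du : Space d → Space d →L[ℝ] Space d)
    (ψ : Space d → ℂ) (x : Space d) : ℝ :=
  ‖fderiv ℝ ψ x‖ * ‖u x‖ + d * (‖Du x‖ * ‖ψ x‖)

theorem divMajorant_nonneg (u : Space d → Space d) (Du : Space d → Space d →L[ℝ] Space d)
    (ψ : Space d → ℂ) (x : Space d) : 0 ≤ divMajorant u Du ψ x := by
  unfold divMajorant
  positivity

theorem norm_scalarDivMul_le (u : Space d → Space d) (Du : Space d → Space d →L[ℝ] Space d)
    (ψ : Space d → ℂ) (f : Space d → F) (x : Space d) :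
    ‖scalarDivMul u Du ψ f x‖ ≤ divMajorant u Du ψ x * ‖f x‖ := by
  rw [scalarDivMul, divMajorant, add_mul]
  refine (norm_add_le _ _).trans (add_le_add ?_ ?_)
  · rw [norm_smul]
    exact mul_le_mul_of_nonneg_right ((fderiv ℝ ψ x).le_opNorm _) (norm_nonneg _)
  · rw [norm_smul, norm_smul, Complex.norm_real, Real.norm_eq_abs, ← mul_assoc, ← mul_assoc]
    gcongr
    exact abs_divergence_le Du x

theorem aestronglyMeasurable_divergence {Du : Space d → Space d →L[ℝ] Space d}
    (h : AEStronglyMeasurable Du volume) : AEStronglyMeasurable (divergence Du) volume := by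
  have : divergence Du = fun x => ∑ i, Du x (EuclideanSpace.single i 1) i := by
    ext x
    exact divergence_eq_sum Du x
  rw [this]
  have hc : Continuous fun L : Space d →L[ℝ] Space d =>
      ∑ i, L (EuclideanSpace.single i 1) i := by fun_prop
  exact hc.comp_aestronglyMeasurable h

theorem aestronglyMeasurable_scalarDivMul {u : Space d → Space d}
    {Du : Space d → Space d →L[ℝ] Space d} {ψ : Space d → ℂ} {f : Space d → F}
    (hu : AEStronglyMeasurable u volume) (hDu : AEStronglyMeasurable Du volume)
    (hψ : Differentiable ℝ ψ) (hf : AEStronglyMeasurable f volume) :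
    AEStronglyMeasurable (scalarDivMul u Du ψ f) volume := by
  have h1 : AEStronglyMeasurable (fun x => fderiv ℝ ψ x (u x)) volume :=
    isBoundedBilinearMap_apply.continuous.comp_aestronglyMeasurable
      ((measurable_fderiv ℝ ψ).aestronglyMeasurable.prodMk hu)
  exact (h1.smul hf).add
    ((Complex.continuous_ofReal.comp_aestronglyMeasurable (aestronglyMeasurable_divergence hDu)).smul
      (hψ.continuous.aestronglyMeasurable.smul hf))

theorem aestronglyMeasurable_divMajorant {u : Space d → Space d}
    {Du : Space d → Space d →L[ℝ] Space d} {ψ : Space d → ℂ}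
    (hu : AEStronglyMeasurable u volume) (hDu : AEStronglyMeasurable Du volume)
    (hψ : Differentiable ℝ ψ) : AEStronglyMeasurable (divMajorant u Du ψ) volume :=
  ((measurable_fderiv ℝ ψ).aestronglyMeasurable.norm.mul hu.norm).add
    ((hDu.norm.mul hψ.continuous.aestronglyMeasurable.norm).const_mul _)

theorem lintegral_enorm_smul_le {p s : ℝ} (hps : p.HolderConjugate s) {ψ : Space d → ℂ}
    {g : Space d → F} (hψ : AEStronglyMeasurable ψ volume) (hg : AEStronglyMeasurable g volume) :
    ∫⁻ x, ‖ψ x • g x‖ₑ ≤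
      eLpNorm ψ (ENNReal.ofReal s) volume * eLpNorm g (ENNReal.ofReal p) volume := by
  have := holderTriple_ofReal hps
  rw [← eLpNorm_one_eq_lintegral_enorm]
  exact eLpNorm_smul_le_mul_eLpNorm hg hψ

theorem lintegral_divMajorant_le {p s : ℝ} (hps : p.HolderConjugate s) {u : Space d → Space d}
    {Du : Space d → Space d →L[ℝ] Space d} {ψ : Space d → ℂ} (hψ : Differentiable ℝ ψ)
    (hDu : AEStronglyMeasurable Du volume) {C : ℝ≥0}
    (hC : ∀ x, ‖fderiv ℝ ψ x‖ ≤ C * weight x) :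
    ∫⁻ x, ‖divMajorant u Du ψ x‖ₑ ≤ C * (∫⁻ x, ‖u x‖ₑ * ENNReal.ofReal (weight x)) +
      d * (eLpNorm ψ (ENNReal.ofReal s) volume * eLpNorm Du (ENNReal.ofReal p) volume) := by
  have h1 : ∀ x, ‖divMajorant u Du ψ x‖ₑ ≤
      C * (‖u x‖ₑ * ENNReal.ofReal (weight x)) + d * ‖ψ x • (‖Du x‖ : ℂ)‖ₑ := fun x => by
    refine (enorm_add_le _ _).trans (add_le_add ?_ (le_of_eq ?_))
    · rw [enorm_mul, enorm_norm, enorm_norm, mul_comm, mul_left_comm]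
      refine mul_le_mul_right ?_ _
      rw [← ofReal_norm, ← ENNReal.ofReal_coe_nnreal, ← ENNReal.ofReal_mul C.coe_nonneg]
      exact ENNReal.ofReal_le_ofReal (hC x)
    · rw [enorm_mul, enorm_mul, enorm_norm, enorm_norm, enorm_smul, mul_comm ‖ψ x‖ₑ]
      congr 1
      · simp
      · congr 1
        rw [← ofReal_norm, ← ofReal_norm, Complex.norm_real, norm_norm]
  refine (lintegral_mono h1).trans ?_
  have hDm : AEStronglyMeasurable (fun x => (‖Du x‖ : ℂ)) volume :=
    Complex.continuous_ofReal.comp_aestronglyMeasurable hDu.norm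
  have hψm := hψ.continuous.aestronglyMeasurable (μ := volume)
  have hm : AEMeasurable (fun x => (d : ℝ≥0∞) * ‖ψ x • (‖Du x‖ : ℂ)‖ₑ) volume :=
    (hψm.smul hDm).enorm.const_mul _
  rw [lintegral_add_right' _ hm,
    lintegral_const_mul' _ _ ENNReal.coe_ne_top, lintegral_const_mul' _ _ (by simp)]
  gcongr
  refine (lintegral_enorm_smul_le hps hψm hDm).trans (le_of_eq ?_)
  congr 1
  exact eLpNorm_congr_norm_ae (Eventually.of_forall fun x => by simp)

theorem lintegral_scalarDivMul_le {u : Space d → Space d}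
    {Du : Space d → Space d →L[ℝ] Space d} {ψ : Space d → ℂ} {f : Space d → F} {B : ℝ}
    (hf : ∀ᵐ x, ‖f x‖ ≤ B) :
    ∫⁻ x, ‖scalarDivMul u Du ψ f x‖ₑ ≤
      ENNReal.ofReal B * ∫⁻ x, ‖divMajorant u Du ψ x‖ₑ := by
  rw [← lintegral_const_mul' _ _ ENNReal.ofReal_ne_top]
  refine lintegral_mono_ae (hf.mono fun x hx => ?_)
  rw [← ofReal_norm, ← ofReal_norm, Real.norm_of_nonneg (divMajorant_nonneg u Du ψ x), mul_comm,
    ← ENNReal.ofReal_mul (divMajorant_nonneg u Du ψ x)]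
  exact ENNReal.ofReal_le_ofReal ((norm_scalarDivMul_le u Du ψ f x).trans
    (mul_le_mul_of_nonneg_left hx (divMajorant_nonneg u Du ψ x)))

theorem lintegral_weight_ne_top : ∫⁻ x : Space d, ENNReal.ofReal (weight x) ≠ ∞ := by
  have h := (memLp_one_iff_integrable.1 (by simpa using memLp_weight (d := d) le_rfl)).2
  rw [hasFiniteIntegral_iff_enorm] at h
  refine ne_of_lt (lt_of_le_of_lt (le_of_eq ?_) h)
  exact lintegral_congr fun x => (Real.enorm_eq_ofReal (weight_pos x).le).symm

/-- The constant subtracted in the Poincaré inequality can be put back, because the weight itself is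
integrable. -/
theorem IsWeakGradient.lintegral_weight_ne_top {p : ℝ} (hp₁ : 1 ≤ p) (hp₂ : p < 2) (hd : 0 < d)
    {u : Space d → Space d} {Du : Space d → Space d →L[ℝ] Space d} (h : IsWeakGradient u Du)
    (hDu : MemLp Du (ENNReal.ofReal p) volume) :
    ∫⁻ x, ‖u x‖ₑ * ENNReal.ofReal (weight x) ≠ ∞ := by
  have hum := h.1.aestronglyMeasurable
  obtain ⟨A, hA⟩ := exists_lintegral_weight_le (G := Space d) hd hp₁ hp₂
  obtain ⟨c, hc⟩ := hA u hum _ (h.eLpNorm_sub_translate_le hp₁)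
  have hwm : Measurable fun x : Space d => ENNReal.ofReal (weight x) :=
    (continuous_weight.measurable).ennreal_ofReal
  have h1 : ∫⁻ x, ‖u x‖ₑ * ENNReal.ofReal (weight x) ≤
      (∫⁻ x, ‖u x - c‖ₑ * ENNReal.ofReal (weight x)) +
        ‖c‖ₑ * ∫⁻ x : Space d, ENNReal.ofReal (weight x) := by
    rw [← lintegral_const_mul _ hwm, ← lintegral_add_right _ (hwm.const_mul _)]
    refine lintegral_mono fun x => ?_
    rw [← add_mul]
    refine mul_le_mul_left ?_ _
    simpa using enorm_add_le (u x - c) c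
  refine ne_top_of_le_ne_top (ENNReal.add_ne_top.2 ⟨?_, ?_⟩) h1
  · exact ne_top_of_le_ne_top (ENNReal.mul_ne_top ENNReal.coe_ne_top hDu.2.ne) hc
  · exact ENNReal.mul_ne_top enorm_ne_top CommutatorEstimate.lintegral_weight_ne_top

theorem IsWeakGradient.integrable_divMajorant {p : ℝ} (hp₁ : 1 < p) (hp₂ : p < 2) (hd : 0 < d)
    {u : Space d → Space d} {Du : Space d → Space d →L[ℝ] Space d} (h : IsWeakGradient u Du)
    (hDu : MemLp Du (ENNReal.ofReal p) volume) {ψ : Space d → ℂ} (hψ : IsWeightedTest ψ) :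
    Integrable (divMajorant u Du ψ) := by
  have hps : p.HolderConjugate (p / (p - 1)) := Real.HolderConjugate.conjExponent hp₁
  obtain ⟨C, hC⟩ := hψ.exists_bound
  refine ⟨aestronglyMeasurable_divMajorant h.1.aestronglyMeasurable hDu.1 hψ.differentiable, ?_⟩
  rw [hasFiniteIntegral_iff_enorm]
  refine (lintegral_divMajorant_le hps hψ.differentiable hDu.1 hC).trans_lt ?_
  refine ENNReal.add_lt_top.2 ⟨ENNReal.mul_lt_top ENNReal.coe_lt_top
    (h.lintegral_weight_ne_top hp₁.le hp₂ hd hDu).lt_top, ENNReal.mul_lt_top (by simp)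
    (ENNReal.mul_lt_top (hψ.memLp _ hps.symm.lt).2 hDu.2)⟩

theorem integrable_scalarDivMul {u : Space d → Space d}
    {Du : Space d → Space d →L[ℝ] Space d} {ψ : Space d → ℂ} {f : Space d → F}
    (hu : AEStronglyMeasurable u volume) (hDu : AEStronglyMeasurable Du volume)
    (hψ : Differentiable ℝ ψ) (hf : AEStronglyMeasurable f volume)
    (h : Integrable (divMajorant u Du ψ)) {B : ℝ} (hB : ∀ᵐ x, ‖f x‖ ≤ B) :
    Integrable (scalarDivMul u Du ψ f) := by
  refine (h.mul_const B).mono' (aestronglyMeasurable_scalarDivMul hu hDu hψ hf)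
    (hB.mono fun x hx => (norm_scalarDivMul_le u Du ψ f x).trans ?_)
  exact mul_le_mul_of_nonneg_left hx (divMajorant_nonneg u Du ψ x)

theorem scalarDivMul_sub_left (u v : Space d → Space d)
    (Du Dv : Space d → Space d →L[ℝ] Space d) (ψ : Space d → ℂ) (f : Space d → F) (x : Space d) :
    scalarDivMul (fun x => u x - v x) (fun x => Du x - Dv x) ψ f x =
      scalarDivMul u Du ψ f x - scalarDivMul v Dv ψ f x := by
  have : divergence (fun x => Du x - Dv x) x = divergence Du x - divergence Dv x := by
    simp [divergence]
  rw [scalarDivMul, scalarDivMul, scalarDivMul, this, map_sub]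
  push_cast
  module

end WeakIdentity

section WeakIdentity

open Filter Topology

variable {d : ℕ} {F : Type*} [NormedAddCommGroup F] [NormedSpace ℂ F] [CompleteSpace F]

theorem IsWeakGradient.localCommutator_sub {p L : ℝ} (hp : 1 ≤ p) (hd : 0 < d) (K : 𝓢(Space d, ℂ))
    {u v : Space d → Space d} {Du Dv : Space d → Space d →L[ℝ] Space d} (hu : IsWeakGradient u Du)
    (hv : IsWeakGradient v Dv) (hDu : MemLp Du (ENNReal.ofReal p) volume)
    (hDv : MemLp Dv (ENNReal.ofReal p) volume) {f : Space d → F} (hf : ContDiff ℝ 1 f)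
    (hfL : ∀ x, ‖fderiv ℝ f x‖ ≤ L) :
    localCommutator K (fun x => u x - v x) f =ᵐ[volume]
      fun x => localCommutator K u f x - localCommutator K v f x := by
  filter_upwards [ae_integrable_localCommutator hp hd K hu.1.aestronglyMeasurable hf hfL
    (hu.eLpNorm_sub_translate_le hp) hDu.2.ne,
    ae_integrable_localCommutator hp hd K hv.1.aestronglyMeasurable hf hfL
    (hv.eLpNorm_sub_translate_le hp) hDv.2.ne] with x h1 h2
  rw [localCommutator, localCommutator, localCommutator, ← integral_sub h1 h2]
  refine integral_congr_ae (Eventually.of_forall fun z => ?_)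
  change K z • _ = K z • _ - K z • _
  rw [← smul_sub, ← map_sub]
  congr 2
  abel

section

variable {p q : ℝ} {m : Space d → ℂ} {κ M : 𝓢(Space d, ℂ)} {f : Space d → F} {B : ℝ}

theorem IsBlock.norm_conv_le (hB : ∀ x, ‖f x‖ ≤ B) (M : 𝓢(Space d, ℂ)) (x : Space d) :
    ‖CommutatorEstimate.conv M f x‖ ≤ (∫ z, ‖M z‖) * B :=
  CommutatorEstimate.norm_conv_le M.integrable (Eventually.of_forall hB) x

theorem commutatorDefect_sub (hp₁ : 1 < p) (hp₂ : p < 2) (hd : 0 < d)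
    (hm : IsHomogeneousSymbol m) (hq : 1 < q) (h : IsBlock q κ f) (hB : ∀ x, ‖f x‖ ≤ B)
    {u v : Space d → Space d} {Du Dv : Space d → Space d →L[ℝ] Space d} (hu : IsWeakGradient u Du)
    (hv : IsWeakGradient v Dv) (hDu : MemLp Du (ENNReal.ofReal p) volume)
    (hDv : MemLp Dv (ENNReal.ofReal p) volume) (θ : 𝓢(Space d, ℂ)) :
    commutatorDefect m κ M θ (fun x => u x - v x) (fun x => Du x - Dv x) f =
      commutatorDefect m κ M θ u Du f - commutatorDefect m κ M θ v Dv f := by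
  have hps : p.HolderConjugate (p / (p - 1)) := Real.HolderConjugate.conjExponent hp₁
  have hψ := hm.isWeightedTest hd θ
  have hθ := isWeightedTest_schwartz θ
  have hfL := h.norm_fderiv_le hq (Eventually.of_forall hB)
  have key : ∀ (K : 𝓢(Space d, ℂ)) {ψ : Space d → ℂ}, IsWeightedTest ψ →
      ∫ x, ψ x • localCommutator K (fun x => u x - v x) f x =
      (∫ x, ψ x • localCommutator K u f x) - ∫ x, ψ x • localCommutator K v f x := by
    intro K ψ hψ
    have hψp := hψ.memLp _ hps.symm.lt
    rw [← integral_sub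
      (integrable_smul_of_memLp hps hψp (memLp_localCommutator hp₁.le hd K
        hu.1.aestronglyMeasurable (h.contDiff hq) hfL (hu.eLpNorm_sub_translate_le hp₁.le) hDu.2.ne))
      (integrable_smul_of_memLp hps hψp (memLp_localCommutator hp₁.le hd K
        hv.1.aestronglyMeasurable (h.contDiff hq) hfL (hv.eLpNorm_sub_translate_le hp₁.le) hDv.2.ne))]
    refine integral_congr_ae ?_
    filter_upwards [IsWeakGradient.localCommutator_sub hp₁.le hd K hu hv hDu hDv
      (h.contDiff hq) hfL] with x hx
    rw [hx, smul_sub]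
  have key2 : ∀ {ψ : Space d → ℂ} {g : Space d → F} {B' : ℝ}, IsWeightedTest ψ → Continuous g →
      (∀ x, ‖g x‖ ≤ B') →
      ∫ x, scalarDivMul (fun x => u x - v x) (fun x => Du x - Dv x) ψ g x =
        (∫ x, scalarDivMul u Du ψ g x) - ∫ x, scalarDivMul v Dv ψ g x := by
    intro ψ g B' hψ hg hgB
    rw [← integral_sub
      (integrable_scalarDivMul hu.1.aestronglyMeasurable hDu.1 hψ.differentiable
        hg.aestronglyMeasurable (hu.integrable_divMajorant hp₁ hp₂ hd hDu hψ)
        (Eventually.of_forall hgB))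
      (integrable_scalarDivMul hv.1.aestronglyMeasurable hDv.1 hψ.differentiable
        hg.aestronglyMeasurable (hv.integrable_divMajorant hp₁ hp₂ hd hDv hψ)
        (Eventually.of_forall hgB))]
    simp only [scalarDivMul_sub_left]
  rw [commutatorDefect, commutatorDefect, commutatorDefect, key κ hψ, key M hθ,
    key2 hψ (h.contDiff hq).continuous hB,
    key2 hθ ((h.conv hq M).contDiff hq).continuous (IsBlock.norm_conv_le hB M)]
  abel

/-- The local commutators see only differences of `u`, so `‖Du‖_p` controls them. The divergence
terms see `u` itself, through its weighted `L^1` norm; the normalisation by `A` bounds this norm by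
`‖Du‖_p` as well. -/
theorem exists_enorm_commutatorDefect_le (hp₁ : 1 < p) (hd : 0 < d)
    (hm : IsHomogeneousSymbol m) (hq : 1 < q) (h : IsBlock q κ f) (hB : ∀ x, ‖f x‖ ≤ B)
    (θ : 𝓢(Space d, ℂ)) (A : ℝ≥0) :
    ∃ K : ℝ≥0∞, K ≠ ∞ ∧ ∀ (u : Space d → Space d) (Du : Space d → Space d →L[ℝ] Space d),
      IsWeakGradient u Du → MemLp Du (ENNReal.ofReal p) volume →
      ∫⁻ x, ‖u x‖ₑ * ENNReal.ofReal (weight x) ≤ A * eLpNorm Du (ENNReal.ofReal p) volume →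
      ‖commutatorDefect m κ M θ u Du f‖ₑ ≤ K * eLpNorm Du (ENNReal.ofReal p) volume := by
  have hps : p.HolderConjugate (p / (p - 1)) := Real.HolderConjugate.conjExponent hp₁
  set s := p / (p - 1)
  have hψ := hm.isWeightedTest hd θ
  have hθ := isWeightedTest_schwartz θ
  have hfL := h.norm_fderiv_le hq (Eventually.of_forall hB)
  set L := (∑ i : Fin d, ∫ z, ‖(LineDeriv.lineDerivOp (EuclideanSpace.single i (1 : ℝ)) κ :
    𝓢(Space d, ℂ)) z‖) * B
  set ψ := transposedTest m θ
  have key : ∀ (K : 𝓢(Space d, ℂ)) {ψ : Space d → ℂ}, IsWeightedTest ψ →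
      ∃ C : ℝ≥0∞, C ≠ ∞ ∧ ∀ (u : Space d → Space d) (Du : Space d → Space d →L[ℝ] Space d),
      IsWeakGradient u Du → MemLp Du (ENNReal.ofReal p) volume →
      ‖∫ x, ψ x • localCommutator K u f x‖ₑ ≤ C * eLpNorm Du (ENNReal.ofReal p) volume := by
    intro K ψ hψ
    refine ⟨eLpNorm ψ (ENNReal.ofReal s) volume * ((∫⁻ z, ‖K z‖ₑ * ‖z‖ₑ) * ENNReal.ofReal L),
      ENNReal.mul_ne_top (hψ.memLp _ hps.symm.lt).2.ne
        (ENNReal.mul_ne_top (lintegral_mul_enorm_ne_top K) ENNReal.ofReal_ne_top),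
      fun u Du hu hDu => ?_⟩
    have h1 := memLp_localCommutator hp₁.le hd K hu.1.aestronglyMeasurable (h.contDiff hq) hfL
      (hu.eLpNorm_sub_translate_le hp₁.le) hDu.2.ne
    refine (enorm_integral_le_lintegral_enorm _).trans
      ((lintegral_enorm_smul_le hps (hψ.memLp _ hps.symm.lt).1 h1.1).trans ?_)
    rw [mul_assoc, mul_assoc]
    refine mul_le_mul_right ?_ _
    exact eLpNorm_localCommutator_le hp₁.le hd K hu.1.aestronglyMeasurable (h.contDiff hq) hfL
      (hu.eLpNorm_sub_translate_le hp₁.le)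
  have key2 : ∀ {ψ : Space d → ℂ} {g : Space d → F} {B' : ℝ}, IsWeightedTest ψ →
      (∀ x, ‖g x‖ ≤ B') →
      ∃ C : ℝ≥0∞, C ≠ ∞ ∧ ∀ (u : Space d → Space d) (Du : Space d → Space d →L[ℝ] Space d),
      IsWeakGradient u Du → MemLp Du (ENNReal.ofReal p) volume →
      ∫⁻ x, ‖u x‖ₑ * ENNReal.ofReal (weight x) ≤ A * eLpNorm Du (ENNReal.ofReal p) volume →
      ‖∫ x, scalarDivMul u Du ψ g x‖ₑ ≤ C * eLpNorm Du (ENNReal.ofReal p) volume := by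
    intro ψ g B' hψ hgB
    obtain ⟨C, hC⟩ := hψ.exists_bound
    refine ⟨ENNReal.ofReal B' * (C * A + d * eLpNorm ψ (ENNReal.ofReal s) volume), ?_,
      fun u Du hu hDu hA => ?_⟩
    · have := (hψ.memLp _ hps.symm.lt).2.ne
      finiteness
    refine (enorm_integral_le_lintegral_enorm _).trans
      ((lintegral_scalarDivMul_le (Eventually.of_forall hgB)).trans ?_)
    rw [mul_assoc]
    refine mul_le_mul_right ((lintegral_divMajorant_le hps hψ.differentiable hDu.1 hC).trans ?_) _
    rw [add_mul, mul_assoc, mul_assoc]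
    gcongr
  obtain ⟨C₁, hC₁, h₁⟩ := key κ hψ
  obtain ⟨C₂, hC₂, h₂⟩ := key M hθ
  obtain ⟨C₃, hC₃, h₃⟩ := key2 hψ hB
  obtain ⟨C₄, hC₄, h₄⟩ := key2 hθ (IsBlock.norm_conv_le hB M)
  refine ⟨C₁ + C₂ + (C₃ + C₄), by finiteness, fun u Du hu hDu hA => ?_⟩
  rw [commutatorDefect, add_mul, add_mul, add_mul]
  refine (enorm_add_le _ _).trans (add_le_add (enorm_sub_le.trans ?_) (enorm_sub_le.trans ?_))
  · exact add_le_add (h₁ u Du hu hDu) (h₂ u Du hu hDu)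
  · exact add_le_add (h₃ u Du hu hDu hA) (h₄ u Du hu hDu hA)

/-- Subtract from `u` a smooth approximant `v n` and then the Poincaré constant of the remainder.
Neither contributes to the defect, so the defect of `u` is bounded by a constant times `‖Du - ∇(v
n)‖_p`, which tends to zero. -/
theorem commutatorDefect_eq_zero (hp₁ : 1 < p) (hp₂ : p < 2) (hd : 0 < d)
    (hm : IsHomogeneousSymbol m) (hκM : ∀ ξ, 𝓕 M ξ = 𝓕 κ ξ * m ξ) (hq : 1 < q)
    (h : IsBlock q κ f) (hB : ∀ x, ‖f x‖ ≤ B)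
    {u : Space d → Space d} {Du : Space d → Space d →L[ℝ] Space d} (hu : IsWeakGradient u Du)
    (hDu : MemLp Du (ENNReal.ofReal p) volume) (θ : 𝓢(Space d, ℂ)) :
    commutatorDefect m κ M θ u Du f = 0 := by
  obtain ⟨A, hA⟩ := exists_lintegral_weight_le (G := Space d) hd hp₁.le hp₂
  obtain ⟨K, hK, hKle⟩ := exists_enorm_commutatorDefect_le (M := M) hp₁ hd hm hq h hB θ A
  obtain ⟨v, hv1, hvp, hDv, hlim⟩ := hu.exists_approx hp₁ hp₂ hd hDu
  have hle : ∀ n, ‖commutatorDefect m κ M θ u Du f‖ₑ ≤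
      K * eLpNorm (fun x => Du x - fderiv ℝ (v n) x) (ENNReal.ofReal p) volume := fun n => by
    have hw := hu.sub (IsWeakGradient.of_contDiff (hv1 n))
    have hDw : MemLp (fun x => Du x - fderiv ℝ (v n) x) (ENNReal.ofReal p) volume :=
      hDu.sub (hDv n)
    obtain ⟨c, hc⟩ := hA _ hw.1.aestronglyMeasurable _ (hw.eLpNorm_sub_translate_le hp₁.le)
    have hcW : IsWeakGradient (fun _ : Space d => c) (fderiv ℝ fun _ => c) :=
      IsWeakGradient.of_contDiff contDiff_const
    have hcD : MemLp (fderiv ℝ fun _ : Space d => c) (ENNReal.ofReal p) volume :=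
      hDu.mono (contDiff_const.continuous_fderiv one_ne_zero).aestronglyMeasurable
        (Eventually.of_forall fun x => by simp)
    have e1 := commutatorDefect_sub (M := M) hp₁ hp₂ hd hm hq h hB hu
      (IsWeakGradient.of_contDiff (hv1 n)) hDu (hDv n) θ
    have e2 := commutatorDefect_sub (M := M) hp₁ hp₂ hd hm hq h hB hw hcW hDw hcD θ
    rw [commutatorDefect_eq_zero_of_memLp hm hd hκM hq hp₁ h (hv1 n) (hvp n) (hDv n) ⟨B, hB⟩ θ,
      sub_zero] at e1
    rw [commutatorDefect_const hm hd hκM hq h ⟨B, hB⟩ c θ, sub_zero, e1] at e2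
    have e3 : (fun x => (Du x - fderiv ℝ (v n) x) - fderiv ℝ (fun _ : Space d => c) x) =
        fun x => Du x - fderiv ℝ (v n) x := by simp
    have h5 := hKle _ _ (hw.sub hcW) (hDw.sub hcD) (by
      rw [e3]
      exact hc)
    rw [e2, e3] at h5
    exact h5
  have hlim0 : Tendsto (fun n => K * eLpNorm (fun x => Du x - fderiv ℝ (v n) x)
      (ENNReal.ofReal p) volume) atTop (𝓝 0) := by
    simpa using ENNReal.Tendsto.const_mul hlim (Or.inr hK)
  have : ‖commutatorDefect m κ M θ u Du f‖ₑ ≤ 0 := ge_of_tendsto' hlim0 hle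
  exact enorm_eq_zero.1 (le_antisymm this (by simp))

end

end WeakIdentity

/-! ### Summation of the blocks -/

section Summation

open Filter Topology

/-- Absolute convergence in the Banach space `L^p`; pairing with a dual function is continuous, so
it commutes with the sum. -/
theorem exists_tsum_memLp {α : Type*} {mα : MeasurableSpace α} {μ : Measure α} {F : Type*}
    [NormedAddCommGroup F] [NormedSpace ℂ F] [CompleteSpace F] {p s : ℝ}
    (hps : p.HolderConjugate s) {ι : Type*} {E : ι → α → F}
    (hE : ∀ j, MemLp (E j) (ENNReal.ofReal p) μ)
    (hsum : ∑' j, eLpNorm (E j) (ENNReal.ofReal p) μ ≠ ∞) :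
    ∃ S : α → F, MemLp S (ENNReal.ofReal p) μ ∧
      eLpNorm S (ENNReal.ofReal p) μ ≤ ∑' j, eLpNorm (E j) (ENNReal.ofReal p) μ ∧
      ∀ ψ : α → ℂ, MemLp ψ (ENNReal.ofReal s) μ →
        HasSum (fun j => ∫ x, ψ x • E j x ∂μ) (∫ x, ψ x • S x ∂μ) := by
  have : Fact (1 ≤ ENNReal.ofReal p) := ⟨by simpa using hps.lt.le⟩
  have : Fact (1 ≤ ENNReal.ofReal s) := ⟨by simpa using hps.symm.lt.le⟩
  have := holderTriple_ofReal hps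
  have hs : Summable fun j => (hE j).toLp := by
    refine Summable.of_norm ?_
    simp only [Lp.norm_toLp]
    exact ENNReal.summable_toReal hsum
  refine ⟨(∑' j, (hE j).toLp : Lp F (ENNReal.ofReal p) μ), Lp.memLp _, ?_, fun ψ hψ => ?_⟩
  · rw [← Lp.enorm_def]
    refine enorm_tsum_le_tsum_enorm.trans (le_of_eq (tsum_congr fun j => ?_))
    rw [Lp.enorm_toLp]
  · have h := hs.hasSum.mapL ((ContinuousLinearMap.lsmul ℂ ℂ (E := F)).lpPairing μ
      (ENNReal.ofReal s) (ENNReal.ofReal p) hψ.toLp)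
    simp only [ContinuousLinearMap.lpPairing_eq_integral, ContinuousLinearMap.lsmul_apply] at h
    have e1 : ∀ g : α → F, ∫ x, (hψ.toLp ψ : Lp ℂ (ENNReal.ofReal s) μ) x • g x ∂μ =
          ∫ x, ψ x • g x ∂μ := fun g =>
      integral_congr_ae (hψ.coeFn_toLp.mono fun x hx => by simp only [hx])
    simp only [e1] at h
    convert! h using 2 with j
    exact integral_congr_ae ((hE j).coeFn_toLp.mono fun x hx => by simp only [hx])

theorem hasSum_integral_smul_of_summable_bound {α : Type*} {mα : MeasurableSpace α}
    {μ : Measure α} {F : Type*} [NormedAddCommGroup F] [NormedSpace ℂ F] {ι : Type*} [Countable ι]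
    {a : α → ℂ} (ha : Integrable a μ) {f : ι → α → F} {T : α → F} {B : ι → ℝ}
    (hf : ∀ j, AEStronglyMeasurable (f j) μ) (hfB : ∀ j x, ‖f j x‖ ≤ B j) (hB : Summable B)
    (hT : ∀ᵐ x ∂μ, HasSum (fun j => f j x) (T x)) :
    HasSum (fun j => ∫ x, a x • f j x ∂μ) (∫ x, a x • T x ∂μ) := by
  refine hasSum_integral_of_dominated_convergence (fun j x => ‖a x‖ * B j)
    (fun j => ha.1.smul (hf j)) (fun j => Eventually.of_forall fun x => ?_)
    (Eventually.of_forall fun x => hB.mul_left _) ?_ (hT.mono fun x hx => hx.const_smul (a x))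
  · rw [norm_smul]
    exact mul_le_mul_of_nonneg_left (hfB j x) (norm_nonneg _)
  · simp only [tsum_mul_left]
    exact ha.norm.mul_const _

/-- Convergence in `L^p` gives almost everywhere convergence along a subsequence, whose limit must
be the pointwise sum. -/
theorem ae_eq_of_tendsto_eLpNorm_of_hasSum {α : Type*} {mα : MeasurableSpace α} {μ : Measure α}
    {F : Type*} [NormedAddCommGroup F] {p : ℝ≥0∞} (hp : p ≠ 0) {ι : Type*} {f : ι → α → F}
    {τ T : α → F} (hf : ∀ j, AEStronglyMeasurable (f j) μ) (hτ : AEStronglyMeasurable τ μ)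
    (hT : ∀ x, HasSum (fun j => f j x) (T x)) {s : ℕ → Finset ι} (hs : Tendsto s atTop atTop)
    (h : Tendsto (fun n => eLpNorm (fun x => ∑ j ∈ s n, f j x - τ x) p μ) atTop (𝓝 0)) :
    T =ᵐ[μ] τ := by
  have h1 : TendstoInMeasure μ (fun n x => ∑ j ∈ s n, f j x) atTop τ :=
    tendstoInMeasure_of_tendsto_eLpNorm hp
      (fun n => Finset.aestronglyMeasurable_fun_sum _ fun j _ => hf j) hτ h
  obtain ⟨ns, hns, hlim⟩ := h1.exists_seq_tendsto_ae
  filter_upwards [hlim] with x hx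
  exact tendsto_nhds_unique ((hT x).comp (hs.comp hns.tendsto_atTop)) hx

variable {d : ℕ}

/-- The scalar coefficient of `f` in `div (ψ u) f`. -/
def divCoeff (u : Space d → Space d) (Du : Space d → Space d →L[ℝ] Space d)
    (ψ : Space d → ℂ) (x : Space d) : ℂ :=
  fderiv ℝ ψ x (u x) + ((divergence Du x : ℝ) : ℂ) * ψ x

theorem scalarDivMul_eq_smul {F : Type*} [NormedAddCommGroup F] [NormedSpace ℂ F]
    (u : Space d → Space d) (Du : Space d → Space d →L[ℝ] Space d)
    (ψ : Space d → ℂ) (f : Space d → F) (x : Space d) :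
    scalarDivMul u Du ψ f x = divCoeff u Du ψ x • f x := by
  rw [scalarDivMul, divCoeff, add_smul, mul_smul]

theorem IsWeakGradient.integrable_divCoeff {p : ℝ} (hp₁ : 1 < p) (hp₂ : p < 2) (hd : 0 < d)
    {u : Space d → Space d} {Du : Space d → Space d →L[ℝ] Space d} (h : IsWeakGradient u Du)
    (hDu : MemLp Du (ENNReal.ofReal p) volume) {ψ : Space d → ℂ} (hψ : IsWeightedTest ψ) :
    Integrable (divCoeff u Du ψ) := by
  have := integrable_scalarDivMul (f := fun _ : Space d => (1 : ℂ)) (B := 1)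
    h.1.aestronglyMeasurable hDu.1 hψ.differentiable aestronglyMeasurable_const
    (h.integrable_divMajorant hp₁ hp₂ hd hDu hψ) (by simp)
  refine this.congr (Eventually.of_forall fun x => ?_)
  rw [scalarDivMul_eq_smul]
  simp

/-- Weak form of `h = [m(D), u · ∇] τ` for a scalar symbol `m`. -/
def IsScalarCommutator {F : Type*} [NormedAddCommGroup F] [NormedSpace ℂ F] (m : Space d → ℂ)
    (u : Space d → Space d) (Du : Space d → Space d →L[ℝ] Space d) (τ h : Space d → F) : Prop :=
  ∃ g : Space d → F,
    (∀ θ : 𝓢(Space d, ℂ), Integrable (fun x => θ x • g x) ∧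
      Integrable (fun x => transposedTest m θ x • τ x) ∧
      ∫ x, θ x • g x = ∫ x, transposedTest m θ x • τ x) ∧
    ∀ θ : 𝓢(Space d, ℂ), Integrable (fun x => θ x • h x) ∧
      Integrable (scalarDivMul u Du (transposedTest m θ) τ) ∧
      Integrable (scalarDivMul u Du θ g) ∧
      ∫ x, θ x • h x =
        -(∫ x, scalarDivMul u Du (transposedTest m θ) τ x) - -∫ x, scalarDivMul u Du θ g x

theorem fourier_scaled_mul {m : Space d → ℂ} (hm : IsHomogeneousSymbol m) {κ M : 𝓢(Space d, ℂ)}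
    (hκM : ∀ ξ, 𝓕 M ξ = 𝓕 κ ξ * m ξ) (j : ℤ) (ξ : Space d) :
    𝓕 (scaled j M) ξ = 𝓕 (scaled j κ) ξ * m ξ := by
  rw [fourier_scaled, fourier_scaled, hκM, hm.hom _ _ (by positivity)]

/-- The total mass of the first derivatives of a kernel. -/
def gradMass (κ : 𝓢(Space d, ℂ)) : ℝ :=
  ∑ i : Fin d, ∫ z, ‖(LineDeriv.lineDerivOp (EuclideanSpace.single i (1 : ℝ)) κ :
    𝓢(Space d, ℂ)) z‖

theorem gradMass_nonneg (κ : 𝓢(Space d, ℂ)) : 0 ≤ gradMass κ :=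
  Finset.sum_nonneg fun _ _ => integral_nonneg fun _ => norm_nonneg _

theorem gradMass_scaled (j : ℤ) (κ : 𝓢(Space d, ℂ)) :
    gradMass (scaled j κ) = 2 ^ j * gradMass κ := by
  rw [gradMass, gradMass, Finset.mul_sum]
  refine Finset.sum_congr rfl fun i _ => ?_
  rw [lineDeriv_scaled, ← integral_norm_scaled j (LineDeriv.lineDerivOp _ κ), ← integral_const_mul]
  refine integral_congr_ae (Eventually.of_forall fun z => ?_)
  change ‖((2 : ℝ) ^ j) • (scaled j (LineDeriv.lineDerivOp (EuclideanSpace.single i (1 : ℝ)) κ) :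
    𝓢(Space d, ℂ)) z‖ = _
  rw [norm_smul, Real.norm_of_nonneg (by positivity)]

/-- The scale invariance of the estimate: the moment of the kernel gives `2^{-j}`, the gradient mass
of the reproducing kernel gives `2^j`, and the resulting bound contains no power of the scale. -/
theorem IsWeakGradient.eLpNorm_localCommutator_scaled_le {F : Type*} [NormedAddCommGroup F]
    [NormedSpace ℂ F] [CompleteSpace F] {p q : ℝ} (hp : 1 ≤ p) (hd : 0 < d) (hq : 1 < q)
    {κ : 𝓢(Space d, ℂ)} (K : 𝓢(Space d, ℂ)) {j : ℤ} {f : Space d → F} {B : ℝ}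
    (h : IsBlock q (scaled j κ) f) (hB : ∀ x, ‖f x‖ ≤ B) {u : Space d → Space d}
    {Du : Space d → Space d →L[ℝ] Space d} (hu : IsWeakGradient u Du) :
    eLpNorm (localCommutator (scaled j K) u f) (ENNReal.ofReal p) volume ≤
      (∫⁻ z, ‖K z‖ₑ * ‖z‖ₑ) * ENNReal.ofReal (gradMass κ) *
        eLpNorm Du (ENNReal.ofReal p) volume * ENNReal.ofReal B := by
  have h1 := eLpNorm_localCommutator_le hp hd (scaled j K) hu.1.aestronglyMeasurable
    (h.contDiff hq) (h.norm_fderiv_le hq (Eventually.of_forall hB))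
    (hu.eLpNorm_sub_translate_le hp)
  refine h1.trans (le_of_eq ?_)
  change _ * (ENNReal.ofReal (gradMass (scaled j κ) * B) * _) = _
  rw [gradMass_scaled, lintegral_scaled_mul_enorm, mul_assoc ((2 : ℝ) ^ j),
    ENNReal.ofReal_mul (by positivity), ENNReal.ofReal_mul (gradMass_nonneg κ)]
  have h2 : ENNReal.ofReal (2 ^ (-j)) * ENNReal.ofReal (2 ^ j) = 1 := by
    rw [← ENNReal.ofReal_mul (by positivity), ← zpow_add₀ (by norm_num)]
    simp
  calc _ = (ENNReal.ofReal (2 ^ (-j)) * ENNReal.ofReal (2 ^ j)) *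
      ((∫⁻ z, ‖K z‖ₑ * ‖z‖ₑ) * ENNReal.ofReal (gradMass κ) *
        eLpNorm Du (ENNReal.ofReal p) volume * ENNReal.ofReal B) := by ring
    _ = _ := by rw [h2, one_mul]

end Summation

/-! ### The commutator assembled from its blocks. -/

section Summation

open Filter Topology

variable {d : ℕ}

/-- The commutator is built as `R - D`, where `D` sums the local commutators with `M_j`, `E` sums
those with `κ_j`, and `R = m(D) E`. Applying the multiplier once to the sum `E` uses its `L^p` bound
only once. The function `m(D) τ` is realised as the uniformly convergent sum of `M_j * f_j`. -/
theorem exists_commutator_of_blocks {p q : ℝ} (hp₁ : 1 < p) (hp₂ : p < 2) (hq : 1 < q) (hd : 0 < d)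
    {m : Space d → ℂ} (hm : IsHomogeneousSymbol m) (hmp : IsLpMultiplier p m)
    {κ M : 𝓢(Space d, ℂ)} (hκM : ∀ ξ, 𝓕 M ξ = 𝓕 κ ξ * m ξ) (F : Type*) [NormedAddCommGroup F]
    [NormedSpace ℂ F] [FiniteDimensional ℂ F] [CompleteSpace F] :
    ∃ C : ℝ≥0, ∀ (u : Space d → Space d) (Du : Space d → Space d →L[ℝ] Space d)
      (τ : Space d → F) (f : ℤ → Space d → F) (B : ℤ → ℝ) (s : ℕ → Finset ℤ),
      IsWeakGradient u Du → MemLp Du (ENNReal.ofReal p) volume →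
      MemLp τ (ENNReal.ofReal q) volume → (∀ j, IsBlock q (scaled j κ) (f j)) →
      (∀ j x, ‖f j x‖ ≤ B j) → Summable B → Tendsto s atTop atTop →
      Tendsto (fun n => eLpNorm (fun x => ∑ j ∈ s n, f j x - τ x) (ENNReal.ofReal q) volume)
        atTop (𝓝 0) →
      ∃ h : Space d → F, MemLp h (ENNReal.ofReal p) volume ∧ IsScalarCommutator m u Du τ h ∧
        eLpNorm h (ENNReal.ofReal p) volume ≤
          C * eLpNorm Du (ENNReal.ofReal p) volume * ∑' j, ENNReal.ofReal (B j) := by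
  have hps : p.HolderConjugate (p / (p - 1)) := Real.HolderConjugate.conjExponent hp₁
  have hqr : q.HolderConjugate (q / (q - 1)) := Real.HolderConjugate.conjExponent hq
  have hp1 : 1 ≤ ENNReal.ofReal p := by simpa using hp₁.le
  obtain ⟨C, hC⟩ := hmp.exists_image hp₁ hm hd F
  set Aκ : ℝ≥0∞ := (∫⁻ z, ‖κ z‖ₑ * ‖z‖ₑ) * ENNReal.ofReal (gradMass κ) with hAκ
  set AM : ℝ≥0∞ := (∫⁻ z, ‖M z‖ₑ * ‖z‖ₑ) * ENNReal.ofReal (gradMass κ) with hAM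
  have hAκt : Aκ ≠ ∞ := ENNReal.mul_ne_top (lintegral_mul_enorm_ne_top κ) ENNReal.ofReal_ne_top
  have hAMt : AM ≠ ∞ := ENNReal.mul_ne_top (lintegral_mul_enorm_ne_top M) ENNReal.ofReal_ne_top
  refine ⟨C * Aκ.toNNReal + AM.toNNReal,
    fun u Du τ f B s hu hDu hτ hf hB hBs hs hlim => ?_⟩
  have hBt : ∑' j, ENNReal.ofReal (B j) ≠ ∞ := hBs.tsum_ofReal_ne_top
  have hsumE : ∀ K : 𝓢(Space d, ℂ),
      ∑' j, eLpNorm (localCommutator (scaled j K) u (f j)) (ENNReal.ofReal p) volume ≤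
      (∫⁻ z, ‖K z‖ₑ * ‖z‖ₑ) * ENNReal.ofReal (gradMass κ) *
        eLpNorm Du (ENNReal.ofReal p) volume * ∑' j, ENNReal.ofReal (B j) := fun K => by
    rw [← ENNReal.tsum_mul_left]
    exact ENNReal.tsum_le_tsum fun j =>
      hu.eLpNorm_localCommutator_scaled_le hp₁.le hd hq K (hf j) (hB j)
  have hEj : ∀ (K : 𝓢(Space d, ℂ)) j, MemLp (localCommutator (scaled j K) u (f j))
      (ENNReal.ofReal p) volume := fun K j =>
    memLp_localCommutator hp₁.le hd _ hu.1.aestronglyMeasurable ((hf j).contDiff hq)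
      ((hf j).norm_fderiv_le hq (Eventually.of_forall (hB j)))
      (hu.eLpNorm_sub_translate_le hp₁.le) hDu.2.ne
  have hEt : ∀ K : 𝓢(Space d, ℂ),
      ∑' j, eLpNorm (localCommutator (scaled j K) u (f j)) (ENNReal.ofReal p) volume ≠ ∞ :=
    fun K => ne_top_of_le_ne_top (ENNReal.mul_ne_top (ENNReal.mul_ne_top (ENNReal.mul_ne_top
      (lintegral_mul_enorm_ne_top K) ENNReal.ofReal_ne_top) hDu.2.ne) hBt) (hsumE K)
  obtain ⟨E, hE, hEle, hEsum⟩ := exists_tsum_memLp hps (hEj κ) (hEt κ)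
  obtain ⟨D, hD, hDle, hDsum⟩ := exists_tsum_memLp hps (hEj M) (hEt M)
  obtain ⟨R, hR, hRle, hRθ⟩ := hC E hE
  have hfc : ∀ j, Continuous (f j) := fun j => ((hf j).contDiff hq).continuous
  have hfs : ∀ x, Summable fun j => f j x := fun x => Summable.of_norm_bounded hBs fun j => hB j x
  have hτf : ∀ᵐ x, HasSum (fun j => f j x) (τ x) := by
    filter_upwards [ae_eq_of_tendsto_eLpNorm_of_hasSum (T := fun x => ∑' j, f j x)
      (by simpa using hq.trans' zero_lt_one) (fun j => (hfc j).aestronglyMeasurable) hτ.1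
      (fun x => (hfs x).hasSum) hs hlim] with x hx
    rw [← hx]
    exact (hfs x).hasSum
  -- Although `m(D)` is unbounded on `L^∞` in general, it is bounded on each block with a constant
  -- independent of `j`. Hence `m(D) τ` is bounded and continuous, and its pairing with a growing
  -- `u` converges absolutely.
  set g : Space d → F := fun x => ∑' j, conv (scaled j M) (f j) x
  have hgb : ∀ j, IsBlock q (scaled j κ) (conv (scaled j M) (f j)) := fun j => (hf j).conv hq _
  have hgB : ∀ j x, ‖conv (scaled j M) (f j) x‖ ≤ (∫ z, ‖M z‖) * B j := fun j x => by
    rw [← integral_norm_scaled j]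
    exact IsBlock.norm_conv_le (hB j) _ x
  have hgBs : Summable fun j => (∫ z, ‖M z‖) * B j := hBs.mul_left _
  have hgsum : ∀ x, HasSum (fun j => conv (scaled j M) (f j) x) (g x) := fun x =>
    (Summable.of_norm_bounded hgBs fun j => hgB j x).hasSum
  have hgc : ∀ j, Continuous (conv (scaled j M) (f j)) := fun j =>
    ((hgb j).contDiff hq).continuous
  have hgcont : Continuous g := continuous_tsum hgc hgBs hgB
  have hgbd : ∀ x, ‖g x‖ ≤ ∑' j, (∫ z, ‖M z‖) * B j := fun x =>
    tsum_of_norm_bounded hgBs.hasSum fun j => hgB j x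
  have hτB : ∀ᵐ x, ‖τ x‖ ≤ ∑' j, B j := hτf.mono fun x hx => by
    rw [← hx.tsum_eq]
    exact tsum_of_norm_bounded hBs.hasSum fun j => hB j x
  have hψw := fun θ => hm.isWeightedTest hd θ
  have hθw := fun θ : 𝓢(Space d, ℂ) => isWeightedTest_schwartz θ
  have hpair : ∀ (θ : 𝓢(Space d, ℂ)) j, ∫ x, transposedTest m θ x • f j x =
      ∫ x, θ x • conv (scaled j M) (f j) x := fun θ j => by
    rw [← integral_transposedTest_smul_conv hm hd (fourier_scaled_mul hm hκM j) hq (hf j).memLp θ,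
      (hf j).conv_eq]
  refine ⟨fun x => R x - D x, hR.sub hD, ⟨g, fun θ => ?_, fun θ => ?_⟩, ?_⟩
  · have hψq := (hψw θ).memLp _ hqr.symm.lt
    refine ⟨((θ.integrable (μ := volume)).norm.mul_const (∑' j, (∫ z, ‖M z‖) * B j)).mono'
      ((θ.integrable (μ := volume)).1.smul hgcont.aestronglyMeasurable)
      (Eventually.of_forall fun x => ?_), integrable_smul_of_memLp hqr hψq hτ, ?_⟩
    · rw [norm_smul]
      exact mul_le_mul_of_nonneg_left (hgbd x) (norm_nonneg _)
    · have h1 := hasSum_integral_smul_of_summable_bound (θ.integrable (μ := volume))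
        (fun j => (hgc j).aestronglyMeasurable) hgB hgBs (Eventually.of_forall hgsum)
      have h2 := tendsto_integral_smul_of_eLpNorm hqr hψq
        (g := fun n x => ∑ j ∈ s n, f j x) (fun n => memLp_finsetSum _ fun j _ => (hf j).memLp)
        hτ hlim
      have h3 : ∀ n, ∫ x, transposedTest m θ x • ∑ j ∈ s n, f j x =
          ∑ j ∈ s n, ∫ x, θ x • conv (scaled j M) (f j) x := fun n => by
        simp only [Finset.smul_sum]
        rw [integral_finsetSum _ fun j _ => integrable_smul_of_memLp hqr hψq (hf j).memLp]
        exact Finset.sum_congr rfl fun j _ => hpair θ j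
      simp only [h3] at h2
      exact tendsto_nhds_unique (h1.comp hs) h2
  · have hψp := (hψw θ).memLp _ hps.symm.lt
    have hθp := (hθw θ).memLp _ hps.symm.lt
    have hum := hu.1.aestronglyMeasurable
    refine ⟨?_, integrable_scalarDivMul hum hDu.1 (hψw θ).differentiable hτ.1
      (hu.integrable_divMajorant hp₁ hp₂ hd hDu (hψw θ)) hτB,
      integrable_scalarDivMul hum hDu.1 (hθw θ).differentiable hgcont.aestronglyMeasurable
      (hu.integrable_divMajorant hp₁ hp₂ hd hDu (hθw θ)) (Eventually.of_forall hgbd), ?_⟩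
    · simp only [smul_sub]
      exact (integrable_smul_of_memLp hps hθp hR).sub (integrable_smul_of_memLp hps hθp hD)
    · have a1 := hEsum _ hψp
      have a2 := hDsum _ hθp
      have a3 := hasSum_integral_smul_of_summable_bound
        (hu.integrable_divCoeff hp₁ hp₂ hd hDu (hψw θ))
        (fun j => (hfc j).aestronglyMeasurable) hB hBs hτf
      have a4 := hasSum_integral_smul_of_summable_bound
        (hu.integrable_divCoeff hp₁ hp₂ hd hDu (hθw θ))
        (fun j => (hgc j).aestronglyMeasurable) hgB hgBs (Eventually.of_forall hgsum)
      -- Summing the four pairings over `j` reproduces the defect of each block, which is zero; the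
      -- weak identity for the sums follows by uniqueness of the limit.
      have a5 := (a1.sub a2).add (a3.sub a4)
      have a6 : ∀ j, ((∫ x, transposedTest m θ x • localCommutator (scaled j κ) u (f j) x) -
          ∫ x, θ x • localCommutator (scaled j M) u (f j) x) +
          ((∫ x, divCoeff u Du (transposedTest m θ) x • f j x) -
            ∫ x, divCoeff u Du θ x • conv (scaled j M) (f j) x) = 0 := fun j => by
        simp only [← scalarDivMul_eq_smul]
        exact commutatorDefect_eq_zero hp₁ hp₂ hd hm (fourier_scaled_mul hm hκM j) hq (hf j) (hB j)
          hu hDu θ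
      simp only [a6] at a5
      have a7 := a5.unique hasSum_zero
      simp only [← scalarDivMul_eq_smul] at a7
      simp only [smul_sub]
      rw [integral_sub (integrable_smul_of_memLp hps hθp hR) (integrable_smul_of_memLp hps hθp hD),
        hRθ θ]
      rw [← sub_eq_zero, ← a7]
      abel
  · refine (eLpNorm_sub_le hR.1 hD.1 hp1).trans ?_
    push_cast
    rw [ENNReal.coe_toNNReal hAκt, ENNReal.coe_toNNReal hAMt]
    refine (add_le_add (hRle.trans (mul_le_mul_right (hEle.trans (hsumE κ)) _))
      (hDle.trans (hsumE M))).trans (le_of_eq ?_)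
    rw [← hAκ, ← hAM]
    ring

end Summation

/-! ### Littlewood-Paley decomposition -/

section LittlewoodPaley

open Filter Topology

variable {d : ℕ} {χ φ : Space d → ℝ}

namespace IsDyadicPartition

theorem annulus_eq_zero (h : IsDyadicPartition χ φ) {ξ : Space d}
    (hξ : ‖ξ‖ < 3 / 4 ∨ 8 / 3 < ‖ξ‖) : φ ξ = 0 := by
  by_contra h0
  obtain ⟨h1, h2⟩ := h.support_annulus (subset_tsupport φ h0)
  rcases hξ with hξ | hξ <;> linarith

/-- For `|ξ| < 3/4` every point `2^{-j} ξ` also lies below the annulus, so the sum vanishes and the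
low-frequency cutoff equals one. -/
theorem isCutoff (h : IsDyadicPartition χ φ) : IsCutoff χ where
  smooth := h.smooth_low
  eq_one ξ hξ := by
    have h1 : (fun j : ℕ => φ (((2 : ℝ) ^ j)⁻¹ • ξ)) = fun _ => 0 := by
      ext j
      refine h.annulus_eq_zero (Or.inl (lt_of_le_of_lt ?_ hξ))
      rw [norm_smul, norm_inv, norm_pow, Real.norm_two]
      exact mul_le_of_le_one_left (norm_nonneg _) (inv_le_one_of_one_le₀ (one_le_pow₀ one_le_two))
    have h2 := h.sum_eq_one ξ
    rw [h1] at h2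
    linarith [h2.unique hasSum_zero]
  eq_zero ξ hξ := by
    by_contra h0
    have := h.support_low (subset_tsupport χ h0)
    rw [mem_ball_zero_iff] at this
    linarith
  mem_Icc := h.mem_Icc_low

/-- The series at `ξ` without its first term is the series at `ξ/2`. -/
theorem annulus_eq (h : IsDyadicPartition χ φ) (ξ : Space d) :
    φ ξ = χ ((2 : ℝ)⁻¹ • ξ) - χ ξ := by
  have h1 := (hasSum_nat_add_iff' 1).2 (h.sum_eq_one ξ)
  have h2 := h.sum_eq_one ((2 : ℝ)⁻¹ • ξ)
  have h3 : (fun j : ℕ => φ (((2 : ℝ) ^ (j + 1))⁻¹ • ξ)) =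
      fun j : ℕ => φ (((2 : ℝ) ^ j)⁻¹ • (2 : ℝ)⁻¹ • ξ) := by
    ext j
    rw [smul_smul, pow_succ, mul_inv]
  rw [h3] at h1
  have h4 := h1.unique h2
  simp at h4
  linarith

end IsDyadicPartition

/-- A cutoff to an annulus containing the support of the dyadic blocks. -/
def annulusCutoff (χ : Space d → ℝ) (ξ : Space d) : ℝ := χ ((4 : ℝ)⁻¹ • ξ) - χ ((2 : ℝ) • ξ)

theorem IsCutoff.contDiff_annulusCutoff (h : IsCutoff χ) :
    ContDiff ℝ ((⊤ : ℕ∞) : WithTop ℕ∞) (annulusCutoff χ) :=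
  (h.smooth.comp (contDiff_const_smul _)).sub (h.smooth.comp (contDiff_const_smul _))

theorem IsCutoff.annulusCutoff_eq_zero_low (h : IsCutoff χ) (ξ : Space d) (hξ : ‖ξ‖ < 3 / 8) :
    annulusCutoff χ ξ = 0 := by
  rw [annulusCutoff, h.eq_one, h.eq_one, sub_self] <;> rw [norm_smul] <;> norm_num <;> linarith

theorem IsCutoff.annulusCutoff_eq_zero_high (h : IsCutoff χ) (ξ : Space d) (hξ : 16 / 3 ≤ ‖ξ‖) :
    annulusCutoff χ ξ = 0 := by
  rw [annulusCutoff, h.eq_zero, h.eq_zero, sub_self] <;> rw [norm_smul] <;> norm_num <;> linarith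

/-- On `3/4 ≤ |ξ| ≤ 8/3` the point `ξ/4` lies where the cutoff is one and `2ξ` where it is zero. -/
theorem IsDyadicPartition.annulusCutoff_mul (h : IsDyadicPartition χ φ) (ξ : Space d) :
    annulusCutoff χ ξ * φ ξ = φ ξ := by
  by_cases h1 : ‖ξ‖ < 3 / 4
  · simp [h.annulus_eq_zero (Or.inl h1)]
  by_cases h2 : 8 / 3 < ‖ξ‖
  · simp [h.annulus_eq_zero (Or.inr h2)]
  rw [annulusCutoff, h.isCutoff.eq_one, h.isCutoff.eq_zero, sub_zero, one_mul] <;>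
    rw [norm_smul] <;> norm_num <;> linarith

theorem schwartz_ext_of_fourier {K L : 𝓢(Space d, ℂ)} (h : ∀ ξ, 𝓕 K ξ = 𝓕 L ξ) : K = L := by
  rw [← FourierTransform.fourierInv_fourier_eq (F := 𝓢(Space d, ℂ)) K,
    ← FourierTransform.fourierInv_fourier_eq (F := 𝓢(Space d, ℂ)) L]
  congr 1
  ext ξ
  exact h ξ

theorem sum_Ico_sub_int {G : Type*} [AddCommGroup G] (a : ℤ → G) (n : ℕ) :
    ∑ j ∈ Finset.Ico (-(n : ℤ)) n, (a (j + 1) - a j) = a n - a (-n) := by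
  have key : ∀ (m : ℤ) (k : ℕ), ∑ j ∈ Finset.Ico m (m + k), (a (j + 1) - a j) =
        a (m + k) - a m := by
    intro m k
    induction k with
    | zero => simp
    | succ k ih =>
      have : Finset.Ico m (m + (k + 1 : ℕ)) = insert (m + k) (Finset.Ico m (m + k)) := by
        ext j
        simp only [Finset.mem_Ico, Finset.mem_insert]
        push_cast
        omega
      rw [this, Finset.sum_insert (by simp), ih]
      push_cast
      rw [add_assoc]
      abel
  have h := key (-n) (2 * n)
  have e : -(n : ℤ) + (2 * n : ℕ) = n := by
    push_cast
    ring
  rwa [e] at h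

theorem summable_pow_natAbs {r : ℝ} (h0 : 0 ≤ r) (h1 : r < 1) :
    Summable fun j : ℤ => r ^ j.natAbs := by
  apply Summable.of_nat_of_neg <;> simpa using summable_geometric_of_lt_one h0 h1

variable {F : Type*} [NormedAddCommGroup F] [NormedSpace ℂ F] [CompleteSpace F]

theorem conv_comp_neg_eq_fourier (K θ : 𝓢(Space d, ℂ)) (x : Space d) :
    conv (fun z => K (-z)) θ x =
      𝓕 (SchwartzMap.smulLeftCLM ℂ (𝓕 K : 𝓢(Space d, ℂ)) (𝓕⁻ θ) : 𝓢(Space d, ℂ)) x := by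
  have hneg : ∀ ξ, 𝓕 (fun z => K (-z)) ξ = 𝓕 K (-ξ) := fun ξ => by
    rw [SchwartzMap.fourier_coe]
    exact Real.fourier_comp_linearIsometry (LinearIsometryEquiv.neg ℝ) K ξ
  have hθ : (θ : Space d → ℂ) = 𝓕⁻ (⇑(𝓕 θ : 𝓢(Space d, ℂ))) := by
    rw [← SchwartzMap.fourierInv_coe, FourierTransform.fourierInv_fourier_eq]
  conv_lhs => rw [hθ]
  rw [conv_fourierInv K.integrable.comp_neg (𝓕 θ : 𝓢(Space d, ℂ)).integrable,
    SchwartzMap.fourier_coe, Real.fourierInv_eq_fourier_comp_neg]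
  refine congrFun (congrArg _ (funext fun ξ => ?_)) x
  rw [hneg, neg_neg, SchwartzMap.smulLeftCLM_apply_apply (SchwartzMap.hasTemperateGrowth _),
    SchwartzMap.fourierInv_coe, Real.fourierInv_eq_fourier_neg, SchwartzMap.fourier_coe,
    smul_eq_mul]

theorem fourierMultiplierCLM_apply_eq_integral {q : ℝ} (hq : 1 < q) [Fact (1 ≤ ENNReal.ofReal q)]
    (K : 𝓢(Space d, ℂ)) (τ : Lp F (ENNReal.ofReal q) (volume : Measure (Space d)))
    (θ : 𝓢(Space d, ℂ)) :
    TemperedDistribution.fourierMultiplierCLM F (𝓕 K : 𝓢(Space d, ℂ)) (τ : 𝓢'(Space d, F)) θ =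
      ∫ x, θ x • conv K τ x := by
  have hqr : q.HolderConjugate (q / (q - 1)) := Real.HolderConjugate.conjExponent hq
  rw [TemperedDistribution.fourierMultiplierCLM_apply_apply, Lp.toTemperedDistribution_apply,
    integral_smul_conv hqr K.integrable (θ.memLp _ volume) (Lp.memLp τ)]
  simp only [conv_comp_neg_eq_fourier]

/-- The distributional block is represented by the function `K * τ`. Any competitor in the infimum
agrees with it almost everywhere, and continuity upgrades the essential bound to a bound at every
point. -/
theorem enorm_conv_le_distLpNorm {q : ℝ} (hq : 1 < q) [Fact (1 ≤ ENNReal.ofReal q)]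
    (K : 𝓢(Space d, ℂ)) (τ : Lp F (ENNReal.ofReal q) (volume : Measure (Space d))) (x : Space d) :
    ‖conv K τ x‖ₑ ≤ distLpNorm ∞ (TemperedDistribution.fourierMultiplierCLM F
      (𝓕 K : 𝓢(Space d, ℂ)) (τ : 𝓢'(Space d, F))) := by
  have hτ : IsTempered (τ : Space d → F) := IsTempered.of_memLp hq.le (Lp.memLp τ)
  have hc : Continuous (conv K τ) := (hτ.differentiable_conv K).continuous
  refine le_iInf₂ fun g hg => ?_
  have hae : ∀ᵐ y, conv K τ y = g y := by
    refine ae_eq_of_integral_contDiff_smul_eq hc.locallyIntegrable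
      ((Lp.memLp g).locallyIntegrable le_top) fun a ha hac => ?_
    have ha1 : HasCompactSupport (Complex.ofRealCLM ∘ a) := hac.comp_left rfl
    have ha2 : ContDiff ℝ ((⊤ : ℕ∞) : WithTop ℕ∞) (Complex.ofRealCLM ∘ a) :=
      Complex.ofRealCLM.contDiff.comp ha
    have h1 := fourierMultiplierCLM_apply_eq_integral hq K τ (ha1.toSchwartzMap ha2)
    rw [← hg, Lp.toTemperedDistribution_apply] at h1
    simpa using h1.symm
  have hle : ∀ᵐ y, ‖conv K τ y‖ ≤ ‖g‖ := by
    filter_upwards [hae, ae_le_eLpNormEssSup (f := g) (μ := volume)] with y hy h2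
    rw [hy, Lp.norm_def, eLpNorm_exponent_top, ← toReal_enorm]
    exact ENNReal.toReal_mono (by simpa using (Lp.memLp g).2.ne) h2
  have hall : ∀ y, ‖conv K τ y‖ ≤ ‖g‖ := by
    have := hc.norm
    by_contra! hcon
    obtain ⟨y, hy⟩ := hcon
    have hopen : IsOpen {y | ‖g‖ < ‖conv K τ y‖} := isOpen_lt continuous_const this
    have hpos := hopen.measure_pos volume ⟨y, hy⟩
    refine hpos.ne' (measure_mono_null (fun z hz => ?_) hle)
    simp only [Set.mem_compl_iff, Set.mem_ofPred_eq, not_le]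
    exact hz
  rw [← ofReal_norm, ← ofReal_norm]
  exact ENNReal.ofReal_le_ofReal (hall x)

end LittlewoodPaley

/-! ### Decomposition into homogeneous blocks and the `ℓ^1` bound. -/

section LittlewoodPaley

open Filter Topology

variable {d : ℕ} {χ φ : Space d → ℝ}

/-- A tempered function in `L^q ∩ B^0_{∞,1}` is the sum of its homogeneous dyadic blocks. -/
theorem IsDyadicPartition.exists_block_decomposition (h : IsDyadicPartition χ φ) (hd : 0 < d)
    {q : ℝ} (hq : 1 < q) [Fact (1 ≤ ENNReal.ofReal q)] {κ : 𝓢(Space d, ℂ)}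
    (hκ : ∀ ξ, 𝓕 κ ξ = annulusCutoff χ ξ) (F : Type*) [NormedAddCommGroup F] [NormedSpace ℂ F]
    [CompleteSpace F] :
    ∃ C : ℝ≥0, ∀ τ : Lp F (ENNReal.ofReal q) (volume : Measure (Space d)),
      besovNorm χ φ (τ : 𝓢'(Space d, F)) < ∞ →
      ∃ (f : ℤ → Space d → F) (B : ℤ → ℝ) (s : ℕ → Finset ℤ),
        (∀ j, IsBlock q (scaled j κ) (f j)) ∧ (∀ j x, ‖f j x‖ ≤ B j) ∧ Summable B ∧
        Tendsto s atTop atTop ∧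
        Tendsto (fun n => eLpNorm (fun x => ∑ j ∈ s n, f j x - τ x) (ENNReal.ofReal q) volume)
          atTop (𝓝 0) ∧
        ∑' j, ENNReal.ofReal (B j) ≤ C * (eLpNorm τ (ENNReal.ofReal q) volume +
          besovNorm χ φ (τ : 𝓢'(Space d, F))) := by
  have hqr : q.HolderConjugate (q / (q - 1)) := Real.HolderConjugate.conjExponent hq
  set q' := q / (q - 1) with hq'
  have hq1 : 1 < q' := hqr.symm.lt
  have hχ := h.isCutoff
  obtain ⟨X, hX⟩ := exists_kernel_of_contDiff hχ.smooth hχ.eq_zero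
  obtain ⟨L, hL⟩ := exists_kernel_of_contDiff h.smooth_annulus (R := 3)
    fun ξ hξ => h.annulus_eq_zero (Or.inr (by linarith))
  have hX1 : ∫ z, X z = 1 := by
    have h1 := hX 0
    rw [hχ.eq_one 0 (by simp), SchwartzMap.fourier_coe, Real.fourier_eq] at h1
    simpa using h1
  -- The block kernels telescope over all integers `j`, not only `j ≥ 0`. This replaces the block
  -- `Δ_{-1}` by infinitely many low-frequency blocks, each localised in an annulus.
  have hLX : ∀ j : ℤ, scaled j L = scaled (j + 1) X - scaled j X := fun j => by
    refine schwartz_ext_of_fourier fun ξ => ?_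
    have e1 : (𝓕 (scaled (j + 1) X - scaled j X) : 𝓢(Space d, ℂ)) =
        𝓕 (scaled (j + 1) X) - 𝓕 (scaled j X) :=
      map_sub (FourierTransform.fourierCLE ℂ 𝓢(Space d, ℂ)) _ _
    rw [e1, sub_apply, fourier_scaled, fourier_scaled, fourier_scaled, hL, hX, hX, h.annulus_eq,
      smul_smul, zpow_add_one₀ two_ne_zero, mul_inv_rev]
    push_cast
    rfl
  -- The Bernstein rate: for `j < 0`, Hölder bounds a block by the `L^{q'}` norm of its kernel,
  -- which scales like `2^{jd/q} = r^{|j|}`, times `‖τ‖_q`. Since `q < ∞` and `d > 0`, the series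
  -- over `j < 0` converges.
  set r : ℝ := ((2 : ℝ) ^ d)⁻¹ ^ (1 / q) with hr
  have h2d : (1 : ℝ) < 2 ^ d := one_lt_pow₀ one_lt_two hd.ne'
  have hr0 : 0 ≤ r := by positivity
  have hr1 : r < 1 := Real.rpow_lt_one (by positivity) (inv_lt_one_of_one_lt₀ h2d)
    (by have := hqr.pos; positivity)
  have hrs := summable_pow_natAbs hr0 hr1
  set Λ : ℝ := (eLpNorm L (ENNReal.ofReal q') volume).toReal with hΛ
  have hΛt : eLpNorm L (ENNReal.ofReal q') volume ≠ ∞ := (L.memLp _ volume).2.ne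
  refine ⟨1 + (∑' j : ℤ, r ^ j.natAbs).toNNReal * Λ.toNNReal, fun τ hτ => ?_⟩
  set N : ℝ := (eLpNorm τ (ENNReal.ofReal q) volume).toReal with hN
  have hNt : eLpNorm τ (ENNReal.ofReal q) volume ≠ ∞ := (Lp.memLp τ).2.ne
  have hτt : IsTempered (τ : Space d → F) := IsTempered.of_memLp hq.le (Lp.memLp τ)
  set f : ℤ → Space d → F := fun j => conv (scaled j L) τ with hf
  set β : ℤ → ℝ := fun j => (distLpNorm ∞ (dyadicBlock χ φ j (τ : 𝓢'(Space d, F)))).toReal with hβ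
  -- The sum of the two bounds serves every `j`: the Besov term is used for `j ≥ 0` and the
  -- Bernstein term for `j < 0`, and both sequences are summable over the integers.
  set B : ℤ → ℝ := fun j => β j + r ^ j.natAbs * (Λ * N) with hB
  have hβt : ∀ j, distLpNorm ∞ (dyadicBlock χ φ j (τ : 𝓢'(Space d, F))) ≠ ∞ :=
    ENNReal.ne_top_of_tsum_ne_top hτ.ne
  have hβs : Summable β := ENNReal.summable_toReal hτ.ne
  have hfX : ∀ j x, f j x = conv (scaled (j + 1) X) τ x - conv (scaled j X) τ x := fun j x => by
    simp only [hf, hLX, conv]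
    rw [← integral_sub (hτt.integrable_smul_comp_sub _ x) (hτt.integrable_smul_comp_sub _ x)]
    simp only [sub_apply, sub_smul]
  have hlow : ∀ (j : ℤ) x, j < 0 → ‖f j x‖ ≤ r ^ j.natAbs * (Λ * N) := fun j x hj => by
    have e0 : eLpNorm (scaled j L) (ENNReal.ofReal q') volume =
        ENNReal.ofReal (r ^ j.natAbs) * eLpNorm L (ENNReal.ofReal q') volume := by
      have e1 := eLpNorm_scaled_rpow hq1.le j L
      have hq0 : 0 < q' := by linarith
      refine (ENNReal.rpow_left_injective hq0.ne') ?_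
      change _ ^ q' = _ ^ q'
      rw [e1, ENNReal.mul_rpow_of_nonneg _ _ hq0.le,
        ENNReal.ofReal_rpow_of_nonneg (by positivity) hq0.le]
      congr 2
      have hj2 : ((2 : ℝ) ^ j) ^ d = (((2 : ℝ) ^ d)⁻¹) ^ j.natAbs := by
        obtain ⟨n, rfl⟩ : ∃ n : ℕ, j = -n := ⟨j.natAbs, by omega⟩
        simp only [zpow_neg, zpow_natCast, Int.natAbs_neg, Int.natAbs_natCast, inv_pow]
        rw [← pow_mul, ← pow_mul, mul_comm]
      have hb : 0 ≤ ((2 : ℝ) ^ d)⁻¹ := by positivity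
      rw [hj2, hr]
      generalize ((2 : ℝ) ^ d)⁻¹ = b at hb
      rw [← Real.rpow_natCast b, ← Real.rpow_natCast (b ^ (1 / q)), ← Real.rpow_mul hb,
        ← Real.rpow_mul hb, ← Real.rpow_mul hb]
      congr 1
      have h5 : q - 1 ≠ 0 := by linarith
      have h6 : q ≠ 0 := by linarith
      rw [hq']
      field_simp
      ring
    have hsh : MemLp (fun z => τ (x - z)) (ENNReal.ofReal q) volume :=
      (Lp.memLp τ).comp_measurePreserving (volume.measurePreserving_sub_left x)
    have h1 : ‖f j x‖ₑ ≤ eLpNorm (scaled j L) (ENNReal.ofReal q') volume *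
        eLpNorm τ (ENNReal.ofReal q) volume := by
      refine (enorm_integral_le_lintegral_enorm _).trans
        ((lintegral_enorm_smul_le hqr (scaled j L).continuous.aestronglyMeasurable hsh.1).trans
        (le_of_eq ?_))
      congr 1
      exact eLpNorm_comp_measurePreserving (Lp.memLp τ).1 (volume.measurePreserving_sub_left x)
    rw [e0] at h1
    have h2 := ENNReal.toReal_mono (ENNReal.mul_ne_top (ENNReal.mul_ne_top ENNReal.ofReal_ne_top
      hΛt) hNt) h1
    rw [toReal_enorm, ENNReal.toReal_mul, ENNReal.toReal_mul,
      ENNReal.toReal_ofReal (by positivity), mul_assoc] at h2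
    exact h2
  have hhigh : ∀ (j : ℤ) x, 0 ≤ j → ‖f j x‖ ≤ β j := fun j x hj => by
    have h1 := enorm_conv_le_distLpNorm hq (scaled j L) τ x
    have e1 : TemperedDistribution.fourierMultiplierCLM F (𝓕 (scaled j L) : 𝓢(Space d, ℂ))
        (τ : 𝓢'(Space d, F)) = dyadicBlock χ φ j (τ : 𝓢'(Space d, F)) := by
      rw [dyadicBlock, if_neg (by omega), if_neg (by omega)]
      congr 2
      ext ξ
      rw [fourier_scaled, hL]
    rw [e1] at h1
    have h2 := ENNReal.toReal_mono (hβt j) h1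
    rwa [toReal_enorm] at h2
  have hβ0 : ∀ j, 0 ≤ β j := fun j => ENNReal.toReal_nonneg
  have hΛN : 0 ≤ Λ * N := mul_nonneg ENNReal.toReal_nonneg ENNReal.toReal_nonneg
  have hγ0 : ∀ j : ℤ, 0 ≤ r ^ j.natAbs * (Λ * N) := fun j => mul_nonneg (pow_nonneg hr0 _) hΛN
  refine ⟨f, B, fun n => Finset.Ico (-(n : ℤ)) n, fun j => ⟨?_, ?_⟩, fun j x => ?_,
    hβs.add (hrs.mul_right _), ?_, ?_, ?_⟩
  · exact memLp_conv hq.le (scaled j L).integrable (Lp.memLp τ)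
  · rw [hf]
    simp only
    rw [conv_conv hq _ _ (Lp.memLp τ)]
    congr 1
    refine conv_eq_of_fourier_eq fun ξ => ?_
    rw [fourier_scaled, fourier_scaled, hκ, hL]
    exact_mod_cast h.annulusCutoff_mul _
  · rcases lt_or_ge j 0 with hj | hj
    · exact (hlow j x hj).trans (le_add_of_nonneg_left (hβ0 j))
    · exact (hhigh j x hj).trans (le_add_of_nonneg_right (hγ0 j))
  · refine tendsto_atTop_finset_of_monotone (fun m n hmn => ?_) fun j => ⟨j.natAbs + 1, ?_⟩
    · exact Finset.Ico_subset_Ico (by omega) (by omega)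
    · rw [Finset.mem_Ico]
      omega
  -- The symmetric partial sums telescope to a high-frequency approximation of `τ` minus a
  -- low-frequency remainder; the first converges to `τ`, the second to zero.
  · have e1 : ∀ (n : ℕ) x, ∑ j ∈ Finset.Ico (-(n : ℤ)) n, f j x =
        conv (scaled n X) τ x - conv (scaled (-n) X) τ x := fun n x => by
      simp only [hfX]
      exact sum_Ico_sub_int (fun j => conv (scaled j X) τ x) n
    have hm : ∀ j : ℤ, AEStronglyMeasurable (conv (scaled j X) τ) volume := fun j =>
      (hτt.differentiable_conv _).continuous.aestronglyMeasurable
    have hle : ∀ n : ℕ, eLpNorm (fun x => ∑ j ∈ Finset.Ico (-(n : ℤ)) n, f j x - τ x)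
        (ENNReal.ofReal q) volume ≤
        eLpNorm (fun x => conv (scaled n X) τ x - τ x) (ENNReal.ofReal q) volume +
          eLpNorm (conv (scaled (-n) X) τ) (ENNReal.ofReal q) volume := fun n => by
      refine le_trans (le_of_eq ?_) (eLpNorm_sub_le ((hm n).sub (Lp.memLp τ).1) (hm (-n))
        (by simpa using hq.le))
      congr 1
      ext x
      rw [e1]
      simp only [Pi.sub_apply]
      abel
    refine tendsto_of_tendsto_of_tendsto_of_le_of_le tendsto_const_nhds ?_ (fun _ => zero_le) hle
    simpa using (tendsto_conv_scaled_sub hq.le (Lp.memLp τ) hX1 hd).add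
      (tendsto_conv_scaled_neg hq (Lp.memLp τ) X hd)
  · have e1 : ∀ j, ENNReal.ofReal (B j) =
        distLpNorm ∞ (dyadicBlock χ φ j (τ : 𝓢'(Space d, F))) +
          ENNReal.ofReal (r ^ j.natAbs) * ENNReal.ofReal (Λ * N) := fun j => by
      rw [ENNReal.ofReal_add (hβ0 j) (hγ0 j), ENNReal.ofReal_toReal (hβt j),
        ENNReal.ofReal_mul (pow_nonneg hr0 _)]
    simp only [e1]
    rw [ENNReal.tsum_add, ENNReal.tsum_mul_right,
      ← ENNReal.ofReal_tsum_of_nonneg (fun j => pow_nonneg hr0 _) hrs,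
      ENNReal.ofReal_mul ENNReal.toReal_nonneg, ENNReal.ofReal_toReal hNt]
    change besovNorm χ φ (τ : 𝓢'(Space d, F)) + _ ≤ _
    push_cast
    rw [add_mul, one_mul, mul_add]
    calc _ = besovNorm χ φ (τ : 𝓢'(Space d, F)) +
          ENNReal.ofReal (∑' j : ℤ, r ^ j.natAbs) * ENNReal.ofReal Λ *
            eLpNorm τ (ENNReal.ofReal q) volume := by rw [mul_assoc]
      _ ≤ _ := add_le_add le_add_self le_self_add

end LittlewoodPaley

/-! ### Operator-valued symbols -/

section OperatorValued

open Filter Topology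

variable {d : ℕ} {F G : Type*} [NormedAddCommGroup F] [NormedSpace ℂ F]
  [NormedAddCommGroup G] [NormedSpace ℂ G]

theorem divMul_sum_smul {ι : Type*} [Fintype ι] {ψ : ι → Space d → ℂ}
    (hψ : ∀ a, Differentiable ℝ (ψ a)) (P : ι → F →L[ℂ] G) (u : Space d → Space d)
    (Du : Space d → Space d →L[ℝ] Space d) (f : Space d → F) (x : Space d) :
    divMul u Du (fun x => ∑ a, ψ a x • P a) f x = ∑ a, P a (scalarDivMul u Du (ψ a) f x) := by
  have h1 : HasFDerivAt (fun x => ∑ a, ψ a x • P a)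
      (∑ a, (fderiv ℝ (ψ a) x).smulRight (P a)) x :=
    HasFDerivAt.fun_sum fun a _ => (hψ a x).hasFDerivAt.smul_const (P a)
  rw [divMul, h1.fderiv]
  simp only [scalarDivMul, map_add, map_smul, Finset.sum_add_distrib, ← Finset.smul_sum]
  simp

theorem divMul_smul_id {ψ : Space d → ℂ} (hψ : Differentiable ℝ ψ) (u : Space d → Space d)
    (Du : Space d → Space d →L[ℝ] Space d) (f : Space d → F) (x : Space d) :
    divMul u Du (fun x => ψ x • ContinuousLinearMap.id ℂ F) f x = scalarDivMul u Du ψ f x := by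
  have h := divMul_sum_smul (ι := Unit) (fun _ => hψ) (fun _ => ContinuousLinearMap.id ℂ F) u Du f x
  simpa using h

theorem scalarDivMul_sum {ι : Type*} [Fintype ι] (ψ : Space d → ℂ) (P : ι → F →L[ℂ] G)
    (u : Space d → Space d) (Du : Space d → Space d →L[ℝ] Space d) (f : ι → Space d → F)
    (x : Space d) :
    scalarDivMul u Du ψ (fun x => ∑ a, P a (f a x)) x =
      ∑ a, P a (scalarDivMul u Du ψ (f a) x) := by
  simp only [scalarDivMul_eq_smul, map_smul, Finset.smul_sum]

variable [CompleteSpace F] [CompleteSpace G]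

theorem transposeMultiplier_eq_sum {ι : Type*} [Fintype ι] {m : ι → Space d → ℂ}
    (hm : ∀ a, IsHomogeneousSymbol (m a)) (P : ι → F →L[ℂ] G) {μ : Space d → F →L[ℂ] G}
    (hμ : ∀ ξ, μ ξ = ∑ a, m a ξ • P a) (θ : 𝓢(Space d, ℂ)) :
    transposeMultiplier μ θ = fun x => ∑ a, transposedTest (m a) θ x • P a := by
  ext1 x
  rw [transposeMultiplier, Real.fourierInv_eq]
  simp only [transposedTest, Real.fourierInv_eq, hμ, Finset.smul_sum]
  rw [integral_finsetSum]
  · refine Finset.sum_congr rfl fun a _ => ?_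
    refine Eq.trans ?_ (integral_smul_const _ (P a))
    refine integral_congr_ae (Eventually.of_forall fun ξ => ?_)
    simp only [Circle.smul_def, smul_smul, smul_eq_mul]
    congr 1
    ring
  · intro a _
    have h1 := (Real.fourierIntegral_convergent_iff (μ := volume) (-x)).2
      (integrable_symbol_mul_fourier (hm a).comp_neg θ)
    refine (h1.smul_const (P a)).congr (Eventually.of_forall fun ξ => ?_)
    simp only [Circle.smul_def, smul_smul, smul_eq_mul, inner_neg_right, neg_neg]
    congr 1
    ring

/-- An operator-valued symbol with finitely many scalar components reduces to the scalar
commutators, since the weak formulation is linear and continuous linear maps commute with integrals.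
-/
theorem isCommutator_sum {ι : Type*} [Fintype ι] (hd : 0 < d) {m : ι → Space d → ℂ}
    (hm : ∀ a, IsHomogeneousSymbol (m a)) (P : ι → F →L[ℂ] G) {μ : Space d → F →L[ℂ] G}
    (hμ : ∀ ξ, μ ξ = ∑ a, m a ξ • P a) {u : Space d → Space d}
    {Du : Space d → Space d →L[ℝ] Space d} {τ : Space d → F} {h : ι → Space d → F}
    (hh : ∀ a, IsScalarCommutator (m a) u Du τ (h a)) :
    IsCommutator μ u Du τ fun x => ∑ a, P a (h a x) := by
  choose g hg1 hg2 using hh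
  refine ⟨fun x => ∑ a, P a (g a x), fun θ => ?_, fun θ => ?_⟩
  · have e1 : ∀ x, θ x • ∑ a, P a (g a x) = ∑ a, P a (θ x • g a x) := fun x => by
      simp only [map_smul, Finset.smul_sum]
    have e2 : ∀ x, transposeMultiplier μ θ x (τ x) =
        ∑ a, P a (transposedTest (m a) θ x • τ x) := fun x => by
      rw [transposeMultiplier_eq_sum hm P hμ]
      simp
    simp only [e1, e2]
    refine ⟨integrable_finsetSum _ fun a _ => (P a).integrable_comp (hg1 a θ).1,
      integrable_finsetSum _ fun a _ => (P a).integrable_comp (hg1 a θ).2.1, ?_⟩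
    rw [integral_finsetSum _ fun a _ => (P a).integrable_comp (hg1 a θ).1,
      integral_finsetSum _ fun a _ => (P a).integrable_comp (hg1 a θ).2.1]
    refine Finset.sum_congr rfl fun a _ => ?_
    rw [(P a).integral_comp_comm (hg1 a θ).1, (P a).integral_comp_comm (hg1 a θ).2.1,
      (hg1 a θ).2.2]
  · have e1 : ∀ x, θ x • ∑ a, P a (h a x) = ∑ a, P a (θ x • h a x) := fun x => by
      simp only [map_smul, Finset.smul_sum]
    have e2 : divMul u Du (transposeMultiplier μ θ) τ =
        fun x => ∑ a, P a (scalarDivMul u Du (transposedTest (m a) θ) τ x) := by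
      ext1 x
      rw [transposeMultiplier_eq_sum hm P hμ]
      exact divMul_sum_smul (fun a => ((hm a).isWeightedTest hd θ).differentiable) P u Du τ x
    have e3 : divMul u Du (fun x => θ x • ContinuousLinearMap.id ℂ G)
        (fun x => ∑ a, P a (g a x)) = fun x => ∑ a, P a (scalarDivMul u Du θ (g a) x) := by
      ext1 x
      rw [divMul_smul_id θ.differentiable, scalarDivMul_sum]
    rw [convection, convection]
    simp only [e1, e2, e3]
    have i1 := fun a => (P a).integrable_comp (hg2 a θ).1
    have i2 := fun a => (P a).integrable_comp (hg2 a θ).2.1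
    have i3 := fun a => (P a).integrable_comp (hg2 a θ).2.2.1
    refine ⟨integrable_finsetSum _ fun a _ => i1 a, integrable_finsetSum _ fun a _ => i2 a,
      integrable_finsetSum _ fun a _ => i3 a, ?_⟩
    rw [integral_finsetSum _ fun a _ => i1 a, integral_finsetSum _ fun a _ => i2 a,
      integral_finsetSum _ fun a _ => i3 a, ← Finset.sum_neg_distrib, ← Finset.sum_neg_distrib,
      ← Finset.sum_sub_distrib]
    refine Finset.sum_congr rfl fun a _ => ?_
    rw [(P a).integral_comp_comm (hg2 a θ).1, (P a).integral_comp_comm (hg2 a θ).2.1,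
      (P a).integral_comp_comm (hg2 a θ).2.2.1, (hg2 a θ).2.2.2, map_sub, map_neg, map_neg]

end OperatorValued

/-! ### The estimate for symbols with finitely many scalar components, and the two concrete symbols.
-/

section MainEstimate

open Filter Topology

variable {d : ℕ} {χ φ : Space d → ℝ}

theorem IsDyadicPartition.exists_scalarCommutator (h : IsDyadicPartition χ φ) (hd : 0 < d)
    {p q : ℝ} (hp₁ : 1 < p) (hp₂ : p < 2) (hq : 1 < q) [Fact (1 ≤ ENNReal.ofReal q)]
    {m : Space d → ℂ} (hm : IsHomogeneousSymbol m) (hmp : IsLpMultiplier p m)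
    (F : Type*) [NormedAddCommGroup F] [NormedSpace ℂ F] [FiniteDimensional ℂ F]
    [CompleteSpace F] :
    ∃ C : ℝ≥0, ∀ (u : Space d → Space d) (Du : Space d → Space d →L[ℝ] Space d)
      (τ : Lp F (ENNReal.ofReal q) (volume : Measure (Space d))),
      IsWeakGradient u Du → MemLp Du (ENNReal.ofReal p) volume →
      besovNorm χ φ (τ : 𝓢'(Space d, F)) < ∞ →
      ∃ g : Space d → F, MemLp g (ENNReal.ofReal p) volume ∧ IsScalarCommutator m u Du τ g ∧
        eLpNorm g (ENNReal.ofReal p) volume ≤ C * eLpNorm Du (ENNReal.ofReal p) volume *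
          (eLpNorm τ (ENNReal.ofReal q) volume + besovNorm χ φ (τ : 𝓢'(Space d, F))) := by
  have hχ := h.isCutoff
  obtain ⟨κ, hκ⟩ := exists_kernel_of_contDiff hχ.contDiff_annulusCutoff
    hχ.annulusCutoff_eq_zero_high
  obtain ⟨M, hM⟩ := hm.exists_kernel hχ.contDiff_annulusCutoff (by norm_num : (0 : ℝ) < 3 / 8)
    hχ.annulusCutoff_eq_zero_low hχ.annulusCutoff_eq_zero_high
  obtain ⟨C₁, hC₁⟩ := h.exists_block_decomposition hd hq hκ F
  obtain ⟨C₂, hC₂⟩ := exists_commutator_of_blocks hp₁ hp₂ hq hd hm hmp (κ := κ) (M := M)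
    (fun ξ => by rw [hM, hκ]) F
  refine ⟨C₂ * C₁, fun u Du τ hu hDu hτ => ?_⟩
  obtain ⟨f, B, s, h1, h2, h3, h4, h5, h6⟩ := hC₁ τ hτ
  obtain ⟨g, hg, hg', hle⟩ := hC₂ u Du τ f B s hu hDu (Lp.memLp τ) h1 h2 h3 h4 h5
  refine ⟨g, hg, hg', hle.trans ((mul_le_mul_right h6 _).trans (le_of_eq ?_))⟩
  push_cast
  ring

theorem IsDyadicPartition.exists_commutator (h : IsDyadicPartition χ φ) (hd : 0 < d)
    {p q : ℝ} (hp₁ : 1 < p) (hp₂ : p < 2) (hq : 1 < q) [Fact (1 ≤ ENNReal.ofReal q)]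
    {ι : Type*} [Fintype ι] {m : ι → Space d → ℂ} (hm : ∀ a, IsHomogeneousSymbol (m a))
    (hmp : ∀ a, IsLpMultiplier p (m a)) {F G : Type*} [NormedAddCommGroup F] [NormedSpace ℂ F]
    [FiniteDimensional ℂ F] [CompleteSpace F] [NormedAddCommGroup G] [NormedSpace ℂ G]
    [CompleteSpace G] (P : ι → F →L[ℂ] G) {μ : Space d → F →L[ℂ] G}
    (hμ : ∀ ξ, μ ξ = ∑ a, m a ξ • P a) :
    ∃ C : ℝ≥0, ∀ (u : Space d → Space d) (Du : Space d → Space d →L[ℝ] Space d)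
      (τ : Lp F (ENNReal.ofReal q) (volume : Measure (Space d))),
      IsWeakGradient u Du → MemLp Du (ENNReal.ofReal p) volume →
      besovNorm χ φ (τ : 𝓢'(Space d, F)) < ∞ →
      ∃ g : Space d → G, MemLp g (ENNReal.ofReal p) volume ∧ IsCommutator μ u Du τ g ∧
        eLpNorm g (ENNReal.ofReal p) volume ≤ C * eLpNorm Du (ENNReal.ofReal p) volume *
          (eLpNorm τ (ENNReal.ofReal q) volume + besovNorm χ φ (τ : 𝓢'(Space d, F))) := by
  choose C hC using fun a => h.exists_scalarCommutator hd hp₁ hp₂ hq (hm a) (hmp a) F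
  refine ⟨∑ a, ‖P a‖₊ * C a, fun u Du τ hu hDu hτ => ?_⟩
  choose g hg hg' hle using fun a => hC a u Du τ hu hDu hτ
  have hPg : ∀ a, MemLp (fun x => P a (g a x)) (ENNReal.ofReal p) volume := fun a =>
    (P a).comp_memLp' (hg a)
  refine ⟨_, memLp_finsetSum _ fun a _ => hPg a, isCommutator_sum hd hm P hμ hg', ?_⟩
  have e1 : (fun x => ∑ a, P a (g a x)) = ∑ a, fun x => P a (g a x) := by
    ext x
    simp
  rw [e1]
  refine (eLpNorm_sum_le (fun a _ => (hPg a).1) (by simpa using hp₁.le)).trans ?_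
  push_cast
  rw [Finset.sum_mul, Finset.sum_mul]
  refine Finset.sum_le_sum fun a _ => ?_
  have h2 : eLpNorm (fun x => P a (g a x)) (ENNReal.ofReal p) volume ≤
      ENNReal.ofReal ‖P a‖ * eLpNorm (g a) (ENNReal.ofReal p) volume :=
    eLpNorm_le_mul_eLpNorm_of_ae_le_mul (Eventually.of_forall fun x => (P a).le_opNorm _) _
  refine h2.trans (le_trans (mul_le_mul_right (hle a) _) (le_of_eq ?_))
  rw [ofReal_norm, enorm_eq_nnnorm]
  ring

theorem isLpMultiplier_riesz {p : ℝ} (hp₁ : 1 < p) (hp₂ : p < 2) (i : Fin d) :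
    IsLpMultiplier p fun ξ : Space d => Complex.I * ((ξ i / ‖ξ‖ : ℝ) : ℂ) :=
  exists_eLpNorm_riesz_le hp₁ hp₂ i

theorem rieszSymbol_eq_sum (F : Type*) [NormedAddCommGroup F] [NormedSpace ℂ F] (i : Fin d)
    (ξ : Space d) : rieszSymbol F i ξ =
      ∑ _a : Unit, (Complex.I * ((ξ i / ‖ξ‖ : ℝ) : ℂ)) • ContinuousLinearMap.id ℂ F := by
  simp [rieszSymbol]

/-- The product of two Riesz symbols is `-ξ_k ξ_j / |ξ|²` because `i² = -1`. This accounts for the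
minus sign placed on the `(l, j)` projections and its absence on the `(k, j)` ones. -/
theorem curlDivSymbol_eq_sum (k l : Fin d) (ξ : Space d) :
    curlDivSymbol k l ξ = ∑ a : Fin d ⊕ Fin d,
      Sum.elim
        (fun j => (Complex.I * ((ξ k / ‖ξ‖ : ℝ) : ℂ)) * (Complex.I * ((ξ j / ‖ξ‖ : ℝ) : ℂ)))
        (fun j => (Complex.I * ((ξ l / ‖ξ‖ : ℝ) : ℂ)) * (Complex.I * ((ξ j / ‖ξ‖ : ℝ) : ℂ))) a •
      Sum.elim (fun j => -EuclideanSpace.proj (𝕜 := ℂ) (l, j))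
        (fun j => EuclideanSpace.proj (𝕜 := ℂ) (k, j)) a := by
  have h : ∀ k j : Fin d, (Complex.I * ((ξ k / ‖ξ‖ : ℝ) : ℂ)) *
      (Complex.I * ((ξ j / ‖ξ‖ : ℝ) : ℂ)) = -((ξ k * ξ j / ‖ξ‖ ^ 2 : ℝ) : ℂ) := fun k j => by
    have : ξ k * ξ j / ‖ξ‖ ^ 2 = (ξ k / ‖ξ‖) * (ξ j / ‖ξ‖) := by
      rw [div_mul_div_comm, sq]
    rw [this]
    push_cast
    linear_combination ((ξ k : ℂ) / ‖ξ‖) * (ξ j / ‖ξ‖) * Complex.I_mul_I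
  rw [Fintype.sum_sum_type, ← Finset.sum_add_distrib]
  refine Finset.sum_congr rfl fun j _ => ?_
  simp only [Sum.elim_inl, Sum.elim_inr, h, sub_eq_add_neg]
  rw [smul_neg, neg_smul, neg_neg]
  exact congrArg _ (neg_smul _ _).symm

end MainEstimate

end CommutatorEstimate

end

theorem mainTheorem5 {d : ℕ} (χ φ : CommutatorEstimate.Space d → ℝ)
    (hχφ : CommutatorEstimate.IsDyadicPartition χ φ)
    (p q : ℝ) (hp₁ : 1 < p) (hp₂ : p < 2) (hq : p / (p - 1) ≤ q)
    [Fact (1 ≤ ENNReal.ofReal q)] :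
    (∀ (F : Type*) [NormedAddCommGroup F] [NormedSpace ℂ F] [FiniteDimensional ℂ F]
      [CompleteSpace F], ∃ C : ℝ≥0, ∀ (i : Fin d)
      (u : CommutatorEstimate.Space d → CommutatorEstimate.Space d)
      (Du : CommutatorEstimate.Space d →
        CommutatorEstimate.Space d →L[ℝ] CommutatorEstimate.Space d)
      (τ : Lp F (ENNReal.ofReal q) (volume : Measure (CommutatorEstimate.Space d))),
      CommutatorEstimate.IsWeakGradient u Du →
      MemLp Du (ENNReal.ofReal p) volume →
      CommutatorEstimate.besovNorm χ φ (τ : 𝓢'(CommutatorEstimate.Space d, F)) < ∞ →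
      ∃ h : CommutatorEstimate.Space d → F,
        MemLp h (ENNReal.ofReal p) volume ∧
        CommutatorEstimate.IsCommutator (CommutatorEstimate.rieszSymbol F i) u Du τ h ∧
        eLpNorm h (ENNReal.ofReal p) volume ≤
          C * eLpNorm Du (ENNReal.ofReal p) volume *
            (eLpNorm τ (ENNReal.ofReal q) volume +
              CommutatorEstimate.besovNorm χ φ (τ : 𝓢'(CommutatorEstimate.Space d, F)))) ∧
    (∃ C : ℝ≥0, ∀ (k l : Fin d)
      (u : CommutatorEstimate.Space d → CommutatorEstimate.Space d)
      (Du : CommutatorEstimate.Space d →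
        CommutatorEstimate.Space d →L[ℝ] CommutatorEstimate.Space d)
      (τ : Lp (CommutatorEstimate.Tensor d) (ENNReal.ofReal q)
        (volume : Measure (CommutatorEstimate.Space d))),
      CommutatorEstimate.IsWeakGradient u Du →
      MemLp Du (ENNReal.ofReal p) volume →
      (∀ᵐ x, CommutatorEstimate.divergence Du x = 0) →
      CommutatorEstimate.besovNorm χ φ
        (τ : 𝓢'(CommutatorEstimate.Space d, CommutatorEstimate.Tensor d)) < ∞ →
      ∃ h : CommutatorEstimate.Space d → ℂ,
        MemLp h (ENNReal.ofReal p) volume ∧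
        CommutatorEstimate.IsCommutator (CommutatorEstimate.curlDivSymbol k l) u Du τ h ∧
        eLpNorm h (ENNReal.ofReal p) volume ≤
          C * eLpNorm Du (ENNReal.ofReal p) volume *
            (eLpNorm τ (ENNReal.ofReal q) volume +
              CommutatorEstimate.besovNorm χ φ
                (τ : 𝓢'(CommutatorEstimate.Space d, CommutatorEstimate.Tensor d)))) := by
  have hq₁ : 1 < q := (Real.HolderConjugate.conjExponent hp₁).symm.lt.trans_le hq
  -- In dimension zero there are no indices and both claims are empty. Positive dimension is needed
  -- above, for instance for `|z| ≠ 0` almost everywhere.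
  rcases Nat.eq_zero_or_pos d with rfl | hd
  · exact ⟨fun F _ _ _ _ => ⟨0, fun i => i.elim0⟩, 0, fun k => k.elim0⟩
  refine ⟨fun F _ _ _ _ => ?_, ?_⟩
  · choose C hC using fun i : Fin d => hχφ.exists_commutator hd hp₁ hp₂ hq₁ (ι := Unit)
      (fun _ => CommutatorEstimate.isHomogeneousSymbol_riesz i)
      (fun _ => CommutatorEstimate.isLpMultiplier_riesz hp₁ hp₂ i)
      (fun _ => ContinuousLinearMap.id ℂ F) (CommutatorEstimate.rieszSymbol_eq_sum F i)
    -- Summing the constants over the finitely many indices makes the bound uniform in `i`.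
    refine ⟨∑ i, C i, fun i u Du τ hu hDu hτ => ?_⟩
    obtain ⟨h, h1, h2, h3⟩ := hC i u Du τ hu hDu hτ
    refine ⟨h, h1, h2, h3.trans ?_⟩
    gcongr
    exact Finset.single_le_sum (fun _ _ => zero_le) (Finset.mem_univ i)
  · choose C hC using fun a : Fin d × Fin d =>
      hχφ.exists_commutator hd hp₁ hp₂ hq₁ (ι := Fin d ⊕ Fin d)
        (fun b => by
          rcases b with j | j <;>
          exact (CommutatorEstimate.isHomogeneousSymbol_riesz _).mul
            (CommutatorEstimate.isHomogeneousSymbol_riesz j))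
        (fun b => by
          rcases b with j | j <;>
          exact CommutatorEstimate.IsLpMultiplier.mul hp₁
            (CommutatorEstimate.isHomogeneousSymbol_riesz _)
            (CommutatorEstimate.isHomogeneousSymbol_riesz j) hd
            (CommutatorEstimate.isLpMultiplier_riesz hp₁ hp₂ _)
            (CommutatorEstimate.isLpMultiplier_riesz hp₁ hp₂ j))
        _ (CommutatorEstimate.curlDivSymbol_eq_sum a.1 a.2)
    refine ⟨∑ a, C a, fun k l u Du τ hu hDu _ hτ => ?_⟩
    obtain ⟨h, h1, h2, h3⟩ := hC (k, l) u Du τ hu hDu hτ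
    refine ⟨h, h1, h2, h3.trans ?_⟩
    gcongr
    exact Finset.single_le_sum (fun _ _ => zero_le) (Finset.mem_univ (k, l))
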